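/- **Formal Normalization Theorem.** Let $k\geq 1$ be an integer. For $\varepsilon=(\varepsilon_0,\dots,\varepsilon_{k-1})\in\mathbb C^k$ put $$P_\varepsilon(x)=x^{k+1}+\sum_{j=0}^{k-1}\varepsilon_jx^j .$$ *Definitions.* A germ of a holomorphic vector field at $0\in\mathbb C^2$ is a *saddle-node of codimension $k$* if $0$ is an isolated singularity of multiplicity $k+1$ at which the linear part has exactly one non-zero eigenvalue. A holomorphic germ at $0\in\mathbb C^k\times\mathbb C^2$ of a $k$-parameter family $Z=(Z_\varepsilon)$ of planar vector fields, with $Z_0$ a saddle-node of codimension $k$, is a *generic unfolding* if there is a germ of biholomorphism $(\varepsilon,x,y)\mapsto(\phi(\varepsilon),\Psi_\varepsilon(x,y))$ fixing $0$ such that in the new coordinates and parameter the singular points of each $Z_\varepsilon$ are given by $P_\varepsilon(x)=y=0$. A *formal change* is a formal map $\Psi:(\varepsilon,x,y)\mapsto(\phi(\varepsilon),\Psi_\varepsilon(x,y))$ fixing $0$ with $\phi$ and $\Psi_0$ of invertible derivative at $0$. It is a *formal conjugacy* from $Z$ to $\widetilde Z$ if $Z_\varepsilon\cdot\Psi_\varepsilon=\widetilde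 Z_{\phi(\varepsilon)}\circ\Psi_\varepsilon$, where $Z\cdot f$ is the derivative of $f$ along $Z$. It is a *formal orbital equivalence* from $Z$ to $\widetilde Z$ if it is a formal conjugacy from $UZ$ to $\widetilde Z$ for some formal power series $U(\varepsilon,x,y)$ with $U(0)\neq0$. A *formal invariant* is a pair $(\mu,u)$ with $\mu\in\mathbb C\{\varepsilon\}$ and $u\in\mathbb C\{\varepsilon\}[x]$ of degree at most $k$ in $x$ with $u_0(0)\neq 0$. Its *formal normal form* is $$\widehat Z^{(\mu,u)}_\varepsilon(x,y)=u_\varepsilon(x)\left(P_\varepsilon(x)\frac{\partial}{\partial x}+y\,(1+\mu_\varepsilon x^k)\frac{\partial}{\partial y}\right).$$ For $\alpha^k=1$ write $\theta_\alpha(\varepsilon)=(\alpha^{1-j}\varepsilon_j)_{0\le j<k}$. *Existence.* For every generic unfolding $Z$ of a saddle-node of codimension $k$ there are a formal invariant $(\mu,u)$ and a formal conjugacy from $Z$ to $\widehat Z^{(\mu,u)}$ whose change of parameter $\phi$ is convergent. *Uniqueness.* Let $N$ be a formal conjugacy from such a $Z$ to $\widehat Z^{(\mu,u)}$, let $(\mu',u')$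 be a formal invariant and let $N'$ be a formal change. Then $N'$ is a formal conjugacy from $Z$ to $\widehat Z^{(\mu',u')}$ if and only if there exist $\alpha\in\mathbb C$ with $\alpha^k=1$, an invertible $c\in\mathbb C[[\varepsilon]]$ and $t\in\mathbb C[[\varepsilon]]$ such that $$\mu'_{\theta_\alpha(\varepsilon)}=\mu_\varepsilon,\qquad u'_{\theta_\alpha(\varepsilon)}(\alpha x)=u_\varepsilon(x),\qquad N'=L_{\alpha,c}\circ\Phi^t\circ N,$$ where $L_{\alpha,c}(\varepsilon,x,y)=(\theta_\alpha(\varepsilon),\alpha x,c_\varepsilon y)$ and $\Phi^t$ is the formal flow of $\widehat Z^{(\mu,u)}$ at time $t_\varepsilon$ (with $\varepsilon$ fixed). The triple $(\alpha,c,t)$ is then unique. *Normal forms.* Let $(\mu,u)$ and $(\mu',u')$ be formal invariants. If a formal change with parameter part $\phi$ is a formal orbital equivalence from $\widehat Z^{(\mu,u)}$ to $\widehat Z^{(\mu',u')}$, then $\phi=\theta_\alpha$ for some $\alpha$ with $\alpha^k=1$, and $\mu'\circ\theta_\alpha=\mu$. The two normal forms are formally orbitally equivalent by a change fixing the parameter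 $\varepsilon$ if and only if $\mu=\mu'$, and formally conjugate by a change fixing $\varepsilon$ if and only if $(\mu,u)=(\mu',u')$. -/

import Mathlib

namespace SaddleNode

open Filter Topology

noncomputable section

/-- A power series over `ℂ` in finitely many variables converges if it converges absolutely on
some polydisc of positive radius. The convergent power series form the algebra `ℂ{z}`. -/
def IsConvergent {σ : Type} (f : MvPowerSeries σ ℂ) : Prop :=
  ∃ r : ℝ, 0 < r ∧ Summable fun d : σ →₀ ℕ => ‖MvPowerSeries.coeff d f‖ * r ^ d.degree

/-- The sum of a (convergent) power series at a point `z` close to `0`. -/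
def evalAt {σ : Type} (f : MvPowerSeries σ ℂ) (z : σ → ℂ) : ℂ :=
  ∑' d : σ →₀ ℕ, MvPowerSeries.coeff d f * d.prod fun i n => z i ^ n

/-- The derivative at `0` of a formal map. -/
def jacobianAtZero {σ : Type} (F : σ → MvPowerSeries σ ℂ) : Matrix σ σ ℂ :=
  Matrix.of fun i j => MvPowerSeries.coeff (Finsupp.single j 1) (F i)

/-- `ℂ[[ε₀, …, ε_{k-1}]]`. -/
abbrev ParamSeries (k : ℕ) : Type := MvPowerSeries (Fin k) ℂ

/-- `ℂ[[ε₀, …, ε_{k-1}, x, y]]`: the variable `Sum.inl j` is `ε_j`, the variables `Sum.inr 0` and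
`Sum.inr 1` are `x` and `y`. -/
abbrev Series (k : ℕ) : Type := MvPowerSeries (Fin k ⊕ Fin 2) ℂ

/-- A `k`-parameter family of pairs of power series in `(x, y)`; as a family of vector fields,
`Z` stands for `Z 0 ∂/∂x + Z 1 ∂/∂y`. -/
abbrev Family (k : ℕ) : Type := Fin 2 → Series k

/-- The inclusion `ℂ[[ε]] ⊆ ℂ[[ε, x, y]]`. -/
def liftParam (k : ℕ) : ParamSeries k →ₐ[ℂ] Series k :=
  MvPowerSeries.rename Sum.inl

/-- The member `F_0` of a family, obtained by setting `ε := 0`. -/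
def atParamZero {k : ℕ} (F : Family k) : Fin 2 → MvPowerSeries (Fin 2) ℂ :=
  fun i => MvPowerSeries.killCompl Function.Embedding.inr (F i)

/-- `P_ε(x) = x^{k+1} + ∑_{j<k} ε_j x^j`, over any commutative ring. -/
def bifPoly {R : Type} [CommRing R] {k : ℕ} (e : Fin k → R) (x : R) : R :=
  x ^ (k + 1) + ∑ j : Fin k, e j * x ^ (j : ℕ)

/-- The planar vector field germ `V 0 ∂/∂x + V 1 ∂/∂y` is a saddle-node of codimension `k`: the
origin is an isolated singularity, the linear part has exactly one non-zero eigenvalue, and the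
multiplicity of the singularity is `k + 1`. The multiplicity is the dimension of the local algebra
`ℂ[[x, y]] / (V 0, V 1)`; it is the same for formal and for convergent power series. -/
structure IsSaddleNode (k : ℕ) (V : Fin 2 → MvPowerSeries (Fin 2) ℂ) : Prop where
  singular : ∀ i, MvPowerSeries.constantCoeff (V i) = 0
  isolated : ∀ᶠ p in 𝓝[≠] (0 : Fin 2 → ℂ), ¬ ∀ i, evalAt (V i) p = 0
  eigenvalues : ∃ l : ℂ, l ≠ 0 ∧
    (jacobianAtZero V).charpoly = Polynomial.X * (Polynomial.X - Polynomial.C l)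
  multiplicity : Module.finrank ℂ
    (MvPowerSeries (Fin 2) ℂ ⧸ Ideal.span (Set.range V)) = k + 1

/-- A formal change of coordinates and parameter `(ε, x, y) ↦ (φ(ε), Ψ_ε(x, y))` fixing the
origin, with `φ` and `Ψ_0` of invertible derivative at `0`. -/
structure FormalChange (k : ℕ) where
  /-- the components of `φ` -/
  par : Fin k → ParamSeries k
  /-- the components of `Ψ` -/
  map : Family k
  par_zero : ∀ j, MvPowerSeries.constantCoeff (par j) = 0
  map_zero : ∀ i, MvPowerSeries.constantCoeff (map i) = 0
  par_invertible : (jacobianAtZero par).det ≠ 0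
  map_invertible : (jacobianAtZero (atParamZero map)).det ≠ 0

/-- All the components of the map `(ε, x, y) ↦ (φ(ε), Ψ_ε(x, y))`. -/
def FormalChange.total {k : ℕ} (Ψ : FormalChange k) : Fin k ⊕ Fin 2 → Series k :=
  Sum.elim (fun j => liftParam k (Ψ.par j)) Ψ.map

/-- The composition `f ∘ Ψ`, that is `f(φ(ε), Ψ_ε(x, y))`. -/
def FormalChange.pull {k : ℕ} (Ψ : FormalChange k) (f : Series k) : Series k :=
  MvPowerSeries.subst Ψ.total f

/-- The change is given by convergent power series, i.e. it is a germ of a biholomorphism. -/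
def FormalChange.IsAnalytic {k : ℕ} (Ψ : FormalChange k) : Prop :=
  (∀ j, IsConvergent (Ψ.par j)) ∧ ∀ i, IsConvergent (Ψ.map i)

/-- The change fixes the parameter. -/
def FormalChange.FixesParam {k : ℕ} (Ψ : FormalChange k) : Prop :=
  ∀ j, Ψ.par j = MvPowerSeries.X j

/-- `Z` is a generic unfolding (with `k` parameters) of a saddle-node of codimension `k`: `Z` is a
holomorphic germ of a family, `Z_0` is a saddle-node of codimension `k`, and in suitable holomorphic
coordinates and parameter the singular points of each `Z_ε` are given by `P_ε(x) = y = 0`. -/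
structure IsGenericUnfolding {k : ℕ} (Z : Family k) : Prop where
  convergent : ∀ i, IsConvergent (Z i)
  saddleNode : IsSaddleNode k (atParamZero Z)
  generic : ∃ Φ : FormalChange k, Φ.IsAnalytic ∧
    ∀ᶠ p in 𝓝 (0 : Fin k ⊕ Fin 2 → ℂ),
      (∀ i, evalAt (Z i) p = 0) ↔
        bifPoly (fun j => evalAt (Φ.par j) fun l => p (Sum.inl l)) (evalAt (Φ.map 0) p) = 0 ∧
          evalAt (Φ.map 1) p = 0

/-- The directional derivative `Z · f`; the parameters are constants. -/
def lieDeriv {k : ℕ} (Z : Family k) (f : Series k) : Series k :=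
  ∑ i : Fin 2, Z i * MvPowerSeries.pderiv ℂ (Sum.inr i) f

/-- `Ψ` is a formal conjugacy from `Z` to `Z'`: it sends each `Z_ε` to `Z'_{φ(ε)}`, i.e.
`Z_ε · Ψ_ε = Z'_{φ(ε)} ∘ Ψ_ε`. -/
def Conjugates {k : ℕ} (Ψ : FormalChange k) (Z Z' : Family k) : Prop :=
  ∀ i, lieDeriv Z (Ψ.map i) = Ψ.pull (Z' i)

/-- `Ψ` is a formal orbital equivalence from `Z` to `Z'`. -/
def OrbitallyConjugates {k : ℕ} (Ψ : FormalChange k) (Z Z' : Family k) : Prop :=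
  ∃ U : Series k, MvPowerSeries.constantCoeff U ≠ 0 ∧ Conjugates Ψ (fun i => U * Z i) Z'

/-- The data `(μ, u)`, with `μ ∈ ℂ{ε}` and `u_ε(x) = ∑_{i ≤ k} u_i(ε) x^i`, `u_i ∈ ℂ{ε}`,
`u_0(0) ≠ 0`. -/
@[ext]
structure FormalInvariant (k : ℕ) where
  mu : ParamSeries k
  u : Fin (k + 1) → ParamSeries k
  mu_convergent : IsConvergent mu
  u_convergent : ∀ i, IsConvergent (u i)
  u_ne_zero : MvPowerSeries.constantCoeff (u 0) ≠ 0

/-- The formal normal form `u_ε(x) (P_ε(x) ∂/∂x + y (1 + μ_ε x^k) ∂/∂y)`. -/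
def normalForm {k : ℕ} (I : FormalInvariant k) : Family k :=
  let x : Series k := MvPowerSeries.X (Sum.inr 0)
  let y : Series k := MvPowerSeries.X (Sum.inr 1)
  let u : Series k := ∑ i : Fin (k + 1), liftParam k (I.u i) * x ^ (i : ℕ)
  ![u * bifPoly (fun j => MvPowerSeries.X (Sum.inl j)) x,
    u * (y * (1 + liftParam k I.mu * x ^ k))]

/-- `Φ` is the flow of the formal family `Z` at the time `t ∈ ℂ[[ε]]`, given by the Lie series
`Φ = ∑_n (t^n / n!) Z·^n (x, y)`. The series converges coefficientwise in `ℂ`. -/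
def IsTimeFlow {k : ℕ} (Z : Family k) (t : ParamSeries k) (Φ : Family k) : Prop :=
  ∀ (i : Fin 2) (d : Fin k ⊕ Fin 2 →₀ ℕ),
    HasSum
      (fun n : ℕ => MvPowerSeries.coeff d
        ((n.factorial : ℂ)⁻¹ • (liftParam k t ^ n * (lieDeriv Z)^[n] (MvPowerSeries.X (Sum.inr i)))))
      (MvPowerSeries.coeff d (Φ i))

/-- The coefficients of the linear change of parameter `(ε_j) ↦ (α^{k+1-j} ε_j)`; when `α^k = 1`
this is `(ε_j) ↦ (α^{1-j} ε_j)`. -/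
def rotation (k : ℕ) (α : ℂ) : Fin k → ℂ :=
  fun j => α ^ (k + 1 - (j : ℕ))

/-- The data `I'` is obtained from `I` by the symmetry `(ε, x) ↦ (rotation α · ε, α x)`:
`μ'(rotation α · ε) = μ(ε)` and `u'(rotation α · ε, α x) = u(ε, x)`. -/
def FormalInvariant.IsRotation {k : ℕ} (α : ℂ) (I I' : FormalInvariant k) : Prop :=
  MvPowerSeries.rescale (rotation k α) I'.mu = I.mu ∧
    ∀ i : Fin (k + 1), α ^ (i : ℕ) • MvPowerSeries.rescale (rotation k α) (I'.u i) = I.u i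

/-- `N' = L ∘ Φ ∘ N` where `Φ` is the flow of `Z` at time `t` and `L` is the linear map
`(ε, x, y) ↦ (rotation α · ε, α x, c_ε y)`. -/
def FormalChange.IsLinearFlowOf {k : ℕ} (Z : Family k) (α : ℂ) (c t : ParamSeries k)
    (N N' : FormalChange k) : Prop :=
  (∀ j, N'.par j = rotation k α j • N.par j) ∧
    ∃ Φ : Family k, IsTimeFlow Z t Φ ∧
      N'.map 0 = N.pull (α • Φ 0) ∧ N'.map 1 = N.pull (liftParam k c * Φ 1)

end

end SaddleNode

/-! Normalisation is governed by the linear action of `Z_ε` at its singular points. In analytic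
coordinates where the singular points are `P = y = 0`, write `Z = M (P, y)` with `M` an analytic
matrix. The ideal `I = (P, y)` is preserved by `Z`, and on the conormal module `I / I²` the field
acts with trace `P' M₀₀ + M₁₁` and determinant `P' det M`. The multiplicity `k + 1` makes `det M` a
unit and the non-zero eigenvalue makes `M₁₁` a unit. Hence the characteristic polynomial factors
analytically, with roots `P' h` and `l₂`, where `h` and `l₂` are units. The normal form has the
roots `P' u` and `u (1 + μ x^k)`, so `(μ, u)` must match these roots modulo `P`.

The matching is done by convergent series (`exists_adapted`). The one-variable field `P (h / l₂)
∂/∂x`, which encodes the ratio of the eigenvalues, is brought analytically to `P_φ / (1 + μ x^k)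
∂/∂x` (`kostov_exists`, `exists_normalisation_x`). This fixes the parameter change `φ` and `μ`.
Weierstrass division of `l₂ / (1 + μ x^k)` by `P` then gives `u`. Only the remaining change of
coordinates, which fixes the parameter, may diverge (`exists_conjugates_normalForm`). It eliminates
`y` in the manner of Poincaré and Dulac (`exists_poincareDulac`). It then conjugates along `y = 0`
two fields that agree modulo `P²`, by a map `x + P q` where `q` solves a regular differential
equation. Finally it rescales `y` by a solution of a regular linear equation.

For uniqueness, an equivalence of normal forms is restricted to the curve `y = 0`, which it must
preserve. The uniqueness half of the one-variable normalisation (`kostov_unique`) leaves only the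
rotations `x ↦ α x` with `α^k = 1` and forces `μ` to correspond (`orbital_structure`). For
conjugacies, division by `P` determines `u`, the components do not involve `y` beyond the linear
factor (`conj_structure`), and uniqueness for the two differential equations leaves one time `t(ε)`
and one factor `c(ε)` (`Conjugates.eq_linearFlow`). The coefficient of `x^(k+1)` in the first
component measures the time.

One analytic device is used throughout. The variables `ε_j`, `x`, `y` have weights `2 (k + 1 - j) +
1`, `2`, `3`, so that `P` is `x^(k+1)` plus terms of higher weight and a linear term `y ∂/∂x` raises
the weight. Equations are solved as fixed points of maps that contract for the resulting filtration.
When a solution must converge, the iteration is also confined to a ball for a weighted `ℓ¹` norm.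
Such a ball is closed for the filtration topology, so no contraction estimate in norm is needed. -/

namespace SaddleNode

open Filter Topology MvPowerSeries

noncomputable section

variable {σ τ : Type}

/-! ### The filtration by weighted order -/

/-- The ideal of the power series all of whose monomials have weight at least `s`. -/
def fil (ω : σ → ℕ) (s : ℕ) : Ideal (MvPowerSeries σ ℂ) where
  carrier := {f | ∀ d, Finsupp.weight ω d < s → coeff d f = 0}
  add_mem' := fun {f g} hf hg d hd => by rw [map_add, hf d hd, hg d hd, add_zero]
  zero_mem' := fun d _ => by simp
  smul_mem' := fun c f hf d hd => by
    classical
    rw [smul_eq_mul, coeff_mul]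
    refine Finset.sum_eq_zero fun p hp => ?_
    rw [Finset.HasAntidiagonal.mem_antidiagonal] at hp
    rw [hf p.2, mul_zero]
    rw [← hp, map_add] at hd
    omega

theorem fil_anti {ω : σ → ℕ} {s t : ℕ} (h : s ≤ t) {f : MvPowerSeries σ ℂ}
    (hf : f ∈ fil ω t) : f ∈ fil ω s := fun d hd => hf d (hd.trans_le h)

theorem mem_fil_zero {ω : σ → ℕ} (f : MvPowerSeries σ ℂ) : f ∈ fil ω 0 :=
  fun _ hd => absurd hd (Nat.not_lt_zero _)

theorem mul_mem_fil {ω : σ → ℕ} {s t : ℕ} {f g : MvPowerSeries σ ℂ} (hf : f ∈ fil ω s)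
    (hg : g ∈ fil ω t) : f * g ∈ fil ω (s + t) := by
  classical
  intro d hd
  rw [coeff_mul]
  refine Finset.sum_eq_zero fun p hp => ?_
  rw [Finset.HasAntidiagonal.mem_antidiagonal] at hp
  rw [← hp, map_add] at hd
  rcases lt_or_ge (Finsupp.weight ω p.1) s with h | h
  · rw [hf _ h, zero_mul]
  · rw [hg p.2 (by omega), mul_zero]

theorem mul_mem_fil_of_le {ω : σ → ℕ} {s t u : ℕ} {f g : MvPowerSeries σ ℂ} (hf : f ∈ fil ω s)
    (hg : g ∈ fil ω t) (h : u ≤ s + t) : f * g ∈ fil ω u := fil_anti h (mul_mem_fil hf hg)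

theorem pow_mem_fil {ω : σ → ℕ} {s : ℕ} {f : MvPowerSeries σ ℂ} (hf : f ∈ fil ω s) (n : ℕ) :
    f ^ n ∈ fil ω (n * s) := by
  induction n with
  | zero => rw [Nat.zero_mul]; exact mem_fil_zero _
  | succ n ih => rw [pow_succ]; exact mul_mem_fil_of_le ih hf (by rw [Nat.succ_mul])

theorem smul_mem_fil {ω : σ → ℕ} {s : ℕ} {f : MvPowerSeries σ ℂ} (c : ℂ) (hf : f ∈ fil ω s) :
    c • f ∈ fil ω s := by
  intro d hd
  rw [coeff_smul, hf d hd, mul_zero]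

theorem X_mem_fil {ω : σ → ℕ} (i : σ) : (X i : MvPowerSeries σ ℂ) ∈ fil ω (ω i) := by
  classical
  intro d hd
  rw [coeff_X, if_neg]
  rintro rfl
  rw [Finsupp.weight_single, one_smul] at hd
  exact lt_irrefl _ hd

theorem eq_zero_of_mem_fil {ω : σ → ℕ} {f : MvPowerSeries σ ℂ} (h : ∀ s, f ∈ fil ω s) :
    f = 0 := by
  ext d
  simpa using h (Finsupp.weight ω d + 1) d (Nat.lt_succ_self _)

/-- The uniqueness principle used throughout: if an equation expresses a difference of solutions by
something of one order more, the difference vanishes. -/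
theorem eq_zero_of_mem_fil_succ {ω : σ → ℕ} {f : MvPowerSeries σ ℂ}
    (h : ∀ s, f ∈ fil ω s → f ∈ fil ω (s + 1)) : f = 0 := by
  refine eq_zero_of_mem_fil (ω := ω) fun s => ?_
  induction s with
  | zero => exact mem_fil_zero f
  | succ s ih => exact h s ih

theorem mem_fil_one {ω : σ → ℕ} (hω : ∀ i, ω i ≠ 0) {f : MvPowerSeries σ ℂ} :
    f ∈ fil ω 1 ↔ constantCoeff f = 0 := by
  have : Finsupp.NonTorsionWeight ℕ ω := Finsupp.nonTorsionWeight_of _ _ hω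
  rw [← coeff_zero_eq_constantCoeff_apply]
  constructor
  · intro h
    exact h 0 (by simp)
  · intro h d hd
    have : Finsupp.weight ω d = 0 := by omega
    rw [Finsupp.weight_eq_zero_iff_eq_zero] at this
    rw [this, h]

theorem sub_C_mem_fil_one {ω : σ → ℕ} (hω : ∀ i, ω i ≠ 0) (f : MvPowerSeries σ ℂ) :
    f - C (constantCoeff f) ∈ fil ω 1 := by
  rw [mem_fil_one hω]; simp

/-- A set of power series that is closed for the topology defined by the filtration. -/
def Stable (ω : σ → ℕ) (A : Set (MvPowerSeries σ ℂ)) : Prop :=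
  ∀ f, (∀ s, ∃ g ∈ A, f - g ∈ fil ω s) → f ∈ A

theorem Stable.inter {ω : σ → ℕ} {A B : Set (MvPowerSeries σ ℂ)} (hA : Stable ω A)
    (hB : Stable ω B) : Stable ω (A ∩ B) := fun f hf =>
  ⟨hA f fun s => (hf s).imp fun _ h => ⟨h.1.1, h.2⟩, hB f fun s => (hf s).imp fun _ h => ⟨h.1.2, h.2⟩⟩

theorem stable_univ {ω : σ → ℕ} : Stable ω Set.univ := fun _ _ => trivial

theorem stable_coeff {ω : σ → ℕ} (D : Set (σ →₀ ℕ)) :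
    Stable ω {f | ∀ d ∈ D, coeff d f = 0} := by
  intro f hf d hd
  obtain ⟨g, hg, h⟩ := hf (Finsupp.weight ω d + 1)
  have := h d (Nat.lt_succ_self _)
  rwa [map_sub, hg d hd, sub_zero] at this

theorem stable_fil {ω : σ → ℕ} (s : ℕ) : Stable ω (fil ω s : Set (MvPowerSeries σ ℂ)) :=
  stable_coeff {d | Finsupp.weight ω d < s}

/-- A contraction for the topology defined by the filtration has a fixed point. -/
theorem exists_fixedPoint_family {ι : Type} [Fintype ι] {ω : σ → ℕ} (m : ι → ℕ)
    (A : ι → Set (MvPowerSeries σ ℂ)) (T : (ι → MvPowerSeries σ ℂ) → ι → MvPowerSeries σ ℂ)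
    (hne : ∃ a : ι → MvPowerSeries σ ℂ, ∀ i, a i ∈ A i) (hT : ∀ a, (∀ i, a i ∈ A i) → ∀ i, T a i ∈ A i)
    (hA : ∀ i, Stable ω (A i)) (hAm : ∀ i, ∀ f ∈ A i, ∀ g ∈ A i, f - g ∈ fil ω (m i))
    (hc : ∀ a b, (∀ i, a i ∈ A i) → (∀ i, b i ∈ A i) → ∀ s,
      (∀ i, a i - b i ∈ fil ω (s + m i)) → ∀ i, T a i - T b i ∈ fil ω (s + 1 + m i)) :
    ∃ a, (∀ i, a i ∈ A i) ∧ T a = a := by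
  obtain ⟨a₀, ha₀⟩ := hne
  let a : ℕ → ι → MvPowerSeries σ ℂ := fun n => T^[n] a₀
  have ha : ∀ n, a (n + 1) = T (a n) := fun n => Function.iterate_succ_apply' T n a₀
  have haA : ∀ n i, a n i ∈ A i := by
    intro n
    induction n with
    | zero => exact ha₀
    | succ n ih => rw [ha]; exact hT _ ih
  -- The offsets `m i` allow unknowns of different natural weights: each step gains one order
  -- relative to the offset of its component.
  have hstep : ∀ n i, a (n + 1) i - a n i ∈ fil ω (n + m i) := by
    intro n
    induction n with
    | zero => intro i; rw [Nat.zero_add]; exact hAm i _ (haA _ _) _ (haA _ _)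
    | succ n ih =>
      intro i
      rw [ha (n + 1), ha n]
      have := hc _ _ (haA (n + 1)) (haA n) n ih i
      rwa [ha n] at this
  have hcauchy : ∀ n p i, a (n + p) i - a n i ∈ fil ω (n + m i) := by
    intro n p i
    induction p with
    | zero => simp
    | succ p ih =>
      have h := add_mem (fil_anti (by omega) (hstep (n + p) i)) ih
      rwa [sub_add_sub_cancel] at h
  -- The coefficient of exponent `d` is stationary from iteration `weight d + 1` on, and the limit
  -- is read off there.
  let l : ι → MvPowerSeries σ ℂ := fun i d => coeff d (a (Finsupp.weight ω d + 1) i)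
  have hl : ∀ n i, l i - a n i ∈ fil ω n := by
    intro n i d hd
    obtain ⟨p, rfl⟩ := Nat.exists_eq_add_of_le (Nat.succ_le_of_lt hd)
    have := hcauchy (Finsupp.weight ω d + 1) p i d (by omega)
    rw [map_sub, sub_eq_zero] at this ⊢
    exact this.symm
  have hlA : ∀ i, l i ∈ A i := fun i => hA i _ fun s => ⟨a s i, haA s i, hl s i⟩
  refine ⟨l, hlA, funext fun i => ?_⟩
  rw [← sub_eq_zero]
  refine eq_zero_of_mem_fil (ω := ω) fun s => ?_
  -- `hl` carries no offset, so an iterate `∑ m i` steps later is used to pay for all the offsets at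
  -- once.
  have h1 := hc l (a (s + ∑ i, m i)) hlA (haA _) s (fun j => fil_anti
    (Nat.add_le_add_left (Finset.single_le_sum (fun _ _ => Nat.zero_le _) (Finset.mem_univ j)) s)
    (hl _ j)) i
  rw [← ha] at h1
  have h2 := hl (s + ∑ i, m i + 1) i
  have := sub_mem (fil_anti (s := s) (by omega) h1) (fil_anti (s := s) (by omega) h2)
  rwa [sub_sub_sub_cancel_right] at this

theorem exists_fixedPoint {ω : σ → ℕ} (A : Set (MvPowerSeries σ ℂ))
    (T : MvPowerSeries σ ℂ → MvPowerSeries σ ℂ) (hne : A.Nonempty) (hT : ∀ a ∈ A, T a ∈ A)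
    (hA : Stable ω A)
    (hc : ∀ a ∈ A, ∀ b ∈ A, ∀ s, a - b ∈ fil ω s → T a - T b ∈ fil ω (s + 1)) :
    ∃ a ∈ A, T a = a := by
  obtain ⟨a₀, ha₀⟩ := hne
  obtain ⟨a, ha, h⟩ := exists_fixedPoint_family (ι := Unit) (ω := ω) (fun _ => 0) (fun _ => A)
    (fun a _ => T (a ())) ⟨fun _ => a₀, fun _ => ha₀⟩ (fun a ha _ => hT _ (ha ())) (fun _ => hA)
    (fun _ f _ g _ => mem_fil_zero _) (fun a b ha hb s h _ => hc _ (ha ()) _ (hb ()) s (h ()))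
  exact ⟨a (), ha (), congrFun h ()⟩

/-! ### Majorants -/

/-- The value of the monomial of exponent `d` at the point `v`. -/
def mon (v : σ → ℝ) (d : σ →₀ ℕ) : ℝ := d.prod fun i n => v i ^ n

theorem mon_zero (v : σ → ℝ) : mon v 0 = 1 := by simp [mon]

theorem mon_add (v : σ → ℝ) (d e : σ →₀ ℕ) : mon v (d + e) = mon v d * mon v e :=
  Finsupp.prod_add_index' (fun _ => pow_zero _) fun _ _ _ => pow_add _ _ _

theorem mon_single (v : σ → ℝ) (i : σ) (n : ℕ) : mon v (Finsupp.single i n) = v i ^ n := by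
  simp [mon]

theorem mon_nonneg {v : σ → ℝ} (hv : ∀ i, 0 ≤ v i) (d : σ →₀ ℕ) : 0 ≤ mon v d :=
  Finset.prod_nonneg fun i _ => pow_nonneg (hv i) _

theorem mon_pos {v : σ → ℝ} (hv : ∀ i, 0 < v i) (d : σ →₀ ℕ) : 0 < mon v d :=
  Finset.prod_pos fun i _ => pow_pos (hv i) _

theorem mon_mono {v w : σ → ℝ} (hv : ∀ i, 0 ≤ v i) (h : ∀ i, v i ≤ w i) (d : σ →₀ ℕ) :
    mon v d ≤ mon w d :=
  Finset.prod_le_prod (fun i _ => pow_nonneg (hv i) _) fun i _ => pow_le_pow_left₀ (hv i) (h i) _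

theorem mon_pow (r : ℝ) (ω : σ → ℕ) (d : σ →₀ ℕ) :
    mon (fun i => r ^ ω i) d = r ^ Finsupp.weight ω d := by
  rw [mon, Finsupp.weight_apply, Finsupp.prod, Finsupp.sum, ← Finset.prod_pow_eq_pow_sum]
  refine Finset.prod_congr rfl fun i _ => ?_
  rw [← pow_mul, smul_eq_mul, mul_comm]

theorem mon_const (r : ℝ) (d : σ →₀ ℕ) : mon (fun _ => r) d = r ^ d.degree := by
  have := mon_pow r (fun _ : σ => 1) d
  simp only [pow_one] at this
  rw [this, Finsupp.degree_eq_weight_one]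

/-- The series of the absolute values of the terms of `f` at the point `v` has sum at most `c`. -/
def Bd (v : σ → ℝ) (f : MvPowerSeries σ ℂ) (c : ℝ) : Prop :=
  ∀ s : Finset (σ →₀ ℕ), ∑ d ∈ s, ‖coeff d f‖ * mon v d ≤ c

theorem Bd.nonneg {v : σ → ℝ} {f : MvPowerSeries σ ℂ} {c : ℝ} (h : Bd v f c) : 0 ≤ c := by
  simpa using h ∅

theorem Bd.mono {v : σ → ℝ} {f : MvPowerSeries σ ℂ} {c c' : ℝ} (h : Bd v f c) (hc : c ≤ c') :
    Bd v f c' := fun s => (h s).trans hc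

theorem Bd.anti {v w : σ → ℝ} (hv : ∀ i, 0 ≤ v i) (hvw : ∀ i, v i ≤ w i)
    {f : MvPowerSeries σ ℂ} {c : ℝ} (h : Bd w f c) : Bd v f c := fun s =>
  (Finset.sum_le_sum fun d _ =>
    mul_le_mul_of_nonneg_left (mon_mono hv hvw d) (norm_nonneg _)).trans (h s)

theorem Bd.of_norm_le {v : σ → ℝ} (hv : ∀ i, 0 ≤ v i) {f g : MvPowerSeries σ ℂ} {c : ℝ}
    (h : Bd v f c) (hg : ∀ d, ‖coeff d g‖ ≤ ‖coeff d f‖) : Bd v g c := fun s =>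
  (Finset.sum_le_sum fun d _ =>
    mul_le_mul_of_nonneg_right (hg d) (mon_nonneg hv d)).trans (h s)

theorem Bd.zero (v : σ → ℝ) : Bd v 0 0 := fun s => by simp

theorem Bd.add {v : σ → ℝ} (hv : ∀ i, 0 ≤ v i) {f g : MvPowerSeries σ ℂ} {b c : ℝ}
    (hf : Bd v f b) (hg : Bd v g c) : Bd v (f + g) (b + c) := fun s => by
  refine le_trans ?_ (add_le_add (hf s) (hg s))
  rw [← Finset.sum_add_distrib]
  refine Finset.sum_le_sum fun d _ => ?_
  rw [← add_mul, map_add]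
  exact mul_le_mul_of_nonneg_right (norm_add_le _ _) (mon_nonneg hv d)

theorem Bd.neg {v : σ → ℝ} {f : MvPowerSeries σ ℂ} {c : ℝ} (hf : Bd v f c) : Bd v (-f) c :=
  fun s => by simpa using hf s

theorem Bd.sub {v : σ → ℝ} (hv : ∀ i, 0 ≤ v i) {f g : MvPowerSeries σ ℂ} {b c : ℝ}
    (hf : Bd v f b) (hg : Bd v g c) : Bd v (f - g) (b + c) := by
  rw [sub_eq_add_neg]; exact hf.add hv hg.neg

theorem Bd.sum {v : σ → ℝ} (hv : ∀ i, 0 ≤ v i) {ι : Type*} (s : Finset ι)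
    {f : ι → MvPowerSeries σ ℂ} {c : ι → ℝ} (h : ∀ i ∈ s, Bd v (f i) (c i)) :
    Bd v (∑ i ∈ s, f i) (∑ i ∈ s, c i) := by
  classical
  induction s using Finset.induction_on with
  | empty => simpa using Bd.zero v
  | insert i s hi ih =>
    rw [Finset.sum_insert hi, Finset.sum_insert hi]
    exact (h i (Finset.mem_insert_self i s)).add hv
      (ih fun j hj => h j (Finset.mem_insert_of_mem hj))

theorem Bd.smul {v : σ → ℝ} {f : MvPowerSeries σ ℂ} {c : ℝ} (hf : Bd v f c) (a : ℂ) :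
    Bd v (a • f) (‖a‖ * c) := fun s => by
  refine le_trans (le_of_eq ?_) (mul_le_mul_of_nonneg_left (hf s) (norm_nonneg a))
  rw [Finset.mul_sum]
  exact Finset.sum_congr rfl fun d _ => by rw [coeff_smul, norm_mul, mul_assoc]

/-- The weighted `ℓ¹` norm is submultiplicative: the pairs in finitely many antidiagonals lie in a
finite product set, over which the double sum factors. -/
theorem Bd.mul {v : σ → ℝ} (hv : ∀ i, 0 ≤ v i) {f g : MvPowerSeries σ ℂ} {b c : ℝ}
    (hf : Bd v f b) (hg : Bd v g c) : Bd v (f * g) (b * c) := by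
  classical
  intro s
  let U : Finset ((σ →₀ ℕ) × (σ →₀ ℕ)) := s.biUnion Finset.HasAntidiagonal.antidiagonal
  have hdisj : ∀ x ∈ s, ∀ y ∈ s, x ≠ y →
      Disjoint (Finset.HasAntidiagonal.antidiagonal x) (Finset.HasAntidiagonal.antidiagonal y) := by
    intro x _ y _ hxy
    rw [Finset.disjoint_left]
    intro p hp hq
    rw [Finset.HasAntidiagonal.mem_antidiagonal] at hp hq
    exact hxy (hp.symm.trans hq)
  calc ∑ d ∈ s, ‖coeff d (f * g)‖ * mon v d
      ≤ ∑ d ∈ s, ∑ p ∈ Finset.HasAntidiagonal.antidiagonal d,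
          (‖coeff p.1 f‖ * mon v p.1) * (‖coeff p.2 g‖ * mon v p.2) := by
        refine Finset.sum_le_sum fun d _ => ?_
        rw [coeff_mul]
        refine (mul_le_mul_of_nonneg_right (norm_sum_le _ _) (mon_nonneg hv d)).trans
          (le_of_eq ?_)
        rw [Finset.sum_mul]
        refine Finset.sum_congr rfl fun p hp => ?_
        rw [← Finset.HasAntidiagonal.mem_antidiagonal.1 hp, mon_add, norm_mul]
        ring
    _ = ∑ p ∈ U, (‖coeff p.1 f‖ * mon v p.1) * (‖coeff p.2 g‖ * mon v p.2) :=
        (Finset.sum_biUnion hdisj).symm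
    _ ≤ ∑ p ∈ U.image Prod.fst ×ˢ U.image Prod.snd,
          (‖coeff p.1 f‖ * mon v p.1) * (‖coeff p.2 g‖ * mon v p.2) := by
        refine Finset.sum_le_sum_of_subset_of_nonneg ?_ fun p _ _ =>
          mul_nonneg (mul_nonneg (norm_nonneg _) (mon_nonneg hv _))
            (mul_nonneg (norm_nonneg _) (mon_nonneg hv _))
        intro p hp
        exact Finset.mem_product.2 ⟨Finset.mem_image_of_mem _ hp, Finset.mem_image_of_mem _ hp⟩
    _ = (∑ d ∈ U.image Prod.fst, ‖coeff d f‖ * mon v d) *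
          ∑ d ∈ U.image Prod.snd, ‖coeff d g‖ * mon v d := by
        rw [Finset.sum_mul_sum, Finset.sum_product]
    _ ≤ b * c := mul_le_mul (hf _) (hg _)
        (Finset.sum_nonneg fun d _ => mul_nonneg (norm_nonneg _) (mon_nonneg hv _)) hf.nonneg

theorem Bd.monomial (v : σ → ℝ) (d : σ →₀ ℕ) (a : ℂ) (hv : ∀ i, 0 ≤ v i) :
    Bd v (MvPowerSeries.monomial d a) (‖a‖ * mon v d) := by
  classical
  intro s
  have : ∀ e ∈ s, ‖coeff e (MvPowerSeries.monomial d a)‖ * mon v e =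
      if e = d then ‖a‖ * mon v d else 0 := by
    intro e _
    rw [coeff_monomial]
    split_ifs with h
    · rw [h]
    · simp
  rw [Finset.sum_congr rfl this, Finset.sum_ite_eq']
  split_ifs
  · exact le_rfl
  · exact mul_nonneg (norm_nonneg _) (mon_nonneg hv _)

theorem Bd.C {v : σ → ℝ} (hv : ∀ i, 0 ≤ v i) (a : ℂ) : Bd v (MvPowerSeries.C a) ‖a‖ := by
  have := Bd.monomial v 0 a hv
  rwa [mon_zero, mul_one] at this

theorem Bd.one {v : σ → ℝ} (hv : ∀ i, 0 ≤ v i) : Bd v 1 1 := by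
  simpa using Bd.C hv 1

theorem Bd.X {v : σ → ℝ} (hv : ∀ i, 0 ≤ v i) (i : σ) : Bd v (MvPowerSeries.X i) (v i) := by
  have := Bd.monomial v (Finsupp.single i 1) 1 hv
  rwa [mon_single, norm_one, one_mul, pow_one] at this

theorem Bd.pow {v : σ → ℝ} (hv : ∀ i, 0 ≤ v i) {f : MvPowerSeries σ ℂ} {c : ℝ}
    (hf : Bd v f c) (n : ℕ) : Bd v (f ^ n) (c ^ n) := by
  induction n with
  | zero => simpa using Bd.one hv
  | succ n ih => rw [pow_succ, pow_succ]; exact ih.mul hv hf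

theorem Bd.prod {v : σ → ℝ} (hv : ∀ i, 0 ≤ v i) {ι : Type*} (s : Finset ι)
    {f : ι → MvPowerSeries σ ℂ} {c : ι → ℝ} (h : ∀ i ∈ s, Bd v (f i) (c i)) :
    Bd v (∏ i ∈ s, f i) (∏ i ∈ s, c i) := by
  classical
  induction s using Finset.induction_on with
  | empty => simpa using Bd.one hv
  | insert i s hi ih =>
    rw [Finset.prod_insert hi, Finset.prod_insert hi]
    exact (h i (Finset.mem_insert_self i s)).mul hv
      (ih fun j hj => h j (Finset.mem_insert_of_mem hj))

/-- Each partial sum sees only finitely many coefficients, and these agree with those of a good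
enough approximation. Confining a formal contraction to such a ball therefore makes its fixed point
convergent. -/
theorem stable_Bd {ω : σ → ℕ} (v : σ → ℝ) (c : ℝ) : Stable ω {f | Bd v f c} := by
  intro f hf s
  obtain ⟨g, hg, h⟩ := hf (s.sup (Finsupp.weight ω) + 1)
  refine le_trans (le_of_eq (Finset.sum_congr rfl fun d hd => ?_)) (hg s)
  have := h d (Nat.lt_succ_of_le (Finset.le_sup hd))
  rw [map_sub, sub_eq_zero] at this
  rw [this]

/-- Elements of high order are small near the origin. -/
theorem Bd.of_mem_fil {ω : σ → ℕ} {r₀ r : ℝ} (hr : 0 ≤ r) (hr₀ : 0 < r₀) (h : r ≤ r₀)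
    {f : MvPowerSeries σ ℂ} {c : ℝ} (hf : Bd (fun i => r₀ ^ ω i) f c) {s : ℕ}
    (hs : f ∈ fil ω s) : Bd (fun i => r ^ ω i) f (c / r₀ ^ s * r ^ s) := by
  intro t
  rw [div_mul_eq_mul_div, mul_comm, mul_div_right_comm, ← div_pow]
  refine le_trans ?_ (mul_le_mul_of_nonneg_left (hf t) (pow_nonneg (div_nonneg hr hr₀.le) s))
  rw [Finset.mul_sum]
  refine Finset.sum_le_sum fun d _ => ?_
  rcases lt_or_ge (Finsupp.weight ω d) s with hd | hd
  · rw [hs d hd]; simp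
  · rw [mul_left_comm]
    refine mul_le_mul_of_nonneg_left ?_ (norm_nonneg _)
    rw [mon_pow, mon_pow]
    have h1 : r ^ Finsupp.weight ω d = (r / r₀) ^ Finsupp.weight ω d * r₀ ^ Finsupp.weight ω d := by
      rw [← mul_pow, div_mul_cancel₀ _ hr₀.ne']
    rw [h1]
    refine mul_le_mul_of_nonneg_right ?_ (pow_nonneg hr₀.le _)
    exact pow_le_pow_of_le_one (div_nonneg hr hr₀.le) ((div_le_one hr₀).2 h) hd

theorem IsConvergent.exists_bd {f : MvPowerSeries σ ℂ} (hf : IsConvergent f) :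
    ∃ r : ℝ, 0 < r ∧ ∃ c, Bd (fun _ => r) f c := by
  obtain ⟨r, hr, h⟩ := hf
  refine ⟨r, hr, ∑' d : σ →₀ ℕ, ‖coeff d f‖ * r ^ d.degree, fun s => ?_⟩
  have := h.sum_le_tsum s fun d _ => mul_nonneg (norm_nonneg _) (pow_nonneg hr.le _)
  simpa only [mon_const] using this

theorem Bd.isConvergent [Finite σ] {v : σ → ℝ} (hv : ∀ i, 0 < v i) {f : MvPowerSeries σ ℂ} {c : ℝ}
    (h : Bd v f c) : IsConvergent f := by
  cases nonempty_fintype σ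
  obtain ⟨r, hr, hrv⟩ : ∃ r : ℝ, 0 < r ∧ ∀ i, r ≤ v i := by
    rcases isEmpty_or_nonempty σ with hσ | hσ
    · exact ⟨1, one_pos, fun i => isEmptyElim i⟩
    · obtain ⟨i, hi⟩ := Finite.exists_min v
      exact ⟨v i, hv i, hi⟩
  refine ⟨r, hr, summable_of_sum_le
    (fun d => mul_nonneg (norm_nonneg _) (pow_nonneg hr.le _)) (c := c) fun s => ?_⟩
  have := h.anti (fun _ => hr.le) hrv s
  simpa only [mon_const] using this

theorem isConvergent_iff [Finite σ] {ω : σ → ℕ} (hω : ∀ i, ω i ≠ 0) {f : MvPowerSeries σ ℂ} :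
    IsConvergent f ↔ ∃ r : ℝ, 0 < r ∧ ∃ c, Bd (fun i => r ^ ω i) f c := by
  constructor
  · intro h
    obtain ⟨r, hr, c, hc⟩ := h.exists_bd
    refine ⟨min r 1, lt_min hr one_pos, c, hc.anti (fun i => by positivity) fun i => ?_⟩
    exact (pow_le_of_le_one (by positivity) (min_le_right _ _) (hω i)).trans (min_le_left _ _)
  · rintro ⟨r, hr, c, hc⟩
    exact hc.isConvergent fun i => pow_pos hr _

/-- Finitely many convergent series have a common bound near the origin. -/
theorem exists_common_bd [Finite σ] {ι : Type*} [Finite ι] {ω : σ → ℕ} (hω : ∀ i, ω i ≠ 0)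
    {f : ι → MvPowerSeries σ ℂ} (hf : ∀ i, IsConvergent (f i)) :
    ∃ r : ℝ, 0 < r ∧ r ≤ 1 ∧ ∃ c, 0 < c ∧ ∀ i, Bd (fun i => r ^ ω i) (f i) c := by
  cases nonempty_fintype ι
  choose r hr c hc using fun i => (isConvergent_iff hω).1 (hf i)
  obtain ⟨ρ, hρ, hρ1, hρr⟩ : ∃ ρ : ℝ, 0 < ρ ∧ ρ ≤ 1 ∧ ∀ i, ρ ≤ r i := by
    rcases isEmpty_or_nonempty ι with hι | hι
    · exact ⟨1, one_pos, le_rfl, fun i => isEmptyElim i⟩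
    · obtain ⟨i, hi⟩ := Finite.exists_min r
      exact ⟨min (r i) 1, lt_min (hr i) one_pos, min_le_right _ _,
        fun j => (min_le_left _ _).trans (hi j)⟩
  refine ⟨ρ, hρ, hρ1, 1 + ∑ i, c i,
    by linarith [Finset.sum_nonneg fun i (_ : i ∈ Finset.univ) => (hc i).nonneg], fun i => ?_⟩
  refine ((hc i).anti (fun j => by positivity) fun j =>
    pow_le_pow_left₀ hρ.le (hρr i) _).mono ?_
  linarith [Finset.single_le_sum (fun i _ => (hc i).nonneg) (Finset.mem_univ i)]

section Convergent

variable [Finite σ] {f g : MvPowerSeries σ ℂ}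

theorem exists_common_bd₂ (hf : IsConvergent f) (hg : IsConvergent g) :
    ∃ r : ℝ, 0 < r ∧ ∃ c, Bd (fun _ => r) f c ∧ Bd (fun _ => r) g c := by
  obtain ⟨r, hr, -, c, -, h⟩ := exists_common_bd (ι := Bool) (ω := fun _ : σ => 1)
    (fun _ => one_ne_zero) (f := fun b => cond b f g) (by rintro (_ | _) <;> assumption)
  simp only [pow_one] at h
  exact ⟨r, hr, c, h true, h false⟩

theorem IsConvergent.add (hf : IsConvergent f) (hg : IsConvergent g) : IsConvergent (f + g) := by
  obtain ⟨r, hr, c, h1, h2⟩ := exists_common_bd₂ hf hg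
  exact (h1.add (fun _ => hr.le) h2).isConvergent fun _ => hr

theorem IsConvergent.mul (hf : IsConvergent f) (hg : IsConvergent g) : IsConvergent (f * g) := by
  obtain ⟨r, hr, c, h1, h2⟩ := exists_common_bd₂ hf hg
  exact (h1.mul (fun _ => hr.le) h2).isConvergent fun _ => hr

theorem IsConvergent.neg (hf : IsConvergent f) : IsConvergent (-f) := by
  obtain ⟨r, hr, c, h⟩ := hf.exists_bd
  exact h.neg.isConvergent fun _ => hr

theorem IsConvergent.sub (hf : IsConvergent f) (hg : IsConvergent g) : IsConvergent (f - g) := by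
  rw [sub_eq_add_neg]; exact hf.add hg.neg

theorem isConvergent_C (a : ℂ) : IsConvergent (C a : MvPowerSeries σ ℂ) :=
  (Bd.C (v := fun _ => 1) (fun _ => zero_le_one) a).isConvergent fun _ => one_pos

theorem isConvergent_one : IsConvergent (1 : MvPowerSeries σ ℂ) := by
  simpa using isConvergent_C (σ := σ) 1

theorem isConvergent_X (i : σ) : IsConvergent (X i : MvPowerSeries σ ℂ) :=
  (Bd.X (v := fun _ => 1) (fun _ => zero_le_one) i).isConvergent fun _ => one_pos

theorem IsConvergent.smul (hf : IsConvergent f) (a : ℂ) : IsConvergent (a • f) := by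
  rw [smul_eq_C_mul]; exact (isConvergent_C a).mul hf

theorem IsConvergent.pow (hf : IsConvergent f) (n : ℕ) : IsConvergent (f ^ n) := by
  induction n with
  | zero => simpa using isConvergent_one
  | succ n ih => rw [pow_succ]; exact ih.mul hf

theorem IsConvergent.sum {ι : Type*} (s : Finset ι) {f : ι → MvPowerSeries σ ℂ}
    (h : ∀ i ∈ s, IsConvergent (f i)) : IsConvergent (∑ i ∈ s, f i) :=
  Finset.sum_induction f IsConvergent (fun _ _ => IsConvergent.add)
    (by simpa using isConvergent_C (σ := σ) 0) h

end Convergent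

/-! ### Operations on the coefficients -/

/-- The series whose coefficient of exponent `d` is `c d` times that of exponent `d + s` of `f`. -/
def shiftMul (s : σ →₀ ℕ) (c : (σ →₀ ℕ) → ℂ) : MvPowerSeries σ ℂ →ₗ[ℂ] MvPowerSeries σ ℂ where
  toFun f := fun d => c d * coeff (d + s) f
  map_add' f g := by
    ext d
    change c d * coeff (d + s) (f + g) = c d * coeff (d + s) f + c d * coeff (d + s) g
    rw [map_add, mul_add]
  map_smul' a f := by
    ext d
    change c d * coeff (d + s) (a • f) = a * (c d * coeff (d + s) f)
    rw [coeff_smul, mul_left_comm]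

theorem coeff_shiftMul (s : σ →₀ ℕ) (c : (σ →₀ ℕ) → ℂ) (f : MvPowerSeries σ ℂ) (d : σ →₀ ℕ) :
    coeff d (shiftMul s c f) = c d * coeff (d + s) f := rfl

theorem shiftMul_mem_fil {ω : σ → ℕ} {s : σ →₀ ℕ} {c : (σ →₀ ℕ) → ℂ} {f : MvPowerSeries σ ℂ}
    {n : ℕ} (hf : f ∈ fil ω n) : shiftMul s c f ∈ fil ω (n - Finsupp.weight ω s) := by
  intro d hd
  rw [coeff_shiftMul, hf, mul_zero]
  rw [map_add]
  omega

/-- Division by a monomial with bounded multipliers costs only the value of that monomial. The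
operators `solX`, `divX` and `liftParam k ∘ xc n` are all of this kind. -/
theorem Bd.shiftMul {v : σ → ℝ} (hv : ∀ i, 0 < v i) {s : σ →₀ ℕ} {c : (σ →₀ ℕ) → ℂ} {B : ℝ}
    (hc : ∀ d, ‖c d‖ ≤ B) {f : MvPowerSeries σ ℂ} {b : ℝ} (hf : Bd v f b) :
    Bd v (shiftMul s c f) (B * b / mon v s) := by
  classical
  intro t
  have hB : 0 ≤ B := (norm_nonneg _).trans (hc 0)
  rw [le_div_iff₀ (mon_pos hv s), Finset.sum_mul]
  refine le_trans ?_ (mul_le_mul_of_nonneg_left (hf (t.map (addRightEmbedding s))) hB)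
  rw [Finset.mul_sum, Finset.sum_map]
  refine Finset.sum_le_sum fun d _ => ?_
  rw [coeff_shiftMul, norm_mul, addRightEmbedding_apply, mon_add, mul_assoc, mul_assoc]
  exact mul_le_mul_of_nonneg_right (hc d)
    (mul_nonneg (norm_nonneg _) (mul_nonneg (mon_pos hv _).le (mon_pos hv _).le))

theorem IsConvergent.shiftMul [Finite σ] {s : σ →₀ ℕ} {c : (σ →₀ ℕ) → ℂ} {B : ℝ}
    (hc : ∀ d, ‖c d‖ ≤ B) {f : MvPowerSeries σ ℂ} (hf : IsConvergent f) :
    IsConvergent (shiftMul s c f) := by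
  obtain ⟨r, hr, b, h⟩ := hf.exists_bd
  exact (h.shiftMul (fun _ => hr) hc).isConvergent fun _ => hr

end

end SaddleNode

namespace SaddleNode

open Filter Topology MvPowerSeries

noncomputable section

variable {σ τ : Type}

/-! ### Substitution -/

/-- The product of powers `a ^ d`. -/
def powProd (a : σ → MvPowerSeries τ ℂ) (d : σ →₀ ℕ) : MvPowerSeries τ ℂ :=
  d.prod fun i n => a i ^ n

theorem powProd_add (a : σ → MvPowerSeries τ ℂ) (d e : σ →₀ ℕ) :
    powProd a (d + e) = powProd a d * powProd a e :=
  Finsupp.prod_add_index' (fun _ => pow_zero _) fun _ _ _ => pow_add _ _ _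

theorem powProd_single (a : σ → MvPowerSeries τ ℂ) (i : σ) (n : ℕ) :
    powProd a (Finsupp.single i n) = a i ^ n := by
  simp [powProd]

theorem powProd_mem_fil {ω : σ → ℕ} {ω' : τ → ℕ} {a : σ → MvPowerSeries τ ℂ}
    (ha : ∀ i, a i ∈ fil ω' (ω i)) (d : σ →₀ ℕ) :
    powProd a d ∈ fil ω' (Finsupp.weight ω d) := by
  induction d using Finsupp.induction_linear with
  | zero => rw [map_zero]; exact mem_fil_zero _
  | add d e hd he => rw [powProd_add, map_add]; exact mul_mem_fil hd he
  | single i n =>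
    rw [powProd_single, Finsupp.weight_single, smul_eq_mul]
    exact pow_mem_fil (ha i) n

theorem powProd_sub_mem_fil {ω : σ → ℕ} {ω' : τ → ℕ} {a b : σ → MvPowerSeries τ ℂ}
    (ha : ∀ i, a i ∈ fil ω' (ω i)) (hb : ∀ i, b i ∈ fil ω' (ω i)) {s : ℕ}
    (hab : ∀ i, a i - b i ∈ fil ω' (ω i + s)) (d : σ →₀ ℕ) :
    powProd a d - powProd b d ∈ fil ω' (Finsupp.weight ω d + s) := by
  have hadd : ∀ d e : σ →₀ ℕ,
      powProd a d - powProd b d ∈ fil ω' (Finsupp.weight ω d + s) →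
      powProd a e - powProd b e ∈ fil ω' (Finsupp.weight ω e + s) →
      powProd a (d + e) - powProd b (d + e) ∈ fil ω' (Finsupp.weight ω (d + e) + s) := by
    intro d e hd he
    have h : powProd a (d + e) - powProd b (d + e) =
        powProd a d * (powProd a e - powProd b e) + (powProd a d - powProd b d) * powProd b e := by
      rw [powProd_add, powProd_add]; ring
    rw [h, map_add]
    exact add_mem (mul_mem_fil_of_le (powProd_mem_fil ha d) he (by omega))
      (mul_mem_fil_of_le hd (powProd_mem_fil hb e) (by omega))
  induction d using Finsupp.induction_linear with
  | zero => simp [powProd]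
  | add d e hd he => exact hadd d e hd he
  | single i n =>
    induction n with
    | zero => simp [powProd]
    | succ n ih =>
      rw [Finsupp.single_add]
      refine hadd _ _ ih ?_
      rw [powProd_single, powProd_single, Finsupp.weight_single, pow_one, pow_one, one_smul]
      exact hab i

theorem hasSubst_of_zero [Finite σ] {a : σ → MvPowerSeries τ ℂ} (ha : ∀ i, constantCoeff (a i) = 0) :
    HasSubst a := hasSubst_of_constantCoeff_zero ha

theorem subst_mem_fil {ω : σ → ℕ} {ω' : τ → ℕ} {a : σ → MvPowerSeries τ ℂ}
    (ha0 : HasSubst a) (ha : ∀ i, a i ∈ fil ω' (ω i)) {m : ℕ}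
    {f : MvPowerSeries σ ℂ} (hf : f ∈ fil ω m) : subst a f ∈ fil ω' m := by
  intro e he
  rw [coeff_subst ha0]
  refine finsum_eq_zero_of_forall_eq_zero fun d => ?_
  rcases lt_or_ge (Finsupp.weight ω d) m with hd | hd
  · rw [hf d hd, zero_smul]
  · have := powProd_mem_fil ha d e (he.trans_le hd)
    rw [powProd] at this
    rw [this, smul_zero]

/-- Composition is Lipschitz in the inner series: a perturbation of relative weight `s` inside
causes one of relative weight `s` outside. Iterations that contain compositions contract for this
reason. -/
theorem subst_sub_subst_mem_fil {ω : σ → ℕ} {ω' : τ → ℕ} {a b : σ → MvPowerSeries τ ℂ}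
    (ha0 : HasSubst a) (hb0 : HasSubst b)
    (ha : ∀ i, a i ∈ fil ω' (ω i)) (hb : ∀ i, b i ∈ fil ω' (ω i)) {s m : ℕ}
    (hab : ∀ i, a i - b i ∈ fil ω' (ω i + s)) {f : MvPowerSeries σ ℂ} (hf : f ∈ fil ω m) :
    subst a f - subst b f ∈ fil ω' (m + s) := by
  intro e he
  rw [map_sub, coeff_subst ha0, coeff_subst hb0,
    ← finsum_sub_distrib (coeff_subst_finite ha0 f e) (coeff_subst_finite hb0 f e)]
  refine finsum_eq_zero_of_forall_eq_zero fun d => ?_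
  rcases lt_or_ge (Finsupp.weight ω d) m with hd | hd
  · rw [hf d hd, zero_smul, zero_smul, sub_zero]
  · have := powProd_sub_mem_fil ha hb hab d e (by omega)
    rw [powProd, powProd, map_sub] at this
    rw [← smul_sub, this, smul_zero]

variable [Finite σ]

theorem exists_mvPolynomial_sub_mem_fil {ω : σ → ℕ} (hω : ∀ i, ω i ≠ 0) (f : MvPowerSeries σ ℂ)
    (n : ℕ) : ∃ p : MvPolynomial σ ℂ, f - p ∈ fil ω n := by
  classical
  have hfin := Finsupp.finite_of_nat_weight_lt ω hω n
  refine ⟨∑ d ∈ hfin.toFinset, MvPolynomial.monomial d (coeff d f), fun d hd => ?_⟩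
  rw [map_sub, MvPolynomial.coeff_coe, MvPolynomial.coeff_sum, sub_eq_zero]
  simp_rw [MvPolynomial.coeff_monomial]
  rw [Finset.sum_ite_eq', if_pos]
  simpa using hd

/-- Two continuous additive maps that agree on polynomials are equal. -/
theorem addMonoidHom_ext {ω : σ → ℕ} (ω' : τ → ℕ) (hω : ∀ i, ω i ≠ 0)
    {L L' : MvPowerSeries σ ℂ →+ MvPowerSeries τ ℂ}
    (hL : ∀ s, ∃ n, ∀ f ∈ fil ω n, L f - L' f ∈ fil ω' s)
    (hp : ∀ p : MvPolynomial σ ℂ, L p = L' p) (f : MvPowerSeries σ ℂ) : L f = L' f := by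
  rw [← sub_eq_zero]
  refine eq_zero_of_mem_fil (ω := ω') fun s => ?_
  obtain ⟨n, hn⟩ := hL s
  obtain ⟨p, hfp⟩ := exists_mvPolynomial_sub_mem_fil hω f n
  have := hn _ hfp
  rwa [map_sub, map_sub, hp, sub_sub_sub_cancel_right] at this

theorem pderiv_mem_fil {σ : Type} {ω : σ → ℕ} (i : σ) {n : ℕ} {f : MvPowerSeries σ ℂ}
    (hf : f ∈ fil ω n) : pderiv ℂ i f ∈ fil ω (n - ω i) := by
  intro d hd
  rw [coeff_pderiv, hf, zero_mul]
  rw [map_add, Finsupp.weight_single, one_smul]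
  omega

theorem coeff_single_eq {σ : Type} (i : σ) (f : MvPowerSeries σ ℂ) :
    coeff (Finsupp.single i 1) f = constantCoeff (pderiv ℂ i f) := by
  rw [← coeff_zero_eq_constantCoeff_apply, coeff_pderiv]
  simp

theorem constantCoeff_subst_of_zero {a : σ → MvPowerSeries τ ℂ}
    (ha : ∀ i, constantCoeff (a i) = 0) (f : MvPowerSeries σ ℂ) :
    constantCoeff (subst a f) = constantCoeff f := by
  have h := subst_mem_fil (ω := fun _ => 1) (ω' := fun _ => 1) (hasSubst_of_zero ha)
    (fun i => (mem_fil_one fun _ => one_ne_zero).2 (ha i))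
    (sub_C_mem_fil_one (fun _ => one_ne_zero) f)
  rw [mem_fil_one fun _ => one_ne_zero, subst_sub (hasSubst_of_zero ha), map_sub, sub_eq_zero] at h
  rw [h, subst_C, constantCoeff_C]

/-- The chain rule. -/
theorem pderiv_subst {σ : Type} [Fintype σ] {a : σ → MvPowerSeries τ ℂ}
    (ha : ∀ i, constantCoeff (a i) = 0) (t : τ) (f : MvPowerSeries σ ℂ) :
    pderiv ℂ t (subst a f) = ∑ i, subst a (pderiv ℂ i f) * pderiv ℂ t (a i) := by
  have ha0 := hasSubst_of_zero ha
  have hfil : ∀ n, ∀ f ∈ fil (fun _ : σ => 1) n, subst a f ∈ fil (fun _ : τ => 1) n :=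
    fun n f => subst_mem_fil ha0 (fun i => (mem_fil_one fun _ => one_ne_zero).2 (ha i))
  let L : MvPowerSeries σ ℂ →+ MvPowerSeries τ ℂ :=
    ((pderiv ℂ t).toLinearMap.comp (substAlgHom ha0 (R := ℂ)).toLinearMap).toAddMonoidHom
  let L' : MvPowerSeries σ ℂ →+ MvPowerSeries τ ℂ :=
    { toFun := fun f => ∑ i, subst a (pderiv ℂ i f) * pderiv ℂ t (a i)
      map_zero' := Finset.sum_eq_zero fun i _ => by
        rw [map_zero, ← coe_substAlgHom ha0, map_zero, zero_mul]
      map_add' := fun f g => by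
        rw [← Finset.sum_add_distrib]
        exact Finset.sum_congr rfl fun i _ => by rw [map_add, subst_add ha0, add_mul] }
  have hL : ∀ f, L f = pderiv ℂ t (subst a f) := fun f => by
    rw [← coe_substAlgHom ha0]; rfl
  have hL' : ∀ f, L' f = ∑ i, subst a (pderiv ℂ i f) * pderiv ℂ t (a i) := fun f => rfl
  rw [← hL, ← hL']
  -- Both sides are additive and continuous in `f`, so polynomials suffice. Differentiation loses
  -- one degree, whence `s + 1` below.
  refine addMonoidHom_ext (ω := fun _ => 1) (fun _ => 1) (fun _ => one_ne_zero) ?_ ?_ f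
  · intro s
    refine ⟨s + 1, fun f hf => ?_⟩
    rw [hL, hL']
    refine sub_mem ?_ (Ideal.sum_mem _ fun i _ => ?_)
    · exact fil_anti (by omega) (pderiv_mem_fil t (hfil _ _ hf))
    · exact Ideal.mul_mem_right _ _ (fil_anti (by omega) (hfil _ _ (pderiv_mem_fil i hf)))
  · intro p
    induction p using MvPolynomial.induction_on with
    | C c =>
      rw [hL, hL', MvPolynomial.coe_C, subst_C, pderiv_C]
      refine (Finset.sum_eq_zero fun i _ => ?_).symm
      rw [pderiv_C, ← coe_substAlgHom ha0, map_zero, zero_mul]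
    | add p q hp hq => rw [MvPolynomial.coe_add, map_add, map_add, hp, hq]
    | mul_X p j hp =>
      rw [hL, hL'] at hp ⊢
      rw [MvPolynomial.coe_mul, MvPolynomial.coe_X, subst_mul ha0, subst_X ha0, Derivation.leibniz,
        hp, smul_eq_mul, smul_eq_mul, Finset.mul_sum]
      have : ∀ i, subst a (pderiv ℂ i ((p : MvPowerSeries σ ℂ) * X j)) * pderiv ℂ t (a i) =
          subst a (p : MvPowerSeries σ ℂ) * (subst a (pderiv ℂ i (X j : MvPowerSeries σ ℂ)) *
            pderiv ℂ t (a i)) + a j * (subst a (pderiv ℂ i (p : MvPowerSeries σ ℂ)) *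
            pderiv ℂ t (a i)) := by
        intro i
        rw [Derivation.leibniz, subst_add ha0, smul_eq_mul, smul_eq_mul, subst_mul ha0,
          subst_mul ha0, subst_X ha0]
        ring
      rw [Finset.sum_congr rfl fun i _ => this i, Finset.sum_add_distrib]
      congr 1
      rw [← Finset.mul_sum, Finset.sum_eq_single j]
      · rw [pderiv_X_self, ← coe_substAlgHom ha0, map_one, one_mul]
      · intro i _ hij
        rw [pderiv_X_of_ne hij.symm, ← coe_substAlgHom ha0, map_zero, zero_mul]
      · simp

theorem coeff_single_subst {σ : Type} [Fintype σ] {a : σ → MvPowerSeries τ ℂ}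
    (ha : ∀ i, constantCoeff (a i) = 0) (t : τ) (f : MvPowerSeries σ ℂ) :
    coeff (Finsupp.single t 1) (subst a f) =
      ∑ i, coeff (Finsupp.single i 1) f * coeff (Finsupp.single t 1) (a i) := by
  simp_rw [coeff_single_eq, pderiv_subst ha, map_sum, map_mul, constantCoeff_subst_of_zero ha]

theorem jacobianAtZero_subst {σ : Type} [Fintype σ] {a b : σ → MvPowerSeries σ ℂ}
    (hb : ∀ i, constantCoeff (b i) = 0) :
    jacobianAtZero (fun i => subst b (a i)) = jacobianAtZero a * jacobianAtZero b := by
  ext i j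
  rw [Matrix.mul_apply]
  exact coeff_single_subst hb j (a i)

theorem jacobianAtZero_X {σ : Type} [DecidableEq σ] :
    jacobianAtZero (fun i : σ => (X i : MvPowerSeries σ ℂ)) = 1 := by
  ext i j
  simp [jacobianAtZero, coeff_X, Matrix.one_apply, Finsupp.single_left_inj, eq_comm]

/-! ### Substitution and convergence -/

theorem Bd.powProd {σ : Type} {w : τ → ℝ} (hw : ∀ i, 0 ≤ w i) {v : σ → ℝ} {a : σ → MvPowerSeries τ ℂ}
    (ha : ∀ i, Bd w (a i) (v i)) (d : σ →₀ ℕ) : Bd w (powProd a d) (mon v d) :=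
  Bd.prod hw _ fun i _ => (ha i).pow hw _

/-- If each `a i` has norm at most `v i`, then `a ^ d` has norm at most `v ^ d`; exchanging two
finite sums transfers the bound from `f` to the composition. -/
theorem Bd.subst {σ : Type} {w : τ → ℝ} (hw : ∀ i, 0 ≤ w i) {v : σ → ℝ} {a : σ → MvPowerSeries τ ℂ}
    (ha0 : HasSubst a) (ha : ∀ i, Bd w (a i) (v i)) {f : MvPowerSeries σ ℂ} {c : ℝ}
    (hf : Bd v f c) : Bd w (subst a f) c := by
  classical
  intro s
  let E : Finset (σ →₀ ℕ) := s.biUnion fun e => (coeff_subst_finite ha0 f e).toFinset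
  have h1 : ∀ e ∈ s, coeff e (MvPowerSeries.subst a f) =
      ∑ d ∈ E, coeff d f * coeff e (SaddleNode.powProd a d) := by
    intro e he
    rw [coeff_subst ha0]
    refine finsum_eq_sum_of_support_subset _ fun d hd => ?_
    simp only [E, Finset.coe_biUnion, Set.mem_iUnion]
    exact ⟨e, he, by simpa using hd⟩
  calc ∑ e ∈ s, ‖coeff e (MvPowerSeries.subst a f)‖ * mon w e
      ≤ ∑ e ∈ s, ∑ d ∈ E, ‖coeff d f‖ * (‖coeff e (SaddleNode.powProd a d)‖ * mon w e) := by
        refine Finset.sum_le_sum fun e he => ?_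
        rw [h1 e he]
        refine (mul_le_mul_of_nonneg_right (norm_sum_le _ _) (mon_nonneg hw e)).trans ?_
        rw [Finset.sum_mul]
        exact Finset.sum_le_sum fun d _ => by rw [norm_mul, mul_assoc]
    _ = ∑ d ∈ E, ‖coeff d f‖ * ∑ e ∈ s, ‖coeff e (SaddleNode.powProd a d)‖ * mon w e := by
        rw [Finset.sum_comm]
        exact Finset.sum_congr rfl fun d _ => (Finset.mul_sum _ _ _).symm
    _ ≤ ∑ d ∈ E, ‖coeff d f‖ * mon v d := Finset.sum_le_sum fun d _ =>
        mul_le_mul_of_nonneg_left (Bd.powProd hw ha d s) (norm_nonneg _)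
    _ ≤ c := hf E

theorem exists_bd_le_of_zero [Finite τ] {a : σ → MvPowerSeries τ ℂ}
    (ha0 : ∀ i, constantCoeff (a i) = 0) (ha : ∀ i, IsConvergent (a i)) {ε : ℝ} (hε : 0 < ε) :
    ∃ r : ℝ, 0 < r ∧ ∀ i, Bd (fun _ => r) (a i) ε := by
  obtain ⟨ρ, hρ, -, c, hc, h⟩ := exists_common_bd (ω := fun _ : τ => 1) (fun _ => one_ne_zero) ha
  refine ⟨min ρ (ε * ρ / c), by positivity, fun i => ?_⟩
  have := (h i).of_mem_fil (r := min ρ (ε * ρ / c)) (by positivity) hρ (min_le_left _ _)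
    ((mem_fil_one fun _ => one_ne_zero).2 (ha0 i))
  simp only [pow_one] at this
  refine this.mono ((mul_le_mul_of_nonneg_left (min_le_right _ _) (by positivity)).trans
    (le_of_eq ?_))
  field_simp

theorem IsConvergent.subst [Finite τ] {a : σ → MvPowerSeries τ ℂ}
    (ha0 : ∀ i, constantCoeff (a i) = 0) (ha : ∀ i, IsConvergent (a i))
    {f : MvPowerSeries σ ℂ} (hf : IsConvergent f) : IsConvergent (subst a f) := by
  obtain ⟨r, hr, c, h⟩ := hf.exists_bd
  obtain ⟨ρ, hρ, h'⟩ := exists_bd_le_of_zero ha0 ha hr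
  exact (Bd.subst (fun _ => hρ.le) (hasSubst_of_zero ha0) h' h).isConvergent fun _ => hρ

/-! ### The inverse function theorem -/

section Inverse

variable {σ : Type} [Fintype σ] {a : σ → MvPowerSeries σ ℂ}

/-- The part of order at least two of a map. -/
def higherPart (a : σ → MvPowerSeries σ ℂ) (i : σ) : MvPowerSeries σ ℂ :=
  a i - ∑ j, jacobianAtZero a i j • X j

theorem higherPart_mem_fil (ha : ∀ i, constantCoeff (a i) = 0) (i : σ) :
    higherPart a i ∈ fil (fun _ => 1) 2 := by
  intro d hd
  rw [← Finsupp.degree_eq_weight_one] at hd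
  rw [higherPart, map_sub, map_sum]
  simp_rw [coeff_smul]
  obtain h | h : d.degree = 0 ∨ d.degree = 1 := by omega
  · rw [Finsupp.degree_eq_zero_iff] at h
    subst h
    simp [ha i]
  · obtain ⟨j, rfl⟩ : ∃ j, d = Finsupp.single j 1 := by
      have : d ∈ Set.range fun j : σ => Finsupp.single j 1 := by
        rw [Finsupp.range_single_one]; exact h
      exact this.imp fun _ h => h.symm
    classical
    rw [Finset.sum_eq_single j]
    · simp [jacobianAtZero]
    · intro l _ hl
      rw [coeff_X, if_neg, mul_zero]
      rw [Finsupp.single_left_inj one_ne_zero]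
      exact hl.symm
    · simp

/-- With `a = J X + H` and `H` of order two, the inverse is the fixed point of `b ↦ J⁻¹ (X - H ∘
b)`. The invariant set `A` is left free, so that the formal case (series without constant term) and
the convergent case (a ball in it) share one argument. -/
theorem exists_rightInverse_mem [DecidableEq σ] (ha : ∀ i, constantCoeff (a i) = 0)
    (hdet : (jacobianAtZero a).det ≠ 0) (A : Set (MvPowerSeries σ ℂ))
    (hA : Stable (fun _ => 1) A) (hA1 : A ⊆ (fil (fun _ => 1) 1 : Ideal (MvPowerSeries σ ℂ))) (hne : A.Nonempty)
    (hT : ∀ g : σ → MvPowerSeries σ ℂ, (∀ i, g i ∈ A) → ∀ i,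
      ∑ j, (jacobianAtZero a)⁻¹ i j • (X j - subst g (higherPart a j)) ∈ A) :
    ∃ b : σ → MvPowerSeries σ ℂ, (∀ i, b i ∈ A) ∧ ∀ i, subst b (a i) = X i := by
  have h0 : ∀ g : σ → MvPowerSeries σ ℂ, (∀ i, g i ∈ A) → HasSubst g := fun g hg =>
    hasSubst_of_zero fun i => (mem_fil_one fun _ => one_ne_zero).1 (hA1 (hg i))
  obtain ⟨f₀, hf₀⟩ := hne
  obtain ⟨b, hb, hfix⟩ := exists_fixedPoint_family (ω := fun _ : σ => 1) (fun _ => 1) (fun _ => A)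
    (fun g i => ∑ j, (jacobianAtZero a)⁻¹ i j • (X j - subst g (higherPart a j)))
    ⟨fun _ => f₀, fun _ => hf₀⟩ hT (fun _ => hA)
    (fun _ f hf g hg => sub_mem (hA1 hf) (hA1 hg)) (by
      intro f g hf hg s hfg i
      rw [← Finset.sum_sub_distrib]
      refine Ideal.sum_mem _ fun j _ => ?_
      rw [← smul_sub, sub_sub_sub_cancel_left, ← neg_sub]
      refine smul_mem_fil _ (neg_mem ?_)
      refine fil_anti (t := 2 + s) (by omega) (subst_sub_subst_mem_fil (ω := fun _ => 1) (h0 f hf) (h0 g hg)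
        (fun i => hA1 (hf i)) (fun i => hA1 (hg i)) (fun i => by rw [add_comm]; exact hfg i)
        (higherPart_mem_fil ha j)))
  refine ⟨b, hb, fun i => ?_⟩
  have h1 : a i = ∑ j, jacobianAtZero a i j • X j + higherPart a i := by
    rw [higherPart]; abel
  have hmul : jacobianAtZero a * (jacobianAtZero a)⁻¹ = 1 :=
    Matrix.mul_nonsing_inv _ (Ne.isUnit hdet)
  have h2 : ∑ j, jacobianAtZero a i j • b j = X i - subst b (higherPart a i) := by
    calc ∑ j, jacobianAtZero a i j • b j
        = ∑ j, jacobianAtZero a i j •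
            ∑ l, (jacobianAtZero a)⁻¹ j l • (X l - subst b (higherPart a l)) :=
          Finset.sum_congr rfl fun j _ => by rw [← congrFun hfix j]
      _ = ∑ l, (jacobianAtZero a * (jacobianAtZero a)⁻¹) i l •
            (X l - subst b (higherPart a l)) := by
          simp_rw [Finset.smul_sum, smul_smul]
          rw [Finset.sum_comm]
          exact Finset.sum_congr rfl fun l _ => by rw [← Finset.sum_smul, Matrix.mul_apply]
      _ = _ := by
          rw [hmul, Finset.sum_eq_single i]
          · rw [Matrix.one_apply_eq, one_smul]
          · intro l _ hl
            rw [Matrix.one_apply_ne hl.symm, zero_smul]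
          · simp
  have hb0 := h0 b hb
  conv_lhs => rw [h1]
  rw [subst_add hb0, ← coe_substAlgHom hb0, map_sum]
  simp_rw [map_smul, coe_substAlgHom, subst_X hb0]
  rw [h2, sub_add_cancel]

theorem exists_rightInverse [DecidableEq σ] (ha : ∀ i, constantCoeff (a i) = 0)
    (hdet : (jacobianAtZero a).det ≠ 0) :
    ∃ b : σ → MvPowerSeries σ ℂ, (∀ i, constantCoeff (b i) = 0) ∧ (∀ i, subst b (a i) = X i) ∧
      ((∀ i, IsConvergent (a i)) → ∀ i, IsConvergent (b i)) := by
  have hone : ∀ i : σ, (fun _ : σ => 1) i ≠ 0 := fun _ => one_ne_zero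
  have hT1 : ∀ g : σ → MvPowerSeries σ ℂ, (∀ i, g i ∈ fil (fun _ => 1) 1) → ∀ i,
      ∑ j, (jacobianAtZero a)⁻¹ i j • (X j - subst g (higherPart a j)) ∈ fil (fun _ => 1) 1 :=
    fun g hg i => Ideal.sum_mem _ fun j _ => smul_mem_fil _ (sub_mem (X_mem_fil j)
      (fil_anti one_le_two (subst_mem_fil (ω := fun _ => 1)
        (hasSubst_of_zero fun i => (mem_fil_one hone).1 (hg i)) hg (higherPart_mem_fil ha j))))
  by_cases hconv : ∀ i, IsConvergent (a i)
  · have hH : ∀ i, IsConvergent (higherPart a i) := fun i =>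
      (hconv i).sub (IsConvergent.sum _ fun j _ => (isConvergent_X j).smul _)
    obtain ⟨ρ, hρ, -, c, hc, hbd⟩ := exists_common_bd hone hH
    let α : ℝ := 1 + ∑ i, ∑ j, ‖(jacobianAtZero a)⁻¹ i j‖
    have hαi : ∀ i, ∑ j, ‖(jacobianAtZero a)⁻¹ i j‖ ≤ α := fun i => by
      have := Finset.single_le_sum (f := fun i => ∑ j, ‖(jacobianAtZero a)⁻¹ i j‖)
        (fun i _ => Finset.sum_nonneg fun j _ => norm_nonneg _) (Finset.mem_univ i)
      simp only [α]; linarith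
    have hα : 0 < α := by positivity
    -- The first bound keeps the radius `2 α r` inside the domain `ρ` of `H`. The second uses that
    -- `H` is quadratic, so that its norm at radius `2 α r` is at most `r`. Then `α (r + r) = 2 α r`
    -- closes the ball.
    let r : ℝ := min (ρ / (2 * α)) (ρ ^ 2 / (c * (2 * α) ^ 2))
    have hr : 0 < r := by positivity
    have hr1 : 2 * α * r ≤ ρ := by
      have := min_le_left (ρ / (2 * α)) (ρ ^ 2 / (c * (2 * α) ^ 2))
      rwa [le_div_iff₀ (by positivity), mul_comm] at this
    have hr2 : c / ρ ^ 2 * (2 * α * r) ^ 2 ≤ r := by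
      have := min_le_right (ρ / (2 * α)) (ρ ^ 2 / (c * (2 * α) ^ 2))
      rw [le_div_iff₀ (by positivity)] at this
      rw [div_mul_eq_mul_div, div_le_iff₀ (by positivity)]
      calc c * (2 * α * r) ^ 2 = r * (r * (c * (2 * α) ^ 2)) := by ring
        _ ≤ _ := mul_le_mul_of_nonneg_left this hr.le
    have hb2 : ∀ j, Bd (fun _ => 2 * α * r) (higherPart a j) r := fun j => by
      have := (hbd j).of_mem_fil (r := 2 * α * r) (by positivity) hρ hr1 (higherPart_mem_fil ha j)
      simp only [pow_one] at this
      exact this.mono hr2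
    obtain ⟨b, hb, h⟩ := exists_rightInverse_mem ha hdet
      ((fil (fun _ => 1) 1 : Ideal (MvPowerSeries σ ℂ)) ∩ {f | Bd (fun _ => r) f (2 * α * r)})
      ((stable_fil 1).inter (stable_Bd _ _)) Set.inter_subset_left
      ⟨0, zero_mem _, (Bd.zero _).mono (by positivity)⟩ (by
        intro g hg i
        refine ⟨hT1 g (fun i => (hg i).1) i, ?_⟩
        have := Bd.sum (v := fun _ : σ => r) (fun _ => hr.le) Finset.univ fun j _ =>
          ((Bd.X (v := fun _ : σ => r) (fun _ => hr.le) j).sub (fun _ => hr.le)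
            (Bd.subst (fun _ => hr.le) (hasSubst_of_zero fun i => (mem_fil_one hone).1 (hg i).1)
              (fun i => (hg i).2) (hb2 j))).smul ((jacobianAtZero a)⁻¹ i j)
        refine this.mono ?_
        rw [← Finset.sum_mul]
        calc _ ≤ α * (r + r) := mul_le_mul_of_nonneg_right (hαi i) (by positivity)
          _ = _ := by ring)
    exact ⟨b, fun i => (mem_fil_one hone).1 (hb i).1, h, fun _ i =>
      (hb i).2.isConvergent fun _ => hr⟩
  · obtain ⟨b, hb, h⟩ := exists_rightInverse_mem ha hdet (fil (fun _ => 1) 1 : Ideal (MvPowerSeries σ ℂ))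
      (stable_fil 1) subset_rfl ⟨0, zero_mem _⟩ hT1
    exact ⟨b, fun i => (mem_fil_one hone).1 (hb i), h, fun h => absurd h hconv⟩

theorem subst_subst_of_inverse {τ : Type} [Finite τ] {a : σ → MvPowerSeries τ ℂ}
    {b : τ → MvPowerSeries σ ℂ} (ha : ∀ i, constantCoeff (a i) = 0)
    (hb : ∀ i, constantCoeff (b i) = 0) (h : ∀ i, subst b (a i) = X i) (f : MvPowerSeries σ ℂ) :
    subst b (subst a f) = f := by
  rw [subst_comp_subst_apply (hasSubst_of_zero ha) (hasSubst_of_zero hb)]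
  simp_rw [h]
  exact congrFun subst_self f

theorem exists_inverse [DecidableEq σ] (ha : ∀ i, constantCoeff (a i) = 0)
    (hdet : (jacobianAtZero a).det ≠ 0) :
    ∃ b : σ → MvPowerSeries σ ℂ, (∀ i, constantCoeff (b i) = 0) ∧ (∀ i, subst b (a i) = X i) ∧
      (∀ i, subst a (b i) = X i) ∧ (jacobianAtZero b).det ≠ 0 ∧
      ((∀ i, IsConvergent (a i)) → ∀ i, IsConvergent (b i)) := by
  obtain ⟨b, hb, hab, hconv⟩ := exists_rightInverse ha hdet
  have hdetb : (jacobianAtZero b).det ≠ 0 := by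
    have h := jacobianAtZero_subst (a := a) hb
    simp_rw [hab] at h
    rw [jacobianAtZero_X] at h
    intro h0
    have := congrArg Matrix.det h
    rw [Matrix.det_mul, h0, mul_zero, Matrix.det_one] at this
    exact one_ne_zero this
  -- A right inverse that itself has a right inverse is two-sided: the second one is the original
  -- map.
  obtain ⟨c, hc, hbc, -⟩ := exists_rightInverse hb hdetb
  have hac : a = c := funext fun i => by
    have := subst_subst_of_inverse hb hc hbc (a i)
    rw [hab, subst_X (hasSubst_of_zero hc)] at this
    exact this.symm
  exact ⟨b, hb, hab, hac ▸ hbc, hdetb, hconv⟩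

end Inverse

end

end SaddleNode

namespace SaddleNode

open Filter Topology MvPowerSeries

noncomputable section

variable {σ τ : Type}

/-! ### Values of convergent power series -/

/-- The value of the monomial of exponent `d` at the point `z`. -/
def cmon (z : σ → ℂ) (d : σ →₀ ℕ) : ℂ := d.prod fun i n => z i ^ n

theorem cmon_add (z : σ → ℂ) (d e : σ →₀ ℕ) : cmon z (d + e) = cmon z d * cmon z e :=
  Finsupp.prod_add_index' (fun _ => pow_zero _) fun _ _ _ => pow_add _ _ _

theorem cmon_single (z : σ → ℂ) (i : σ) (n : ℕ) : cmon z (Finsupp.single i n) = z i ^ n := by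
  simp [cmon]

theorem cmon_smul (t : ℂ) (z : σ → ℂ) (d : σ →₀ ℕ) :
    cmon (t • z) d = t ^ d.degree * cmon z d := by
  rw [cmon, Finsupp.prod]
  simp_rw [Pi.smul_apply, smul_eq_mul, mul_pow]
  rw [Finset.prod_mul_distrib, Finset.prod_pow_eq_pow_sum]
  rfl

theorem norm_cmon_le {v : σ → ℝ} {z : σ → ℂ} (hz : ∀ i, ‖z i‖ ≤ v i) (d : σ →₀ ℕ) :
    ‖cmon z d‖ ≤ mon v d := by
  rw [cmon, mon, Finsupp.prod, Finsupp.prod, norm_prod]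
  refine Finset.prod_le_prod (fun i _ => norm_nonneg _) fun i _ => ?_
  rw [norm_pow]
  exact pow_le_pow_left₀ (norm_nonneg _) (hz i) _

theorem evalAt_eq (f : MvPowerSeries σ ℂ) (z : σ → ℂ) :
    evalAt f z = ∑' d, coeff d f * cmon z d := rfl

theorem Bd.sum_norm_le {v : σ → ℝ} {f : MvPowerSeries σ ℂ} {c : ℝ} (h : Bd v f c) {z : σ → ℂ}
    (hz : ∀ i, ‖z i‖ ≤ v i) (s : Finset (σ →₀ ℕ)) : ∑ d ∈ s, ‖coeff d f * cmon z d‖ ≤ c :=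
  (Finset.sum_le_sum fun d _ => by
    rw [norm_mul]
    exact mul_le_mul_of_nonneg_left (norm_cmon_le hz d) (norm_nonneg _)).trans (h s)

theorem Bd.summable_norm {v : σ → ℝ} {f : MvPowerSeries σ ℂ} {c : ℝ} (h : Bd v f c) {z : σ → ℂ}
    (hz : ∀ i, ‖z i‖ ≤ v i) : Summable fun d => ‖coeff d f * cmon z d‖ :=
  summable_of_sum_le (fun _ => norm_nonneg _) (h.sum_norm_le hz)

theorem Bd.norm_evalAt_le {v : σ → ℝ} {f : MvPowerSeries σ ℂ} {c : ℝ} (h : Bd v f c) {z : σ → ℂ}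
    (hz : ∀ i, ‖z i‖ ≤ v i) : ‖evalAt f z‖ ≤ c :=
  (norm_tsum_le_tsum_norm (h.summable_norm hz)).trans
    ((h.summable_norm hz).tsum_le_of_sum_le (h.sum_norm_le hz))

theorem evalAt_coe (p : MvPolynomial σ ℂ) (z : σ → ℂ) :
    evalAt (p : MvPowerSeries σ ℂ) z = MvPolynomial.eval z p := by
  rw [evalAt_eq, MvPolynomial.eval_eq, tsum_eq_sum (s := p.support)]
  · rfl
  · intro d hd
    rw [MvPolynomial.coeff_coe, MvPolynomial.notMem_support_iff.1 hd, zero_mul]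

theorem evalAt_X (i : σ) (z : σ → ℂ) : evalAt (X i) z = z i := by
  rw [← MvPolynomial.coe_X, evalAt_coe, MvPolynomial.eval_X]

theorem evalAt_one (z : σ → ℂ) : evalAt (1 : MvPowerSeries σ ℂ) z = 1 := by
  rw [← MvPolynomial.coe_one, evalAt_coe, map_one]

theorem evalAt_sub {v : σ → ℝ} {f g : MvPowerSeries σ ℂ} {b c : ℝ} (hf : Bd v f b)
    (hg : Bd v g c) {z : σ → ℂ} (hz : ∀ i, ‖z i‖ ≤ v i) :
    evalAt (f - g) z = evalAt f z - evalAt g z := by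
  rw [evalAt_eq, evalAt_eq, evalAt_eq,
    ← (hf.summable_norm hz).of_norm.tsum_sub (hg.summable_norm hz).of_norm]
  exact tsum_congr fun d => by rw [map_sub, sub_mul]

theorem evalAt_mul {v : σ → ℝ} {f g : MvPowerSeries σ ℂ} {b c : ℝ} (hf : Bd v f b)
    (hg : Bd v g c) {z : σ → ℂ} (hz : ∀ i, ‖z i‖ ≤ v i) :
    evalAt (f * g) z = evalAt f z * evalAt g z := by
  classical
  have hfg : Summable fun x : (σ →₀ ℕ) × (σ →₀ ℕ) =>
      (coeff x.1 f * cmon z x.1) * (coeff x.2 g * cmon z x.2) :=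
    summable_mul_of_summable_norm (f := fun d => coeff d f * cmon z d)
      (g := fun d => coeff d g * cmon z d) (hf.summable_norm hz) (hg.summable_norm hz)
  have h := Summable.tsum_mul_tsum_eq_tsum_sum_antidiagonal (f := fun d => coeff d f * cmon z d)
    (g := fun d => coeff d g * cmon z d) (hf.summable_norm hz).of_norm
    (hg.summable_norm hz).of_norm hfg
  rw [evalAt_eq, evalAt_eq, evalAt_eq]
  refine Eq.trans ?_ h.symm
  refine tsum_congr fun d => ?_
  rw [coeff_mul, Finset.sum_mul]
  refine Finset.sum_congr rfl fun p hp => ?_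
  rw [← Finset.HasAntidiagonal.mem_antidiagonal.1 hp, cmon_add]
  ring

theorem evalAt_powProd {w : τ → ℝ} (hw : ∀ i, 0 ≤ w i) {v : σ → ℝ} {a : σ → MvPowerSeries τ ℂ}
    (ha : ∀ i, Bd w (a i) (v i)) {z : τ → ℂ} (hz : ∀ i, ‖z i‖ ≤ w i) (d : σ →₀ ℕ) :
    evalAt (powProd a d) z = cmon (fun i => evalAt (a i) z) d := by
  induction d using Finsupp.induction_linear with
  | zero => simp [powProd, cmon, evalAt_one]
  | add d e hd he =>
    rw [powProd_add, cmon_add, evalAt_mul (Bd.powProd hw ha d) (Bd.powProd hw ha e) hz, hd, he]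
  | single i n =>
    rw [powProd_single, cmon_single]
    induction n with
    | zero => rw [pow_zero, pow_zero, evalAt_one]
    | succ n ih => rw [pow_succ, pow_succ, evalAt_mul ((ha i).pow hw n) (ha i) hz, ih]

/-- The norm bound makes the double family over exponents of `f` and of the result absolutely
summable, so the order of summation may be exchanged. -/
theorem evalAt_subst_of_bd {w : τ → ℝ} (hw : ∀ i, 0 ≤ w i) {v : σ → ℝ}
    {a : σ → MvPowerSeries τ ℂ} (ha0 : HasSubst a) (ha : ∀ i, Bd w (a i) (v i))
    {f : MvPowerSeries σ ℂ} {c : ℝ} (hf : Bd v f c) {z : τ → ℂ} (hz : ∀ i, ‖z i‖ ≤ w i) :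
    evalAt (subst a f) z = evalAt f fun i => evalAt (a i) z := by
  have h1 : ∀ e, coeff e (subst a f) * cmon z e =
      ∑' d, coeff d f * (coeff e (powProd a d) * cmon z e) := by
    intro e
    rw [coeff_subst ha0, ← tsum_eq_finsum (L := .unconditional _) (coeff_subst_finite ha0 f e), ← tsum_mul_right]
    exact tsum_congr fun d => by rw [smul_eq_mul, mul_assoc]; rfl
  have h2 : Summable (Function.uncurry fun (e : τ →₀ ℕ) (d : σ →₀ ℕ) =>
      coeff d f * (coeff e (powProd a d) * cmon z e)) := by
    classical
    refine Summable.of_norm (summable_of_sum_le (c := c) (fun _ => norm_nonneg _) fun u => ?_)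
    calc ∑ p ∈ u, ‖coeff p.2 f * (coeff p.1 (powProd a p.2) * cmon z p.1)‖
        ≤ ∑ p ∈ u.image Prod.fst ×ˢ u.image Prod.snd,
            ‖coeff p.2 f * (coeff p.1 (powProd a p.2) * cmon z p.1)‖ :=
          Finset.sum_le_sum_of_subset_of_nonneg (fun p hp => Finset.mem_product.2
            ⟨Finset.mem_image_of_mem _ hp, Finset.mem_image_of_mem _ hp⟩)
            fun p _ _ => norm_nonneg _
      _ = ∑ d ∈ u.image Prod.snd, ‖coeff d f‖ *
            ∑ e ∈ u.image Prod.fst, ‖coeff e (powProd a d) * cmon z e‖ := by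
          rw [Finset.sum_product_right]
          refine Finset.sum_congr rfl fun d _ => ?_
          rw [Finset.mul_sum]
          exact Finset.sum_congr rfl fun e _ => norm_mul _ _
      _ ≤ ∑ d ∈ u.image Prod.snd, ‖coeff d f‖ * mon v d := Finset.sum_le_sum fun d _ =>
          mul_le_mul_of_nonneg_left ((Bd.powProd hw ha d).sum_norm_le hz _) (norm_nonneg _)
      _ ≤ c := hf _
  rw [evalAt_eq, tsum_congr h1, ← h2.tsum_comm, evalAt_eq]
  refine tsum_congr fun d => ?_
  rw [tsum_mul_left, ← evalAt_powProd hw ha hz, evalAt_eq]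

theorem eventually_norm_le [Finite τ] {r : ℝ} (hr : 0 < r) :
    ∀ᶠ z in 𝓝 (0 : τ → ℂ), ∀ i, ‖z i‖ ≤ r := by
  rw [eventually_all]
  intro i
  have h : Tendsto (fun z : τ → ℂ => ‖z i‖) (𝓝 0) (𝓝 0) := by
    have := ((continuous_apply i).norm (E := ℂ)).tendsto (0 : τ → ℂ)
    simpa using this
  exact (h.eventually (gt_mem_nhds hr)).mono fun _ h => le_of_lt h

section Convergent

variable [Finite σ] [Finite τ] {a : σ → MvPowerSeries τ ℂ}

theorem eventually_evalAt_subst (ha0 : ∀ i, constantCoeff (a i) = 0)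
    (ha : ∀ i, IsConvergent (a i)) {f : MvPowerSeries σ ℂ} (hf : IsConvergent f) :
    ∀ᶠ z in 𝓝 (0 : τ → ℂ), evalAt (subst a f) z = evalAt f fun i => evalAt (a i) z := by
  obtain ⟨r, hr, c, h⟩ := hf.exists_bd
  obtain ⟨ρ, hρ, h'⟩ := exists_bd_le_of_zero ha0 ha hr
  exact (eventually_norm_le hρ).mono fun z hz =>
    evalAt_subst_of_bd (fun _ => hρ.le) (hasSubst_of_zero ha0) h' h hz

theorem tendsto_evalAt_zero (ha0 : ∀ i, constantCoeff (a i) = 0)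
    (ha : ∀ i, IsConvergent (a i)) :
    Tendsto (fun (z : τ → ℂ) i => evalAt (a i) z) (𝓝 0) (𝓝 0) := by
  rw [tendsto_pi_nhds]
  intro i
  rw [Metric.tendsto_nhds]
  intro ε hε
  obtain ⟨ρ, hρ, h⟩ := exists_bd_le_of_zero ha0 ha (half_pos hε)
  refine (eventually_norm_le hρ).mono fun z hz => ?_
  rw [Pi.zero_apply, dist_zero_right]
  exact ((h i).norm_evalAt_le hz).trans_lt (half_lt_self hε)

/-- A convergent power series whose sum vanishes near the origin is zero. -/
theorem eq_zero_of_evalAt_eq_zero {f : MvPowerSeries τ ℂ} (hf : IsConvergent f)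
    (h0 : ∀ᶠ z in 𝓝 (0 : τ → ℂ), evalAt f z = 0) : f = 0 := by
  classical
  cases nonempty_fintype τ
  obtain ⟨ρ, hρ, c, hc⟩ := hf.exists_bd
  obtain ⟨δ, hδ, h0⟩ := Metric.eventually_nhds_iff.1 h0
  refine eq_zero_of_mem_fil_succ (ω := fun _ => 1) fun N hN => ?_
  -- `p` is the homogeneous part of degree `N`. Since `f` has order at least `N`, `f (t z) = t^N
  -- p(z) + O(t^(N+1))`, and vanishing of `f` near `0` gives `p(z) = 0` as `t → 0`.
  let F := (Finsupp.finite_of_degree_eq (σ := τ) N).toFinset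
  let p : MvPolynomial τ ℂ := ∑ d ∈ F, MvPolynomial.monomial d (coeff d f)
  have hp : ∀ d : τ →₀ ℕ, MvPolynomial.coeff d p = if d.degree = N then coeff d f else 0 := by
    intro d
    rw [MvPolynomial.coeff_sum]
    simp_rw [MvPolynomial.coeff_monomial]
    rw [Finset.sum_ite_eq']
    simp [F]
  have hfp : f - p ∈ fil (fun _ => 1) (N + 1) := by
    intro d hd
    rw [map_sub, MvPolynomial.coeff_coe, hp]
    split_ifs with h
    · rw [sub_self]
    · rw [sub_zero]
      rw [← Finsupp.degree_eq_weight_one] at hd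
      refine hN d ?_
      rw [← Finsupp.degree_eq_weight_one]
      omega
  have hpb : Bd (fun _ => ρ) (p : MvPowerSeries τ ℂ) c := hc.of_norm_le (fun _ => hρ.le) fun d => by
    rw [MvPolynomial.coeff_coe, hp]
    split_ifs
    · exact le_rfl
    · rw [norm_zero]; exact norm_nonneg _
  have hsmul : ∀ (t : ℂ) (z : τ → ℂ),
      MvPolynomial.eval (t • z) p = t ^ N * MvPolynomial.eval z p := by
    intro t z
    simp_rw [p, map_sum, MvPolynomial.eval_monomial, Finset.mul_sum]
    refine Finset.sum_congr rfl fun d hd => ?_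
    have hd : d.degree = N := by simpa [F] using hd
    change coeff d f * cmon (t • z) d = t ^ N * (coeff d f * cmon z d)
    rw [cmon_smul, hd, mul_left_comm]
  have hsmall : ∀ z : τ → ℂ, (∀ i, ‖z i‖ ≤ 1) → MvPolynomial.eval z p = 0 := by
    intro z hz
    rw [← norm_le_zero_iff]
    refine le_of_forall_pos_le_add fun ε hε => ?_
    rw [zero_add]
    have hC : 0 ≤ (c + c) / ρ ^ (N + 1) :=
      div_nonneg (add_nonneg hc.nonneg hc.nonneg) (pow_nonneg hρ.le _)
    -- `ρ` is for the bound, `δ / 2` for the vanishing of `f`, and the last term makes the remainder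
    -- at most `ε` after division by `t^N`.
    let t : ℝ := min (min ρ (δ / 2)) (ε / ((c + c) / ρ ^ (N + 1) + 1))
    have ht : 0 < t := by positivity
    have htρ : t ≤ ρ := (min_le_left _ _).trans (min_le_left _ _)
    have htz : ∀ i, ‖((t : ℂ) • z) i‖ ≤ t := by
      intro i
      rw [Pi.smul_apply, smul_eq_mul, norm_mul, Complex.norm_real, Real.norm_of_nonneg ht.le]
      exact mul_le_of_le_one_right ht.le (hz i)
    have hev : evalAt f ((t : ℂ) • z) = 0 := by
      refine h0 ?_
      rw [dist_zero_right]
      refine lt_of_le_of_lt ((pi_norm_le_iff_of_nonneg ht.le).2 htz) ?_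
      exact ((min_le_left _ _).trans (min_le_right _ _)).trans_lt (half_lt_self hδ)
    have h1 := evalAt_sub (z := (t : ℂ) • z) hc hpb fun i => (htz i).trans htρ
    rw [hev, zero_sub, evalAt_coe, hsmul] at h1
    have hb : Bd (fun _ => ρ) (f - (p : MvPowerSeries τ ℂ)) (c + c) := hc.sub (fun _ => hρ.le) hpb
    have h2 := Bd.of_mem_fil (r := t) (r₀ := ρ) (ω := fun _ => 1) ht.le hρ htρ
      (by simpa only [pow_one] using hb) hfp
    simp only [pow_one] at h2
    have h3 := h2.norm_evalAt_le htz
    rw [h1, norm_neg, norm_mul, norm_pow, Complex.norm_real, Real.norm_of_nonneg ht.le,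
      pow_succ t, ← mul_assoc, mul_comm (_ / _), mul_assoc] at h3
    refine (le_of_mul_le_mul_left h3 (pow_pos ht N)).trans ?_
    have h4 : t ≤ ε / ((c + c) / ρ ^ (N + 1) + 1) := min_le_right _ _
    rw [le_div_iff₀ (by positivity)] at h4
    nlinarith
  have hzero : p = 0 := by
    refine MvPolynomial.funext fun z => ?_
    rw [map_zero]
    have hpos : (0 : ℝ) < ‖z‖ + 1 := by positivity
    have h1 := hsmall ((((‖z‖ + 1)⁻¹ : ℝ) : ℂ) • z) fun i => by
      rw [Pi.smul_apply, smul_eq_mul, norm_mul, Complex.norm_real, Real.norm_of_nonneg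
        (inv_nonneg.2 hpos.le), inv_mul_le_iff₀ hpos, mul_one]
      exact (norm_le_pi_norm z i).trans (by linarith)
    rw [hsmul] at h1
    refine (mul_eq_zero.1 h1).resolve_left (pow_ne_zero _ ?_)
    exact_mod_cast (inv_pos.2 hpos).ne'
  rw [hzero, MvPolynomial.coe_zero, sub_zero] at hfp
  exact hfp

end Convergent

end

end SaddleNode

namespace SaddleNode

open Filter Topology MvPowerSeries

noncomputable section

variable {k : ℕ}

/-! ### Formal changes -/

theorem liftParam_eq_subst (p : ParamSeries k) :
    liftParam k p = subst (fun j : Fin k => (X (Sum.inl j) : Series k)) p := by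
  rw [liftParam, rename_eq_subst]; rfl

theorem constantCoeff_liftParam (p : ParamSeries k) :
    constantCoeff (liftParam k p) = constantCoeff p := by
  rw [liftParam, constantCoeff_rename]

theorem liftParam_X (j : Fin k) : liftParam k (X j) = X (Sum.inl j) := by
  rw [liftParam, rename_X]

theorem liftParam_injective : Function.Injective (liftParam k) :=
  rename_injective (Function.Embedding.inl : Fin k ↪ Fin k ⊕ Fin 2)

theorem coeff_liftParam (p : ParamSeries k) (d : Fin k →₀ ℕ) :
    coeff (d.embDomain Function.Embedding.inl) (liftParam k p) = coeff d p :=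
  coeff_embDomain_rename (Function.Embedding.inl : Fin k ↪ Fin k ⊕ Fin 2) p d

theorem coeff_liftParam_eq_zero (p : ParamSeries k) {d : Fin k ⊕ Fin 2 →₀ ℕ} {i : Fin 2}
    (h : d (Sum.inr i) ≠ 0) : coeff d (liftParam k p) = 0 := by
  refine coeff_rename_eq_zero (f := Sum.inl) p ?_
  rintro ⟨e, rfl⟩
  refine h ?_
  rw [Finsupp.mapDomain_of_notMem_range]
  rintro ⟨j, hj⟩
  exact Sum.inl_ne_inr hj

theorem X_inl_zero (j : Fin k) : constantCoeff (X (Sum.inl j) : Series k) = 0 := by simp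

theorem subst_inl_hasSubst : HasSubst (fun j : Fin k => (X (Sum.inl j) : Series k)) :=
  hasSubst_of_zero X_inl_zero

theorem IsConvergent.liftParam {p : ParamSeries k} (hp : IsConvergent p) :
    IsConvergent (liftParam k p) := by
  rw [liftParam_eq_subst]
  exact IsConvergent.subst X_inl_zero (fun j => isConvergent_X _) hp

theorem liftParam_subst {a : Fin k → ParamSeries k} (ha : ∀ j, constantCoeff (a j) = 0)
    (p : ParamSeries k) : liftParam k (subst a p) = subst (fun j => liftParam k (a j)) p := by
  simp_rw [liftParam_eq_subst]
  exact subst_comp_subst_apply (hasSubst_of_zero ha) subst_inl_hasSubst p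

namespace FormalChange

variable (Ψ Ψ' : FormalChange k)

theorem total_inl (j : Fin k) : Ψ.total (Sum.inl j) = liftParam k (Ψ.par j) := rfl

theorem total_inr (i : Fin 2) : Ψ.total (Sum.inr i) = Ψ.map i := rfl

theorem total_zero (i : Fin k ⊕ Fin 2) : constantCoeff (Ψ.total i) = 0 := by
  rcases i with j | i
  · rw [total_inl, constantCoeff_liftParam, Ψ.par_zero]
  · exact Ψ.map_zero i

theorem hasSubst_total : HasSubst Ψ.total := hasSubst_of_zero Ψ.total_zero

/-- Composition with a formal change, as a homomorphism of algebras. -/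
def pullHom : Series k →ₐ[ℂ] Series k := substAlgHom Ψ.hasSubst_total

theorem pull_eq (f : Series k) : Ψ.pull f = Ψ.pullHom f := by
  rw [pull, pullHom, coe_substAlgHom]

theorem pull_inl (j : Fin k) : Ψ.pull (X (Sum.inl j)) = liftParam k (Ψ.par j) :=
  subst_X Ψ.hasSubst_total _

theorem pull_inr (i : Fin 2) : Ψ.pull (X (Sum.inr i)) = Ψ.map i :=
  subst_X Ψ.hasSubst_total _

theorem pull_liftParam (p : ParamSeries k) :
    Ψ.pull (liftParam k p) = liftParam k (subst Ψ.par p) := by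
  rw [liftParam_subst Ψ.par_zero, liftParam_eq_subst, pull,
    subst_comp_subst_apply subst_inl_hasSubst Ψ.hasSubst_total]
  congr 1
  funext j
  exact Ψ.pull_inl j

theorem constantCoeff_pull (f : Series k) : constantCoeff (Ψ.pull f) = constantCoeff f :=
  constantCoeff_subst_of_zero Ψ.total_zero f

theorem IsAnalytic.pull {Ψ : FormalChange k} (h : Ψ.IsAnalytic) {f : Series k}
    (hf : IsConvergent f) : IsConvergent (Ψ.pull f) := by
  refine IsConvergent.subst Ψ.total_zero (fun i => ?_) hf
  rcases i with j | i
  · exact (h.1 j).liftParam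
  · exact h.2 i

end FormalChange

/-- The `ε`-components do not involve `x` and `y`, so the Jacobian matrix is block triangular. -/
theorem jacobian_elim (p : Fin k → ParamSeries k) (m : Family k) :
    (jacobianAtZero (Sum.elim (fun j => liftParam k (p j)) m)).det =
      (jacobianAtZero p).det * (jacobianAtZero (atParamZero m)).det := by
  have : jacobianAtZero (Sum.elim (fun j => liftParam k (p j)) m) =
      Matrix.fromBlocks (jacobianAtZero p) 0
        (Matrix.of fun i j => coeff (Finsupp.single (Sum.inl j) 1) (m i))
        (jacobianAtZero (atParamZero m)) := by
    ext i j
    rcases i with i | i <;> rcases j with j | j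
    · have := coeff_liftParam (p i) (Finsupp.single j 1)
      rw [Finsupp.embDomain_single] at this
      exact this
    · exact coeff_liftParam_eq_zero _ (i := j) (by simp)
    · rfl
    · have := coeff_killCompl (e := (Function.Embedding.inr : Fin 2 ↪ Fin k ⊕ Fin 2)) (m i)
        (Finsupp.single j 1)
      rw [Finsupp.embDomain_single] at this
      exact this.symm
  rw [this, Matrix.det_fromBlocks_zero₁₂]

namespace FormalChange

variable (Ψ Ψ' : FormalChange k)

theorem det_total : (jacobianAtZero Ψ.total).det ≠ 0 := by
  rw [total, jacobian_elim]
  exact mul_ne_zero Ψ.par_invertible Ψ.map_invertible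

/-- The formal change with the given components. -/
def ofTotal (p : Fin k → ParamSeries k) (m : Family k) (hp : ∀ j, constantCoeff (p j) = 0)
    (hm : ∀ i, constantCoeff (m i) = 0)
    (h : (jacobianAtZero (Sum.elim (fun j => liftParam k (p j)) m)).det ≠ 0) :
    FormalChange k where
  par := p
  map := m
  par_zero := hp
  map_zero := hm
  par_invertible := left_ne_zero_of_mul (jacobian_elim p m ▸ h)
  map_invertible := right_ne_zero_of_mul (jacobian_elim p m ▸ h)

theorem subst_total (i : Fin k ⊕ Fin 2) : Sum.elim
    (fun j => liftParam k (subst Ψ'.par (Ψ.par j))) (fun i => Ψ'.pull (Ψ.map i)) i =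
      subst Ψ'.total (Ψ.total i) := by
  rcases i with j | i
  · exact (Ψ'.pull_liftParam _).symm
  · rfl

/-- The composition `Ψ ∘ Ψ'`. -/
def comp : FormalChange k :=
  ofTotal (fun j => subst Ψ'.par (Ψ.par j)) (fun i => Ψ'.pull (Ψ.map i))
    (fun j => by rw [constantCoeff_subst_of_zero Ψ'.par_zero, Ψ.par_zero])
    (fun i => by rw [constantCoeff_pull, Ψ.map_zero]) (by
      rw [funext (subst_total Ψ Ψ'), jacobianAtZero_subst Ψ'.total_zero, Matrix.det_mul]
      exact mul_ne_zero Ψ.det_total Ψ'.det_total)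

theorem comp_par (j : Fin k) : (Ψ.comp Ψ').par j = subst Ψ'.par (Ψ.par j) := rfl

theorem comp_map (i : Fin 2) : (Ψ.comp Ψ').map i = Ψ'.pull (Ψ.map i) := rfl

theorem comp_pull (f : Series k) : (Ψ.comp Ψ').pull f = Ψ'.pull (Ψ.pull f) := by
  have h : (Ψ.comp Ψ').total = fun i => subst Ψ'.total (Ψ.total i) := funext (subst_total Ψ Ψ')
  rw [pull, h]
  exact (subst_comp_subst_apply Ψ.hasSubst_total Ψ'.hasSubst_total f).symm

theorem exists_inv : ∃ Θ : FormalChange k, (∀ f, Ψ.pull (Θ.pull f) = f) ∧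
    (∀ f, Θ.pull (Ψ.pull f) = f) ∧ (∀ p, subst Ψ.par (subst Θ.par p) = p) ∧
    (∀ p, subst Θ.par (subst Ψ.par p) = p) ∧
    ((∀ j, IsConvergent (Ψ.par j)) → ∀ j, IsConvergent (Θ.par j)) ∧
    (Ψ.IsAnalytic → Θ.IsAnalytic) := by
  obtain ⟨b, hb0, hb1, hb2, -, hbc⟩ := exists_inverse Ψ.par_zero Ψ.par_invertible
  obtain ⟨G, hG0, hG1, hG2, hGdet, hGc⟩ := exists_inverse Ψ.total_zero Ψ.det_total
  -- The inverse of the total map is again fibred over the parameter: substituting `G` in `φ⁻¹ ∘ φ =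
  -- id` shows that its `ε`-components are those of `φ⁻¹`, in `ε` alone.
  have hG : G = Sum.elim (fun j => liftParam k (b j)) (fun i => G (Sum.inr i)) := by
    funext i
    rcases i with j | i
    · have h1 : ∀ l, subst G (liftParam k (Ψ.par l)) = X (Sum.inl l) := fun l => hG1 (Sum.inl l)
      have h2 : subst G (liftParam k (subst Ψ.par (b j))) = G (Sum.inl j) := by
        rw [hb2, liftParam_X, subst_X (hasSubst_of_zero hG0)]
      rw [liftParam_subst Ψ.par_zero, subst_comp_subst_apply (hasSubst_of_zero fun l => by
        rw [constantCoeff_liftParam, Ψ.par_zero]) (hasSubst_of_zero hG0)] at h2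
      simp_rw [h1] at h2
      rw [← h2, Sum.elim_inl, liftParam_eq_subst]
    · rfl
  have htot : ∀ h h' h'', (ofTotal b (fun i => G (Sum.inr i)) h h' h'').total = G :=
    fun _ _ _ => hG.symm
  refine ⟨ofTotal b (fun i => G (Sum.inr i)) hb0 (fun i => hG0 _) (by rwa [← hG]), ?_, ?_, ?_, ?_,
    hbc, ?_⟩
  · intro f
    rw [pull, pull, htot]
    exact subst_subst_of_inverse hG0 Ψ.total_zero hG2 f
  · intro f
    rw [pull, pull, htot]
    exact subst_subst_of_inverse Ψ.total_zero hG0 hG1 f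
  · exact subst_subst_of_inverse hb0 Ψ.par_zero hb2
  · exact subst_subst_of_inverse Ψ.par_zero hb0 hb1
  · intro h
    refine ⟨hbc h.1, fun i => hGc (fun i => ?_) _⟩
    rcases i with j | i
    · exact (h.1 j).liftParam
    · exact h.2 i

theorem pull_bijective : Function.Bijective Ψ.pull := by
  obtain ⟨Θ, h1, h2, -⟩ := Ψ.exists_inv
  exact ⟨Function.LeftInverse.injective h2, Function.RightInverse.surjective h1⟩

end FormalChange

/-- Halving the radius absorbs the factor `d i + 1 ≤ 2 ^ |d|` produced by differentiation. -/
theorem IsConvergent.pderiv {σ : Type} [Finite σ] {f : MvPowerSeries σ ℂ} (hf : IsConvergent f)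
    {i : σ} : IsConvergent (pderiv ℂ i f) := by
  classical
  obtain ⟨r, hr, c, h⟩ := hf.exists_bd
  refine Bd.isConvergent (v := fun _ => r / 2) (c := c / r) (fun _ => half_pos hr) fun s => ?_
  rw [le_div_iff₀ hr, Finset.sum_mul]
  refine le_trans ?_ (h (s.map (addRightEmbedding (Finsupp.single i 1))))
  rw [Finset.sum_map]
  refine Finset.sum_le_sum fun d _ => ?_
  rw [coeff_pderiv, addRightEmbedding_apply, mon_add, mon_single, pow_one, mon_const, mon_const,
    norm_mul, ← Nat.cast_succ, Complex.norm_natCast, mul_assoc, mul_assoc, ← mul_assoc _ _ r]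
  refine mul_le_mul_of_nonneg_left (mul_le_mul_of_nonneg_right ?_ hr.le) (norm_nonneg _)
  have h1 : ((d i).succ : ℝ) ≤ 2 ^ d.degree := by
    have : (d i).succ ≤ 2 ^ d.degree :=
      (Nat.succ_le_of_lt Nat.lt_two_pow_self).trans
        (Nat.pow_le_pow_right two_pos (Finsupp.le_degree i d))
    exact_mod_cast this
  calc ((d i).succ : ℝ) * (r / 2) ^ d.degree
      ≤ 2 ^ d.degree * (r / 2) ^ d.degree := mul_le_mul_of_nonneg_right h1 (by positivity)
    _ = r ^ d.degree := by rw [← mul_pow]; congr 1; ring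

/-! ### Derivatives along families of vector fields -/

/-- The directional derivative as a derivation. -/
def lieDerivation (Z : Family k) : Derivation ℂ (Series k) (Series k) :=
  ∑ i : Fin 2, Z i • pderiv ℂ (Sum.inr i)

theorem lieDeriv_eq (Z : Family k) (f : Series k) : lieDeriv Z f = lieDerivation Z f := by
  rw [lieDerivation, lieDeriv, Fin.sum_univ_two, Fin.sum_univ_two]
  rfl

theorem lieDeriv_eq_two (Z : Family k) (f : Series k) : lieDeriv Z f =
    Z 0 * pderiv ℂ (Sum.inr 0) f + Z 1 * pderiv ℂ (Sum.inr 1) f := by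
  rw [lieDeriv, Fin.sum_univ_two]

theorem lieDeriv_add (Z : Family k) (f g : Series k) :
    lieDeriv Z (f + g) = lieDeriv Z f + lieDeriv Z g := by
  simp_rw [lieDeriv_eq, map_add]

theorem lieDeriv_sub (Z : Family k) (f g : Series k) :
    lieDeriv Z (f - g) = lieDeriv Z f - lieDeriv Z g := by
  simp_rw [lieDeriv_eq, map_sub]

theorem lieDeriv_smul (Z : Family k) (a : ℂ) (f : Series k) :
    lieDeriv Z (a • f) = a • lieDeriv Z f := by
  rw [lieDeriv_eq, lieDeriv_eq, Derivation.map_smul]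

theorem lieDeriv_mul (Z : Family k) (f g : Series k) :
    lieDeriv Z (f * g) = f * lieDeriv Z g + g * lieDeriv Z f := by
  simp_rw [lieDeriv_eq, Derivation.leibniz, smul_eq_mul]

theorem lieDeriv_X (Z : Family k) (i : Fin 2) : lieDeriv Z (X (Sum.inr i)) = Z i := by
  rw [lieDeriv, Finset.sum_eq_single i]
  · rw [pderiv_X_self, mul_one]
  · intro j _ hj
    rw [pderiv_X_of_ne fun h => hj (Sum.inr_injective h).symm, mul_zero]
  · simp

theorem pderiv_liftParam (i : Fin 2) (p : ParamSeries k) :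
    pderiv ℂ (Sum.inr i) (liftParam k p) = 0 := by
  ext d
  rw [coeff_pderiv, coeff_liftParam_eq_zero (i := i), zero_mul, map_zero]
  rw [Finsupp.add_apply, Finsupp.single_eq_same]
  exact Nat.succ_ne_zero _

theorem lieDeriv_liftParam (Z : Family k) (p : ParamSeries k) :
    lieDeriv Z (liftParam k p) = 0 :=
  Finset.sum_eq_zero fun i _ => by rw [pderiv_liftParam, mul_zero]

theorem lieDeriv_liftParam_mul (Z : Family k) (p : ParamSeries k) (f : Series k) :
    lieDeriv Z (liftParam k p * f) = liftParam k p * lieDeriv Z f := by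
  rw [lieDeriv_mul, lieDeriv_liftParam, mul_zero, add_zero]

theorem pderiv_pull (Ψ : FormalChange k) (i : Fin 2) (f : Series k) :
    pderiv ℂ (Sum.inr i) (Ψ.pull f) =
      ∑ l : Fin 2, Ψ.pull (pderiv ℂ (Sum.inr l) f) * pderiv ℂ (Sum.inr i) (Ψ.map l) := by
  rw [FormalChange.pull, pderiv_subst Ψ.total_zero, Fintype.sum_sum_type,
    Finset.sum_eq_zero, zero_add]
  · rfl
  · intro j _
    rw [FormalChange.total_inl, pderiv_liftParam, mul_zero]

theorem lieDeriv_pull_eq (Ψ : FormalChange k) (Z : Family k) (f : Series k) :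
    lieDeriv Z (Ψ.pull f) =
      ∑ l : Fin 2, Ψ.pull (pderiv ℂ (Sum.inr l) f) * lieDeriv Z (Ψ.map l) := by
  simp_rw [lieDeriv_eq_two, pderiv_pull, Fin.sum_univ_two]
  ring

/-- By the chain rule, a conjugacy, which is a condition on the two coordinates, intertwines the
derivatives of every series. -/
theorem Conjugates.lieDeriv_pull {Ψ : FormalChange k} {Z Z' : Family k} (h : Conjugates Ψ Z Z')
    (f : Series k) : lieDeriv Z (Ψ.pull f) = Ψ.pull (lieDeriv Z' f) := by
  rw [lieDeriv_pull_eq, lieDeriv, Ψ.pull_eq, map_sum]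
  refine Finset.sum_congr rfl fun l _ => ?_
  rw [h l, map_mul, Ψ.pull_eq, Ψ.pull_eq, mul_comm]

theorem Conjugates.comp {Ψ Ψ' : FormalChange k} {Z Z' Z'' : Family k} (h' : Conjugates Ψ' Z Z')
    (h : Conjugates Ψ Z' Z'') : Conjugates (Ψ.comp Ψ') Z Z'' := by
  intro i
  rw [FormalChange.comp_map, FormalChange.comp_pull, h'.lieDeriv_pull, h i]

/-- Every family is conjugate by a given change to a unique family. -/
theorem exists_conjugates (Ψ : FormalChange k) (Z : Family k) :
    ∃ Z', Conjugates Ψ Z Z' ∧ (Ψ.IsAnalytic → (∀ i, IsConvergent (Z i)) →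
      ∀ i, IsConvergent (Z' i)) := by
  obtain ⟨Θ, h1, -, -, -, -, h⟩ := Ψ.exists_inv
  refine ⟨fun i => Θ.pull (lieDeriv Z (Ψ.map i)), fun i => (h1 _).symm, fun hΨ hZ i => ?_⟩
  refine (h hΨ).pull (IsConvergent.sum _ fun l _ => (hZ l).mul (hΨ.2 i).pderiv)

end

end SaddleNode

namespace SaddleNode

open Filter Topology MvPowerSeries

noncomputable section

/-! ### Setting a variable to zero -/

section SetZero

variable {σ : Type}

/-- The series obtained by deleting the monomials that contain the variable `i`. -/
def deleteVar (i : σ) (f : MvPowerSeries σ ℂ) : MvPowerSeries σ ℂ :=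
  fun d => if d i = 0 then coeff d f else 0

theorem coeff_deleteVar (i : σ) (f : MvPowerSeries σ ℂ) (d : σ →₀ ℕ) :
    coeff d (deleteVar i f) = if d i = 0 then coeff d f else 0 := rfl

theorem deleteVar_C (i : σ) (c : ℂ) : deleteVar i (C c) = C c := by
  classical
  ext d
  rw [coeff_deleteVar, coeff_C]
  split_ifs with h1 h2 h2
  · rfl
  · rfl
  · exact absurd (by rw [h2]; rfl) h1
  · rfl

theorem deleteVar_mul (i : σ) (f g : MvPowerSeries σ ℂ) :
    deleteVar i (f * g) = deleteVar i f * deleteVar i g := by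
  classical
  ext d
  rw [coeff_deleteVar, coeff_mul, coeff_mul]
  split_ifs with h
  · refine Finset.sum_congr rfl fun p hp => ?_
    have hd := congrArg (fun d => d i) (Finset.HasAntidiagonal.mem_antidiagonal.1 hp)
    simp only [Finsupp.add_apply, h] at hd
    rw [coeff_deleteVar, coeff_deleteVar, if_pos (by omega), if_pos (by omega)]
  · refine (Finset.sum_eq_zero fun p hp => ?_).symm
    have hd := congrArg (fun d => d i) (Finset.HasAntidiagonal.mem_antidiagonal.1 hp)
    simp only [Finsupp.add_apply] at hd
    rw [coeff_deleteVar, coeff_deleteVar]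
    by_cases h1 : p.1 i = 0
    · rw [if_neg (c := p.2 i = 0) (by omega), mul_zero]
    · rw [if_neg h1, zero_mul]

/-- The substitution of `0` for the variable `i`. -/
def setZero (i : σ) : MvPowerSeries σ ℂ →ₐ[ℂ] MvPowerSeries σ ℂ where
  toFun := deleteVar i
  map_one' := by simpa using deleteVar_C i 1
  map_zero' := by simpa using deleteVar_C i 0
  map_mul' := deleteVar_mul i
  map_add' f g := by
    ext d
    rw [map_add]
    simp_rw [coeff_deleteVar]
    split_ifs
    · rw [map_add]
    · rw [add_zero]
  commutes' c := deleteVar_C i c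

theorem coeff_setZero (i : σ) (f : MvPowerSeries σ ℂ) (d : σ →₀ ℕ) :
    coeff d (setZero i f) = if d i = 0 then coeff d f else 0 := rfl

theorem setZero_X_self (i : σ) : setZero i (X i) = 0 := by
  classical
  ext d
  rw [coeff_setZero, coeff_X, map_zero]
  split_ifs with h1 h2
  · rw [h2, Finsupp.single_eq_same] at h1
    exact absurd h1 one_ne_zero
  · rfl
  · rfl

theorem setZero_X_of_ne {i j : σ} (h : j ≠ i) : setZero i (X j) = X j := by
  classical
  ext d
  rw [coeff_setZero, coeff_X]
  split_ifs with h1 h2 h2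
  · rfl
  · rfl
  · exact absurd (by rw [h2, Finsupp.single_eq_of_ne h.symm]) h1
  · rfl

theorem setZero_eq_zero_iff {i : σ} {f : MvPowerSeries σ ℂ} : setZero i f = 0 ↔ X i ∣ f := by
  rw [X_dvd_iff]
  constructor
  · intro h d hd
    have := congrArg (coeff d) h
    rwa [coeff_setZero, if_pos hd, map_zero] at this
  · intro h
    ext d
    rw [coeff_setZero, map_zero]
    split_ifs with hd
    · exact h d hd
    · rfl

theorem setZero_setZero (i : σ) (f : MvPowerSeries σ ℂ) :
    setZero i (setZero i f) = setZero i f := by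
  ext d
  simp_rw [coeff_setZero]
  split_ifs <;> rfl

theorem X_dvd_sub_setZero (i : σ) (f : MvPowerSeries σ ℂ) : X i ∣ f - setZero i f := by
  rw [← setZero_eq_zero_iff, map_sub, setZero_setZero, sub_self]

theorem setZero_eq_self_iff {i : σ} {f : MvPowerSeries σ ℂ} :
    setZero i f = f ↔ ∀ d, d i ≠ 0 → coeff d f = 0 := by
  constructor
  · intro h d hd
    rw [← h, coeff_setZero, if_neg hd]
  · intro h
    ext d
    rw [coeff_setZero]
    split_ifs with hd
    · rfl
    · exact (h d hd).symm

theorem constantCoeff_setZero (i : σ) (f : MvPowerSeries σ ℂ) :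
    constantCoeff (setZero i f) = constantCoeff f := by
  rw [← coeff_zero_eq_constantCoeff_apply, ← coeff_zero_eq_constantCoeff_apply, coeff_setZero,
    if_pos Finsupp.zero_apply]

theorem setZero_mem_fil {ω : σ → ℕ} {i : σ} {n : ℕ} {f : MvPowerSeries σ ℂ} (hf : f ∈ fil ω n) :
    setZero i f ∈ fil ω n := by
  intro d hd
  rw [coeff_setZero, hf d hd, ite_self]

theorem norm_coeff_setZero_le (i : σ) (f : MvPowerSeries σ ℂ) (d : σ →₀ ℕ) :
    ‖coeff d (setZero i f)‖ ≤ ‖coeff d f‖ := by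
  rw [coeff_setZero]
  split_ifs
  · exact le_rfl
  · rw [norm_zero]; exact norm_nonneg _

theorem IsConvergent.setZero [Finite σ] {f : MvPowerSeries σ ℂ} (hf : IsConvergent f) (i : σ) :
    IsConvergent (setZero i f) := by
  obtain ⟨r, hr, c, h⟩ := hf.exists_bd
  exact (h.of_norm_le (fun _ => hr.le) (norm_coeff_setZero_le i f)).isConvergent fun _ => hr

theorem setZero_pderiv {i j : σ} (h : i ≠ j) (f : MvPowerSeries σ ℂ) :
    setZero i (pderiv ℂ j f) = pderiv ℂ j (setZero i f) := by
  ext d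
  rw [coeff_setZero, coeff_pderiv, coeff_pderiv, coeff_setZero]
  have : (d + Finsupp.single j 1 : σ →₀ ℕ) i = d i := by
    rw [Finsupp.add_apply, Finsupp.single_eq_of_ne h, add_zero]
  rw [this]
  split_ifs
  · rfl
  · rw [zero_mul]

theorem setZero_inv {i : σ} {f : MvPowerSeries σ ℂ} (hf : constantCoeff f ≠ 0) :
    setZero i f⁻¹ = (setZero i f)⁻¹ := by
  have h0 : constantCoeff (setZero i f) ≠ 0 := by rwa [constantCoeff_setZero]
  have h1 : setZero i f * setZero i f⁻¹ = 1 := by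
    rw [← map_mul, MvPowerSeries.mul_inv_cancel _ hf, map_one]
  calc setZero i f⁻¹ = (setZero i f)⁻¹ * (setZero i f * setZero i f⁻¹) := by
        rw [← mul_assoc, MvPowerSeries.inv_mul_cancel _ h0, one_mul]
    _ = _ := by rw [h1, mul_one]

/-- The inverse of a convergent power series. -/
theorem IsConvergent.inv [Finite σ] {f : MvPowerSeries σ ℂ} (hf : IsConvergent f)
    (h0 : constantCoeff f ≠ 0) : IsConvergent f⁻¹ := by
  have hone : ∀ i : σ, (fun _ : σ => 1) i ≠ 0 := fun _ => one_ne_zero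
  let a := constantCoeff f
  let g := a⁻¹ • (f - C a)
  have hg : IsConvergent g := (hf.sub (isConvergent_C a)).smul _
  have hg1 : g ∈ fil (fun _ => 1) 1 := smul_mem_fil _ (sub_C_mem_fil_one hone f)
  obtain ⟨r, hr, h⟩ := exists_bd_le_of_zero (a := fun _ : Unit => g)
    (fun _ => (mem_fil_one hone).1 hg1) (fun _ => hg) (ε := 1 / 2) (by norm_num)
  -- Geometric series for `a (1 + g)`: as `g` has norm at most `1/2`, the ball of radius `2 |a⁻¹|`
  -- is mapped into itself.
  obtain ⟨b, hb, hfix⟩ := exists_fixedPoint (ω := fun _ : σ => 1)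
    {b | Bd (fun _ => r) b (‖a⁻¹‖ * 2)} (fun b => C a⁻¹ - g * b)
    ⟨0, (Bd.zero _).mono (by positivity)⟩
    (fun b hb => ((Bd.C (fun _ => hr.le) _).sub (fun _ => hr.le)
      ((h ()).mul (fun _ => hr.le) hb)).mono (le_of_eq (by ring)))
    (stable_Bd _ _) (fun b _ b' _ s hs => by
      rw [sub_sub_sub_cancel_left, ← mul_sub, ← neg_sub b, mul_neg]
      exact neg_mem (mul_mem_fil_of_le hg1 hs (by omega)))
  have hfb : f * b = 1 := by
    have h1 : f = C a * (1 + g) := by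
      have : C a * g = f - C a := by
        rw [← smul_eq_C_mul, smul_smul, mul_inv_cancel₀ h0, one_smul]
      rw [mul_add, this, mul_one, add_sub_cancel]
    have h2 : (1 + g) * b = C a⁻¹ := by
      have h3 : b + g * b = C a⁻¹ := by
        nth_rewrite 1 [← hfix]
        rw [sub_add_cancel]
      rw [add_mul, one_mul, h3]
    rw [h1, mul_assoc, h2, ← map_mul, mul_inv_cancel₀ h0, map_one]
  have : f⁻¹ = b := by
    rw [← mul_one f⁻¹, ← hfb, ← mul_assoc, MvPowerSeries.inv_mul_cancel _ h0, one_mul]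
  rw [this]
  exact hb.isConvergent fun _ => hr

end SetZero

/-! ### The variables `x` and `y` and the quasi-homogeneous weights -/

variable {k : ℕ}

/-- The variable `x`. -/
abbrev xv (k : ℕ) : Series k := X (Sum.inr 0)

/-- The variable `y`. -/
abbrev yv (k : ℕ) : Series k := X (Sum.inr 1)

/-- The weights of the variables. -/
def wt (k : ℕ) : Fin k ⊕ Fin 2 → ℕ := Sum.elim (fun j => 2 * (k + 1 - j) + 1) ![2, 3]

theorem wt_ne_zero (i : Fin k ⊕ Fin 2) : wt k i ≠ 0 := by
  rcases i with j | i
  · exact Nat.succ_ne_zero _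
  · fin_cases i <;> simp [wt]

theorem xv_mem_fil : xv k ∈ fil (wt k) 2 := X_mem_fil (ω := wt k) (Sum.inr 0)

theorem yv_mem_fil : yv k ∈ fil (wt k) 3 := X_mem_fil (ω := wt k) (Sum.inr 1)

theorem X_inl_mem_fil (j : Fin k) : (X (Sum.inl j) : Series k) ∈ fil (wt k) (2 * (k + 1 - j) + 1) :=
  X_mem_fil (ω := wt k) (Sum.inl j)

theorem xpow_mem_fil (n : ℕ) : xv k ^ n ∈ fil (wt k) (2 * n) := by
  rw [mul_comm]; exact pow_mem_fil xv_mem_fil n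

theorem wt_x : wt k (Sum.inr 0) = 2 := rfl

theorem wt_y : wt k (Sum.inr 1) = 3 := rfl

theorem pderiv_x_mem_fil {n : ℕ} {f : Series k} (hf : f ∈ fil (wt k) n) :
    pderiv ℂ (Sum.inr 0) f ∈ fil (wt k) (n - 2) :=
  pderiv_mem_fil (ω := wt k) (Sum.inr 0) hf

/-- Because `y` weighs more than `x`, even a linear term `y ∂/∂x` raises the weight. Everything in
`Z` except `l y ∂/∂y` thus acts as a higher-order perturbation. -/
theorem lieDeriv_mem_fil {Z : Family k} (h0 : Z 0 ∈ fil (wt k) 3) (h1 : Z 1 ∈ fil (wt k) 4)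
    {n : ℕ} {f : Series k} (hf : f ∈ fil (wt k) n) : lieDeriv Z f ∈ fil (wt k) (n + 1) := by
  rw [lieDeriv_eq_two]
  refine add_mem (mul_mem_fil_of_le h0 (pderiv_mem_fil _ hf) ?_)
    (mul_mem_fil_of_le h1 (pderiv_mem_fil _ hf) ?_)
  · rw [wt_x]; omega
  · rw [wt_y]; omega

/-- The restriction to `y = 0`. -/
abbrev res : Series k →ₐ[ℂ] Series k := setZero (Sum.inr 1)

theorem res_X_inl (j : Fin k) : res (X (Sum.inl j) : Series k) = X (Sum.inl j) :=
  setZero_X_of_ne Sum.inl_ne_inr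

theorem res_xv : res (xv k) = xv k :=
  setZero_X_of_ne fun h => absurd (Sum.inr_injective h) (by decide)

theorem res_yv : res (yv k) = 0 := setZero_X_self _

theorem res_liftParam (p : ParamSeries k) : res (liftParam k p) = liftParam k p :=
  setZero_eq_self_iff.2 fun _ hd => coeff_liftParam_eq_zero p hd

theorem res_pderiv_x (f : Series k) :
    res (pderiv ℂ (Sum.inr 0) f) = pderiv ℂ (Sum.inr 0) (res f) :=
  setZero_pderiv (fun h => absurd (Sum.inr_injective h) (by decide)) f

theorem pderiv_y_of_res {f : Series k} (hf : res f = f) : pderiv ℂ (Sum.inr 1) f = 0 := by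
  ext d
  rw [coeff_pderiv, setZero_eq_self_iff.1 hf, zero_mul, map_zero]
  rw [Finsupp.add_apply, Finsupp.single_eq_same]
  exact Nat.succ_ne_zero _

theorem lieDeriv_of_res (Z : Family k) {f : Series k} (hf : res f = f) :
    lieDeriv Z f = Z 0 * pderiv ℂ (Sum.inr 0) f := by
  rw [lieDeriv_eq_two, pderiv_y_of_res hf, mul_zero, add_zero]

theorem pderiv_x_of_res {f : Series k} (hf : res f = f) :
    res (pderiv ℂ (Sum.inr 0) f) = pderiv ℂ (Sum.inr 0) f := by
  rw [res_pderiv_x, hf]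

/-! ### Coefficients of the powers of `x` -/

/-- The part of a series in `(ε, x, y)` that depends on `ε` only. -/
def lower (k : ℕ) : Series k →ₐ[ℂ] ParamSeries k :=
  killCompl (Function.Embedding.inl : Fin k ↪ Fin k ⊕ Fin 2)

theorem coeff_lower (f : Series k) (e : Fin k →₀ ℕ) :
    coeff e (lower k f) = coeff (e.embDomain Function.Embedding.inl) f :=
  coeff_killCompl _ _

theorem lower_liftParam (p : ParamSeries k) : lower k (liftParam k p) = p := by
  ext e
  rw [coeff_lower, coeff_liftParam]

theorem weight_embDomain (ω : Fin k ⊕ Fin 2 → ℕ) (e : Fin k →₀ ℕ) :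
    Finsupp.weight ω (e.embDomain Function.Embedding.inl) =
      Finsupp.weight (fun j => ω (Sum.inl j)) e := by
  rw [Finsupp.weight_apply, Finsupp.weight_apply, Finsupp.embDomain_eq_mapDomain,
    Finsupp.sum_mapDomain_index (h := fun i c => c • ω i) (fun _ => zero_smul _ _) (fun _ _ _ => add_smul _ _ _)]
  rfl

theorem IsConvergent.lower {f : Series k} (hf : IsConvergent f) : IsConvergent (lower k f) := by
  obtain ⟨r, hr, c, h⟩ := hf.exists_bd
  refine Bd.isConvergent (v := fun _ => r) (c := c) (fun _ => hr) fun s => ?_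
  refine le_trans (le_of_eq ?_)
    (h (s.map ⟨_, Finsupp.embDomain_injective (M := ℕ) (Function.Embedding.inl : Fin k ↪ _)⟩))
  rw [Finset.sum_map]
  refine Finset.sum_congr rfl fun d _ => ?_
  rw [Function.Embedding.coeFn_mk, coeff_lower, mon_const, mon_const,
    Finsupp.degree_eq_weight_one, Finsupp.degree_eq_weight_one]
  congr 2
  exact (weight_embDomain (fun _ => 1) d).symm

theorem exists_embDomain_of_inr {d : Fin k ⊕ Fin 2 →₀ ℕ} (h : ∀ i, d (Sum.inr i) = 0) :
    ∃ e : Fin k →₀ ℕ, d = e.embDomain Function.Embedding.inl := by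
  refine ⟨d.comapDomain Sum.inl Sum.inl_injective.injOn, ?_⟩
  ext i
  rcases i with j | i
  · exact (Finsupp.embDomain_apply_self (Function.Embedding.inl : Fin k ↪ Fin k ⊕ Fin 2)
      (d.comapDomain Sum.inl Sum.inl_injective.injOn) j).symm
  · rw [h, Finsupp.embDomain_of_notMem_range]
    rintro ⟨j, hj⟩
    exact Sum.inl_ne_inr hj

/-- The coefficient of `x ^ n` (for `y = 0`), a series in `ε`. -/
def xc (n : ℕ) : Series k →ₗ[ℂ] ParamSeries k :=
  (lower k).toLinearMap.comp (shiftMul (Finsupp.single (Sum.inr 0) n) fun _ => 1)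

theorem xc_eq (n : ℕ) (f : Series k) :
    xc n f = lower k (shiftMul (Finsupp.single (Sum.inr 0) n) (fun _ => 1) f) := rfl

theorem coeff_xc (n : ℕ) (f : Series k) (e : Fin k →₀ ℕ) : coeff e (xc n f) =
    coeff (e.embDomain Function.Embedding.inl + Finsupp.single (Sum.inr 0) n) f := by
  rw [xc_eq, coeff_lower, coeff_shiftMul, one_mul]

theorem IsConvergent.xc {f : Series k} (hf : IsConvergent f) (n : ℕ) : IsConvergent (xc n f) :=
  IsConvergent.lower (hf.shiftMul (B := 1) fun d => by simp)

open Classical in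
/-- The indicator function of the monomials in `ε`. -/
def paramInd (d : Fin k ⊕ Fin 2 →₀ ℕ) : ℂ := if ∀ i, d (Sum.inr i) = 0 then 1 else 0

theorem norm_paramInd_le (d : Fin k ⊕ Fin 2 →₀ ℕ) : ‖paramInd d‖ ≤ 1 := by
  rw [paramInd]; split_ifs <;> simp

/-- Seen in all the variables, extracting a coefficient is a shift with multipliers `0` and `1`, to
which the weight and norm estimates for `shiftMul` apply. -/
theorem liftParam_xc (n : ℕ) (f : Series k) :
    liftParam k (xc n f) = shiftMul (Finsupp.single (Sum.inr 0) n) paramInd f := by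
  ext d
  rw [coeff_shiftMul, paramInd]
  split_ifs with h
  · obtain ⟨e, rfl⟩ := exists_embDomain_of_inr h
    rw [coeff_liftParam, coeff_xc, one_mul]
  · push Not at h
    obtain ⟨i, hi⟩ := h
    rw [coeff_liftParam_eq_zero _ hi, zero_mul]

theorem xc_mem_fil {n s : ℕ} {f : Series k} (hf : f ∈ fil (wt k) s) :
    liftParam k (xc n f) ∈ fil (wt k) (s - 2 * n) := by
  rw [liftParam_xc]
  have := shiftMul_mem_fil (s := Finsupp.single (Sum.inr 0) n) (c := paramInd) hf
  rwa [Finsupp.weight_single, wt_x, smul_eq_mul, mul_comm] at this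

theorem coeff_xpow_mul (n : ℕ) (f : Series k) (d : Fin k ⊕ Fin 2 →₀ ℕ) :
    coeff d (xv k ^ n * f) =
      if n ≤ d (Sum.inr 0) then coeff (d - Finsupp.single (Sum.inr 0) n) f else 0 := by
  rw [X_pow_eq, coeff_monomial_mul, one_mul]
  simp only [Finsupp.single_le_iff]

theorem xc_xpow_mul (m n : ℕ) (f : Series k) :
    xc n (xv k ^ m * f) = if m ≤ n then xc (n - m) f else 0 := by
  ext e
  rw [coeff_xc, coeff_xpow_mul, Finsupp.add_apply, Finsupp.single_eq_same,
    Finsupp.embDomain_of_notMem_range _ _ _ (by rintro ⟨j, hj⟩; exact Sum.inl_ne_inr hj), zero_add]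
  split_ifs with h
  · rw [coeff_xc]
    congr 2
    rw [← Nat.sub_add_cancel h, Finsupp.single_add, ← add_assoc, add_tsub_cancel_right,
      Nat.sub_add_cancel h]
  · rw [map_zero]

theorem xc_liftParam_mul (n : ℕ) (p : ParamSeries k) (f : Series k) :
    xc n (liftParam k p * f) = p * xc n f := by
  classical
  have h1 : shiftMul (Finsupp.single (Sum.inr 0) n) (fun _ => 1) (liftParam k p * f) =
      liftParam k p * shiftMul (Finsupp.single (Sum.inr 0) n) (fun _ => 1) f := by
    ext d
    rw [coeff_shiftMul, one_mul, coeff_mul, coeff_mul]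
    symm
    refine Finset.sum_of_injOn (fun q => (q.1, q.2 + Finsupp.single (Sum.inr 0) n)) ?_ ?_ ?_ ?_
    · intro q _ q' _ h
      simp only [Prod.mk.injEq, add_left_inj] at h
      exact Prod.ext h.1 h.2
    · intro q hq
      rw [Finset.mem_coe, Finset.HasAntidiagonal.mem_antidiagonal] at hq ⊢
      rw [← hq, add_assoc]
    · intro q hq hq'
      by_cases h : n ≤ q.2 (Sum.inr 0)
      · exfalso
        refine hq' ⟨(q.1, q.2 - Finsupp.single (Sum.inr 0) n), ?_, ?_⟩
        · rw [Finset.mem_coe, Finset.HasAntidiagonal.mem_antidiagonal] at *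
          have h' : Finsupp.single (Sum.inr 0) n ≤ q.2 := Finsupp.single_le_iff.2 h
          rw [← add_tsub_assoc_of_le h', hq, add_tsub_cancel_right]
        · simp only
          rw [tsub_add_cancel_of_le (Finsupp.single_le_iff.2 h)]
      · rw [coeff_liftParam_eq_zero p (i := 0), zero_mul]
        have := congrArg (fun d => d (Sum.inr 0))
          (Finset.HasAntidiagonal.mem_antidiagonal.1 hq)
        simp only [Finsupp.add_apply, Finsupp.single_eq_same] at this
        omega
    · intro q _
      rw [coeff_shiftMul, one_mul]
  rw [xc_eq, h1, xc_eq, map_mul, lower_liftParam]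

theorem xc_liftParam (n : ℕ) (p : ParamSeries k) :
    xc n (liftParam k p) = if n = 0 then p else 0 := by
  ext e
  rw [coeff_xc]
  split_ifs with h
  · rw [h, Finsupp.single_zero, add_zero, coeff_liftParam]
  · rw [coeff_liftParam_eq_zero p (i := 0), map_zero]
    simp [h]

theorem xc_liftParam_mul_xpow (m n : ℕ) (p : ParamSeries k) :
    xc n (liftParam k p * xv k ^ m) = if n = m then p else 0 := by
  rw [mul_comm, xc_xpow_mul]
  split_ifs with h1 h2 h2
  · rw [xc_liftParam, if_pos (by omega)]
  · rw [xc_liftParam, if_neg (by omega)]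
  · omega
  · rfl

theorem ext_xc {f g : Series k} (hf : res f = f) (hg : res g = g) (h : ∀ n, xc n f = xc n g) :
    f = g := by
  ext d
  by_cases hd : d (Sum.inr 1) = 0
  · obtain ⟨e, he⟩ : ∃ e : Fin k →₀ ℕ, d - Finsupp.single (Sum.inr 0) (d (Sum.inr 0)) =
        e.embDomain Function.Embedding.inl := by
      refine exists_embDomain_of_inr fun i => ?_
      fin_cases i
      · simp
      · simp [hd]
    have h1 := congrArg (coeff e) (h (d (Sum.inr 0)))
    rw [coeff_xc, coeff_xc, ← he, tsub_add_cancel_of_le (Finsupp.single_le_iff.2 le_rfl)] at h1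
    exact h1
  · rw [setZero_eq_self_iff.1 hf d hd, setZero_eq_self_iff.1 hg d hd]

/-! ### Integration -/

/-- The primitive with respect to `x` that vanishes for `x = 0`. -/
def intg (f : Series k) : Series k :=
  xv k * shiftMul 0 (fun d => ((d (Sum.inr 0) : ℂ) + 1)⁻¹) f

theorem coeff_intg (f : Series k) (d : Fin k ⊕ Fin 2 →₀ ℕ) : coeff d (intg f) =
    if 1 ≤ d (Sum.inr 0) then
      (d (Sum.inr 0) : ℂ)⁻¹ * coeff (d - Finsupp.single (Sum.inr 0) 1) f else 0 := by
  rw [intg, ← pow_one (xv k), coeff_xpow_mul]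
  split_ifs with h
  · rw [coeff_shiftMul, add_zero]
    congr 2
    rw [Finsupp.tsub_apply, Finsupp.single_eq_same, Nat.cast_sub h]
    push_cast
    ring
  · rfl

theorem pderiv_intg (f : Series k) : pderiv ℂ (Sum.inr 0) (intg f) = f := by
  ext d
  rw [coeff_pderiv, coeff_intg, if_pos (by simp), add_tsub_cancel_right, Finsupp.add_apply,
    Finsupp.single_eq_same, mul_right_comm, Nat.cast_add, Nat.cast_one, inv_mul_cancel₀, one_mul]
  exact Nat.cast_add_one_ne_zero _

theorem intg_mem_fil {n : ℕ} {f : Series k} (hf : f ∈ fil (wt k) n) :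
    intg f ∈ fil (wt k) (n + 2) := by
  have := shiftMul_mem_fil (s := 0) (c := fun d => ((d (Sum.inr 0) : ℂ) + 1)⁻¹) hf
  rw [map_zero, Nat.sub_zero] at this
  exact mul_mem_fil_of_le xv_mem_fil this (by omega)

theorem intg_sub (f g : Series k) : intg (f - g) = intg f - intg g := by
  rw [intg, map_sub, mul_sub]; rfl

theorem res_intg {f : Series k} (hf : res f = f) : res (intg f) = intg f := by
  rw [setZero_eq_self_iff] at *
  intro d hd
  rw [coeff_intg]
  split_ifs
  · rw [hf, mul_zero]
    simpa using hd
  · rfl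

theorem xc_zero_intg (f : Series k) : xc 0 (intg f) = 0 := by
  rw [intg, ← pow_one (xv k), xc_xpow_mul, if_neg (by omega)]

theorem intg_pderiv {f : Series k} (hf : res f = f) :
    intg (pderiv ℂ (Sum.inr 0) f) + liftParam k (xc 0 f) = f := by
  ext d
  rw [map_add, coeff_intg]
  by_cases hd : 1 ≤ d (Sum.inr 0)
  · rw [if_pos hd, coeff_pderiv, tsub_add_cancel_of_le (Finsupp.single_le_iff.2 hd),
      coeff_liftParam_eq_zero _ (i := 0) (by omega), add_zero, Finsupp.tsub_apply,
      Finsupp.single_eq_same, Nat.cast_sub hd, Nat.cast_one, sub_add_cancel, mul_comm, mul_assoc,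
      mul_inv_cancel₀, mul_one]
    exact Nat.cast_ne_zero.2 (by omega)
  · rw [if_neg hd, zero_add, liftParam_xc, coeff_shiftMul, Finsupp.single_zero, add_zero]
    by_cases hy : d (Sum.inr 1) = 0
    · rw [paramInd, if_pos, one_mul]
      intro i
      fin_cases i
      · exact Nat.lt_one_iff.1 (not_le.1 hd)
      · exact hy
    · rw [setZero_eq_self_iff.1 hf d hy, mul_zero]

theorem eq_liftParam_of_pderiv_eq_zero {f : Series k} (hf : res f = f)
    (h : pderiv ℂ (Sum.inr 0) f = 0) : f = liftParam k (xc 0 f) := by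
  have := intg_pderiv hf
  rw [h] at this
  have h0 : intg (0 : Series k) = 0 := by rw [intg, map_zero, mul_zero]
  rw [h0, zero_add] at this
  exact this.symm

end

end SaddleNode

namespace SaddleNode

open Filter Topology MvPowerSeries

noncomputable section

variable {k : ℕ}

/-! ### The polynomial `P` -/

theorem map_bifPoly {R S : Type} [CommRing R] [CommRing S] (f : R →+* S) (e : Fin k → R) (x : R) :
    f (bifPoly e x) = bifPoly (fun j => f (e j)) (f x) := by
  simp [bifPoly]

/-- The polynomial `P_ε(x)` as a power series. -/
def bifP (k : ℕ) : Series k := bifPoly (fun j => X (Sum.inl j)) (xv k)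

/-- The weights are made for this. Under the natural weights `P` is quasi-homogeneous; doubling them
and adding `1` to that of each `ε_j` gives `ε_j x^j` the weight `2k + 3`, one more than `x^(k+1)`,
which becomes the leading term. -/
theorem bifP_sub_xpow_mem_fil : bifP k - xv k ^ (k + 1) ∈ fil (wt k) (2 * k + 3) := by
  rw [bifP, bifPoly, add_sub_cancel_left]
  exact Ideal.sum_mem _ fun j _ =>
    mul_mem_fil_of_le (X_inl_mem_fil j) (xpow_mem_fil _) (by have := j.2; omega)

theorem bifP_mem_fil : bifP k ∈ fil (wt k) (2 * k + 2) := by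
  have h := add_mem (fil_anti (show 2 * k + 2 ≤ 2 * k + 3 by omega) bifP_sub_xpow_mem_fil)
    (fil_anti (show 2 * k + 2 ≤ 2 * (k + 1) by omega) (xpow_mem_fil (k := k) (k + 1)))
  rwa [sub_add_cancel] at h

theorem res_bifP : res (bifP k) = bifP k := by
  have := map_bifPoly (res (k := k)).toRingHom (fun j => X (Sum.inl j)) (xv k)
  refine this.trans ?_
  rw [bifP]
  congr 1
  · funext j; exact res_X_inl j
  · exact res_xv

theorem isConvergent_bifP : IsConvergent (bifP k) :=
  ((isConvergent_X _).pow _).add (IsConvergent.sum _ fun _ _ =>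
    (isConvergent_X _).mul ((isConvergent_X _).pow _))

theorem xc_pderiv (n : ℕ) (f : Series k) :
    xc n (pderiv ℂ (Sum.inr 0) f) = ((n : ℂ) + 1) • xc (n + 1) f := by
  ext e
  rw [coeff_xc, coeff_pderiv, coeff_smul, coeff_xc, Finsupp.single_add, add_assoc, mul_comm,
    Finsupp.add_apply, Finsupp.single_eq_same,
    Finsupp.embDomain_of_notMem_range _ _ _ (by rintro ⟨j, hj⟩; exact Sum.inl_ne_inr hj), zero_add]

theorem pow_sub_pow_mem_fil {f g : Series k} (hf : f ∈ fil (wt k) 2) (hg : g ∈ fil (wt k) 2)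
    {t : ℕ} (h : f - g ∈ fil (wt k) t) (n : ℕ) :
    f ^ n - g ^ n ∈ fil (wt k) (2 * n - 2 + t) := by
  rw [← (Commute.all f g).geom_sum₂_mul]
  refine mul_mem_fil (Ideal.sum_mem _ fun i hi => ?_) h
  rw [Finset.mem_range] at hi
  exact mul_mem_fil_of_le (pow_mem_fil hf i) (pow_mem_fil hg _) (by omega)

/-! ### The linearised conjugacy equation in one variable -/

/-- The linear part of the equation conjugating two vector fields in the variable `x`. -/
def linK (ξ : Series k) (φ : Fin k → Series k) (μ : Series k) : Series k :=
  xv k ^ (k + 1) * pderiv ℂ (Sum.inr 0) ξ - (k + 1 : ℂ) • (xv k ^ k * ξ) + μ * xv k ^ (2 * k + 1) -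
    ∑ j, φ j * xv k ^ (j : ℕ)

/-- The operator `x^(k+1) ∂/∂x - (k+1) x^k` sends `x^m` to `(m - k - 1) x^(m+k)`. Its kernel is
spanned by `x^(k+1)`, and what it misses, `x^n` for `n < k` and for `n = 2k + 1`, is exactly
supplied by `φ` and `μ`. -/
theorem xc_linK (n : ℕ) (ξ : Series k) (φ : Fin k → ParamSeries k) (μ : ParamSeries k) :
    xc n (linK ξ (fun j => liftParam k (φ j)) (liftParam k μ)) =
      (if k ≤ n then ((n : ℂ) - (2 * k + 1)) • xc (n - k) ξ else 0) +
        (if n = 2 * k + 1 then μ else 0) - if h : n < k then φ ⟨n, h⟩ else 0 := by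
  have hsum : ∑ j, xc n (liftParam k (φ j) * xv k ^ (j : ℕ)) =
      if h : n < k then φ ⟨n, h⟩ else 0 := by
    simp_rw [xc_liftParam_mul_xpow]
    split_ifs with h
    · rw [Finset.sum_eq_single ⟨n, h⟩]
      · simp
      · intro j _ hj
        rw [if_neg]
        rintro rfl
        exact hj rfl
      · simp
    · refine Finset.sum_eq_zero fun j _ => if_neg ?_
      have := j.2
      omega
  rw [linK, map_sub, map_add, map_sub, map_smul, map_sum, hsum, xc_xpow_mul, xc_xpow_mul,
    xc_liftParam_mul_xpow]
  congr 2
  by_cases h : k ≤ n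
  · rw [if_pos h, if_pos h]
    by_cases h1 : k + 1 ≤ n
    · rw [if_pos h1, xc_pderiv, show n - (k + 1) + 1 = n - k by omega, ← sub_smul]
      congr 1
      rw [Nat.cast_sub h1]
      push_cast
      ring
    · have h2 : n = k := by omega
      subst h2
      rw [if_neg h1, zero_sub, ← neg_smul]
      congr 1
      ring
  · rw [if_neg h, if_neg h, if_neg (by omega), smul_zero, sub_zero]

/-- The component along `∂/∂x` of the solution of the linearised equation. -/
def solX : Series k →ₗ[ℂ] Series k :=
  shiftMul (Finsupp.single (Sum.inr 0) k) fun d => ((d (Sum.inr 0) : ℂ) - (k + 1))⁻¹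

theorem xc_shiftMul_x (n m : ℕ) (c : ℕ → ℂ) (f : Series k) :
    xc n (shiftMul (Finsupp.single (Sum.inr 0) m) (fun d => c (d (Sum.inr 0))) f) =
      c n • xc (n + m) f := by
  ext e
  rw [coeff_xc, coeff_shiftMul, coeff_smul, coeff_xc, Finsupp.single_add, add_assoc,
    Finsupp.add_apply, Finsupp.single_eq_same,
    Finsupp.embDomain_of_notMem_range _ _ _ (by rintro ⟨j, hj⟩; exact Sum.inl_ne_inr hj), zero_add]

theorem xc_solX (n : ℕ) (g : Series k) :
    xc n (solX g) = ((n : ℂ) - (k + 1))⁻¹ • xc (n + k) g :=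
  xc_shiftMul_x n k (fun n => ((n : ℂ) - (k + 1))⁻¹) g

theorem res_shiftMul_x (m : ℕ) (c : (Fin k ⊕ Fin 2 →₀ ℕ) → ℂ) {f : Series k} (hf : res f = f) :
    res (shiftMul (Finsupp.single (Sum.inr 0) m) c f) =
      shiftMul (Finsupp.single (Sum.inr 0) m) c f := by
  rw [setZero_eq_self_iff] at *
  intro d hd
  rw [coeff_shiftMul, hf, mul_zero]
  simpa using hd

theorem res_solX {g : Series k} (hg : res g = g) : res (solX g) = solX g :=
  res_shiftMul_x k _ hg

theorem solX_mem_fil {s : ℕ} {g : Series k} (hg : g ∈ fil (wt k) s) :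
    solX g ∈ fil (wt k) (s - 2 * k) := by
  have := shiftMul_mem_fil (s := Finsupp.single (Sum.inr 0) k)
    (c := fun d => ((d (Sum.inr 0) : ℂ) - (k + 1))⁻¹) hg
  rwa [Finsupp.weight_single, wt_x, smul_eq_mul, mul_comm] at this

theorem res_linK {ξ : Series k} (hξ : res ξ = ξ) (φ : Fin k → ParamSeries k)
    (μ : ParamSeries k) : res (linK ξ (fun j => liftParam k (φ j)) (liftParam k μ)) =
      linK ξ (fun j => liftParam k (φ j)) (liftParam k μ) := by
  simp only [linK, map_sub, map_add, map_mul, map_pow, map_smul, map_sum, res_xv, res_liftParam,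
    res_pderiv_x, hξ]

theorem two_mul_add_one_sub_ne {n : ℕ} (h : n ≠ k + 1) : (n : ℂ) - (k + 1) ≠ 0 := by
  rw [sub_ne_zero]
  exact_mod_cast h

/-- Since the inverse of `0` is `0`, `solX` leaves out the resonant coefficient of `x^(k+1)`, and
the term `x^(2k+1)` falls to `μ`. -/
theorem linK_sol {g : Series k} (hg : res g = g) :
    linK (solX g) (fun j => liftParam k (-xc (j : ℕ) g)) (liftParam k (xc (2 * k + 1) g)) = g := by
  refine ext_xc (res_linK (res_solX hg) _ _) hg fun n => ?_
  rw [xc_linK, xc_solX]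
  rcases lt_or_ge n k with h | h
  · rw [if_neg (by omega), if_neg (by omega), dif_pos h]
    simp
  · rw [if_pos h, dif_neg (by omega), sub_zero, Nat.sub_add_cancel h, smul_smul]
    by_cases h1 : n = 2 * k + 1
    · rw [if_pos h1, h1]
      have : ((2 * k + 1 : ℕ) : ℂ) - (2 * k + 1) = 0 := by push_cast; ring
      rw [this, zero_mul, zero_smul, zero_add]
    · have h2 : ((n - k : ℕ) : ℂ) - (k + 1) = (n : ℂ) - (2 * k + 1) := by
        rw [Nat.cast_sub h]; ring
      rw [if_neg h1, add_zero, h2, mul_inv_cancel₀, one_smul]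
      rw [← h2]
      exact two_mul_add_one_sub_ne (by omega)

/-- Prescribing the coefficient of `x^(k+1)` kills the kernel, so the linear equation determines all
its unknowns. -/
theorem sol_linK {ξ : Series k} (hξ : res ξ = ξ) (h0 : xc (k + 1) ξ = 0)
    (φ : Fin k → ParamSeries k) (μ : ParamSeries k) :
    solX (linK ξ (fun j => liftParam k (φ j)) (liftParam k μ)) = ξ ∧
      (∀ j : Fin k, xc (j : ℕ) (linK ξ (fun j => liftParam k (φ j)) (liftParam k μ)) = -φ j) ∧
      xc (2 * k + 1) (linK ξ (fun j => liftParam k (φ j)) (liftParam k μ)) = μ := by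
  refine ⟨ext_xc (res_solX (res_linK hξ _ _)) hξ fun n => ?_, fun j => ?_, ?_⟩
  · rw [xc_solX, xc_linK, if_pos (by omega), dif_neg (by omega), sub_zero, Nat.add_sub_cancel]
    by_cases h : n = k + 1
    · rw [h, h0]
      simp
    · have h2 : ((n + k : ℕ) : ℂ) - (2 * k + 1) = (n : ℂ) - (k + 1) := by push_cast; ring
      rw [if_neg (by omega), add_zero, h2, smul_smul, inv_mul_cancel₀, one_smul]
      exact two_mul_add_one_sub_ne h
  · have := j.2
    rw [xc_linK, if_neg (by omega), if_neg (by omega), dif_pos j.2]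
    simp
  · rw [xc_linK, if_pos (by omega), if_pos rfl, dif_neg (by omega), sub_zero]
    have : ((2 * k + 1 : ℕ) : ℂ) - (2 * k + 1) = 0 := by push_cast; ring
    rw [this, zero_smul, zero_add]

/-! ### The nonlinear part -/

/-- The nonlinear part of the equation conjugating two vector fields in the variable `x`. -/
def nonlinK (V ξ : Series k) (φ : Fin k → Series k) (μ : Series k) : Series k :=
  -((V - xv k ^ (k + 1)) * ((1 + pderiv ℂ (Sum.inr 0) ξ) * (1 + μ * (xv k + ξ) ^ k))) -
    xv k ^ (k + 1) * (pderiv ℂ (Sum.inr 0) ξ * (μ * (xv k + ξ) ^ k) +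
      μ * ((xv k + ξ) ^ k - xv k ^ k)) +
    ((xv k + ξ) ^ (k + 1) - xv k ^ (k + 1) - (k + 1 : ℂ) • (xv k ^ k * ξ)) +
    ∑ j, φ j * ((xv k + ξ) ^ (j : ℕ) - xv k ^ (j : ℕ))

/-- The right-hand side vanishes exactly when `x + ξ` carries `V ∂/∂x` to `P_φ / (1 + μ x^k) ∂/∂x`.
The conjugacy equation thus becomes `linK = nonlinK`, ready for iteration. -/
theorem linK_sub_nonlinK (V ξ : Series k) (φ : Fin k → Series k) (μ : Series k) :
    linK ξ φ μ - nonlinK V ξ φ μ =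
      V * (1 + pderiv ℂ (Sum.inr 0) ξ) * (1 + μ * (xv k + ξ) ^ k) - bifPoly φ (xv k + ξ) := by
  rw [linK, nonlinK, bifPoly]
  simp_rw [mul_sub, Finset.sum_sub_distrib]
  ring

/-- The three orders assumed are those obtained by solving the linear equation with right-hand side
of weight `s`. Compared with the linear part, each term here has an extra factor of positive
relative weight (from `V - x^(k+1)`, `ξ`, `φ` or `μ x^k`), so one order is gained. -/
theorem nonlinK_sub_mem_fil (hk : 0 < k) {V ξ ξ' : Series k} {φ φ' : Fin k → Series k}
    {μ μ' : Series k} (hV : V - xv k ^ (k + 1) ∈ fil (wt k) (2 * k + 3))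
    (hξ : ξ ∈ fil (wt k) 3) (hξ' : ξ' ∈ fil (wt k) 3)
    (hφ' : ∀ j : Fin k, φ' j ∈ fil (wt k) (2 * (k + 1 - (j : ℕ)) + 1)) {s : ℕ}
    (h1 : ξ - ξ' ∈ fil (wt k) (s - 2 * k))
    (h2 : ∀ j : Fin k, φ j - φ' j ∈ fil (wt k) (s - 2 * j))
    (h3 : μ - μ' ∈ fil (wt k) (s - 2 * (2 * k + 1))) :
    nonlinK V ξ φ μ - nonlinK V ξ' φ' μ' ∈ fil (wt k) (s + 1) := by
  set x := xv k with hx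
  set D := pderiv ℂ (Sum.inr 0) ξ with hD
  set D' := pderiv ℂ (Sum.inr 0) ξ' with hD'
  have hd : D - D' ∈ fil (wt k) (s - 2 * k - 2) := by
    rw [hD, hD', ← map_sub]; exact pderiv_x_mem_fil h1
  have hD'1 : D' ∈ fil (wt k) 1 := pderiv_x_mem_fil hξ'
  have hX : x + ξ ∈ fil (wt k) 2 := add_mem xv_mem_fil (fil_anti (by omega) hξ)
  have hX' : x + ξ' ∈ fil (wt k) 2 := add_mem xv_mem_fil (fil_anti (by omega) hξ')
  have hXX : x + ξ - (x + ξ') ∈ fil (wt k) (s - 2 * k) := by rwa [add_sub_add_left_eq_sub]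
  have hXx : x + ξ - x ∈ fil (wt k) 3 := by rwa [add_sub_cancel_left]
  have hX'x : x + ξ' - x ∈ fil (wt k) 3 := by rwa [add_sub_cancel_left]
  have hpow := pow_sub_pow_mem_fil hX hX' hXX
  have hpowx := pow_sub_pow_mem_fil hX xv_mem_fil hXx
  have hXk : (x + ξ) ^ k ∈ fil (wt k) (k * 2) := pow_mem_fil hX k
  have hμX : (μ - μ') * (x + ξ) ^ k ∈ fil (wt k) (s - 2 * (2 * k + 1) + k * 2) := mul_mem_fil h3 hXk
  have hμp : μ' * ((x + ξ) ^ k - (x + ξ') ^ k) ∈ fil (wt k) (2 * k - 2 + (s - 2 * k)) :=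
    Ideal.mul_mem_left _ _ (hpow k)
  have hxk := xpow_mem_fil (k := k) (k + 1)
  have e1 : (1 + D) * (1 + μ * (x + ξ) ^ k) - (1 + D') * (1 + μ' * (x + ξ') ^ k) =
      (D - D') * (1 + μ * (x + ξ) ^ k) + (1 + D') * ((μ - μ') * (x + ξ) ^ k +
        μ' * ((x + ξ) ^ k - (x + ξ') ^ k)) := by ring
  have t1 : (V - x ^ (k + 1)) * ((1 + D) * (1 + μ * (x + ξ) ^ k) -
      (1 + D') * (1 + μ' * (x + ξ') ^ k)) ∈ fil (wt k) (s + 1) := by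
    rw [e1]
    refine mul_mem_fil_of_le (t := s - 2 * k - 2) hV (add_mem (Ideal.mul_mem_right _ _ hd)
      (Ideal.mul_mem_left _ _ (add_mem (fil_anti ?_ hμX) (fil_anti ?_ hμp)))) ?_ <;> omega
  have e2 : (D * (μ * (x + ξ) ^ k) + μ * ((x + ξ) ^ k - x ^ k)) -
      (D' * (μ' * (x + ξ') ^ k) + μ' * ((x + ξ') ^ k - x ^ k)) =
      (D - D') * (x + ξ) ^ k * μ + D' * ((μ - μ') * (x + ξ) ^ k) +
        D' * (μ' * ((x + ξ) ^ k - (x + ξ') ^ k)) + (μ - μ') * ((x + ξ) ^ k - x ^ k) +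
        μ' * ((x + ξ) ^ k - (x + ξ') ^ k) := by ring
  have t2 : x ^ (k + 1) * ((D * (μ * (x + ξ) ^ k) + μ * ((x + ξ) ^ k - x ^ k)) -
      (D' * (μ' * (x + ξ') ^ k) + μ' * ((x + ξ') ^ k - x ^ k))) ∈ fil (wt k) (s + 1) := by
    rw [e2]
    refine mul_mem_fil_of_le (t := s - 2 * k - 1) hxk
      (add_mem (add_mem (add_mem (add_mem ?_ ?_) ?_) ?_) ?_) (by omega)
    · exact Ideal.mul_mem_right _ _ (mul_mem_fil_of_le hd hXk (by omega))
    · exact mul_mem_fil_of_le hD'1 hμX (by omega)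
    · exact mul_mem_fil_of_le hD'1 hμp (by omega)
    · exact mul_mem_fil_of_le h3 (hpowx k) (by omega)
    · exact fil_anti (by omega) hμp
  -- The divided difference of `X ↦ X^(k+1)` minus its value at `X = x`: removing the linear term
  -- raises the weight of this factor from `2k` to `2k + 1`.
  have e3 : ((x + ξ) ^ (k + 1) - x ^ (k + 1) - (k + 1 : ℂ) • (x ^ k * ξ)) -
      ((x + ξ') ^ (k + 1) - x ^ (k + 1) - (k + 1 : ℂ) • (x ^ k * ξ')) =
      (∑ i ∈ Finset.range (k + 1), ((x + ξ) ^ i * (x + ξ') ^ (k - i) - x ^ k)) * (ξ - ξ') := by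
    have h := (Commute.all (x + ξ) (x + ξ')).geom_sum₂_mul (k + 1)
    simp only [Nat.add_sub_cancel] at h
    rw [Finset.sum_sub_distrib, sub_mul, Finset.sum_const, Finset.card_range, nsmul_eq_mul,
      ← add_sub_add_left_eq_sub ξ ξ' x, h, smul_eq_C_mul, smul_eq_C_mul, map_add, map_natCast,
      map_one]
    push_cast
    ring
  have t3 : ((x + ξ) ^ (k + 1) - x ^ (k + 1) - (k + 1 : ℂ) • (x ^ k * ξ)) -
      ((x + ξ') ^ (k + 1) - x ^ (k + 1) - (k + 1 : ℂ) • (x ^ k * ξ')) ∈ fil (wt k) (s + 1) := by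
    rw [e3]
    refine mul_mem_fil_of_le (s := 2 * k + 1) (Ideal.sum_mem _ fun i hi => ?_) h1 (by omega)
    rw [Finset.mem_range] at hi
    have e : (x + ξ) ^ i * (x + ξ') ^ (k - i) - x ^ k =
        ((x + ξ) ^ i - x ^ i) * (x + ξ') ^ (k - i) +
          x ^ i * ((x + ξ') ^ (k - i) - x ^ (k - i)) := by
      have : x ^ k = x ^ i * x ^ (k - i) := by rw [← pow_add]; congr 1; omega
      rw [this]; ring
    rw [e]
    refine add_mem (mul_mem_fil_of_le (hpowx i) (pow_mem_fil hX' _) (by omega))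
      (mul_mem_fil_of_le (xpow_mem_fil i) (pow_sub_pow_mem_fil hX' xv_mem_fil hX'x _) (by omega))
  have t4 : ∑ j, φ j * ((x + ξ) ^ (j : ℕ) - x ^ (j : ℕ)) -
      ∑ j, φ' j * ((x + ξ') ^ (j : ℕ) - x ^ (j : ℕ)) ∈ fil (wt k) (s + 1) := by
    rw [← Finset.sum_sub_distrib]
    refine Ideal.sum_mem _ fun j _ => ?_
    have hj := j.2
    have e : φ j * ((x + ξ) ^ (j : ℕ) - x ^ (j : ℕ)) - φ' j * ((x + ξ') ^ (j : ℕ) - x ^ (j : ℕ)) =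
        (φ j - φ' j) * ((x + ξ) ^ (j : ℕ) - x ^ (j : ℕ)) +
          φ' j * ((x + ξ) ^ (j : ℕ) - (x + ξ') ^ (j : ℕ)) := by ring
    rw [e]
    refine add_mem (mul_mem_fil_of_le (h2 j) (hpowx j) (by omega)) ?_
    exact mul_mem_fil_of_le (hφ' j) (hpow j) (by omega)
  have := add_mem (add_mem (sub_mem (neg_mem t1) t2) t3) t4
  convert this using 1
  rw [nonlinK, nonlinK]
  ring

theorem nonlinK_zero (V : Series k) :
    nonlinK V 0 (fun _ => 0) 0 = -(V - xv k ^ (k + 1)) := by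
  simp [nonlinK]

theorem linK_sub (ξ ξ' : Series k) (φ φ' : Fin k → Series k) (μ μ' : Series k) :
    linK ξ φ μ - linK ξ' φ' μ' = linK (ξ - ξ') (fun j => φ j - φ' j) (μ - μ') := by
  simp only [linK, map_sub, mul_sub, sub_mul, Finset.sum_sub_distrib, smul_sub]
  ring

/-- Uniqueness of the normalisation of vector fields in the variable `x`. -/
theorem kostov_unique (hk : 0 < k) {V ξ ξ' : Series k} {φ φ' : Fin k → ParamSeries k}
    {μ μ' : ParamSeries k} (hV : V - xv k ^ (k + 1) ∈ fil (wt k) (2 * k + 3))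
    (hξ : ξ ∈ fil (wt k) 3) (hξ' : ξ' ∈ fil (wt k) 3) (hrξ : res ξ = ξ) (hrξ' : res ξ' = ξ')
    (hφ' : ∀ j : Fin k, liftParam k (φ' j) ∈ fil (wt k) (2 * (k + 1 - (j : ℕ)) + 1))
    (hxc : xc (k + 1) ξ = xc (k + 1) ξ')
    (h : V * (1 + pderiv ℂ (Sum.inr 0) ξ) * (1 + liftParam k μ * (xv k + ξ) ^ k) =
      bifPoly (fun j => liftParam k (φ j)) (xv k + ξ))
    (h' : V * (1 + pderiv ℂ (Sum.inr 0) ξ') * (1 + liftParam k μ' * (xv k + ξ') ^ k) =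
      bifPoly (fun j => liftParam k (φ' j)) (xv k + ξ')) :
    ξ = ξ' ∧ φ = φ' ∧ μ = μ' := by
  have hd : linK (ξ - ξ') (fun j => liftParam k (φ j - φ' j)) (liftParam k (μ - μ')) =
      nonlinK V ξ (fun j => liftParam k (φ j)) (liftParam k μ) -
        nonlinK V ξ' (fun j => liftParam k (φ' j)) (liftParam k μ') := by
    have e := linK_sub_nonlinK V ξ (fun j => liftParam k (φ j)) (liftParam k μ)
    have e' := linK_sub_nonlinK V ξ' (fun j => liftParam k (φ' j)) (liftParam k μ')
    rw [h, sub_self, sub_eq_zero] at e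
    rw [h', sub_self, sub_eq_zero] at e'
    rw [← e, ← e', linK_sub]
    simp_rw [map_sub]
  have hr : res (ξ - ξ') = ξ - ξ' := by rw [map_sub, hrξ, hrξ']
  obtain ⟨s1, s2, s3⟩ := sol_linK hr (by rw [map_sub, hxc, sub_self]) (fun j => φ j - φ' j) (μ - μ')
  -- If this linear expression has weight `s`, solving it bounds all the differences, and then
  -- `nonlinK_sub_mem_fil` gives it weight `s + 1`.
  have hzero : linK (ξ - ξ') (fun j => liftParam k (φ j - φ' j)) (liftParam k (μ - μ')) = 0 := by
    refine eq_zero_of_mem_fil_succ (ω := wt k) fun s hs => ?_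
    rw [hd]
    refine nonlinK_sub_mem_fil hk hV hξ hξ' hφ' ?_ ?_ ?_
    · rw [← s1]; exact solX_mem_fil hs
    · intro j
      rw [← map_sub, ← neg_neg (φ j - φ' j), ← s2 j, map_neg]
      exact neg_mem (xc_mem_fil hs)
    · rw [← map_sub, ← s3]; exact xc_mem_fil hs
  rw [hzero] at s1 s2 s3
  refine ⟨?_, funext fun j => ?_, ?_⟩
  · rw [map_zero] at s1; exact sub_eq_zero.1 s1.symm
  · have := s2 j
    rw [map_zero, zero_eq_neg] at this
    exact sub_eq_zero.1 this
  · rw [map_zero] at s3; exact sub_eq_zero.1 s3.symm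

end

end SaddleNode

namespace SaddleNode

open Filter Topology MvPowerSeries

noncomputable section

variable {k : ℕ}

/-! ### Convergence of the normalisation in one variable -/

/-- The constant in the estimate of `nonlinK`. -/
def nonlinConst (k : ℕ) (C L : ℝ) : ℝ :=
  C * (L * (1 + 2 * 2 ^ k)) + (2 ^ k * L ^ 2 + L * ((k + 1) * 2 ^ k * L)) +
    (k + 1) * (L * ((k + 1) * 2 ^ k * L)) + k * (L * ((k + 1) * 2 ^ k * L))

/-- At the radii `r ^ wt` every quantity has the size of `r` to its weight. Only `V - x^(k+1)`
itself contributes at order `r^(2k+3)`; the other terms carry one more factor `r`, which is what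
keeps a ball invariant for small `r`. -/
theorem Bd.nonlinK {r C L m : ℝ} {p : Fin k → ℝ} (hr : 0 < r) (hC : 0 ≤ C) (hL : 0 ≤ L)
    (hLr : L * r ≤ 1) {V ξ : Series k} {φ : Fin k → Series k} {μ : Series k}
    (hV : Bd (fun i => r ^ wt k i) (V - xv k ^ (k + 1)) (C * r ^ (2 * k + 3)))
    (hξ : Bd (fun i => r ^ wt k i) ξ (L * r ^ 3))
    (hD : Bd (fun i => r ^ wt k i) (pderiv ℂ (Sum.inr 0) ξ) (L * r))
    (hφ : ∀ j, Bd (fun i => r ^ wt k i) (φ j) (p j))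
    (hp : ∀ j : Fin k, p j * r ^ (2 * (j : ℕ)) = L * r ^ (2 * k + 3))
    (hμ : Bd (fun i => r ^ wt k i) μ m) (hm : m * r ^ (2 * k) = L * r) :
    Bd (fun i => r ^ wt k i) (nonlinK V ξ φ μ)
      (C * r ^ (2 * k + 3) + nonlinConst k C L * r ^ (2 * k + 4)) := by
  set v : Fin k ⊕ Fin 2 → ℝ := fun i => r ^ wt k i with hv
  have hv0 : ∀ i, 0 ≤ v i := fun i => pow_nonneg hr.le _
  have hx : Bd v (xv k) (r ^ 2) := Bd.X hv0 _
  have hX : Bd v (xv k + ξ) (2 * r ^ 2) := (hx.add hv0 hξ).mono (by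
    have : L * r ^ 3 = L * r * r ^ 2 := by ring
    nlinarith [pow_pos hr 2])
  have hxn : ∀ n, Bd v (xv k ^ n) (r ^ (2 * n)) := fun n => by
    rw [pow_mul]; exact hx.pow hv0 n
  have hXn : ∀ n, n ≤ k → Bd v ((xv k + ξ) ^ n) (2 ^ k * r ^ (2 * n)) := fun n hn => by
    refine (hX.pow hv0 n).mono ?_
    rw [mul_pow, pow_mul]
    exact mul_le_mul_of_nonneg_right (pow_le_pow_right₀ one_le_two hn) (by positivity)
  set E : ℝ := (k + 1) * 2 ^ k * L with hE
  have hE0 : 0 ≤ E := by positivity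
  have hdiff : ∀ n, n ≤ k → Bd v ((xv k + ξ) ^ n - xv k ^ n) (E * r ^ (2 * n + 1)) := by
    intro n hn
    rw [← (Commute.all (xv k + ξ) (xv k)).geom_sum₂_mul, add_sub_cancel_left]
    have h1 : ∀ i ∈ Finset.range n, Bd v ((xv k + ξ) ^ i * xv k ^ (n - 1 - i))
        (2 ^ k * r ^ (2 * (n - 1))) := by
      intro i hi
      rw [Finset.mem_range] at hi
      refine ((hXn i (by omega)).mul hv0 (hxn _)).mono (le_of_eq ?_)
      rw [mul_assoc, ← pow_add]
      congr 2
      omega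
    refine ((Bd.sum hv0 _ h1).mul hv0 hξ).mono ?_
    rw [Finset.sum_const, Finset.card_range, nsmul_eq_mul]
    rcases Nat.eq_zero_or_pos n with h0 | h0
    · rw [h0]; simp only [Nat.cast_zero, zero_mul]; positivity
    · have e : (n : ℝ) * (2 ^ k * r ^ (2 * (n - 1))) * (L * r ^ 3) =
          n * (2 ^ k * L * r ^ (2 * n + 1)) := by
        rw [show 2 * n + 1 = 2 * (n - 1) + 3 by omega, pow_add]; ring
      have e2 : E * r ^ (2 * n + 1) = (k + 1) * (2 ^ k * L * r ^ (2 * n + 1)) := by rw [hE]; ring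
      rw [e, e2]
      refine mul_le_mul_of_nonneg_right ?_ (by positivity)
      have : (n : ℝ) ≤ k := by exact_mod_cast hn
      linarith
  have hμX : Bd v (μ * (xv k + ξ) ^ k) (2 ^ k * (L * r)) :=
    (hμ.mul hv0 (hXn k le_rfl)).mono (le_of_eq (by rw [← hm]; ring))
  have hμd : Bd v (μ * ((xv k + ξ) ^ k - xv k ^ k)) (L * E * r ^ 2) :=
    (hμ.mul hv0 (hdiff k le_rfl)).mono (le_of_eq (by
      rw [pow_succ]
      calc m * (E * (r ^ (2 * k) * r)) = (m * r ^ (2 * k)) * (E * r) := by ring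
        _ = _ := by rw [hm]; ring))
  have t1 : Bd v ((V - xv k ^ (k + 1)) * ((1 + pderiv ℂ (Sum.inr 0) ξ) * (1 + μ * (xv k + ξ) ^ k)))
      (C * r ^ (2 * k + 3) + C * (L * (1 + 2 * 2 ^ k)) * r ^ (2 * k + 4)) := by
    refine (hV.mul hv0 (((Bd.one hv0).add hv0 hD).mul hv0 ((Bd.one hv0).add hv0 hμX))).mono ?_
    have h1 : (1 + L * r) * (1 + 2 ^ k * (L * r)) ≤ 1 + L * r * (1 + 2 * 2 ^ k) := by
      have h2 : 0 ≤ L * r := mul_nonneg hL hr.le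
      have h3 : L * r * (L * r) ≤ L * r * 1 := mul_le_mul_of_nonneg_left hLr h2
      have h4 := mul_le_mul_of_nonneg_left h3 (pow_nonneg zero_le_two k : (0 : ℝ) ≤ 2 ^ k)
      linarith
    refine (mul_le_mul_of_nonneg_left h1 (by positivity)).trans (le_of_eq ?_)
    ring
  have t2 : Bd v (xv k ^ (k + 1) * (pderiv ℂ (Sum.inr 0) ξ * (μ * (xv k + ξ) ^ k) +
      μ * ((xv k + ξ) ^ k - xv k ^ k))) ((2 ^ k * L ^ 2 + L * E) * r ^ (2 * k + 4)) :=
    ((hxn (k + 1)).mul hv0 ((hD.mul hv0 hμX).add hv0 hμd)).mono (le_of_eq (by ring))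
  have t3 : Bd v ((xv k + ξ) ^ (k + 1) - xv k ^ (k + 1) - (k + 1 : ℂ) • (xv k ^ k * ξ))
      ((k + 1) * (L * E) * r ^ (2 * k + 4)) := by
    have e : (xv k + ξ) ^ (k + 1) - xv k ^ (k + 1) - (k + 1 : ℂ) • (xv k ^ k * ξ) =
        (∑ i ∈ Finset.range (k + 1), ((xv k + ξ) ^ i - xv k ^ i) * xv k ^ (k - i)) * ξ := by
      have h := (Commute.all (xv k + ξ) (xv k)).geom_sum₂_mul (k + 1)
      simp only [Nat.add_sub_cancel, add_sub_cancel_left] at h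
      rw [← h, smul_eq_C_mul, map_add, map_natCast, map_one]
      have : ∑ i ∈ Finset.range (k + 1), ((xv k + ξ) ^ i - xv k ^ i) * xv k ^ (k - i) =
          ∑ i ∈ Finset.range (k + 1), (xv k + ξ) ^ i * xv k ^ (k - i) -
            (((k : ℕ) : Series k) + 1) * xv k ^ k := by
        simp_rw [sub_mul, Finset.sum_sub_distrib]
        congr 1
        have h' : ∀ i ∈ Finset.range (k + 1), xv k ^ i * xv k ^ (k - i) = xv k ^ k := by
          intro i hi
          rw [Finset.mem_range] at hi
          rw [← pow_add]
          congr 1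
          omega
        rw [Finset.sum_congr rfl h', Finset.sum_const, Finset.card_range, nsmul_eq_mul]
        push_cast
        ring
      rw [this]
      ring
    rw [e]
    have h1 : ∀ i ∈ Finset.range (k + 1), Bd v (((xv k + ξ) ^ i - xv k ^ i) * xv k ^ (k - i))
        (E * r ^ (2 * k + 1)) := by
      intro i hi
      rw [Finset.mem_range] at hi
      refine ((hdiff i (by omega)).mul hv0 (hxn _)).mono (le_of_eq ?_)
      rw [mul_assoc, ← pow_add]
      congr 2
      omega
    refine ((Bd.sum hv0 _ h1).mul hv0 hξ).mono (le_of_eq ?_)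
    rw [Finset.sum_const, Finset.card_range, nsmul_eq_mul]
    push_cast
    ring
  have t4 : Bd v (∑ j, φ j * ((xv k + ξ) ^ (j : ℕ) - xv k ^ (j : ℕ)))
      (k * (L * E) * r ^ (2 * k + 4)) := by
    refine (Bd.sum hv0 _ fun j _ => ((hφ j).mul hv0 (hdiff j j.2.le))).mono (le_of_eq ?_)
    have : ∀ j ∈ (Finset.univ : Finset (Fin k)), p j * (E * r ^ (2 * (j : ℕ) + 1)) =
        L * E * r ^ (2 * k + 4) := by
      intro j _
      rw [pow_succ]
      calc p j * (E * (r ^ (2 * (j : ℕ)) * r)) = p j * r ^ (2 * (j : ℕ)) * (E * r) := by ring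
        _ = _ := by rw [hp]; ring
    rw [Finset.sum_congr rfl this, Finset.sum_const, Finset.card_univ, Fintype.card_fin,
      nsmul_eq_mul]
    ring
  refine (((t1.neg.sub hv0 t2).add hv0 t3).add hv0 t4).mono (le_of_eq ?_)
  rw [nonlinConst, ← hE]
  ring

theorem norm_inv_natCast_sub_le (n m : ℕ) : ‖((n : ℂ) - (m + 1))⁻¹‖ ≤ 1 := by
  by_cases h : n = m + 1
  · simp [h]
  · rw [norm_inv]
    refine inv_le_one_of_one_le₀ ?_
    have : (n : ℂ) - (m + 1) = (((n : ℤ) - (m + 1) : ℤ) : ℂ) := by push_cast; ring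
    rw [this, Complex.norm_intCast]
    exact_mod_cast Int.one_le_abs (show (n : ℤ) - (m + 1) ≠ 0 by omega)

/-- The factor `n + 1` from the derivative is balanced by the denominator of `solX`, so the
derivative is bounded at the same radius and no domain is lost in the iteration. -/
theorem pderiv_solX (g : Series k) : pderiv ℂ (Sum.inr 0) (solX g) =
    shiftMul (Finsupp.single (Sum.inr 0) (k + 1))
      (fun d => ((d (Sum.inr 0) : ℂ) + 1) * ((d (Sum.inr 0) : ℂ) - k)⁻¹) g := by
  ext d
  rw [coeff_pderiv, solX, coeff_shiftMul, coeff_shiftMul, add_assoc, ← Finsupp.single_add,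
    add_comm 1 k, Finsupp.add_apply, Finsupp.single_eq_same, Nat.cast_add, Nat.cast_one,
    add_sub_add_right_eq_sub]
  ring

theorem norm_div_sub_le (n : ℕ) : ‖((n : ℂ) + 1) * ((n : ℂ) - k)⁻¹‖ ≤ k + 2 := by
  by_cases h : n = k
  · rw [h, sub_self, inv_zero, mul_zero, norm_zero]
    positivity
  · have hne : (n : ℂ) - k ≠ 0 := by rw [sub_ne_zero]; exact_mod_cast h
    have e : ((n : ℂ) + 1) * ((n : ℂ) - k)⁻¹ = 1 + (k + 1) * ((n : ℂ) - k)⁻¹ := by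
      field_simp
      ring
    have h1 : ‖((n : ℂ) - k)⁻¹‖ ≤ 1 := by
      have := norm_inv_natCast_sub_le (n + 1) k
      push_cast at this
      rwa [add_sub_add_right_eq_sub] at this
    rw [e]
    refine (norm_add_le _ _).trans ?_
    rw [norm_one, norm_mul]
    have h2 : ‖(k + 1 : ℂ)‖ = k + 1 := by
      exact_mod_cast Complex.norm_natCast (k + 1)
    rw [h2]
    nlinarith

/-- Existence of a convergent normalisation of vector fields in the variable `x`. -/
theorem kostov_exists (hk : 0 < k) {V : Series k} (hres : res V = V) (hVc : IsConvergent V)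
    (hV : V - xv k ^ (k + 1) ∈ fil (wt k) (2 * k + 3)) :
    ∃ (ξ : Series k) (φ : Fin k → ParamSeries k) (μ : ParamSeries k),
      IsConvergent ξ ∧ (∀ j, IsConvergent (φ j)) ∧ IsConvergent μ ∧ res ξ = ξ ∧ ξ ∈ fil (wt k) 3 ∧
      (∀ j : Fin k, liftParam k (φ j) ∈ fil (wt k) (2 * (k + 1 - (j : ℕ)) + 1)) ∧
      V * (1 + pderiv ℂ (Sum.inr 0) ξ) * (1 + liftParam k μ * (xv k + ξ) ^ k) =
        bifPoly (fun j => liftParam k (φ j)) (xv k + ξ) := by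
  have hc0 : IsConvergent (V - xv k ^ (k + 1)) := hVc.sub ((isConvergent_X _).pow _)
  obtain ⟨r₀, hr₀, c, hc⟩ := (isConvergent_iff wt_ne_zero).1 hc0
  set C : ℝ := c / r₀ ^ (2 * k + 3) with hC
  have hC0 : 0 ≤ C := div_nonneg hc.nonneg (by positivity)
  -- The solution is sought in the ball of radius `K r^(2k+3)`: `C` accounts for `V - x^(k+1)`, and
  -- the extra `1` for the rest of the nonlinear part, small when `r` is. The factor `k + 2` in `L`
  -- is the bound of `norm_div_sub_le`.
  set K : ℝ := C + 1 with hK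
  have hK0 : 0 < K := by linarith
  set L : ℝ := (k + 2) * K with hL
  have hL0 : 0 < L := by positivity
  have hKL : K ≤ L := by nlinarith [(Nat.cast_nonneg k : (0 : ℝ) ≤ k)]
  have hQ0 : 0 ≤ nonlinConst k C L := by unfold nonlinConst; positivity
  obtain ⟨r, hr, hrr₀, hLr, hQr⟩ : ∃ r : ℝ, 0 < r ∧ r ≤ r₀ ∧ L * r ≤ 1 ∧
      nonlinConst k C L * r ≤ 1 := by
    refine ⟨min r₀ (min (1 / L) (1 / (nonlinConst k C L + 1))), by positivity, min_le_left _ _, ?_, ?_⟩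
    · have : min r₀ (min (1 / L) (1 / (nonlinConst k C L + 1))) ≤ 1 / L :=
        (min_le_right _ _).trans (min_le_left _ _)
      rw [mul_comm]
      exact (le_div_iff₀ hL0).1 this
    · have : min r₀ (min (1 / L) (1 / (nonlinConst k C L + 1))) ≤ 1 / (nonlinConst k C L + 1) :=
        (min_le_right _ _).trans (min_le_right _ _)
      have h1 := (le_div_iff₀ (by positivity)).1 this
      have h2 : 0 < min r₀ (min (1 / L) (1 / (nonlinConst k C L + 1))) := by positivity
      nlinarith
  have hVr : Bd (fun i => r ^ wt k i) (V - xv k ^ (k + 1)) (C * r ^ (2 * k + 3)) :=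
    hc.of_mem_fil hr.le hr₀ hrr₀ hV
  have hv : ∀ i, 0 < r ^ wt k i := fun i => pow_pos hr _
  have hmon : ∀ n, mon (fun i => r ^ wt k i) (Finsupp.single (Sum.inr 0) n) = r ^ (2 * n) :=
    fun n => by rw [mon_single, wt_x, pow_mul]
  -- The unknown of the iteration is the common value `g` of the linear and nonlinear parts; `ξ`,
  -- `φ` and `μ` are recovered from it linearly.
  let T : Series k → Series k := fun g => nonlinK V (solX g)
    (fun j => liftParam k (-xc (j : ℕ) g)) (liftParam k (xc (2 * k + 1) g))
  have hfilφ : ∀ {s : ℕ} {g : Series k}, g ∈ fil (wt k) s → ∀ j : Fin k,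
      liftParam k (-xc (j : ℕ) g) ∈ fil (wt k) (s - 2 * (j : ℕ)) := fun hg j => by
    rw [map_neg]
    exact neg_mem (xc_mem_fil hg)
  have hcontr : ∀ g ∈ fil (wt k) (2 * k + 3), ∀ g' ∈ fil (wt k) (2 * k + 3), ∀ s,
      g - g' ∈ fil (wt k) s → T g - T g' ∈ fil (wt k) (s + 1) := by
    intro g hg g' hg' s hs
    refine nonlinK_sub_mem_fil hk hV (fil_anti (by omega) (solX_mem_fil hg))
      (fil_anti (by omega) (solX_mem_fil hg'))
      (fun j => fil_anti (by have := j.2; omega) (hfilφ hg' j)) ?_ (fun j => ?_) ?_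
    · rw [← map_sub]; exact solX_mem_fil hs
    · have : liftParam k (-xc (j : ℕ) g) - liftParam k (-xc (j : ℕ) g') =
          liftParam k (-xc (j : ℕ) (g - g')) := by
        rw [map_sub, ← map_sub]; congr 1; ring
      rw [this]
      exact hfilφ hs j
    · rw [← map_sub, ← map_sub]; exact xc_mem_fil hs
  have hT0 : T 0 = -(V - xv k ^ (k + 1)) := by
    rw [← nonlinK_zero]
    simp only [T, map_zero, neg_zero]
  obtain ⟨g, ⟨⟨hg1, hg2⟩, hg3⟩, hfix⟩ := exists_fixedPoint (ω := wt k)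
    (({g | ∀ d ∈ {d : Fin k ⊕ Fin 2 →₀ ℕ | d (Sum.inr 1) ≠ 0}, coeff d g = 0} ∩
      (fil (wt k) (2 * k + 3) : Set (Series k))) ∩
      {g | Bd (fun i => r ^ wt k i) g (K * r ^ (2 * k + 3))}) T
    ⟨0, ⟨fun d _ => by simp, zero_mem _⟩, (Bd.zero _).mono (by positivity)⟩
    (by
      rintro g ⟨⟨hg1, hg2⟩, hg3⟩
      have hres' : res g = g := setZero_eq_self_iff.2 hg1
      refine ⟨⟨?_, ?_⟩, ?_⟩
      · refine setZero_eq_self_iff.1 ?_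
        have h1 := res_solX hres'
        simp only [T, nonlinK, map_sub, map_add, map_neg, map_mul, map_pow, map_smul, map_sum,
          res_xv, map_one, h1, hres, res_liftParam, res_pderiv_x]
      · have h1 := hcontr g hg2 0 (zero_mem _) (2 * k + 2)
          (by rw [sub_zero]; exact fil_anti (by omega) hg2)
        rw [hT0] at h1
        have h2 := add_mem h1 (neg_mem hV)
        rwa [sub_add_cancel] at h2
      · have b1 : Bd (fun i => r ^ wt k i) (solX g) (L * r ^ 3) := by
          refine (hg3.shiftMul hv fun d => norm_inv_natCast_sub_le _ k).mono ?_
          rw [hmon, one_mul, pow_add, div_le_iff₀ (by positivity)]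
          have : 0 ≤ r ^ (2 * k) * r ^ 3 := by positivity
          nlinarith
        have b2 : Bd (fun i => r ^ wt k i) (pderiv ℂ (Sum.inr 0) (solX g)) (L * r) := by
          rw [pderiv_solX]
          refine (hg3.shiftMul hv fun d => norm_div_sub_le _).mono (le_of_eq ?_)
          rw [hmon, div_eq_iff (by positivity), hL]
          ring
        have b3 : ∀ n, Bd (fun i => r ^ wt k i) (liftParam k (xc n g))
            (L * r ^ (2 * k + 3) / r ^ (2 * n)) := by
          intro n
          rw [liftParam_xc]
          refine (hg3.shiftMul hv norm_paramInd_le).mono ?_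
          rw [hmon, one_mul]
          exact div_le_div_of_nonneg_right (mul_le_mul_of_nonneg_right hKL (by positivity))
            (by positivity)
        have := Bd.nonlinK hr hC0 hL0.le hLr hVr b1 b2
          (φ := fun j => liftParam k (-xc (j : ℕ) g))
          (p := fun j => L * r ^ (2 * k + 3) / r ^ (2 * (j : ℕ)))
          (fun j => by rw [map_neg]; exact (b3 j).neg)
          (fun j => div_mul_cancel₀ _ (by positivity)) (b3 (2 * k + 1))
          (by rw [div_mul_eq_mul_div, div_eq_iff (by positivity)]; ring)
        refine this.mono ?_
        rw [hK, add_mul, one_mul, pow_succ r (2 * k + 3)]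
        have : 0 < r ^ (2 * k + 3) := by positivity
        nlinarith)
    (((stable_coeff _).inter (stable_fil _)).inter (stable_Bd _ _))
    (fun g hg g' hg' => hcontr g hg.1.2 g' hg'.1.2)
  have hres' : res g = g := setZero_eq_self_iff.2 hg1
  have hgc : IsConvergent g := hg3.isConvergent hv
  refine ⟨solX g, fun j => -xc (j : ℕ) g, xc (2 * k + 1) g,
    hgc.shiftMul fun d => norm_inv_natCast_sub_le _ k, fun j => (hgc.xc _).neg, hgc.xc _,
    res_solX hres', fil_anti (by omega) (solX_mem_fil hg2),
    fun j => fil_anti (by have := j.2; omega) (hfilφ hg2 j), ?_⟩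
  rw [← sub_eq_zero, ← linK_sub_nonlinK, linK_sol hres', sub_eq_zero]
  exact hfix.symm

end

end SaddleNode

/-! ### The parameter change of the one-variable normalisation, and an arbitrary leading coefficient
-/

namespace SaddleNode

open Filter Topology MvPowerSeries

noncomputable section

variable {k : ℕ}

/-- The derivative of `bifPoly e` at `x`. -/
def bifDer {R : Type} [CommRing R] {k : ℕ} (e : Fin k → R) (x : R) : R :=
  (k + 1) * x ^ k + ∑ j : Fin k, (j : ℕ) * e j * x ^ ((j : ℕ) - 1)

theorem map_bifDer {R S : Type} [CommRing R] [CommRing S] (f : R →+* S) (e : Fin k → R) (x : R) :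
    f (bifDer e x) = bifDer (fun j => f (e j)) (f x) := by
  simp [bifDer]

theorem derivation_bifPoly {R : Type} [CommRing R] [Algebra ℂ R] (D : Derivation ℂ R R)
    (e : Fin k → R) (x : R) :
    D (bifPoly e x) = bifDer e x * D x + ∑ j, D (e j) * x ^ (j : ℕ) := by
  simp only [bifPoly, bifDer, map_add, map_sum, Derivation.leibniz, Derivation.leibniz_pow,
    smul_eq_mul, nsmul_eq_mul, Nat.add_sub_cancel, Finset.sum_add_distrib, add_mul, Finset.sum_mul]
  rw [add_assoc]
  congr 1
  · push_cast; ring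
  · congr 1
    · refine Finset.sum_congr rfl fun j _ => ?_
      ring
    · refine Finset.sum_congr rfl fun j _ => ?_
      ring

/-- The derivation `∑ v_j ∂/∂ε_j`. -/
def paramDerivation (v : Fin k → ℂ) : Derivation ℂ (Series k) (Series k) :=
  ∑ j, v j • (pderiv ℂ (Sum.inl j))

theorem paramDerivation_apply (v : Fin k → ℂ) (f : Series k) :
    paramDerivation v f = ∑ j, v j • pderiv ℂ (Sum.inl j) f := by
  have h : ∀ s : Finset (Fin k), (∑ j ∈ s, v j • (pderiv ℂ (Sum.inl j)) :
      Derivation ℂ (Series k) (Series k)) f = ∑ j ∈ s, v j • pderiv ℂ (Sum.inl j) f := by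
    intro s
    induction s using Finset.induction_on with
    | empty => simp
    | insert a s ha ih => rw [Finset.sum_insert ha, Finset.sum_insert ha, Derivation.add_apply, ih,
        Derivation.smul_apply]
  exact h _

/-- Infinitesimal versality: the polynomials `∑ v_j x^j` of degree less than `k` are independent
modulo `x^k`. A kernel vector `v` of the Jacobian of `φ` would make such a polynomial vanish modulo
`(ε, y, x^k)`, as differentiating the identity in the direction `v` shows. -/
theorem det_param_ne_zero (hk : 0 < k) {W U X : Series k} {φ : Fin k → ParamSeries k}
    (hU : constantCoeff (W * U) ≠ 0) (hX : constantCoeff X = 0)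
    (hφ : ∀ j, constantCoeff (φ j) = 0)
    (h : bifP k * (W * U) = bifPoly (fun j => liftParam k (φ j)) X) :
    (jacobianAtZero φ).det ≠ 0 := by
  -- With these weights `fil ω k` is the ideal `(ε, y, x^k)`.
  let ω : Fin k ⊕ Fin 2 → ℕ := Sum.elim (fun _ => k) ![1, k]
  have hω : ∀ i, ω i ≠ 0 := by
    rintro (j | i)
    · exact hk.ne'
    · fin_cases i
      · exact one_ne_zero
      · exact hk.ne'
  intro hdet
  obtain ⟨v, hv, hJ⟩ := Matrix.exists_mulVec_eq_zero_iff.2 hdet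
  set D := paramDerivation v with hD
  have hlift : ∀ p : ParamSeries k, constantCoeff p = 0 → liftParam k p ∈ fil ω k := by
    intro p hp d hd
    by_cases hd0 : d = 0
    · rw [hd0, coeff_zero_eq_constantCoeff_apply, constantCoeff_liftParam, hp]
    · by_cases hx : ∃ i, d (Sum.inr i) ≠ 0
      · obtain ⟨i, hi⟩ := hx
        exact coeff_liftParam_eq_zero p hi
      · push Not at hx
        obtain ⟨e, rfl⟩ := exists_embDomain_of_inr hx
        exfalso
        rw [weight_embDomain, Finsupp.weight_apply] at hd
        obtain ⟨j, hj⟩ : ∃ j, e j ≠ 0 := by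
          by_contra! h'
          exact hd0 (by rw [show e = 0 from Finsupp.ext h', Finsupp.embDomain_zero])
        have h1 : e j • k ≤ e.sum fun i c => c • (fun j => ω (Sum.inl j)) i :=
          Finset.single_le_sum (f := fun i => e i • k) (fun _ _ => Nat.zero_le _)
            (Finsupp.mem_support_iff.2 hj)
        have h2 : 1 * k ≤ e j * k := Nat.mul_le_mul_right k (Nat.one_le_iff_ne_zero.2 hj)
        rw [smul_eq_mul] at h1
        exact absurd (h2.trans h1) (not_le.2 (by rw [one_mul]; exact hd))
  have hpow : ∀ {f : Series k}, constantCoeff f = 0 → f ^ k ∈ fil ω k := fun hf => by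
    have := pow_mem_fil ((mem_fil_one hω).2 hf) k
    rwa [mul_one] at this
  have hder : bifDer (fun j => liftParam k (φ j)) X ∈ fil ω k :=
    add_mem (Ideal.mul_mem_left _ _ (hpow hX)) (Ideal.sum_mem _ fun j _ =>
      Ideal.mul_mem_right _ _ (Ideal.mul_mem_left _ _ (hlift _ (hφ j))))
  have hP : bifP k ∈ fil ω k := by
    refine add_mem ?_ (Ideal.sum_mem _ fun j _ => Ideal.mul_mem_right _ _ ?_)
    · rw [pow_succ]
      exact Ideal.mul_mem_right _ _ (hpow (constantCoeff_X _))
    · exact X_mem_fil (ω := ω) (Sum.inl j)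
  have hDφ : ∀ j, D (liftParam k (φ j)) ∈ fil ω k := by
    intro j
    have e : D (liftParam k (φ j)) = liftParam k (∑ i, v i • pderiv ℂ i (φ j)) := by
      rw [hD, paramDerivation_apply, map_sum]
      refine Finset.sum_congr rfl fun i _ => ?_
      rw [map_smul]
      congr 1
      ext d
      rw [coeff_pderiv]
      by_cases hx : ∃ i, d (Sum.inr i) ≠ 0
      · obtain ⟨l, hl⟩ := hx
        rw [coeff_liftParam_eq_zero _ hl, coeff_liftParam_eq_zero (i := l), zero_mul]
        rw [Finsupp.add_apply]
        omega
      · push Not at hx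
        obtain ⟨e, rfl⟩ := exists_embDomain_of_inr hx
        have h1 := Finsupp.embDomain_apply_self (Function.Embedding.inl : Fin k ↪ Fin k ⊕ Fin 2) e i
        have h2 : e.embDomain Function.Embedding.inl + Finsupp.single (Sum.inl i : Fin k ⊕ Fin 2) 1 =
            (e + Finsupp.single i 1).embDomain Function.Embedding.inl := by
          rw [Finsupp.embDomain_add, Finsupp.embDomain_single]
          rfl
        rw [coeff_liftParam, coeff_pderiv, h2, coeff_liftParam]
        congr 2
        exact congrArg _ h1
    rw [e]
    refine hlift _ ?_
    have := congrFun hJ j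
    rw [Matrix.mulVec, dotProduct, Pi.zero_apply] at this
    rw [map_sum, ← this]
    refine Finset.sum_congr rfl fun i _ => ?_
    rw [← coeff_zero_eq_constantCoeff_apply, coeff_smul, coeff_pderiv]
    simp [jacobianAtZero, mul_comm]
  have hDX : ∑ j, D (MvPowerSeries.X (Sum.inl j)) * xv k ^ (j : ℕ) = ∑ j, v j • xv k ^ (j : ℕ) := by
    refine Finset.sum_congr rfl fun j _ => ?_
    rw [hD, paramDerivation_apply, Finset.sum_eq_single j]
    · rw [pderiv_X_self, smul_mul_assoc, one_mul]
    · intro i _ hij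
      rw [pderiv_X_of_ne (fun h' => hij (Sum.inl_injective h').symm), smul_zero]
    · simp
  have hDx : D (xv k) = 0 := by
    rw [hD, paramDerivation_apply]
    refine Finset.sum_eq_zero fun i _ => ?_
    rw [pderiv_X_of_ne Sum.inr_ne_inl, smul_zero]
  -- Every term of the differentiated identity lies in this ideal except the unit `W U` times `∑ v_j
  -- x^j`, which must then lie in it too.
  have h1 := congrArg D h
  rw [Derivation.leibniz, derivation_bifPoly, bifP, derivation_bifPoly, hDX, hDx, mul_zero, zero_add,
    ← bifP, smul_eq_mul, smul_eq_mul] at h1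
  have h2 : W * U * ∑ j, v j • xv k ^ (j : ℕ) ∈ fil ω k := by
    have : W * U * ∑ j, v j • xv k ^ (j : ℕ) = bifDer (fun j => liftParam k (φ j)) X * D X +
        ∑ j, D (liftParam k (φ j)) * X ^ (j : ℕ) - bifP k * D (W * U) := by
      rw [← h1]; ring
    rw [this]
    exact sub_mem (add_mem (Ideal.mul_mem_right _ _ hder) (Ideal.sum_mem _ fun j _ =>
      Ideal.mul_mem_right _ _ (hDφ j))) (Ideal.mul_mem_right _ _ hP)
  have h3 : ∑ j, v j • xv k ^ (j : ℕ) ∈ fil ω k := by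
    have := Ideal.mul_mem_left _ (W * U)⁻¹ h2
    rwa [← mul_assoc, MvPowerSeries.inv_mul_cancel _ hU, one_mul] at this
  refine hv (funext fun j => ?_)
  have h4 := h3 (Finsupp.single (Sum.inr 0) (j : ℕ)) (by
    rw [Finsupp.weight_single]
    change (j : ℕ) • 1 < k
    simp)
  rw [map_sum, Finset.sum_eq_single j] at h4
  · rwa [coeff_smul, X_pow_eq, coeff_monomial_same, mul_one] at h4
  · intro i _ hij
    rw [coeff_smul, X_pow_eq, coeff_monomial_ne, mul_zero]
    intro h'
    exact hij (Fin.ext (Finsupp.single_injective _ h').symm)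
  · simp

/-- Convergent normalisation of the vector field `P W ∂/∂x`. -/
theorem exists_normalisation_x (hk : 0 < k) {W : Series k} (hres : res W = W)
    (hW : IsConvergent W) (hW0 : constantCoeff W ≠ 0) :
    ∃ (X : Series k) (φ : Fin k → ParamSeries k) (μ : ParamSeries k),
      IsConvergent X ∧ (∀ j, IsConvergent (φ j)) ∧ IsConvergent μ ∧ res X = X ∧
      constantCoeff X = 0 ∧ coeff (Finsupp.single (Sum.inr 0) 1) X ≠ 0 ∧
      (∀ j, constantCoeff (φ j) = 0) ∧ (jacobianAtZero φ).det ≠ 0 ∧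
      bifP k * W * pderiv ℂ (Sum.inr 0) X * (1 + liftParam k μ * X ^ k) =
        bifPoly (fun j => liftParam k (φ j)) X := by
  set h0 := constantCoeff W with hh0
  -- After division by `h0` the coordinate is multiplied by `c`. The left-hand side then gains the
  -- factor `h0 c` and `P_φ` the factor `c^(k+1)` (with `ε_j` scaled by `c^(k+1-j)`), so `c^k` must
  -- be `h0`.
  obtain ⟨c, hc⟩ : ∃ c : ℂ, c ^ k = h0 := IsAlgClosed.exists_pow_nat_eq h0 hk
  have hc0 : c ≠ 0 := by
    rintro rfl
    rw [zero_pow hk.ne'] at hc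
    exact hW0 hc.symm
  obtain ⟨W', hW'⟩ : ∃ W', W' = h0⁻¹ • W := ⟨_, rfl⟩
  have hV : bifP k * W' - xv k ^ (k + 1) ∈ fil (wt k) (2 * k + 3) := by
    have h1 : W' - 1 ∈ fil (wt k) 1 := by
      rw [mem_fil_one wt_ne_zero, map_sub, map_one, hW', constantCoeff_smul, smul_eq_mul,
        inv_mul_cancel₀ hW0, sub_self]
    have e : bifP k * W' - xv k ^ (k + 1) =
        (bifP k - xv k ^ (k + 1)) * W' + xv k ^ (k + 1) * (W' - 1) := by ring
    rw [e]
    exact add_mem (Ideal.mul_mem_right _ _ bifP_sub_xpow_mem_fil)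
      (mul_mem_fil_of_le (xpow_mem_fil _) h1 (by omega))
  obtain ⟨ξ, φ, μ, hξc, hφc, hμc, hrξ, hξ3, hφ, heq⟩ := kostov_exists hk
    (by rw [map_mul, res_bifP, hW', map_smul, hres])
    (isConvergent_bifP.mul (hW' ▸ hW.smul _)) hV
  have hφ0 : ∀ j : Fin k, constantCoeff (c ^ (k + 1 - (j : ℕ)) • φ j) = 0 := fun j => by
    have := (mem_fil_one wt_ne_zero).1 (fil_anti (by omega) (hφ j))
    rw [constantCoeff_liftParam] at this
    rw [constantCoeff_smul, this, smul_zero]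
  have hξ0 : constantCoeff ξ = 0 := (mem_fil_one wt_ne_zero).1 (fil_anti (by omega) hξ3)
  have hX0 : constantCoeff (c • (xv k + ξ)) = 0 := by
    rw [constantCoeff_smul, map_add, hξ0, constantCoeff_X, add_zero, smul_zero]
  have hX1 : coeff (Finsupp.single (Sum.inr 0) 1) (c • (xv k + ξ)) ≠ 0 := by
    rw [coeff_smul, map_add, hξ3 _ (by rw [Finsupp.weight_single, wt_x]; simp), add_zero,
      coeff_X, if_pos rfl, mul_one]
    exact hc0
  have hμX : liftParam k ((c ^ k)⁻¹ • μ) * (c • (xv k + ξ)) ^ k = liftParam k μ * (xv k + ξ) ^ k := by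
    rw [map_smul, smul_pow, smul_mul_smul_comm, inv_mul_cancel₀ (pow_ne_zero _ hc0), one_smul]
  have hbif : bifPoly (fun j => liftParam k (c ^ (k + 1 - (j : ℕ)) • φ j)) (c • (xv k + ξ)) =
      c ^ (k + 1) • bifPoly (fun j => liftParam k (φ j)) (xv k + ξ) := by
    rw [bifPoly, bifPoly, smul_add (c ^ (k + 1)), smul_pow, Finset.smul_sum]
    congr 1
    refine Finset.sum_congr rfl fun j _ => ?_
    rw [map_smul, smul_pow, smul_mul_smul_comm, ← pow_add, Nat.sub_add_cancel (by have := j.2; omega)]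
  have hfin : bifP k * W * pderiv ℂ (Sum.inr 0) (c • (xv k + ξ)) *
      (1 + liftParam k ((c ^ k)⁻¹ • μ) * (c • (xv k + ξ)) ^ k) =
        bifPoly (fun j => liftParam k (c ^ (k + 1 - (j : ℕ)) • φ j)) (c • (xv k + ξ)) := by
    rw [hμX, hbif, ← heq, Derivation.map_smul, map_add, pderiv_X_self, hW']
    simp only [smul_eq_C_mul, map_pow]
    have : (C c : Series k) ^ k * C (h0⁻¹) = 1 := by
      rw [← map_pow, ← map_mul, hc, mul_inv_cancel₀ hW0, map_one]
    linear_combination (-(bifP k * W * C c * (1 + pderiv ℂ (Sum.inr 0) ξ) *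
      (1 + liftParam k μ * (xv k + ξ) ^ k))) * this
  refine ⟨c • (xv k + ξ), fun j => c ^ (k + 1 - (j : ℕ)) • φ j, (c ^ k)⁻¹ • μ,
    ((isConvergent_X _).add hξc).smul _, fun j => (hφc j).smul _, hμc.smul _, ?_, hX0, hX1, hφ0, ?_,
    hfin⟩
  · rw [map_smul, map_add, res_xv, hrξ]
  · refine det_param_ne_zero hk (W := W) (U := pderiv ℂ (Sum.inr 0) (c • (xv k + ξ)) *
      (1 + liftParam k ((c ^ k)⁻¹ • μ) * (c • (xv k + ξ)) ^ k)) ?_ hX0 hφ0 ?_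
    · rw [map_mul, map_mul, map_add, map_mul, map_pow, hX0, zero_pow hk.ne', mul_zero, map_one,
        add_zero, mul_one]
      refine mul_ne_zero hW0 ?_
      rw [← coeff_zero_eq_constantCoeff_apply, coeff_pderiv]
      simpa using hX1
    · rw [← hfin]; ring

end

end SaddleNode

/-! ### Deletion of a variable as a substitution -/

namespace SaddleNode

open Filter Topology MvPowerSeries

noncomputable section

variable {k : ℕ}

theorem setZero_eq_subst {σ : Type} [Finite σ] [DecidableEq σ] (i : σ) (f : MvPowerSeries σ ℂ) :
    setZero i f = subst (Function.update X i 0 : σ → MvPowerSeries σ ℂ) f := by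
  have h0 : ∀ j, constantCoeff ((Function.update X i 0 : σ → MvPowerSeries σ ℂ) j) = 0 := by
    intro j
    rcases eq_or_ne j i with rfl | h
    · simp
    · simp [h]
  have hs := hasSubst_of_zero h0
  have hone : ∀ i : σ, (fun _ : σ => 1) i ≠ 0 := fun _ => one_ne_zero
  have key := addMonoidHom_ext (ω := fun _ : σ => 1) (fun _ : σ => 1) hone
    (L := (setZero i).toRingHom.toAddMonoidHom)
    (L' := (substAlgHom hs).toRingHom.toAddMonoidHom) (fun s => ⟨s, fun f hf => ?_⟩) (fun p => ?_) f
  · refine key.trans ?_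
    exact congrFun (coe_substAlgHom hs) f
  · refine sub_mem (setZero_mem_fil hf) ?_
    have : subst (Function.update X i 0 : σ → MvPowerSeries σ ℂ) f ∈ fil (fun _ : σ => 1) s :=
      subst_mem_fil hs (fun j => (mem_fil_one hone).2 (h0 j)) hf
    rwa [← coe_substAlgHom hs] at this
  · have h := MvPolynomial.algHom_ext
      (f := (setZero i).comp (MvPolynomial.coeToMvPowerSeries.algHom ℂ))
      (g := (substAlgHom hs).comp (MvPolynomial.coeToMvPowerSeries.algHom ℂ)) (fun j => by
        simp only [AlgHom.comp_apply, MvPolynomial.coeToMvPowerSeries.algHom_apply,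
          Algebra.algebraMap_self, MvPowerSeries.map_id, RingHom.id_apply, MvPolynomial.coe_X]
        rw [coe_substAlgHom, subst_X hs]
        rcases eq_or_ne j i with rfl | h
        · rw [setZero_X_self, Function.update_self]
        · rw [setZero_X_of_ne h, Function.update_of_ne h])
    have := DFunLike.congr_fun h p
    simp only [AlgHom.comp_apply, MvPolynomial.coeToMvPowerSeries.algHom_apply,
          Algebra.algebraMap_self, MvPowerSeries.map_id, RingHom.id_apply] at this
    exact this

/-- Taking out a variable. -/
theorem X_mul_shiftMul_add {σ : Type} (i : σ) (f : MvPowerSeries σ ℂ) :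
    X i * shiftMul (Finsupp.single i 1) (fun _ => 1) f + setZero i f = f := by
  classical
  ext d
  rw [map_add, coeff_setZero, ← pow_one (X i), X_pow_eq, coeff_monomial_mul, one_mul,
    coeff_shiftMul, one_mul]
  simp only [Finsupp.single_le_iff]
  rcases Nat.eq_zero_or_pos (d i) with h | h
  · rw [if_neg (by omega), if_pos h, zero_add]
  · rw [if_pos (show 1 ≤ d i from h), if_neg (by omega), add_zero, tsub_add_cancel_of_le (Finsupp.single_le_iff.2 h)]

theorem exists_eq_X_mul_add {σ : Type} [Finite σ] (i : σ) (f : MvPowerSeries σ ℂ) :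
    ∃ g, f = X i * g + setZero i f ∧ (IsConvergent f → IsConvergent g) :=
  ⟨_, (X_mul_shiftMul_add i f).symm, fun h => h.shiftMul (B := 1) fun _ => by simp⟩

/-! ### The polynomial `P` as a coordinate -/

section Straighten

variable (hk : 0 < k)

/-- The polynomial `P - ε₀`, which does not involve `ε₀`. -/
def bifTail : Series k :=
  bifPoly (fun j => if (j : ℕ) = 0 then 0 else X (Sum.inl j)) (xv k)

theorem sum_ite_zero {R : Type} [CommRing R] (e : Fin k → R) (x : R) :
    bifPoly e x = e ⟨0, hk⟩ + bifPoly (fun j => if (j : ℕ) = 0 then 0 else e j) x := by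
  have : ∀ j : Fin k, e j * x ^ (j : ℕ) = (if (j : ℕ) = 0 then e j else 0) +
      (if (j : ℕ) = 0 then 0 else e j) * x ^ (j : ℕ) := by
    intro j
    split_ifs with h
    · rw [h]; ring
    · ring
  rw [bifPoly, bifPoly, Finset.sum_congr rfl fun j _ => this j, Finset.sum_add_distrib,
    Finset.sum_eq_single (⟨0, hk⟩ : Fin k)]
  · rw [if_pos rfl]; ring
  · intro j _ hj
    rw [if_neg]
    exact fun h => hj (Fin.ext h)
  · simp

theorem bifP_eq : bifP k = X (Sum.inl ⟨0, hk⟩) + bifTail := sum_ite_zero hk _ _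

/-- The substitution of `f` for `ε₀`. -/
def subZero (f : Series k) : Fin k ⊕ Fin 2 → Series k :=
  Function.update X (Sum.inl ⟨0, hk⟩) f

theorem subZero_self (f : Series k) : subZero hk f (Sum.inl ⟨0, hk⟩) = f :=
  Function.update_self _ _ _

theorem subZero_of_ne (f : Series k) {i : Fin k ⊕ Fin 2} (h : i ≠ Sum.inl ⟨0, hk⟩) :
    subZero hk f i = X i :=
  Function.update_of_ne h _ _

theorem subZero_zero {f : Series k} (hf : constantCoeff f = 0) (i : Fin k ⊕ Fin 2) :
    constantCoeff (subZero hk f i) = 0 := by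
  rcases eq_or_ne i (Sum.inl ⟨0, hk⟩) with rfl | h
  · rwa [subZero_self]
  · rw [subZero_of_ne hk f h, constantCoeff_X]

theorem isConvergent_subZero {f : Series k} (hf : IsConvergent f) (i : Fin k ⊕ Fin 2) :
    IsConvergent (subZero hk f i) := by
  rcases eq_or_ne i (Sum.inl ⟨0, hk⟩) with rfl | h
  · rwa [subZero_self]
  · rw [subZero_of_ne hk f h]; exact isConvergent_X i

theorem subst_subZero_bifTail {f : Series k} (hf : constantCoeff f = 0) :
    subst (subZero hk f) (bifTail (k := k)) = bifTail := by
  have hs := hasSubst_of_zero (subZero_zero hk hf)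
  have h := map_bifPoly (substAlgHom hs).toRingHom
    (fun j : Fin k => if (j : ℕ) = 0 then 0 else X (Sum.inl j)) (xv k)
  simp only [AlgHom.toRingHom_eq_coe, RingHom.coe_coe, coe_substAlgHom] at h
  rw [bifTail, h]
  congr 1
  · funext j
    split_ifs with h0
    · rw [← coe_substAlgHom hs, map_zero]
    · rw [subst_X hs, subZero_of_ne]
      intro h'
      exact h0 (congrArg Fin.val (Sum.inl_injective h'))
  · rw [subst_X hs, subZero_of_ne _ _ Sum.inr_ne_inl]

theorem constantCoeff_bifP : constantCoeff (bifP k) = 0 :=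
  (mem_fil_one wt_ne_zero).1 (fil_anti (by omega) bifP_mem_fil)

include hk in
theorem constantCoeff_bifTail : constantCoeff (bifTail (k := k)) = 0 := by
  have := constantCoeff_bifP (k := k)
  rwa [bifP_eq hk, map_add, constantCoeff_X, zero_add] at this

include hk in
theorem isConvergent_bifTail : IsConvergent (bifTail (k := k)) := by
  have : bifTail = bifP k - X (Sum.inl ⟨0, hk⟩) := by rw [bifP_eq hk]; ring
  rw [this]
  exact isConvergent_bifP.sub (isConvergent_X _)

theorem constantCoeff_X_sub_bifTail :
    constantCoeff (X (Sum.inl ⟨0, hk⟩) - bifTail : Series k) = 0 := by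
  rw [map_sub, constantCoeff_X, constantCoeff_bifTail hk, sub_zero]

/-- The change of variables for which `P` becomes the coordinate `ε₀`. -/
def straighten : Series k →ₐ[ℂ] Series k :=
  substAlgHom (hasSubst_of_zero (subZero_zero hk (constantCoeff_X_sub_bifTail hk)))

/-- The change of variables that sends `ε₀` to `P`. -/
def unstraighten : Series k →ₐ[ℂ] Series k :=
  substAlgHom (hasSubst_of_zero (subZero_zero hk (constantCoeff_bifP (k := k))))

theorem straighten_eq (f : Series k) :
    straighten hk f = subst (subZero hk (X (Sum.inl ⟨0, hk⟩) - bifTail)) f :=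
  congrFun (coe_substAlgHom _) f

theorem unstraighten_eq (f : Series k) : unstraighten hk f = subst (subZero hk (bifP k)) f :=
  congrFun (coe_substAlgHom _) f

theorem unstraighten_X : unstraighten hk (X (Sum.inl ⟨0, hk⟩)) = bifP k := by
  rw [unstraighten_eq, subst_X (hasSubst_of_zero (subZero_zero hk constantCoeff_bifP)),
    subZero_self]

theorem unstraighten_X_of_ne {i : Fin k ⊕ Fin 2} (h : i ≠ Sum.inl ⟨0, hk⟩) :
    unstraighten hk (X i) = X i := by
  rw [unstraighten_eq, subst_X (hasSubst_of_zero (subZero_zero hk constantCoeff_bifP)),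
    subZero_of_ne hk _ h]

theorem straighten_bifP : straighten hk (bifP k) = X (Sum.inl ⟨0, hk⟩) := by
  have h : straighten hk (X (Sum.inl ⟨0, hk⟩)) = X (Sum.inl ⟨0, hk⟩) - bifTail := by
    rw [straighten_eq, subst_X (hasSubst_of_zero (subZero_zero hk (constantCoeff_X_sub_bifTail hk))),
      subZero_self]
  rw [bifP_eq hk, map_add, h, straighten_eq,
    subst_subZero_bifTail hk (constantCoeff_X_sub_bifTail hk), sub_add_cancel]

theorem unstraighten_straighten (f : Series k) : unstraighten hk (straighten hk f) = f := by
  have hs := subZero_zero hk (constantCoeff_X_sub_bifTail hk)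
  have hu := subZero_zero hk (constantCoeff_bifP (k := k))
  rw [straighten_eq, unstraighten_eq]
  refine subst_subst_of_inverse hs hu (fun i => ?_) f
  rcases eq_or_ne i (Sum.inl ⟨0, hk⟩) with rfl | h
  · rw [subZero_self, ← unstraighten_eq, map_sub, unstraighten_X, unstraighten_eq,
      subst_subZero_bifTail hk constantCoeff_bifP, bifP_eq hk, add_sub_cancel_right]
  · rw [subZero_of_ne hk _ h, ← unstraighten_eq, unstraighten_X_of_ne hk h]

/-- As `ε₀` enters `P` linearly with coefficient `1`, `P` can replace `ε₀` as a coordinate, and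
divisibility by `P` becomes vanishing on a coordinate hyperplane. This makes `P` prime. -/
theorem bifP_dvd_iff (f : Series k) :
    bifP k ∣ f ↔ setZero (Sum.inl ⟨0, hk⟩) (straighten hk f) = 0 := by
  rw [setZero_eq_zero_iff]
  constructor
  · rintro ⟨g, rfl⟩
    rw [map_mul, straighten_bifP]
    exact dvd_mul_right _ _
  · rintro ⟨g, hg⟩
    rw [← unstraighten_straighten hk f, hg, map_mul, unstraighten_X]
    exact dvd_mul_right _ _

include hk in
theorem bifP_dvd_mul {f g : Series k} (h : bifP k ∣ f * g) : bifP k ∣ f ∨ bifP k ∣ g := by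
  simp_rw [bifP_dvd_iff hk] at *
  rw [map_mul, map_mul] at h
  exact mul_eq_zero.1 h

theorem evalAt_bifTail (z : Fin k ⊕ Fin 2 → ℂ) : evalAt (bifTail (k := k)) z =
    bifPoly (fun j => if (j : ℕ) = 0 then 0 else z (Sum.inl j)) (z (Sum.inr 0)) := by
  have h1 : bifTail (k := k) = ((bifPoly (fun j => if (j : ℕ) = 0 then 0 else
      MvPolynomial.X (Sum.inl j)) (MvPolynomial.X (Sum.inr 0)) :
        MvPolynomial (Fin k ⊕ Fin 2) ℂ) : Series k) := by
    have := map_bifPoly (MvPolynomial.coeToMvPowerSeries.ringHom (σ := Fin k ⊕ Fin 2) (R := ℂ))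
      (fun j : Fin k => if (j : ℕ) = 0 then 0 else MvPolynomial.X (Sum.inl j))
      (MvPolynomial.X (Sum.inr 0))
    simp only [MvPolynomial.coeToMvPowerSeries.ringHom_apply] at this
    rw [this, bifTail, MvPolynomial.coe_X]
    congr 1
    funext j
    split_ifs
    · exact MvPolynomial.coe_zero.symm
    · exact (MvPolynomial.coe_X _).symm
  rw [h1, evalAt_coe]
  have := map_bifPoly (MvPolynomial.eval z)
      (fun j : Fin k => if (j : ℕ) = 0 then 0 else MvPolynomial.X (Sum.inl j))
      (MvPolynomial.X (Sum.inr 0))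
  rw [this, MvPolynomial.eval_X]
  congr 1
  funext j
  split_ifs
  · rw [map_zero]
  · rw [MvPolynomial.eval_X]

include hk in
/-- A convergent series that vanishes where `P = y = 0` lies in the ideal `(P, y)`. -/
theorem exists_eq_mul_bifP_add {f : Series k} (hf : IsConvergent f)
    (h : ∀ᶠ p in 𝓝 (0 : Fin k ⊕ Fin 2 → ℂ),
      bifPoly (fun j => p (Sum.inl j)) (p (Sum.inr 0)) = 0 → p (Sum.inr 1) = 0 → evalAt f p = 0) :
    ∃ a b, IsConvergent a ∧ IsConvergent b ∧ f = a * bifP k + b * yv k := by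
  classical
  have hs0 := subZero_zero hk (constantCoeff_X_sub_bifTail hk)
  have hsc := isConvergent_subZero hk ((isConvergent_X (Sum.inl ⟨0, hk⟩)).sub
    (isConvergent_bifTail hk))
  have hτ : ∀ g, IsConvergent g → IsConvergent (straighten hk g) := fun g hg => by
    rw [straighten_eq]
    exact hg.subst hs0 hsc
  have hσ : ∀ g, IsConvergent g → IsConvergent (unstraighten hk g) := fun g hg => by
    rw [unstraighten_eq]
    exact hg.subst (subZero_zero hk constantCoeff_bifP) (isConvergent_subZero hk isConvergent_bifP)
  set e0 : Fin k ⊕ Fin 2 := Sum.inl ⟨0, hk⟩ with he0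
  let a1 : Fin k ⊕ Fin 2 → Series k := Function.update X e0 0
  let a2 : Fin k ⊕ Fin 2 → Series k := Function.update X (Sum.inr 1) 0
  have hz : ∀ i l, constantCoeff ((Function.update X i 0 : Fin k ⊕ Fin 2 → Series k) l) = 0 := by
    intro i l
    rcases eq_or_ne l i with rfl | h
    · simp
    · simp [h]
  -- `c` parametrises `P = y = 0` by the other variables: it puts `ε₀ - P` in place of `ε₀`, and `0`
  -- in place of `y`.
  let c : Fin k ⊕ Fin 2 → Series k := fun i => res (setZero e0 (subZero hk (X e0 - bifTail) i))
  have hc0 : ∀ i, constantCoeff (c i) = 0 := fun i => by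
    rw [constantCoeff_setZero, constantCoeff_setZero]; exact hs0 i
  have hcc : ∀ i, IsConvergent (c i) := fun i => ((hsc i).setZero _).setZero _
  have hc : ∀ g, res (setZero e0 (straighten hk g)) = subst c g := by
    intro g
    rw [straighten_eq, setZero_eq_subst, setZero_eq_subst,
      subst_comp_subst_apply (hasSubst_of_zero hs0) (hasSubst_of_zero (hz e0)),
      subst_comp_subst_apply (hasSubst_of_zero fun i => by
        rw [constantCoeff_subst_of_zero (hz e0)]; exact hs0 i) (hasSubst_of_zero (hz _))]
    congr 1
    funext i
    rw [← setZero_eq_subst, ← setZero_eq_subst]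
  have hce0 : c e0 = -bifTail := by
    have h1 : setZero e0 (bifTail (k := k)) = bifTail := by
      rw [setZero_eq_subst]
      exact subst_subZero_bifTail hk (map_zero _)
    have h2 : res (bifTail (k := k)) = bifTail := by
      have : bifTail = bifP k - X e0 := by rw [bifP_eq hk]; ring
      rw [this, map_sub, res_bifP, he0, res_X_inl]
    simp only [c]
    rw [he0, subZero_self, map_sub, setZero_X_self, ← he0, h1, zero_sub, map_neg, h2]
  have hcy : c (Sum.inr 1) = 0 := by
    simp only [c]
    rw [subZero_of_ne hk _ Sum.inr_ne_inl, setZero_X_of_ne Sum.inr_ne_inl, res_yv]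
  have hcx : c (Sum.inr 0) = xv k := by
    simp only [c]
    rw [subZero_of_ne hk _ Sum.inr_ne_inl, setZero_X_of_ne Sum.inr_ne_inl, res_xv]
  have hcj : ∀ j : Fin k, (j : ℕ) ≠ 0 → c (Sum.inl j) = X (Sum.inl j) := by
    intro j hj
    have hne : (Sum.inl j : Fin k ⊕ Fin 2) ≠ e0 := fun h' =>
      hj (congrArg Fin.val (Sum.inl_injective h'))
    simp only [c]
    rw [subZero_of_ne hk _ hne, setZero_X_of_ne hne, res_X_inl]
  -- The pullback of `f` to the parametrised zero set is convergent and has zero values near the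
  -- origin.
  have hzero : subst c f = 0 := by
    refine eq_zero_of_evalAt_eq_zero (hf.subst hc0 hcc) ?_
    filter_upwards [eventually_evalAt_subst hc0 hcc hf,
      (tendsto_evalAt_zero hc0 hcc).eventually h] with z h1 h2
    rw [h1]
    refine h2 ?_ ?_
    · have hneg : evalAt (-bifTail (k := k)) z = -evalAt (bifTail (k := k)) z := by
        rw [evalAt_eq, evalAt_eq, ← tsum_neg]
        exact tsum_congr fun d => by rw [map_neg, neg_mul]
      have e1 : ∀ e e' : Fin k → ℂ, e = e' → ∀ x x' : ℂ, x = x' → bifPoly e x = bifPoly e' x' := by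
        rintro e _ rfl x _ rfl; rfl
      rw [sum_ite_zero hk]
      rw [← he0, hce0, hneg, evalAt_bifTail, neg_add_eq_zero]
      refine e1 _ _ (funext fun j => ?_) _ _ ?_
      · split_ifs with hj
        · rfl
        · rw [hcj j hj, evalAt_X]
      · rw [hcx, evalAt_X]
    · rw [hcy, evalAt_eq]
      simp
  -- In the straightened coordinates the ideal is `(ε₀, y)`; taking out one variable after the other
  -- leaves the restriction to the zero set, which is zero.
  obtain ⟨g1, hg1, hg1c⟩ := exists_eq_X_mul_add e0 (straighten hk f)
  obtain ⟨g2, hg2, hg2c⟩ := exists_eq_X_mul_add (Sum.inr 1) (setZero e0 (straighten hk f))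
  rw [hc, hzero, add_zero] at hg2
  rw [hg2] at hg1
  have h1c := hg1c (hτ f hf)
  have h2c := hg2c ((hτ f hf).setZero _)
  refine ⟨_, _, hσ _ h1c, hσ _ h2c, ?_⟩
  rw [← unstraighten_straighten hk f, hg1, map_add, map_mul, map_mul, unstraighten_X,
    unstraighten_X_of_ne hk Sum.inr_ne_inl]
  ring

end Straighten

/-! ### Coprimality of `P` and its derivative -/

theorem coeff_single_xpow (n m : ℕ) :
    coeff (Finsupp.single (Sum.inr 0) n) (xv k ^ m) = if n = m then 1 else 0 := by
  classical
  rw [X_pow_eq, coeff_monomial]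
  congr 1
  rw [eq_iff_iff]
  exact ⟨fun h => Finsupp.single_injective _ h, fun h => h ▸ rfl⟩

theorem bifP_ne_zero : bifP k ≠ 0 := by
  intro h
  have h1 := bifP_sub_xpow_mem_fil (k := k) (Finsupp.single (Sum.inr 0) (k + 1))
    (by rw [Finsupp.weight_single, wt_x, smul_eq_mul]; omega)
  rw [h, zero_sub, map_neg, coeff_single_xpow, if_pos rfl] at h1
  exact one_ne_zero (neg_eq_zero.1 h1)

/-- The derivative of `P`. -/
def bifP' (k : ℕ) : Series k := bifDer (fun j => X (Sum.inl j)) (xv k)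

theorem pderiv_bifP : pderiv ℂ (Sum.inr 0) (bifP k) = bifP' k := by
  rw [bifP, derivation_bifPoly, pderiv_X_self, mul_one, Finset.sum_eq_zero, add_zero, bifP']
  intro j _
  rw [pderiv_X_of_ne Sum.inl_ne_inr, zero_mul]

theorem bifP'_mem_fil : bifP' k ∈ fil (wt k) (2 * k) := by
  rw [← pderiv_bifP]
  exact pderiv_x_mem_fil bifP_mem_fil

theorem res_bifP' : res (bifP' k) = bifP' k := by
  rw [← pderiv_bifP, res_pderiv_x, res_bifP]

theorem isConvergent_bifP' : IsConvergent (bifP' k) := by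
  rw [← pderiv_bifP]; exact isConvergent_bifP.pderiv

/-- The leading term `(k + 1) x^k` of `P'` has weight `2k`, below the weight `2k + 2` of every
multiple of `P`. -/
theorem not_bifP_dvd_bifP' : ¬ bifP k ∣ bifP' k := by
  rintro ⟨q, hq⟩
  have h1 : bifP' k ∈ fil (wt k) (2 * k + 2) := by
    rw [hq]; exact Ideal.mul_mem_right _ _ bifP_mem_fil
  have h2 := h1 (Finsupp.single (Sum.inr 0) k)
    (by rw [Finsupp.weight_single, wt_x, smul_eq_mul]; omega)
  have h3 : bifP' k - (k + 1 : ℂ) • xv k ^ k ∈ fil (wt k) (2 * k + 1) := by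
    have := pderiv_x_mem_fil (bifP_sub_xpow_mem_fil (k := k))
    rw [map_sub, pderiv_bifP, Derivation.leibniz_pow, pderiv_X_self, Nat.add_sub_cancel] at this
    convert fil_anti (show 2 * k + 1 ≤ 2 * k + 3 - 2 by omega) this using 2
    rw [smul_eq_mul, mul_one, nsmul_eq_mul, smul_eq_C_mul, map_add, map_natCast, map_one]
    push_cast
    ring
  have h4 := h3 (Finsupp.single (Sum.inr 0) k)
    (by rw [Finsupp.weight_single, wt_x, smul_eq_mul]; omega)
  rw [map_sub, h2, coeff_smul, coeff_single_xpow, if_pos rfl, zero_sub, mul_one, neg_eq_zero] at h4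
  exact Nat.cast_add_one_ne_zero k h4

/-- `P` is coprime to its derivative. -/
theorem bifP_dvd_of_dvd_mul (hk : 0 < k) {f : Series k} (h : bifP k ∣ bifP' k * f) : bifP k ∣ f :=
  (bifP_dvd_mul hk h).resolve_left not_bifP_dvd_bifP'

end

end SaddleNode

namespace SaddleNode

open Filter Topology MvPowerSeries

noncomputable section

variable {k : ℕ}

/-! ### Division by `P` -/

/-- The polynomial in `x` of degree at most `k` with the given coefficients. -/
def polyX (r : Fin (k + 1) → ParamSeries k) : Series k :=
  ∑ i, liftParam k (r i) * xv k ^ (i : ℕ)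

theorem res_polyX (r : Fin (k + 1) → ParamSeries k) : res (polyX r) = polyX r := by
  simp only [polyX, map_sum, map_mul, map_pow, res_liftParam, res_xv]

theorem xc_polyX (r : Fin (k + 1) → ParamSeries k) (n : ℕ) :
    xc n (polyX r) = if h : n < k + 1 then r ⟨n, h⟩ else 0 := by
  rw [polyX, map_sum]
  simp_rw [xc_liftParam_mul_xpow]
  split_ifs with h
  · rw [Finset.sum_eq_single ⟨n, h⟩]
    · simp
    · intro j _ hj
      rw [if_neg]
      rintro rfl
      exact hj rfl
    · simp
  · refine Finset.sum_eq_zero fun j _ => if_neg ?_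
    have := j.2
    omega

theorem polyX_injective : Function.Injective (polyX (k := k)) := by
  intro r r' h
  funext i
  have h1 := congrArg (xc (i : ℕ)) h
  rw [xc_polyX, xc_polyX, dif_pos i.2, dif_pos i.2] at h1
  exact h1

theorem polyX_sub (r r' : Fin (k + 1) → ParamSeries k) :
    polyX r - polyX r' = polyX (fun i => r i - r' i) := by
  simp_rw [polyX, map_sub, sub_mul, Finset.sum_sub_distrib]

theorem constantCoeff_polyX (r : Fin (k + 1) → ParamSeries k) :
    constantCoeff (polyX r) = constantCoeff (r 0) := by
  rw [polyX, map_sum, Finset.sum_eq_single 0]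
  · simp [constantCoeff_liftParam]
  · intro i _ hi
    have : (i : ℕ) ≠ 0 := fun h => hi (Fin.ext h)
    simp [this]
  · simp

/-- The quotient of the division by `x ^ (k + 1)`. -/
def divX : Series k →ₗ[ℂ] Series k :=
  shiftMul (Finsupp.single (Sum.inr 0) (k + 1)) fun _ => 1

theorem xc_divX (n : ℕ) (f : Series k) : xc n (divX f) = xc (n + (k + 1)) f := by
  have := xc_shiftMul_x n (k + 1) (fun _ => 1) f
  rwa [one_smul] at this

theorem divX_xpow_mul (f : Series k) : divX (xv k ^ (k + 1) * f) = f := by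
  ext d
  rw [divX, coeff_shiftMul, one_mul, coeff_xpow_mul, if_pos (by simp), add_tsub_cancel_right]

theorem divX_mem_fil {s : ℕ} {f : Series k} (hf : f ∈ fil (wt k) s) :
    divX f ∈ fil (wt k) (s - 2 * (k + 1)) := by
  have := shiftMul_mem_fil (s := Finsupp.single (Sum.inr 0) (k + 1)) (c := fun _ => 1) hf
  rwa [Finsupp.weight_single, wt_x, smul_eq_mul, mul_comm] at this

theorem divX_polyX (r : Fin (k + 1) → ParamSeries k) : divX (polyX r) = 0 := by
  refine ext_xc (res_shiftMul_x _ _ (res_polyX r)) (map_zero _) fun n => ?_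
  rw [xc_divX, xc_polyX, dif_neg (by omega), map_zero]

theorem xpow_mul_divX_add {f : Series k} (hf : res f = f) :
    xv k ^ (k + 1) * divX f + polyX (fun i => xc (i : ℕ) f) = f := by
  refine ext_xc ?_ hf fun n => ?_
  · rw [map_add, map_mul, map_pow, res_xv, res_polyX, divX, res_shiftMul_x _ _ hf]
  · rw [map_add, xc_xpow_mul, xc_polyX]
    by_cases h : k + 1 ≤ n
    · rw [if_pos h, dif_neg (by omega), add_zero, xc_divX, Nat.sub_add_cancel h]
    · rw [if_neg h, dif_pos (by omega), zero_add]

/-- If `P q` has degree at most `k` in `x`, then `x^(k+1) q = P q - (P - x^(k+1)) q`. Taking the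
quotient by `x^(k+1)` kills the polynomial and shows that the order of `q` exceeds itself. -/
theorem polyX_eq_zero_of_dvd {r : Fin (k + 1) → ParamSeries k} (h : bifP k ∣ polyX r) :
    polyX r = 0 := by
  obtain ⟨q, hq⟩ := h
  suffices hq0 : q = 0 by rw [hq, hq0, mul_zero]
  refine eq_zero_of_mem_fil_succ (ω := wt k) fun s hs => ?_
  have h1 : xv k ^ (k + 1) * q = polyX r - (bifP k - xv k ^ (k + 1)) * q := by rw [hq]; ring
  have h2 := congrArg divX h1
  rw [divX_xpow_mul, map_sub, divX_polyX, zero_sub] at h2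
  rw [h2]
  exact neg_mem (fil_anti (by omega) (divX_mem_fil (mul_mem_fil bifP_sub_xpow_mem_fil hs)))

theorem polyX_eq_of_dvd_sub {r r' : Fin (k + 1) → ParamSeries k}
    (h : bifP k ∣ polyX r - polyX r') : r = r' := by
  rw [polyX_sub] at h
  have := polyX_eq_zero_of_dvd h
  rw [← polyX_sub, sub_eq_zero] at this
  exact polyX_injective this

/-- Weierstrass division by `P`. -/
theorem exists_division {f : Series k} (hf : res f = f) (hc : IsConvergent f) :
    ∃ (q : Series k) (r : Fin (k + 1) → ParamSeries k), IsConvergent q ∧ (∀ i, IsConvergent (r i)) ∧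
      f = q * bifP k + polyX r := by
  have hW : IsConvergent (bifP k - xv k ^ (k + 1)) := isConvergent_bifP.sub ((isConvergent_X _).pow _)
  obtain ⟨r₀, hr₀, -, c, hc0, hbd⟩ := exists_common_bd (ι := Bool) (ω := wt k) wt_ne_zero
    (f := fun b => cond b f (bifP k - xv k ^ (k + 1))) (by rintro (_ | _) <;> assumption)
  have hbf : Bd (fun i => r₀ ^ wt k i) f c := hbd true
  have hbW : Bd (fun i => r₀ ^ wt k i) (bifP k - xv k ^ (k + 1)) c := hbd false
  set C := c / r₀ ^ (2 * k + 3) with hC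
  have hCpos : 0 < C := by positivity
  -- `C r ≤ 1/2` makes the iteration `q ↦ divX (f - q (P - x^(k+1)))` preserve the ball of radius
  -- `2c / r^(2k+2)`: half the radius comes from `f`, at most half from `q`.
  set r := min r₀ (1 / (2 * C)) with hr
  have hrpos : 0 < r := by positivity
  have hrC : C * r ≤ 1 / 2 := by
    have : r ≤ 1 / (2 * C) := min_le_right _ _
    rw [le_div_iff₀ (by positivity)] at this
    linarith
  have hv : ∀ i, 0 < r ^ wt k i := fun i => pow_pos hrpos _
  have hbf' : Bd (fun i => r ^ wt k i) f c := hbf.anti (fun i => (hv i).le) fun i =>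
    pow_le_pow_left₀ hrpos.le (min_le_left _ _) _
  have hbW' : Bd (fun i => r ^ wt k i) (bifP k - xv k ^ (k + 1)) (C * r ^ (2 * k + 3)) :=
    hbW.of_mem_fil hrpos.le hr₀ (min_le_left _ _) bifP_sub_xpow_mem_fil
  have hmon : mon (fun i => r ^ wt k i) (Finsupp.single (Sum.inr 0) (k + 1)) = r ^ (2 * k + 2) := by
    rw [mon_single, wt_x, ← pow_mul]
    congr 1
  set M := 2 * c / r ^ (2 * k + 2) with hM
  obtain ⟨q, ⟨hq1, hq2⟩, hq⟩ := exists_fixedPoint (ω := wt k)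
    ({g | ∀ d ∈ {d : Fin k ⊕ Fin 2 →₀ ℕ | d (Sum.inr 1) ≠ 0}, coeff d g = 0} ∩
      {g | Bd (fun i => r ^ wt k i) g M})
    (fun q => divX (f - q * (bifP k - xv k ^ (k + 1))))
    ⟨0, fun d _ => by simp, (Bd.zero _).mono (by positivity)⟩
    (by
      rintro q ⟨hq1, hq2⟩
      refine ⟨setZero_eq_self_iff.1 (res_shiftMul_x _ _ ?_), ?_⟩
      · have hq1' : res q = q := setZero_eq_self_iff.2 hq1
        rw [map_sub, map_mul, map_sub, map_pow, res_xv, res_bifP, hf, hq1']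
      · refine ((hbf'.sub (fun i => (hv i).le) (hq2.mul (fun i => (hv i).le) hbW')).shiftMul hv
          (B := 1) fun d => by simp).mono ?_
        rw [hmon, one_mul, div_le_iff₀ (by positivity)]
        have hMr : M * r ^ (2 * k + 2) = 2 * c := div_mul_cancel₀ _ (by positivity)
        have e : M * (C * r ^ (2 * k + 3)) = (M * r ^ (2 * k + 2)) * (C * r) := by ring
        rw [e, hMr]
        nlinarith)
    ((stable_coeff _).inter (stable_Bd _ _))
    (fun q _ q' _ s hs => by
      rw [← map_sub]
      have e : f - q * (bifP k - xv k ^ (k + 1)) - (f - q' * (bifP k - xv k ^ (k + 1))) =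
        -((bifP k - xv k ^ (k + 1)) * (q - q')) := by ring
      rw [e]
      exact fil_anti (by omega) (divX_mem_fil (neg_mem (mul_mem_fil bifP_sub_xpow_mem_fil hs))))
  have hqc : IsConvergent q := hq2.isConvergent hv
  have hq1' : res q = q := setZero_eq_self_iff.2 hq1
  have h1 := xpow_mul_divX_add (k := k) (f := f - q * (bifP k - xv k ^ (k + 1)))
    (by rw [map_sub, map_mul, map_sub, map_pow, res_xv, res_bifP, hf, hq1'])
  rw [hq] at h1
  refine ⟨q, fun i => xc (i : ℕ) (f - q * (bifP k - xv k ^ (k + 1))), hqc,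
    fun i => (hc.sub (hqc.mul hW)).xc _, ?_⟩
  linear_combination -h1

end

end SaddleNode

namespace SaddleNode

open Filter Topology MvPowerSeries

noncomputable section

variable {k : ℕ}

/-! ### The multiplicity -/

/-- In the coordinates `(g 0, g 1)` the first `k + 1` Taylor coefficients along the first axis
vanish on `(g 0 ^ (k+1), g 1)`. They induce a surjection from the local algebra of `V` onto
`ℂ^(k+1)`, which by equality of dimensions is injective; hence the two ideals coincide. -/
theorem dvd_of_multiplicity {g : Fin 2 → MvPowerSeries (Fin 2) ℂ}
    (hg : ∀ i, constantCoeff (g i) = 0) (hdet : (jacobianAtZero g).det ≠ 0)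
    {V : Fin 2 → MvPowerSeries (Fin 2) ℂ}
    (hV : ∀ i, V i ∈ Ideal.span {g 0 ^ (k + 1), g 1})
    (hm : Module.finrank ℂ (MvPowerSeries (Fin 2) ℂ ⧸ Ideal.span (Set.range V)) = k + 1) :
    g 0 ^ (k + 1) ∈ Ideal.span (Set.range V) ∧ g 1 ∈ Ideal.span (Set.range V) := by
  obtain ⟨b, hb0, hb, -⟩ := exists_inverse hg hdet
  have hs := hasSubst_of_zero hb0
  let S := substAlgHom (R := ℂ) hs
  have hS : ∀ i, S (g i) = X i := fun i => (congrFun (coe_substAlgHom hs) _).trans (hb i)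
  let L : MvPowerSeries (Fin 2) ℂ →ₗ[ℂ] (Fin (k + 1) → ℂ) :=
    LinearMap.pi fun i => (coeff (Finsupp.single (0 : Fin 2) (i : ℕ))).comp S.toLinearMap
  have hL : ∀ f i, L f i = coeff (Finsupp.single (0 : Fin 2) (i : ℕ)) (S f) := fun _ _ => rfl
  have hLJ : ∀ f ∈ Ideal.span {g 0 ^ (k + 1), g 1}, L f = 0 := by
    intro f hf
    obtain ⟨r, s, rfl⟩ := Ideal.mem_span_pair.1 hf
    funext i
    rw [hL, map_add, map_mul, map_mul, map_pow, hS, hS, map_add, X_pow_eq,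
      coeff_mul_monomial, if_neg, ← pow_one (X 1 : MvPowerSeries (Fin 2) ℂ), X_pow_eq, coeff_mul_monomial, if_neg,
      add_zero, Pi.zero_apply]
    · rw [Finsupp.single_le_iff]; simp
    · rw [Finsupp.single_le_iff, Finsupp.single_eq_same]; have := i.2; omega
  have hV0 : ∀ f ∈ Ideal.span (Set.range V), L f = 0 := fun f hf => hLJ f (by
    refine Ideal.span_le.2 ?_ hf
    rintro _ ⟨i, rfl⟩
    exact hV i)
  let Q : (MvPowerSeries (Fin 2) ℂ ⧸ Ideal.span (Set.range V)) →ₗ[ℂ] (Fin (k + 1) → ℂ) :=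
    Submodule.liftQ ((Ideal.span (Set.range V)).restrictScalars ℂ) L fun f hf => hV0 f hf
  have hQ : ∀ f, Q (Ideal.Quotient.mk _ f) = L f := fun f => rfl
  have hsurj : Function.Surjective Q := by
    intro v
    refine ⟨Ideal.Quotient.mk _ (∑ i : Fin (k + 1), v i • g 0 ^ (i : ℕ)), ?_⟩
    rw [hQ]
    funext j
    rw [hL, map_sum, map_sum, Finset.sum_eq_single j]
    · rw [map_smul, map_pow, hS, coeff_smul, X_pow_eq, coeff_monomial_same, mul_one]
    · intro i _ hij
      rw [map_smul, map_pow, hS, coeff_smul, X_pow_eq, coeff_monomial_ne, mul_zero]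
      intro h
      exact hij (Fin.ext (Finsupp.single_injective _ h).symm)
    · simp
  -- A positive `finrank` excludes infinite dimension, for which its value would be `0`.
  have : FiniteDimensional ℂ (MvPowerSeries (Fin 2) ℂ ⧸ Ideal.span (Set.range V)) :=
    Module.finite_of_finrank_pos (by omega)
  have hinj : Function.Injective Q := by
    refine (LinearMap.injective_iff_surjective_of_finrank_eq_finrank ?_).2 hsurj
    rw [hm, Module.finrank_fin_fun]
  have key : ∀ f ∈ Ideal.span {g 0 ^ (k + 1), g 1}, f ∈ Ideal.span (Set.range V) := by
    intro f hf
    rw [← Ideal.Quotient.eq_zero_iff_mem]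
    refine hinj ?_
    rw [hQ, map_zero, hLJ f hf]
  exact ⟨key _ (Ideal.subset_span (by simp)), key _ (Ideal.subset_span (by simp))⟩

theorem coeff_single_pow_eq_zero {σ : Type} {f : MvPowerSeries σ ℂ} (hf : constantCoeff f = 0)
    {n : ℕ} (hn : 2 ≤ n) (i : σ) : coeff (Finsupp.single i 1) (f ^ n) = 0 := by
  have := pow_mem_fil ((mem_fil_one (ω := fun _ : σ => 1) fun _ => one_ne_zero).2 hf) n
  exact this _ (by rw [Finsupp.weight_single, smul_eq_mul]; omega)

theorem coeff_single_mul_of_zero {σ : Type} {f g : MvPowerSeries σ ℂ} (hg : constantCoeff g = 0)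
    (i : σ) : coeff (Finsupp.single i 1) (f * g) =
      constantCoeff f * coeff (Finsupp.single i 1) g := by
  rw [coeff_single_eq, Derivation.leibniz, map_add, smul_eq_mul, smul_eq_mul, map_mul, map_mul, hg,
    zero_mul, add_zero, ← coeff_single_eq]

/-- The restrictions on the matrix expressing a saddle-node in terms of its ideal. -/
theorem saddleNode_matrix (hk : 0 < k) {g V : Fin 2 → MvPowerSeries (Fin 2) ℂ}
    {N : Fin 2 → Fin 2 → MvPowerSeries (Fin 2) ℂ}
    (hg : ∀ i, constantCoeff (g i) = 0) (hdet : (jacobianAtZero g).det ≠ 0)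
    (hVN : ∀ i, V i = N i 0 * g 0 ^ (k + 1) + N i 1 * g 1) (hV : IsSaddleNode k V) :
    constantCoeff (N 0 0) * constantCoeff (N 1 1) - constantCoeff (N 0 1) * constantCoeff (N 1 0) ≠ 0 ∧
      coeff (Finsupp.single 0 1) (g 1) * constantCoeff (N 0 1) +
        coeff (Finsupp.single 1 1) (g 1) * constantCoeff (N 1 1) ≠ 0 := by
  have hrange : Set.range V = {V 0, V 1} := by
    ext f
    simp only [Set.mem_range, Fin.exists_fin_two, Set.mem_insert_iff, Set.mem_singleton_iff]
    exact or_congr eq_comm eq_comm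
  have hpow0 : constantCoeff (g 0 ^ (k + 1)) = 0 := by rw [map_pow, hg, zero_pow (by omega)]
  have hlin : ∀ i j, coeff (Finsupp.single j 1) (V i) =
      constantCoeff (N i 1) * coeff (Finsupp.single j 1) (g 1) := by
    intro i j
    rw [hVN, map_add, coeff_single_mul_of_zero hpow0, coeff_single_mul_of_zero (hg 1),
      coeff_single_pow_eq_zero (hg 0) (by omega), mul_zero, zero_add]
  refine ⟨fun hzero => ?_, ?_⟩
  -- Both generators are combinations of `V 0` and `V 1`. At the origin this yields `(a, b) N = (1,
  -- 0)` and a combination of the second column of `N` equal to `1`. If `N` were singular, the first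
  -- relation would make that column zero.
  · obtain ⟨h0, h1⟩ := dvd_of_multiplicity (k := k) hg hdet (fun i => by
      rw [hVN]; exact Ideal.mem_span_pair.2 ⟨_, _, rfl⟩) hV.multiplicity
    rw [hrange, Ideal.mem_span_pair] at h0 h1
    obtain ⟨a, b, hab⟩ := h0
    obtain ⟨c, d, hcd⟩ := h1
    obtain ⟨l, hl⟩ : ∃ l, coeff (Finsupp.single l 1) (g 1) ≠ 0 := by
      by_contra! h
      refine hdet ?_
      rw [Matrix.det_fin_two]
      simp [jacobianAtZero, h]
    have hV0 : ∀ i, constantCoeff (V i) = 0 := hV.singular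
    have e1 : constantCoeff c * constantCoeff (N 0 1) + constantCoeff d * constantCoeff (N 1 1) = 1 := by
      have := congrArg (coeff (Finsupp.single l 1)) hcd
      rw [map_add, coeff_single_mul_of_zero (hV0 0), coeff_single_mul_of_zero (hV0 1), hlin, hlin] at this
      refine mul_right_cancel₀ hl ?_
      linear_combination this
    have e2 : constantCoeff a * constantCoeff (N 0 1) + constantCoeff b * constantCoeff (N 1 1) = 0 := by
      have := congrArg (coeff (Finsupp.single l 1)) hab
      rw [map_add, coeff_single_mul_of_zero (hV0 0), coeff_single_mul_of_zero (hV0 1), hlin, hlin,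
        coeff_single_pow_eq_zero (hg 0) (by omega)] at this
      refine mul_right_cancel₀ hl ?_
      rw [zero_mul, ← this]
      ring
    have hrel : (1 - (a * N 0 0 + b * N 1 0)) * g 0 ^ (k + 1) = (a * N 0 1 + b * N 1 1) * g 1 := by
      rw [hVN, hVN] at hab
      linear_combination -hab
    obtain ⟨B, hB0, hB, -⟩ := exists_inverse hg hdet
    have hs := hasSubst_of_zero hB0
    have h3 := congrArg (substAlgHom (R := ℂ) hs) hrel
    have hS : ∀ i, substAlgHom (R := ℂ) hs (g i) = X i := fun i =>
      (congrFun (coe_substAlgHom hs) _).trans (hB i)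
    rw [map_mul, map_mul, map_pow, hS, hS] at h3
    have h4 := congrArg (coeff (Finsupp.single (0 : Fin 2) (k + 1))) h3
    rw [X_pow_eq, coeff_mul_monomial, if_pos le_rfl, tsub_self, mul_one,
      ← pow_one (X 1 : MvPowerSeries (Fin 2) ℂ), X_pow_eq, coeff_mul_monomial, if_neg (by
        rw [Finsupp.single_le_iff]; simp), coe_substAlgHom, coeff_zero_eq_constantCoeff_apply,
      constantCoeff_subst_of_zero hB0] at h4
    simp only [map_sub, map_add, map_mul, map_one] at h4
    rcases eq_or_ne (constantCoeff (N 0 1)) 0 with hn | hn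
    · rw [hn] at e1 e2 hzero
      have hne : constantCoeff (N 1 1) ≠ 0 := fun h => by rw [h] at e1; simp at e1
      have h5 : constantCoeff (N 0 0) = 0 := by
        rcases (by simpa using hzero : constantCoeff (N 0 0) = 0 ∨ _) with h | h
        · exact h
        · exact absurd h hne
      have h6 : constantCoeff b = 0 := by
        rcases (by simpa using e2 : constantCoeff b = 0 ∨ _) with h | h
        · exact h
        · exact absurd h hne
      rw [h5, h6] at h4
      simp at h4
    · have : (1 - (constantCoeff a * constantCoeff (N 0 0) + constantCoeff b * constantCoeff (N 1 0))) *
          constantCoeff (N 0 1) = constantCoeff (N 0 1) := by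
        linear_combination (-constantCoeff (N 0 0)) * e2 + constantCoeff b * hzero
      rw [h4, zero_mul] at this
      exact hn this.symm
  -- The expression is the trace of the linear part, which equals the non-zero eigenvalue.
  · obtain ⟨l, hl, hchar⟩ := hV.eigenvalues
    have htr : (jacobianAtZero V).trace = l := by
      rw [Matrix.trace_eq_neg_charpoly_coeff, hchar]
      simp [mul_sub]
    rw [Matrix.trace_fin_two] at htr
    intro h
    refine hl ?_
    rw [← htr]
    simp only [jacobianAtZero, Matrix.of_apply]
    rw [hlin, hlin, ← h]
    ring

end

end SaddleNode

namespace SaddleNode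

open Filter Topology MvPowerSeries

noncomputable section

variable {k : ℕ}

/-! ### Analytic straightening of the singular points -/

theorem eventually_evalAt_pull {Ψ : FormalChange k} (h : Ψ.IsAnalytic) {f : Series k}
    (hf : IsConvergent f) : ∀ᶠ z in 𝓝 (0 : Fin k ⊕ Fin 2 → ℂ),
      evalAt (Ψ.pull f) z = evalAt f fun i => evalAt (Ψ.total i) z := by
  refine eventually_evalAt_subst Ψ.total_zero (fun i => ?_) hf
  rcases i with j | i
  · exact (h.1 j).liftParam
  · exact h.2 i

theorem eventually_evalAt_liftParam {p : ParamSeries k} (hp : IsConvergent p) :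
    ∀ᶠ z in 𝓝 (0 : Fin k ⊕ Fin 2 → ℂ),
      evalAt (liftParam k p) z = evalAt p fun j => z (Sum.inl j) := by
  refine (eventually_evalAt_subst X_inl_zero (fun j => isConvergent_X _) hp).mono fun z hz => ?_
  rw [liftParam_eq_subst, hz]
  simp_rw [evalAt_X]

/-- The members of a generic unfolding vanish where `P = y = 0` in suitable coordinates. -/
theorem IsGenericUnfolding.exists_eq_mul_bifP_add (hk : 0 < k) {Z : Family k}
    (hZ : ∀ i, IsConvergent (Z i)) {Φ Θ : FormalChange k} (hΦ : Φ.IsAnalytic) (hΘ : Θ.IsAnalytic)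
    (hinv : ∀ f, Θ.pull (Φ.pull f) = f)
    (h : ∀ᶠ p in 𝓝 (0 : Fin k ⊕ Fin 2 → ℂ),
      (∀ i, evalAt (Z i) p = 0) ↔
        bifPoly (fun j => evalAt (Φ.par j) fun l => p (Sum.inl l)) (evalAt (Φ.map 0) p) = 0 ∧
          evalAt (Φ.map 1) p = 0) (i : Fin 2) :
    ∃ a b, IsConvergent a ∧ IsConvergent b ∧ Θ.pull (Z i) = a * bifP k + b * yv k := by
  refine SaddleNode.exists_eq_mul_bifP_add hk (hΘ.pull (hZ i)) ?_
  have hΘt : ∀ i, IsConvergent (Θ.total i) := by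
    rintro (j | i)
    · exact (hΘ.1 j).liftParam
    · exact hΘ.2 i
  have hΦt : ∀ i, IsConvergent (Φ.total i) := by
    rintro (j | i)
    · exact (hΦ.1 j).liftParam
    · exact hΦ.2 i
  have htend := tendsto_evalAt_zero Θ.total_zero hΘt
  have hback : ∀ᶠ z in 𝓝 (0 : Fin k ⊕ Fin 2 → ℂ), ∀ l,
      evalAt (Φ.total l) (fun i => evalAt (Θ.total i) z) = z l := by
    rw [eventually_all]
    intro l
    refine (eventually_evalAt_pull hΘ (hΦt l)).mono fun z hz => ?_
    rw [← hz]
    have : Φ.total l = Φ.pull (X l) := (subst_X Φ.hasSubst_total _).symm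
    rw [this, hinv, evalAt_X]
  have hpar : ∀ᶠ z in 𝓝 (0 : Fin k ⊕ Fin 2 → ℂ), ∀ j,
      evalAt (liftParam k (Φ.par j)) z = evalAt (Φ.par j) fun l => z (Sum.inl l) := by
    rw [eventually_all]
    exact fun j => eventually_evalAt_liftParam (hΦ.1 j)
  filter_upwards [eventually_evalAt_pull hΘ (hZ i), htend.eventually h, htend.eventually hpar, hback]
    with z h1 h2 h3 h4 hz1 hz2
  rw [h1]
  refine h2.2 ⟨?_, ?_⟩ i
  · simp_rw [← h3]
    have h5 : ∀ j, evalAt (liftParam k (Φ.par j)) (fun i => evalAt (Θ.total i) z) = z (Sum.inl j) :=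
      fun j => h4 (Sum.inl j)
    have h6 : evalAt (Φ.map 0) (fun i => evalAt (Θ.total i) z) = z (Sum.inr 0) := h4 (Sum.inr 0)
    simp_rw [h5, h6]
    exact hz1
  · exact (h4 (Sum.inr 1)).trans hz2

theorem pull_bifP (Ψ : FormalChange k) :
    Ψ.pull (bifP k) = bifPoly (fun j => liftParam k (Ψ.par j)) (Ψ.map 0) := by
  have h := map_bifPoly Ψ.pullHom.toRingHom (fun j => X (Sum.inl j)) (xv k)
  simp only [AlgHom.toRingHom_eq_coe, RingHom.coe_coe, ← Ψ.pull_eq, Ψ.pull_inl, Ψ.pull_inr] at h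
  exact h

/-- At `ε = 0` all the coefficients of `P_φ` vanish, and only the leading power remains. -/
theorem atParamZero_bifPoly {p : Fin k → ParamSeries k} (hp : ∀ j, constantCoeff (p j) = 0)
    (f : Series k) : killCompl (Function.Embedding.inr : Fin 2 ↪ Fin k ⊕ Fin 2)
      (bifPoly (fun j => liftParam k (p j)) f) =
        killCompl (Function.Embedding.inr : Fin 2 ↪ Fin k ⊕ Fin 2) f ^ (k + 1) := by
  have h := map_bifPoly (killCompl (R := ℂ) (Function.Embedding.inr : Fin 2 ↪ Fin k ⊕ Fin 2)).toRingHom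
    (fun j => liftParam k (p j)) f
  refine h.trans ?_
  have h0 : ∀ j, killCompl (R := ℂ) (Function.Embedding.inr : Fin 2 ↪ Fin k ⊕ Fin 2)
      (liftParam k (p j)) = 0 := by
    intro j
    ext d
    rw [coeff_killCompl, map_zero]
    by_cases hd : ∃ i, d i ≠ 0
    · obtain ⟨i, hi⟩ := hd
      refine coeff_liftParam_eq_zero _ (i := i) ?_
      have := Finsupp.embDomain_apply_self (Function.Embedding.inr : Fin 2 ↪ Fin k ⊕ Fin 2) d i
      exact fun h => hi (this.symm.trans h)
    · push Not at hd
      rw [show d = 0 from Finsupp.ext hd, Finsupp.embDomain_zero,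
        coeff_zero_eq_constantCoeff_apply, constantCoeff_liftParam, hp]
  rw [bifPoly, Finset.sum_eq_zero, add_zero]
  · rfl
  · intro j _
    change killCompl (R := ℂ) (Function.Embedding.inr : Fin 2 ↪ Fin k ⊕ Fin 2)
      (liftParam k (p j)) * _ = 0
    rw [h0, zero_mul]

theorem constantCoeff_killCompl (f : Series k) : constantCoeff
    (killCompl (R := ℂ) (Function.Embedding.inr : Fin 2 ↪ Fin k ⊕ Fin 2) f) = constantCoeff f := by
  rw [← coeff_zero_eq_constantCoeff_apply, coeff_killCompl, Finsupp.embDomain_zero,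
    coeff_zero_eq_constantCoeff_apply]

theorem coeff_single_killCompl (f : Series k) (i : Fin 2) : coeff (Finsupp.single i 1)
    (killCompl (R := ℂ) (Function.Embedding.inr : Fin 2 ↪ Fin k ⊕ Fin 2) f) =
      constantCoeff (pderiv ℂ (Sum.inr i) f) := by
  rw [coeff_killCompl, Finsupp.embDomain_single, ← coeff_single_eq]
  rfl

/-- In suitable analytic coordinates, a generic unfolding is `M (P, y)` with `M` analytic. -/
theorem IsGenericUnfolding.exists_matrix (hk : 0 < k) {Z : Family k} (hZ : IsGenericUnfolding Z) :
    ∃ (Φ : FormalChange k) (Z' : Family k) (M : Fin 2 → Fin 2 → Series k), Φ.IsAnalytic ∧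
      Conjugates Φ Z Z' ∧ (∀ i j, IsConvergent (M i j)) ∧
      (∀ i, Z' i = M i 0 * bifP k + M i 1 * yv k) ∧
      constantCoeff (M 0 0 * M 1 1 - M 0 1 * M 1 0) ≠ 0 ∧ constantCoeff (M 1 1) ≠ 0 := by
  obtain ⟨Φ, hΦ, hgen⟩ := hZ.generic
  obtain ⟨Θ, hinv', hinv, -, -, -, hΘ⟩ := Φ.exists_inv
  have hΘ := hΘ hΦ
  choose a b ha hb hab using
    IsGenericUnfolding.exists_eq_mul_bifP_add hk hZ.convergent hΦ hΘ hinv hgen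
  let κ := killCompl (R := ℂ) (Function.Embedding.inr : Fin 2 ↪ Fin k ⊕ Fin 2)
  have hZeq : ∀ i, Z i = Φ.pull (a i) * bifPoly (fun j => liftParam k (Φ.par j)) (Φ.map 0) +
      Φ.pull (b i) * Φ.map 1 := by
    intro i
    rw [← hinv' (Z i), hab, Φ.pull_eq, map_add, map_mul, map_mul, ← Φ.pull_eq, ← Φ.pull_eq,
      ← Φ.pull_eq, ← Φ.pull_eq, pull_bifP, Φ.pull_inr]
  obtain ⟨hdetN, htr⟩ := saddleNode_matrix hk (g := atParamZero Φ.map) (V := atParamZero Z)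
    (N := fun i j => κ (Φ.pull (if j = 0 then a i else b i)))
    (fun i => (constantCoeff_killCompl _).trans (Φ.map_zero i)) Φ.map_invertible (fun i => by
      have := congrArg κ (hZeq i)
      rw [map_add, map_mul, map_mul, atParamZero_bifPoly Φ.par_zero] at this
      exact this) hZ.saddleNode
  have hc : ∀ f, constantCoeff (κ (Φ.pull f)) = constantCoeff f := fun f => by
    rw [constantCoeff_killCompl, Φ.constantCoeff_pull]
  simp only [hc, if_true, one_ne_zero, if_false] at hdetN htr
  have hD : ∀ i l, coeff (Finsupp.single l 1) (atParamZero Φ.map i) =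
      constantCoeff (pderiv ℂ (Sum.inr l) (Φ.map i)) := fun i l => coeff_single_killCompl _ _
  rw [hD, hD] at htr
  have hdetD := Φ.map_invertible
  rw [Matrix.det_fin_two] at hdetD
  simp only [jacobianAtZero, Matrix.of_apply, hD] at hdetD
  -- `A` is the Jacobian matrix of `Φ` in the new coordinates and `M = A (a | b)`. Thus `det M` is
  -- at the origin the product of two non-zero determinants, and `M 1 1` is the trace found in
  -- `saddleNode_matrix`.
  let A : Fin 2 → Fin 2 → Series k := fun i l => Θ.pull (pderiv ℂ (Sum.inr l) (Φ.map i))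
  have hAc : ∀ i l, constantCoeff (A i l) = constantCoeff (pderiv ℂ (Sum.inr l) (Φ.map i)) :=
    fun i l => Θ.constantCoeff_pull _
  have hAconv : ∀ i l, IsConvergent (A i l) := fun i l => hΘ.pull (hΦ.2 i).pderiv
  have hM0 : ∀ i, IsConvergent (A i 0 * a 0 + A i 1 * a 1) := fun i =>
    ((hAconv i 0).mul (ha 0)).add ((hAconv i 1).mul (ha 1))
  have hM1 : ∀ i, IsConvergent (A i 0 * b 0 + A i 1 * b 1) := fun i =>
    ((hAconv i 0).mul (hb 0)).add ((hAconv i 1).mul (hb 1))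
  refine ⟨Φ, fun i => Θ.pull (lieDeriv Z (Φ.map i)),
    fun i => ![A i 0 * a 0 + A i 1 * a 1, A i 0 * b 0 + A i 1 * b 1], hΦ,
    fun i => (hinv' _).symm, fun i j => ?_, fun i => ?_, ?_, ?_⟩
  · fin_cases j
    · exact hM0 i
    · exact hM1 i
  · simp only
    rw [lieDeriv_eq_two, Θ.pull_eq, map_add, map_mul, map_mul, ← Θ.pull_eq, ← Θ.pull_eq,
      ← Θ.pull_eq, ← Θ.pull_eq, hab, hab]
    change _ = (A i 0 * a 0 + A i 1 * a 1) * bifP k + (A i 0 * b 0 + A i 1 * b 1) * yv k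
    ring
  · change constantCoeff ((A 0 0 * a 0 + A 0 1 * a 1) * (A 1 0 * b 0 + A 1 1 * b 1) -
      (A 0 0 * b 0 + A 0 1 * b 1) * (A 1 0 * a 0 + A 1 1 * a 1)) ≠ 0
    simp only [map_sub, map_add, map_mul, hAc]
    have := mul_ne_zero hdetD hdetN
    intro h
    refine this ?_
    rw [← h]
    ring
  · change constantCoeff (A 1 0 * b 0 + A 1 1 * b 1) ≠ 0
    simp only [map_add, map_mul, hAc]
    exact htr

end

end SaddleNode

namespace SaddleNode

open Filter Topology MvPowerSeries

noncomputable section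

variable {k : ℕ}

/-! ### Conjugation of vector fields that agree modulo `P ^ 2` -/

/-- The coefficient of `h` in the expansion of `p (x + h)`, minus its value at `h = 0`, is `h` times
this function. -/
def quot₁ {R : Type} [CommRing R] (p : Polynomial R) (x h : R) : R :=
  (Polynomial.taylor x p).divX.eval h

/-- The second order remainder of the expansion of `p (x + h)`, divided by `h ^ 2`. -/
def quot₂ {R : Type} [CommRing R] (p : Polynomial R) (x h : R) : R :=
  (Polynomial.taylor x p).divX.divX.eval h

theorem eval_add_eq_quot₁ {R : Type} [CommRing R] (p : Polynomial R) (x h : R) :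
    p.eval (x + h) = p.eval x + h * quot₁ p x h := by
  have h1 := congrArg (Polynomial.eval h) (Polynomial.divX_mul_X_add (Polynomial.taylor x p))
  rw [Polynomial.taylor_coeff_zero, Polynomial.taylor_eval, Polynomial.eval_add,
    Polynomial.eval_mul, Polynomial.eval_X, Polynomial.eval_C, add_comm h] at h1
  rw [quot₁, ← h1]
  ring

theorem eval_add_eq_quot₂ {R : Type} [CommRing R] (p : Polynomial R) (x h : R) :
    p.eval (x + h) = p.eval x + h * p.derivative.eval x + h ^ 2 * quot₂ p x h := by
  have h1 := congrArg (Polynomial.eval h) (Polynomial.divX_mul_X_add (Polynomial.taylor x p).divX)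
  rw [Polynomial.coeff_divX, zero_add, Polynomial.taylor_coeff_one, Polynomial.eval_add,
    Polynomial.eval_mul, Polynomial.eval_X, Polynomial.eval_C] at h1
  rw [eval_add_eq_quot₁, quot₁, ← h1, quot₂]
  ring

theorem eval_sub_eval_mem_fil (p : Polynomial (Series k)) {h h' : Series k} {s : ℕ}
    (hs : h - h' ∈ fil (wt k) s) : p.eval h - p.eval h' ∈ fil (wt k) s := by
  obtain ⟨m, hm⟩ := Polynomial.sub_dvd_eval_sub h h' p
  rw [hm]
  exact Ideal.mul_mem_right _ _ hs

/-- `P` as a polynomial in one variable. -/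
def bifPolynomial (k : ℕ) : Polynomial (Series k) :=
  bifPoly (fun j => Polynomial.C (X (Sum.inl j))) Polynomial.X

theorem eval_bifPolynomial (x : Series k) :
    (bifPolynomial k).eval x = bifPoly (fun j => X (Sum.inl j)) x := by
  have := map_bifPoly (Polynomial.evalRingHom x)
    (fun j : Fin k => Polynomial.C (X (Sum.inl j) : Series k)) Polynomial.X
  simp only [Polynomial.coe_evalRingHom, Polynomial.eval_C, Polynomial.eval_X] at this
  exact this

theorem eval_derivative_bifPolynomial (x : Series k) :
    (bifPolynomial k).derivative.eval x = bifDer (fun j => X (Sum.inl j)) x := by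
  rw [bifPolynomial, bifPoly, bifDer]
  simp only [Polynomial.derivative_add, Polynomial.derivative_sum, Polynomial.derivative_mul,
    Polynomial.derivative_C, Polynomial.derivative_X_pow, Polynomial.eval_add, Polynomial.eval_mul,
    Polynomial.eval_C, Polynomial.eval_pow, Polynomial.eval_X, Polynomial.eval_finsetSum, zero_mul,
    zero_add, Nat.add_sub_cancel]
  congr 1
  · push_cast; ring
  · refine Finset.sum_congr rfl fun j _ => ?_
    ring

/-- The right-hand side of the differential equation satisfied by `q` when `x + P q` conjugates
`P g ∂/∂x` and `P (b / c) ∂/∂x`. -/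
def odeRhs (b c : Polynomial (Series k)) (g g₁ q : Series k) : Series k :=
  (b.eval (xv k))⁻¹ * (b.derivative.eval (xv k) * q +
    q ^ 2 * quot₂ (b * bifPolynomial k) (xv k) (bifP k * q) -
    (1 + bifP' k * q + bifP k * pderiv ℂ (Sum.inr 0) q) *
      (g₁ + g * q * quot₁ c (xv k) (bifP k * q)))

/-- When the two fields agree modulo `P²`, that is `g c ≡ b` modulo `P`, the conjugacy equation for
`x + P q` is divisible by `P²`. The quotient is a regular first-order equation for `q`, although the
fields vanish on `P = 0`. -/
theorem ode_identity {b c : Polynomial (Series k)} {g g₁ : Series k}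
    (hb : constantCoeff (b.eval (xv k)) ≠ 0)
    (hg : g * c.eval (xv k) = b.eval (xv k) + bifP k * g₁) (q : Series k) :
    bifP k * g * c.eval (xv k + bifP k * q) * pderiv ℂ (Sum.inr 0) (xv k + bifP k * q) -
      b.eval (xv k + bifP k * q) * bifPoly (fun j => X (Sum.inl j)) (xv k + bifP k * q) =
    bifP k ^ 2 * (b.eval (xv k) * (pderiv ℂ (Sum.inr 0) q - odeRhs b c g g₁ q)) := by
  have h1 := eval_add_eq_quot₂ (b * bifPolynomial k) (xv k) (bifP k * q)
  have h2 := eval_add_eq_quot₁ c (xv k) (bifP k * q)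
  have h3 : (bifPolynomial k).eval (xv k) = bifP k := eval_bifPolynomial _
  have h4 : (bifPolynomial k).derivative.eval (xv k) = bifP' k := eval_derivative_bifPolynomial _
  have h5 := MvPowerSeries.mul_inv_cancel _ hb
  rw [Polynomial.derivative_mul, Polynomial.eval_mul, Polynomial.eval_mul, Polynomial.eval_add,
    Polynomial.eval_mul, Polynomial.eval_mul, h3, h4, eval_bifPolynomial] at h1
  rw [h1, h2, map_add, pderiv_X_self, Derivation.leibniz, pderiv_bifP, smul_eq_mul, smul_eq_mul,
    odeRhs]
  linear_combination bifP k * (1 + bifP' k * q + bifP k * pderiv ℂ (Sum.inr 0) q) * hg +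
    bifP k ^ 2 * (b.derivative.eval (xv k) * q +
    q ^ 2 * quot₂ (b * bifPolynomial k) (xv k) (bifP k * q) -
    (1 + bifP' k * q + bifP k * pderiv ℂ (Sum.inr 0) q) *
      (g₁ + g * q * quot₁ c (xv k) (bifP k * q))) * h5

theorem odeRhs_sub_mem_fil (b c : Polynomial (Series k)) (g g₁ : Series k) {q q' : Series k} {s : ℕ}
    (hs : q - q' ∈ fil (wt k) s) :
    odeRhs b c g g₁ q - odeRhs b c g g₁ q' ∈ fil (wt k) s := by
  have hP : bifP k * q - bifP k * q' ∈ fil (wt k) s := by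
    rw [← mul_sub]; exact Ideal.mul_mem_left _ _ hs
  have hd : bifP k * pderiv ℂ (Sum.inr 0) q - bifP k * pderiv ℂ (Sum.inr 0) q' ∈ fil (wt k) s := by
    rw [← mul_sub, ← map_sub]
    exact mul_mem_fil_of_le bifP_mem_fil (pderiv_x_mem_fil hs) (by omega)
  have h2 : quot₂ (b * bifPolynomial k) (xv k) (bifP k * q) -
      quot₂ (b * bifPolynomial k) (xv k) (bifP k * q') ∈ fil (wt k) s := eval_sub_eval_mem_fil _ hP
  have h1 : quot₁ c (xv k) (bifP k * q) - quot₁ c (xv k) (bifP k * q') ∈ fil (wt k) s :=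
    eval_sub_eval_mem_fil _ hP
  rw [← Ideal.Quotient.eq] at *
  simp only [odeRhs, map_mul, map_add, map_sub, map_pow, map_one] at *
  rw [hs, h1, h2, hd]

/-- Integration gains weight `2`, and the correction of the constant of integration gains `1`
because `P - x^(k+1)` has higher weight than `x^(k+1)`. -/
theorem odeStep_sub_mem_fil (b c : Polynomial (Series k)) (g g₁ : Series k) (κ : ParamSeries k)
    {q q' : Series k} {s : ℕ} (hs : q - q' ∈ fil (wt k) s) :
    (intg (res (odeRhs b c g g₁ q)) +
      liftParam k (κ - xc (k + 1) ((bifP k - xv k ^ (k + 1)) * q))) -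
    (intg (res (odeRhs b c g g₁ q')) +
      liftParam k (κ - xc (k + 1) ((bifP k - xv k ^ (k + 1)) * q'))) ∈ fil (wt k) (s + 1) := by
  rw [add_sub_add_comm, ← intg_sub, ← map_sub, ← map_sub, sub_sub_sub_cancel_left, ← map_sub,
    ← mul_sub]
  refine add_mem (fil_anti (by omega) (intg_mem_fil (setZero_mem_fil (odeRhs_sub_mem_fil b c g g₁ hs))))
    (fil_anti (by omega) (xc_mem_fil (mul_mem_fil bifP_sub_xpow_mem_fil
      (show q' - q ∈ fil (wt k) s by rw [← neg_sub]; exact neg_mem hs))))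

theorem xc_bifP_mul (q : Series k) :
    xc (k + 1) (bifP k * q) = xc 0 q + xc (k + 1) ((bifP k - xv k ^ (k + 1)) * q) := by
  have h := xc_xpow_mul (k + 1) (k + 1) q
  rw [if_pos le_rfl, Nat.sub_self] at h
  rw [← h, ← map_add]
  congr 1
  ring

section Ode

variable {b c : Polynomial (Series k)} {g g₁ : Series k}

/-- The initial condition is put on the coefficient of `x^(k+1)` in `P q`, not on `q` at `x = 0`:
this is the resonant coefficient left free in `kostov_unique`. Since that coefficient is `q` at `x =
0` plus a contribution of higher weight, it can serve as the constant of integration. -/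
theorem exists_conj_mod_sq (hbr : ∀ f, res (b.eval f) = b.eval (res f))
    (hcr : ∀ f, res (c.eval f) = c.eval (res f)) (hgr : res g = g)
    (hb : constantCoeff (b.eval (xv k)) ≠ 0)
    (hg : g * c.eval (xv k) = b.eval (xv k) + bifP k * g₁) (κ : ParamSeries k) :
    ∃ q : Series k, res q = q ∧ xc (k + 1) (bifP k * q) = κ ∧
      bifP k * g * c.eval (xv k + bifP k * q) * pderiv ℂ (Sum.inr 0) (xv k + bifP k * q) =
        b.eval (xv k + bifP k * q) * bifPoly (fun j => X (Sum.inl j)) (xv k + bifP k * q) := by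
  obtain ⟨q, hq, hfix⟩ := exists_fixedPoint (ω := wt k)
    {q : Series k | ∀ d ∈ {d : Fin k ⊕ Fin 2 →₀ ℕ | d (Sum.inr 1) ≠ 0}, coeff d q = 0}
    (fun q => intg (res (odeRhs b c g g₁ q)) +
      liftParam k (κ - xc (k + 1) ((bifP k - xv k ^ (k + 1)) * q)))
    ⟨0, fun d _ => by simp⟩ (fun q _ => setZero_eq_self_iff.1 (by
      rw [map_add, res_intg (setZero_setZero _ _), res_liftParam]))
    (stable_coeff _) (fun q _ q' _ s hs => odeStep_sub_mem_fil b c g g₁ κ hs)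
  have hq : res q = q := setZero_eq_self_iff.2 hq
  have hd : pderiv ℂ (Sum.inr 0) q = res (odeRhs b c g g₁ q) := by
    have := congrArg (pderiv ℂ (Sum.inr 0)) hfix
    rw [map_add, pderiv_intg, pderiv_liftParam, add_zero] at this
    exact this.symm
  refine ⟨q, hq, ?_, ?_⟩
  · have := congrArg (xc 0) hfix
    rw [map_add, xc_zero_intg, zero_add, xc_liftParam, if_pos rfl] at this
    rw [xc_bifP_mul, ← this, sub_add_cancel]
  · have h := congrArg res (ode_identity hb hg q)
    have hX : res (xv k + bifP k * q) = xv k + bifP k * q := by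
      rw [map_add, map_mul, res_xv, res_bifP, hq]
    have hbX : res (bifPoly (fun j => X (Sum.inl j)) (xv k + bifP k * q) : Series k) =
        bifPoly (fun j => X (Sum.inl j)) (xv k + bifP k * q) := by
      have := map_bifPoly (res (k := k)).toRingHom (fun j => X (Sum.inl j)) (xv k + bifP k * q)
      refine this.trans ?_
      congr 1
      · funext j; exact res_X_inl j
    rw [map_mul (res (k := k)) (bifP k ^ 2), map_mul (res (k := k)) (b.eval (xv k)), map_sub res (pderiv ℂ (Sum.inr 0) q),
      ← hd, pderiv_x_of_res hq, sub_self, mul_zero, mul_zero, map_sub, map_mul, map_mul, map_mul,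
      map_mul, res_bifP, hgr, hcr, hbr, hX, hbX, pderiv_x_of_res hX, sub_eq_zero] at h
    exact h

theorem conj_mod_sq_unique (hb : constantCoeff (b.eval (xv k)) ≠ 0)
    (hg : g * c.eval (xv k) = b.eval (xv k) + bifP k * g₁) {q q' : Series k}
    (hq : res q = q) (hq' : res q' = q')
    (hκ : xc (k + 1) (bifP k * q) = xc (k + 1) (bifP k * q'))
    (h : bifP k * g * c.eval (xv k + bifP k * q) * pderiv ℂ (Sum.inr 0) (xv k + bifP k * q) =
        b.eval (xv k + bifP k * q) * bifPoly (fun j => X (Sum.inl j)) (xv k + bifP k * q))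
    (h' : bifP k * g * c.eval (xv k + bifP k * q') * pderiv ℂ (Sum.inr 0) (xv k + bifP k * q') =
        b.eval (xv k + bifP k * q') * bifPoly (fun j => X (Sum.inl j)) (xv k + bifP k * q')) :
    q = q' := by
  have key : ∀ p : Series k, res p = p →
      bifP k * g * c.eval (xv k + bifP k * p) * pderiv ℂ (Sum.inr 0) (xv k + bifP k * p) =
        b.eval (xv k + bifP k * p) * bifPoly (fun j => X (Sum.inl j)) (xv k + bifP k * p) →
      xc (k + 1) (bifP k * p) = xc (k + 1) (bifP k * q) →
      p = intg (res (odeRhs b c g g₁ p)) +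
        liftParam k (xc (k + 1) (bifP k * q) - xc (k + 1) ((bifP k - xv k ^ (k + 1)) * p)) := by
    intro p hp hpeq hpκ
    have h1 := ode_identity hb hg p
    rw [hpeq, sub_self] at h1
    have h2 : pderiv ℂ (Sum.inr 0) p = odeRhs b c g g₁ p := by
      have h3 := (mul_eq_zero.1 h1.symm).resolve_left (pow_ne_zero 2 bifP_ne_zero)
      have h4 := (mul_eq_zero.1 h3).resolve_left (fun h0 => hb (by rw [h0, map_zero]))
      exact sub_eq_zero.1 h4
    rw [← h2, pderiv_x_of_res hp, ← hpκ, xc_bifP_mul, add_sub_cancel_right, intg_pderiv hp]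
  rw [← sub_eq_zero]
  refine eq_zero_of_mem_fil_succ (ω := wt k) fun s hs => ?_
  rw [key q hq h rfl, key q' hq' h' hκ.symm]
  exact odeStep_sub_mem_fil b c g g₁ _ hs

end Ode

/-- The linear differential equation `v' = w v`. -/
theorem exists_linear_ode {w : Series k} (hw : res w = w) :
    ∃ v : Series k, res v = v ∧ constantCoeff v = 1 ∧ pderiv ℂ (Sum.inr 0) v = w * v := by
  obtain ⟨v, hv, hfix⟩ := exists_fixedPoint (ω := wt k)
    {q : Series k | ∀ d ∈ {d : Fin k ⊕ Fin 2 →₀ ℕ | d (Sum.inr 1) ≠ 0}, coeff d q = 0}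
    (fun v => 1 + intg (w * v)) ⟨0, fun d _ => by simp⟩ (fun v hv => setZero_eq_self_iff.1 (by
      rw [map_add, map_one, res_intg]
      rw [map_mul, hw, setZero_eq_self_iff.2 hv]))
    (stable_coeff _) (fun v _ v' _ s hs => by
      rw [add_sub_add_left_eq_sub, ← intg_sub, ← mul_sub]
      exact fil_anti (by omega) (intg_mem_fil (Ideal.mul_mem_left _ _ hs)))
  refine ⟨v, setZero_eq_self_iff.2 hv, ?_, ?_⟩
  · rw [← hfix, map_add, map_one, intg, map_mul, constantCoeff_X, zero_mul, add_zero]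
  · have := congrArg (pderiv ℂ (Sum.inr 0)) hfix
    rw [map_add, pderiv_intg, Derivation.map_one_eq_zero, zero_add] at this
    exact this.symm

end

end SaddleNode

namespace SaddleNode

open Filter Topology MvPowerSeries

noncomputable section

variable {k : ℕ}

/-! ### Elimination of the variable `y` -/

theorem update_X_zero {σ : Type} [DecidableEq σ] (i l : σ) :
    constantCoeff ((Function.update X i 0 : σ → MvPowerSeries σ ℂ) l) = 0 := by
  rcases eq_or_ne l i with rfl | h
  · simp
  · simp [h]

theorem res_subst {a : Fin k ⊕ Fin 2 → Series k} (ha : ∀ i, constantCoeff (a i) = 0)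
    (f : Series k) : res (subst a f) = subst (fun i => res (a i)) f := by
  rw [setZero_eq_subst, subst_comp_subst_apply (hasSubst_of_zero ha)
    (hasSubst_of_zero (update_X_zero _))]
  congr 1
  funext i
  rw [← setZero_eq_subst]

theorem subst_congr_of_res {a a' : Fin k ⊕ Fin 2 → Series k} (ha : ∀ i, constantCoeff (a i) = 0)
    (ha' : ∀ i, constantCoeff (a' i) = 0) (h : ∀ i, i ≠ Sum.inr 1 → a i = a' i) {f : Series k}
    (hf : res f = f) : subst a f = subst a' f := by
  rw [← hf, setZero_eq_subst, subst_comp_subst_apply (hasSubst_of_zero (update_X_zero _))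
    (hasSubst_of_zero ha), subst_comp_subst_apply (hasSubst_of_zero (update_X_zero _))
    (hasSubst_of_zero ha')]
  congr 1
  funext i
  rcases eq_or_ne i (Sum.inr 1) with rfl | hi
  · rw [Function.update_self, ← coe_substAlgHom (hasSubst_of_zero ha),
      ← coe_substAlgHom (hasSubst_of_zero ha'), map_zero, map_zero]
  · rw [Function.update_of_ne hi, subst_X (hasSubst_of_zero ha), subst_X (hasSubst_of_zero ha'),
      h i hi]

theorem res_subst_of_res {a : Fin k ⊕ Fin 2 → Series k} (ha : ∀ i, constantCoeff (a i) = 0)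
    (h : ∀ i, i ≠ Sum.inr 1 → res (a i) = X i) {f : Series k} (hf : res f = f) :
    res (subst a f) = f := by
  rw [res_subst ha, subst_congr_of_res (fun i => by rw [constantCoeff_setZero, ha])
    (a' := X) (fun i => constantCoeff_X i) h hf]
  exact congrFun subst_self f

/-- The coefficient of `y`. -/
def yc (f : Series k) : Series k := res (pderiv ℂ (Sum.inr 1) f)

theorem yc_mul (f g : Series k) : yc (f * g) = res f * yc g + res g * yc f := by
  rw [yc, Derivation.leibniz, smul_eq_mul, smul_eq_mul, map_add, map_mul, map_mul]
  rfl

theorem yc_sub (f g : Series k) : yc (f - g) = yc f - yc g := by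
  rw [yc, map_sub, map_sub]; rfl

theorem yc_add (f g : Series k) : yc (f + g) = yc f + yc g := by
  rw [yc, map_add, map_add]; rfl

theorem yc_yv : yc (yv k) = 1 := by rw [yc, pderiv_X_self, map_one]

theorem res_yc (f : Series k) : res (yc f) = yc f := setZero_setZero _ _

theorem yc_mem_fil {s : ℕ} {f : Series k} (hf : f ∈ fil (wt k) s) : yc f ∈ fil (wt k) (s - 3) :=
  setZero_mem_fil (pderiv_mem_fil (ω := wt k) (Sum.inr 1) hf)

theorem coeff_yc (f : Series k) (d : Fin k ⊕ Fin 2 →₀ ℕ) (hd : d (Sum.inr 1) = 1) :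
    coeff (d - Finsupp.single (Sum.inr 1) 1) (yc f) = coeff d f := by
  have h : (d - Finsupp.single (Sum.inr 1) 1 : Fin k ⊕ Fin 2 →₀ ℕ) (Sum.inr 1) = 0 := by simp [hd]
  rw [yc, coeff_setZero, if_pos h, coeff_pderiv, h,
    tsub_add_cancel_of_le (Finsupp.single_le_iff.2 hd.ge)]
  simp

theorem yc_eq_zero_of_coeff {f : Series k} (h : ∀ d, d (Sum.inr 1) = 1 → coeff d f = 0) :
    yc f = 0 := by
  ext d
  rw [yc, coeff_setZero, map_zero]
  split_ifs with hd
  · rw [coeff_pderiv, h _ (by rw [Finsupp.add_apply, hd, Finsupp.single_eq_same]), zero_mul]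
  · rfl

/-- The Euler operator `y ∂/∂y` is diagonal on monomials, so the homological equations of the
elimination are solved by dividing coefficients. -/
theorem coeff_yv_mul_pderiv (f : Series k) (d : Fin k ⊕ Fin 2 →₀ ℕ) :
    coeff d (yv k * pderiv ℂ (Sum.inr 1) f) = d (Sum.inr 1) * coeff d f := by
  rw [← pow_one (yv k), X_pow_eq, coeff_monomial_mul, one_mul]
  simp only [Finsupp.single_le_iff]
  split_ifs with h
  · rw [coeff_pderiv, tsub_add_cancel_of_le (Finsupp.single_le_iff.2 h), Finsupp.tsub_apply,
      Finsupp.single_eq_same, Nat.cast_sub h]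
    push_cast
    ring
  · rw [show d (Sum.inr 1) = 0 by omega, Nat.cast_zero, zero_mul]

/-- The substitution of `f` for `x` and `g` for `y`. -/
def subXY (f g : Series k) : Fin k ⊕ Fin 2 → Series k :=
  Sum.elim (fun j => X (Sum.inl j)) ![f, g]

theorem subXY_mem_fil {f g : Series k} (hf : f ∈ fil (wt k) 2) (hg : g ∈ fil (wt k) 3)
    (i : Fin k ⊕ Fin 2) : subXY f g i ∈ fil (wt k) (wt k i) := by
  rcases i with j | i
  · exact X_mem_fil _
  · fin_cases i
    · exact hf
    · exact hg

theorem subXY_sub_mem_fil {f g f' g' : Series k} {s : ℕ} (hf : f - f' ∈ fil (wt k) (2 + s))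
    (hg : g - g' ∈ fil (wt k) (3 + s)) (i : Fin k ⊕ Fin 2) :
    subXY f g i - subXY f' g' i ∈ fil (wt k) (wt k i + s) := by
  rcases i with j | i
  · rw [subXY, subXY, Sum.elim_inl, Sum.elim_inl, sub_self]; exact zero_mem _
  · fin_cases i
    · exact hf
    · exact hg

theorem zero_of_mem_fil_wt {a : Fin k ⊕ Fin 2 → Series k} (h : ∀ i, a i ∈ fil (wt k) (wt k i))
    (i : Fin k ⊕ Fin 2) : constantCoeff (a i) = 0 :=
  (mem_fil_one wt_ne_zero).1 (fil_anti (Nat.one_le_iff_ne_zero.2 (wt_ne_zero i)) (h i))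

theorem shiftMul_zero_mem_fil {s : ℕ} {c : (Fin k ⊕ Fin 2 →₀ ℕ) → ℂ} {f : Series k}
    (hf : f ∈ fil (wt k) s) : shiftMul 0 c f ∈ fil (wt k) s := by
  have := shiftMul_mem_fil (s := 0) (c := c) hf
  rwa [map_zero] at this

section PoincareDulac

variable (Z : Family k) (l : ℂ)

/-- The function `A` of the next step of the iteration. -/
def pdA (a : Fin 3 → Series k) : Series k :=
  yc (lieDeriv ![Z 0, Z 1 - l • yv k] (yv k + a 1)) -
    yc (subst (subXY (xv k + a 0) (yv k + a 1)) (a 2)) * res (yv k + a 1)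

/-- The iteration that eliminates `y` from a family of vector fields. -/
def pdStep (a : Fin 3 → Series k) : Fin 3 → Series k :=
  ![shiftMul 0 (fun d => (l * d (Sum.inr 1))⁻¹)
      (subst (subXY (xv k + a 0) (yv k + a 1))
        (res (lieDeriv ![Z 0, Z 1 - l • yv k] (xv k + a 0))) -
          lieDeriv ![Z 0, Z 1 - l • yv k] (xv k + a 0)),
    shiftMul 0 (fun d => (l * ((d (Sum.inr 1) : ℂ) - 1))⁻¹)
      (subst (subXY (xv k + a 0) (yv k + a 1)) (pdA Z l a) * (yv k + a 1) -
        lieDeriv ![Z 0, Z 1 - l • yv k] (yv k + a 1)),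
    pdA Z l a]

/-- The set of the admissible unknowns of the iteration. -/
def pdSet : Fin 3 → Set (Series k) :=
  ![{f | ∀ d ∈ {d : Fin k ⊕ Fin 2 →₀ ℕ | d (Sum.inr 1) = 0}, coeff d f = 0} ∩
      (fil (wt k) 3 : Set (Series k)),
    {f | ∀ d ∈ {d : Fin k ⊕ Fin 2 →₀ ℕ | d (Sum.inr 1) = 1}, coeff d f = 0} ∩
      (fil (wt k) 4 : Set (Series k)),
    {f | ∀ d ∈ {d : Fin k ⊕ Fin 2 →₀ ℕ | d (Sum.inr 1) ≠ 0}, coeff d f = 0} ∩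
      (fil (wt k) 1 : Set (Series k))]

variable {Z l}

section

variable {a b : Fin 3 → Series k} (ha : ∀ i, a i ∈ pdSet i) (hb : ∀ i, b i ∈ pdSet i)

include ha

theorem pdX_mem : xv k + a 0 ∈ fil (wt k) 2 := add_mem xv_mem_fil (fil_anti (by omega) (ha 0).2)

theorem pdY_mem : yv k + a 1 ∈ fil (wt k) 3 := add_mem yv_mem_fil (fil_anti (by omega) (ha 1).2)

theorem pdSub_mem (i : Fin k ⊕ Fin 2) :
    subXY (xv k + a 0) (yv k + a 1) i ∈ fil (wt k) (wt k i) :=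
  subXY_mem_fil (pdX_mem ha) (pdY_mem ha) i

theorem pdSub_hasSubst : HasSubst (subXY (xv k + a 0) (yv k + a 1)) :=
  hasSubst_of_zero (zero_of_mem_fil_wt (pdSub_mem ha))

theorem pd_subst_mem {s : ℕ} {f : Series k} (hf : f ∈ fil (wt k) s) :
    subst (subXY (xv k + a 0) (yv k + a 1)) f ∈ fil (wt k) s :=
  subst_mem_fil (pdSub_hasSubst ha) (pdSub_mem ha) hf

theorem res_pdY : res (yv k + a 1) ∈ fil (wt k) 4 := by
  rw [map_add, res_yv, zero_add]
  exact setZero_mem_fil (ha 1).2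

include hb

theorem pd_subst_sub_mem {s m n : ℕ} (h0 : a 0 - b 0 ∈ fil (wt k) (s + 2))
    (h1 : a 1 - b 1 ∈ fil (wt k) (s + 3)) {f g : Series k} (hf : f ∈ fil (wt k) m)
    (hfg : f - g ∈ fil (wt k) n) (hn : n ≤ m + s) :
    subst (subXY (xv k + a 0) (yv k + a 1)) f - subst (subXY (xv k + b 0) (yv k + b 1)) g ∈
      fil (wt k) n := by
  have e : subst (subXY (xv k + a 0) (yv k + a 1)) f - subst (subXY (xv k + b 0) (yv k + b 1)) g =
      (subst (subXY (xv k + a 0) (yv k + a 1)) f - subst (subXY (xv k + b 0) (yv k + b 1)) f) +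
        subst (subXY (xv k + b 0) (yv k + b 1)) (f - g) := by
    rw [subst_sub (pdSub_hasSubst hb)]; ring
  rw [e]
  refine add_mem (fil_anti hn (subst_sub_subst_mem_fil (pdSub_hasSubst ha) (pdSub_hasSubst hb)
    (pdSub_mem ha) (pdSub_mem hb) (subXY_sub_mem_fil ?_ ?_) hf)) (pd_subst_mem hb hfg)
  · rwa [add_sub_add_left_eq_sub, add_comm]
  · rwa [add_sub_add_left_eq_sub, add_comm]

end

variable (h0 : Z 0 ∈ fil (wt k) 3) (h1 : Z 1 - l • yv k ∈ fil (wt k) 4)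

include h0 h1

theorem pd_lieDeriv_mem {s : ℕ} {f : Series k} (hf : f ∈ fil (wt k) s) :
    lieDeriv ![Z 0, Z 1 - l • yv k] f ∈ fil (wt k) (s + 1) :=
  lieDeriv_mem_fil (Z := ![Z 0, Z 1 - l • yv k]) h0 h1 hf

theorem pdA_mem {a : Fin 3 → Series k} (ha : ∀ i, a i ∈ pdSet i) : pdA Z l a ∈ fil (wt k) 1 :=
  sub_mem (fil_anti (by omega) (yc_mem_fil (pd_lieDeriv_mem h0 h1 (pdY_mem ha))))
    (Ideal.mul_mem_left _ _ (fil_anti (by omega) (res_pdY ha)))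

theorem pdStep_mem {a : Fin 3 → Series k} (ha : ∀ i, a i ∈ pdSet i) (i : Fin 3) :
    pdStep Z l a i ∈ pdSet (k := k) i := by
  fin_cases i
  · refine ⟨fun d hd => ?_, shiftMul_zero_mem_fil (sub_mem (pd_subst_mem ha (setZero_mem_fil
      (pd_lieDeriv_mem h0 h1 (pdX_mem ha)))) (pd_lieDeriv_mem h0 h1 (pdX_mem ha)))⟩
    simp only [Set.mem_ofPred_eq] at hd
    change coeff d (shiftMul _ _ _) = 0
    rw [coeff_shiftMul, hd, Nat.cast_zero, mul_zero, inv_zero, zero_mul]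
  · refine ⟨fun d hd => ?_, shiftMul_zero_mem_fil (sub_mem (mul_mem_fil_of_le (pd_subst_mem ha
      (pdA_mem h0 h1 ha)) (pdY_mem ha) (by omega)) (pd_lieDeriv_mem h0 h1 (pdY_mem ha)))⟩
    simp only [Set.mem_ofPred_eq] at hd
    change coeff d (shiftMul _ _ _) = 0
    rw [coeff_shiftMul, hd, Nat.cast_one, sub_self, mul_zero, inv_zero, zero_mul]
  · refine ⟨setZero_eq_self_iff.1 ?_, pdA_mem h0 h1 ha⟩
    change res (pdA Z l a) = pdA Z l a
    rw [pdA, map_sub, map_mul, res_yc, res_yc, setZero_setZero]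

/-- One order is gained because `Z - l y ∂/∂y` raises the weight and because the series that are
composed with the unknowns already have one order more than the terms they correct. -/
theorem pdStep_sub_mem {a b : Fin 3 → Series k} (ha : ∀ i, a i ∈ pdSet i)
    (hb : ∀ i, b i ∈ pdSet i) {s : ℕ} (h : ∀ i, a i - b i ∈ fil (wt k) (s + ![2, 3, 0] i))
    (i : Fin 3) : pdStep Z l a i - pdStep Z l b i ∈ fil (wt k) (s + 1 + ![2, 3, 0] i) := by
  have g0 : a 0 - b 0 ∈ fil (wt k) (s + 2) := h 0
  have g1 : a 1 - b 1 ∈ fil (wt k) (s + 3) := h 1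
  have g2 : a 2 - b 2 ∈ fil (wt k) s := h 2
  have hX : lieDeriv ![Z 0, Z 1 - l • yv k] (xv k + a 0) -
      lieDeriv ![Z 0, Z 1 - l • yv k] (xv k + b 0) ∈ fil (wt k) (s + 3) := by
    rw [← lieDeriv_sub, add_sub_add_left_eq_sub]; exact pd_lieDeriv_mem h0 h1 g0
  have hY : lieDeriv ![Z 0, Z 1 - l • yv k] (yv k + a 1) -
      lieDeriv ![Z 0, Z 1 - l • yv k] (yv k + b 1) ∈ fil (wt k) (s + 4) := by
    rw [← lieDeriv_sub, add_sub_add_left_eq_sub]; exact pd_lieDeriv_mem h0 h1 g1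
  have hrY : res (yv k + a 1) - res (yv k + b 1) ∈ fil (wt k) (s + 3) := by
    rw [← map_sub, add_sub_add_left_eq_sub]; exact setZero_mem_fil g1
  have hA : pdA Z l a - pdA Z l b ∈ fil (wt k) (s + 1) := by
    have e : pdA Z l a - pdA Z l b = yc (lieDeriv ![Z 0, Z 1 - l • yv k] (yv k + a 1) -
        lieDeriv ![Z 0, Z 1 - l • yv k] (yv k + b 1)) -
        (yc (subst (subXY (xv k + a 0) (yv k + a 1)) (a 2) -
          subst (subXY (xv k + b 0) (yv k + b 1)) (b 2)) * res (yv k + a 1) +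
          yc (subst (subXY (xv k + b 0) (yv k + b 1)) (b 2)) *
            (res (yv k + a 1) - res (yv k + b 1))) := by
      rw [pdA, pdA, yc_sub, yc_sub]; ring
    rw [e]
    refine sub_mem (fil_anti (by omega) (yc_mem_fil hY)) (add_mem ?_ ?_)
    · exact mul_mem_fil_of_le (yc_mem_fil (pd_subst_sub_mem ha hb g0 g1 (ha 2).2 g2 (by omega)))
        (res_pdY ha) (by omega)
    · exact Ideal.mul_mem_left _ _ (fil_anti (by omega) hrY)
  fin_cases i
  · change shiftMul _ _ _ - shiftMul _ _ _ ∈ fil (wt k) (s + 1 + 2)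
    rw [← map_sub, sub_sub_sub_comm]
    refine shiftMul_zero_mem_fil (sub_mem ?_ hX)
    exact pd_subst_sub_mem ha hb g0 g1 (setZero_mem_fil (pd_lieDeriv_mem h0 h1 (pdX_mem ha)))
      (by rw [← map_sub]; exact setZero_mem_fil (fil_anti (by omega) hX)) (by omega)
  · change shiftMul _ _ _ - shiftMul _ _ _ ∈ fil (wt k) (s + 1 + 3)
    rw [← map_sub, sub_sub_sub_comm]
    refine shiftMul_zero_mem_fil (sub_mem ?_ hY)
    have e : subst (subXY (xv k + a 0) (yv k + a 1)) (pdA Z l a) * (yv k + a 1) -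
        subst (subXY (xv k + b 0) (yv k + b 1)) (pdA Z l b) * (yv k + b 1) =
        (subst (subXY (xv k + a 0) (yv k + a 1)) (pdA Z l a) -
          subst (subXY (xv k + b 0) (yv k + b 1)) (pdA Z l b)) * (yv k + a 1) +
          subst (subXY (xv k + b 0) (yv k + b 1)) (pdA Z l b) * (a 1 - b 1) := by ring
    rw [e]
    exact add_mem (mul_mem_fil_of_le (pd_subst_sub_mem ha hb g0 g1 (pdA_mem h0 h1 ha) hA (by omega))
      (pdY_mem ha) (by omega)) (mul_mem_fil_of_le (pd_subst_mem hb (pdA_mem h0 h1 hb)) g1 (by omega))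
  · exact hA

/-- Formal elimination of `y` up to the linear term, by a change fixing the parameter. -/
theorem exists_poincareDulac (hl : l ≠ 0) :
    ∃ (Ψ : FormalChange k) (F A : Series k), Ψ.FixesParam ∧ res F = F ∧ res A = A ∧
      constantCoeff A = l ∧ res (Ψ.map 0) = xv k ∧ yc (Ψ.map 1) = 1 ∧
      Conjugates Ψ Z ![F, A * yv k] := by
  -- The unknowns are `X = x + a 0`, `Y = y + a 1` and `A = l + a 2`, subject to `Z·X = F ∘ Ψ` and
  -- `Z·Y = (A ∘ Ψ) Y`. On `y^n` the operator `l y ∂/∂y` has eigenvalue `l n` in the first equation,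
  -- and `l (n - 1)` in the second after subtracting `l`. The resonances `n = 0` and `n = 1` are
  -- absorbed by `F` and `A`. The offsets are the weights of `x`, `y` and `1`.
  obtain ⟨a, ha, hfix⟩ := exists_fixedPoint_family (ω := wt k) ![2, 3, 0] (pdSet (k := k))
    (pdStep Z l) ⟨fun _ => 0, fun i => by
      fin_cases i <;> exact ⟨fun d _ => by simp, zero_mem _⟩⟩
    (fun a ha i => pdStep_mem h0 h1 ha i)
    (fun i => by fin_cases i <;> exact (stable_coeff _).inter (stable_fil _))
    (fun i f hf g hg => by
      fin_cases i
      · exact fil_anti (by simp) (sub_mem hf.2 hg.2)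
      · exact fil_anti (by simp) (sub_mem hf.2 hg.2)
      · exact fil_anti (by simp) (sub_mem hf.2 hg.2))
    (fun a b ha hb s h i => pdStep_sub_mem h0 h1 ha hb h i)
  set Xa := xv k + a 0 with hXa
  set Ya := yv k + a 1 with hYa
  set W := lieDeriv ![Z 0, Z 1 - l • yv k] Xa with hW
  set V := lieDeriv ![Z 0, Z 1 - l • yv k] Ya with hV
  have hA : pdA Z l a = a 2 := congrFun hfix 2
  have hfix0 : a 0 = shiftMul 0 (fun d => (l * d (Sum.inr 1))⁻¹) (subst (subXY Xa Ya) (res W) - W) :=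
    (congrFun hfix 0).symm
  have hfix1 : a 1 = shiftMul 0 (fun d => (l * ((d (Sum.inr 1) : ℂ) - 1))⁻¹)
      (subst (subXY Xa Ya) (a 2) * Ya - V) := by
    have := congrFun hfix 1
    rw [← hA]
    exact this.symm
  have hra : res (a 0) = 0 := by
    ext d
    rw [coeff_setZero, map_zero]
    split_ifs with hd
    · exact (ha 0).1 d hd
    · rfl
  have hrX : res Xa = xv k := by rw [hXa, map_add, res_xv, hra, add_zero]
  have hyY : yc Ya = 1 := by
    rw [hYa, yc_add, yc_yv, yc_eq_zero_of_coeff (ha 1).1, add_zero]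
  have hrA : res (a 2) = a 2 := setZero_eq_self_iff.2 (ha 2).1
  have hs0 := zero_of_mem_fil_wt (pdSub_mem ha)
  have hsub : ∀ i, i ≠ Sum.inr 1 → res (subXY Xa Ya i) = X i := by
    rintro (j | i) hi
    · exact res_X_inl j
    · fin_cases i
      · exact hrX
      · exact absurd rfl hi
  have hsplit : ∀ f, lieDeriv Z f = l • (yv k * pderiv ℂ (Sum.inr 1) f) +
      lieDeriv ![Z 0, Z 1 - l • yv k] f := by
    intro f
    rw [lieDeriv_eq_two, lieDeriv_eq_two]
    simp only [Matrix.cons_val_zero, Matrix.cons_val_one, smul_eq_C_mul]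
    ring
  have e0 : lieDeriv Z Xa = subst (subXY Xa Ya) (res W) := by
    rw [hsplit, ← hW, ← eq_sub_iff_add_eq]
    ext d
    have hd : coeff d (pderiv ℂ (Sum.inr 1) Xa) = coeff d (pderiv ℂ (Sum.inr 1) (a 0)) := by
      rw [hXa, map_add, pderiv_y_of_res res_xv, zero_add]
    have hpd : pderiv ℂ (Sum.inr 1) Xa = pderiv ℂ (Sum.inr 1) (a 0) := by
      rw [hXa, map_add, pderiv_y_of_res res_xv, zero_add]
    rw [hpd, coeff_smul, coeff_yv_mul_pderiv]
    -- For `n = 0` both sides vanish, since `X` restricts to `x` on `y = 0` and `F` is the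
    -- restriction of `W`.
    by_cases hd0 : d (Sum.inr 1) = 0
    · rw [hd0, Nat.cast_zero, zero_mul, mul_zero]
      have h2 : res (subst (subXY Xa Ya) (res W) - W) = 0 := by
        rw [map_sub, res_subst_of_res hs0 hsub (setZero_setZero _ _), sub_self]
      have h3 := congrArg (coeff d) h2
      rw [coeff_setZero, if_pos hd0, map_zero] at h3
      exact h3.symm
    · have hne : l * (d (Sum.inr 1) : ℂ) ≠ 0 := mul_ne_zero hl (Nat.cast_ne_zero.2 hd0)
      rw [hfix0, coeff_shiftMul, add_zero, ← mul_assoc, mul_inv_cancel_left₀ hne]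
  have e1 : lieDeriv Z Ya = (C l + subst (subXY Xa Ya) (a 2)) * Ya := by
    have hpd : pderiv ℂ (Sum.inr 1) Ya = 1 + pderiv ℂ (Sum.inr 1) (a 1) := by
      rw [hYa, map_add, pderiv_X_self]
    have key : l • (yv k * pderiv ℂ (Sum.inr 1) (a 1)) - l • a 1 =
        subst (subXY Xa Ya) (a 2) * Ya - V := by
      ext d
      rw [map_sub, coeff_smul, coeff_smul, coeff_yv_mul_pderiv]
      -- For `n = 1` the right-hand side has no coefficient: this is what `pdA` was chosen for.
      by_cases hd1 : d (Sum.inr 1) = 1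
      · have h2 : yc (subst (subXY Xa Ya) (a 2) * Ya - V) = 0 := by
          rw [yc_sub, yc_mul, res_subst_of_res hs0 hsub hrA, hyY, mul_one]
          nth_rewrite 1 [← hA]
          rw [pdA]
          ring
        have h3 := coeff_yc (subst (subXY Xa Ya) (a 2) * Ya - V) d hd1
        rw [h2, map_zero] at h3
        rw [← h3, hd1]
        ring
      · have hne : l * ((d (Sum.inr 1) : ℂ) - 1) ≠ 0 :=
          mul_ne_zero hl (sub_ne_zero.2 (by exact_mod_cast hd1))
        have h4 := congrArg (coeff d) hfix1
        rw [coeff_shiftMul, add_zero, eq_inv_mul_iff_mul_eq₀ hne] at h4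
        rw [← h4]
        ring
    rw [hsplit, ← hV, hpd]
    have e : l • (yv k * (1 + pderiv ℂ (Sum.inr 1) (a 1))) =
        l • Ya + (l • (yv k * pderiv ℂ (Sum.inr 1) (a 1)) - l • a 1) := by
      rw [hYa, mul_add, mul_one, smul_add, smul_add]; ring
    rw [e, key, smul_eq_C_mul]
    ring
  have hdet : (jacobianAtZero (atParamZero ![Xa, Ya])).det ≠ 0 := by
    have c : ∀ i j, jacobianAtZero (atParamZero ![Xa, Ya]) i j =
        coeff (Finsupp.single (Sum.inr j) 1) (![Xa, Ya] i) := by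
      intro i j
      have := coeff_single_killCompl (![Xa, Ya] i) j
      rw [← coeff_single_eq] at this
      exact this
    have hw : ∀ i : Fin 2, Finsupp.weight (wt k) (Finsupp.single (Sum.inr i) 1) = wt k (Sum.inr i) :=
      fun i => by rw [Finsupp.weight_single, one_smul]
    have c00 : coeff (Finsupp.single (Sum.inr 0) 1) Xa = 1 := by
      rw [hXa, map_add, (ha 0).2 _ (by rw [hw, wt_x]; omega), add_zero, coeff_X, if_pos rfl]
    have c10 : coeff (Finsupp.single (Sum.inr 0) 1) Ya = 0 := by
      rw [hYa, map_add, (ha 1).2 _ (by rw [hw, wt_x]; omega), add_zero, coeff_X, if_neg]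
      rw [Finsupp.single_left_inj one_ne_zero]
      exact fun h => absurd (Sum.inr_injective h) (by decide)
    have c11 : coeff (Finsupp.single (Sum.inr 1) 1) Ya = 1 := by
      rw [hYa, map_add, (ha 1).2 _ (by rw [hw, wt_y]; omega), add_zero, coeff_X, if_pos rfl]
    rw [Matrix.det_fin_two, c, c, c, c]
    simp only [Matrix.cons_val_zero, Matrix.cons_val_one]
    rw [c00, c10, c11]
    simp
  let Ψ : FormalChange k :=
    { par := X
      map := ![Xa, Ya]
      par_zero := fun j => constantCoeff_X j
      map_zero := fun i => by
        fin_cases i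
        · exact hs0 (Sum.inr 0)
        · exact hs0 (Sum.inr 1)
      par_invertible := by rw [jacobianAtZero_X, Matrix.det_one]; exact one_ne_zero
      map_invertible := hdet }
  have htot : Ψ.total = subXY Xa Ya := by
    funext i
    rcases i with j | i
    · exact liftParam_X j
    · rfl
  refine ⟨Ψ, res W, C l + a 2, fun j => rfl, setZero_setZero _ _, ?_, ?_, hrX, hyY, ?_⟩
  · rw [map_add, hrA]
    congr 1
    exact (res (k := k)).commutes l
  · rw [map_add, (mem_fil_one wt_ne_zero).1 (ha 2).2, add_zero, constantCoeff_C]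
  · intro i
    fin_cases i
    · change lieDeriv Z Xa = Ψ.pull (res W)
      rw [FormalChange.pull, htot, e0]
    · change lieDeriv Z Ya = Ψ.pull ((C l + a 2) * yv k)
      rw [Ψ.pull_eq, map_mul, map_add, ← Ψ.pull_eq, ← Ψ.pull_eq, ← Ψ.pull_eq, Ψ.pull_inr, e1]
      have hC : Ψ.pull (C l) = C l := by rw [Ψ.pull_eq]; exact Ψ.pullHom.commutes l
      rw [hC, FormalChange.pull, htot]
      rfl

end PoincareDulac

end

end SaddleNode

/-! ### Composition with a formal change and restriction to `y = 0` -/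

namespace SaddleNode

open Filter Topology MvPowerSeries

noncomputable section

variable {k : ℕ}

namespace FormalChange

variable (Ψ : FormalChange k) (f g : Series k)

theorem pull_add : Ψ.pull (f + g) = Ψ.pull f + Ψ.pull g := by simp_rw [Ψ.pull_eq, map_add]

theorem pull_sub : Ψ.pull (f - g) = Ψ.pull f - Ψ.pull g := by simp_rw [Ψ.pull_eq, map_sub]

theorem pull_mul : Ψ.pull (f * g) = Ψ.pull f * Ψ.pull g := by simp_rw [Ψ.pull_eq, map_mul]

theorem pull_pow (n : ℕ) : Ψ.pull (f ^ n) = Ψ.pull f ^ n := by simp_rw [Ψ.pull_eq, map_pow]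

theorem pull_one : Ψ.pull 1 = 1 := by rw [Ψ.pull_eq, map_one]

theorem pull_bifP' : Ψ.pull (bifP' k) = bifDer (fun j => liftParam k (Ψ.par j)) (Ψ.map 0) := by
  have h := map_bifDer Ψ.pullHom.toRingHom (fun j => X (Sum.inl j)) (xv k)
  simp only [AlgHom.toRingHom_eq_coe, RingHom.coe_coe, ← Ψ.pull_eq, Ψ.pull_inl, Ψ.pull_inr] at h
  exact h

theorem pull_polyX (r : Fin (k + 1) → ParamSeries k) :
    Ψ.pull (polyX r) = ∑ i, liftParam k (subst Ψ.par (r i)) * Ψ.map 0 ^ (i : ℕ) := by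
  rw [polyX, Ψ.pull_eq, map_sum]
  refine Finset.sum_congr rfl fun i _ => ?_
  rw [← Ψ.pull_eq, pull_mul, pull_pow, pull_inr, pull_liftParam]

variable {Ψ}

theorem FixesParam.subst (h : Ψ.FixesParam) (p : ParamSeries k) :
    MvPowerSeries.subst Ψ.par p = p := by
  rw [show Ψ.par = X from funext h]
  exact congrFun subst_self p

theorem FixesParam.par_eq (h : Ψ.FixesParam) (j : Fin k) :
    liftParam k (Ψ.par j) = X (Sum.inl j) := by rw [h j, liftParam_X]

/-- Restriction to `y = 0` commutes with a change preserving `y = 0` whose first component does not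
depend on `y`. -/
theorem res_pull (hX : res (Ψ.map 0) = Ψ.map 0) (hY : res (Ψ.map 1) = 0) :
    res (Ψ.pull f) = Ψ.pull (res f) := by
  obtain ⟨g, hg⟩ := X_dvd_sub_setZero (Sum.inr 1) f
  have h1 : res (Ψ.pull f) = res (Ψ.pull (res f)) := by
    rw [← sub_eq_zero, ← map_sub, ← pull_sub, hg, pull_mul, map_mul, pull_inr, hY, zero_mul]
  rw [h1, pull, res_subst Ψ.total_zero]
  refine subst_congr_of_res (fun i => by rw [constantCoeff_setZero, Ψ.total_zero]) Ψ.total_zero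
    (fun i hi => ?_) (setZero_setZero _ _)
  rcases i with j | i
  · exact res_liftParam _
  · fin_cases i
    · exact hX
    · exact absurd rfl hi

/-- A change that is the identity modulo `y` in `(ε, x)`. -/
theorem res_pull_of_res (h : Ψ.FixesParam) (hX : res (Ψ.map 0) = xv k) {f : Series k}
    (hf : res f = f) : res (Ψ.pull f) = f := by
  refine res_subst_of_res Ψ.total_zero (fun i hi => ?_) hf
  rcases i with j | i
  · rw [total_inl, h.par_eq, res_X_inl]
  · fin_cases i
    · exact hX
    · exact absurd rfl hi

end FormalChange

/-- The formal change `(φ, (f, g))`. -/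
theorem exists_formalChange {p : Fin k → ParamSeries k} {f g : Series k}
    (hp : ∀ j, constantCoeff (p j) = 0) (hdet : (jacobianAtZero p).det ≠ 0)
    (hf : constantCoeff f = 0) (hg : constantCoeff g = 0)
    (hfx : coeff (Finsupp.single (Sum.inr 0) 1) f ≠ 0) (hgx : coeff (Finsupp.single (Sum.inr 0) 1) g = 0)
    (hgy : coeff (Finsupp.single (Sum.inr 1) 1) g ≠ 0) :
    ∃ Ψ : FormalChange k, Ψ.par = p ∧ Ψ.map 0 = f ∧ Ψ.map 1 = g := by
  have c : ∀ i j, jacobianAtZero (atParamZero ![f, g]) i j =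
      coeff (Finsupp.single (Sum.inr j) 1) (![f, g] i) := by
    intro i j
    have := coeff_single_killCompl (![f, g] i) j
    rw [← coeff_single_eq] at this
    exact this
  refine ⟨⟨p, ![f, g], hp, fun i => by fin_cases i <;> assumption, hdet, ?_⟩, rfl, rfl, rfl⟩
  rw [Matrix.det_fin_two, c, c, c, c]
  simp only [Matrix.cons_val_zero, Matrix.cons_val_one]
  rw [hgx, mul_zero, sub_zero]
  exact mul_ne_zero hfx hgy

/-! ### The ideal of the singular points -/

/-- The ideal `(P, y)`. -/
def singIdeal (k : ℕ) : Ideal (Series k) := Ideal.span {bifP k, yv k}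

theorem bifP_mem_singIdeal : bifP k ∈ singIdeal k := Ideal.subset_span (by simp)

theorem yv_mem_singIdeal : yv k ∈ singIdeal k := Ideal.subset_span (by simp)

theorem bifP_dvd_res {f : Series k} (hf : f ∈ singIdeal k) : bifP k ∣ res f := by
  obtain ⟨a, b, rfl⟩ := Ideal.mem_span_pair.1 hf
  rw [map_add, map_mul, map_mul, res_bifP, res_yv, mul_zero, add_zero]
  exact dvd_mul_left _ _

theorem mem_singIdeal_of_res {f : Series k} (h : bifP k ∣ res f) : f ∈ singIdeal k := by
  have h1 := (singIdeal k).mem_of_dvd (X_dvd_sub_setZero (Sum.inr 1) f) yv_mem_singIdeal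
  have h2 := add_mem h1 ((singIdeal k).mem_of_dvd h bifP_mem_singIdeal)
  rwa [sub_add_cancel] at h2

/-- Modulo `(P, y)²`, the part without `y` is seen modulo `P²` and the coefficient of `y` modulo `P`
(`bifP_dvd_yc`). These two tests extract the two eigenvalues on the conormal module. -/
theorem sq_dvd_res {f : Series k} (hf : f ∈ singIdeal k ^ 2) : bifP k ^ 2 ∣ res f := by
  rw [pow_two] at hf
  refine Submodule.mul_induction_on hf (fun a ha b hb => ?_) (fun a b ha hb => ?_)
  · rw [map_mul, pow_two]
    exact mul_dvd_mul (bifP_dvd_res ha) (bifP_dvd_res hb)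
  · rw [map_add]; exact dvd_add ha hb

theorem bifP_dvd_yc {f : Series k} (hf : f ∈ singIdeal k ^ 2) : bifP k ∣ yc f := by
  rw [pow_two] at hf
  refine Submodule.mul_induction_on hf (fun a ha b hb => ?_) (fun a b ha hb => ?_)
  · rw [yc_mul]
    exact dvd_add ((bifP_dvd_res ha).mul_right _) ((bifP_dvd_res hb).mul_right _)
  · rw [yc_add]; exact dvd_add ha hb

theorem lieDeriv_mem_singIdeal {Z : Family k} (hZ : ∀ i, Z i ∈ singIdeal k) (f : Series k) :
    lieDeriv Z f ∈ singIdeal k :=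
  Ideal.sum_mem _ fun i _ => Ideal.mul_mem_right _ _ (hZ i)

theorem pull_mem_singIdeal {Ψ : FormalChange k} (h0 : Ψ.pull (bifP k) ∈ singIdeal k)
    (h1 : Ψ.map 1 ∈ singIdeal k) {f : Series k} (hf : f ∈ singIdeal k) :
    Ψ.pull f ∈ singIdeal k := by
  obtain ⟨a, b, rfl⟩ := Ideal.mem_span_pair.1 hf
  rw [Ψ.pull_add, Ψ.pull_mul, Ψ.pull_mul, Ψ.pull_inr]
  exact add_mem (Ideal.mul_mem_left _ _ h0) (Ideal.mul_mem_left _ _ h1)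

theorem pull_mem_singIdeal_sq {Ψ : FormalChange k} (h0 : Ψ.pull (bifP k) ∈ singIdeal k)
    (h1 : Ψ.map 1 ∈ singIdeal k) {f : Series k} (hf : f ∈ singIdeal k ^ 2) :
    Ψ.pull f ∈ singIdeal k ^ 2 := by
  rw [pow_two] at *
  refine Submodule.mul_induction_on hf (fun a ha b hb => ?_) (fun a b ha hb => ?_)
  · rw [Ψ.pull_mul]
    exact Ideal.mul_mem_mul (pull_mem_singIdeal h0 h1 ha) (pull_mem_singIdeal h0 h1 hb)
  · rw [Ψ.pull_add]; exact add_mem ha hb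

/-- The linear map induced by `Z` on the conormal module of the singular points has trace `s` and
determinant `d`. -/
def HasCharpoly (Z : Family k) (s d : Series k) : Prop :=
  ∀ f ∈ singIdeal k, lieDeriv Z (lieDeriv Z f) - s * lieDeriv Z f + d * f ∈ singIdeal k ^ 2

theorem HasCharpoly.congr {Z : Family k} (hZ : ∀ i, Z i ∈ singIdeal k) {s d s' d' : Series k}
    (h : HasCharpoly Z s d) (hs : s - s' ∈ singIdeal k) (hd : d - d' ∈ singIdeal k) :
    HasCharpoly Z s' d' := by
  intro f hf
  have e : lieDeriv Z (lieDeriv Z f) - s' * lieDeriv Z f + d' * f =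
      lieDeriv Z (lieDeriv Z f) - s * lieDeriv Z f + d * f +
        ((s - s') * lieDeriv Z f - (d - d') * f) := by ring
  rw [e]
  refine add_mem (h f hf) ?_
  rw [pow_two]
  exact sub_mem (Ideal.mul_mem_mul hs (lieDeriv_mem_singIdeal hZ f)) (Ideal.mul_mem_mul hd hf)

/-- Both `Ψ` and its inverse preserve `(P, y)`, hence its square, so the quadratic relation is
transported. -/
theorem HasCharpoly.of_pull {Z Z' : Family k} {Ψ Θ : FormalChange k} (hΨ : Conjugates Ψ Z Z')
    (hinv : ∀ f, Θ.pull (Ψ.pull f) = f)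
    (h0 : Ψ.pull (bifP k) ∈ singIdeal k) (h1 : Ψ.map 1 ∈ singIdeal k)
    (h0' : Θ.pull (bifP k) ∈ singIdeal k) (h1' : Θ.map 1 ∈ singIdeal k) {s d : Series k}
    (h : HasCharpoly Z (Ψ.pull s) (Ψ.pull d)) : HasCharpoly Z' s d := by
  intro f hf
  rw [← hinv (lieDeriv Z' (lieDeriv Z' f) - s * lieDeriv Z' f + d * f)]
  refine pull_mem_singIdeal_sq h0' h1' ?_
  have := h _ (pull_mem_singIdeal h0 h1 hf)
  rwa [hΨ.lieDeriv_pull, hΨ.lieDeriv_pull, ← Ψ.pull_mul, ← Ψ.pull_mul, ← Ψ.pull_sub,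
    ← Ψ.pull_add] at this

/-- Cayley–Hamilton for the matrix of `Z` on the generators `P`, `y` of the conormal module, with
rows `P' (M₀₀, M₀₁)` and `(M₁₀, M₁₁)`. `Z` maps every series into the ideal, so the terms where it
differentiates a coefficient fall into the square of the ideal. -/
theorem hasCharpoly_of_matrix {Z : Family k} {M : Fin 2 → Fin 2 → Series k}
    (hZ : ∀ i, Z i = M i 0 * bifP k + M i 1 * yv k) :
    HasCharpoly Z (bifP' k * M 0 0 + M 1 1) (bifP' k * (M 0 0 * M 1 1 - M 0 1 * M 1 0)) := by
  have hZI : ∀ i, Z i ∈ singIdeal k := fun i => by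
    rw [hZ]; exact Ideal.mem_span_pair.2 ⟨_, _, rfl⟩
  have hP : lieDeriv Z (bifP k) = bifP' k * (M 0 0 * bifP k + M 0 1 * yv k) := by
    rw [lieDeriv_of_res Z res_bifP, pderiv_bifP, hZ, mul_comm]
  have hy : lieDeriv Z (yv k) = M 1 0 * bifP k + M 1 1 * yv k := by rw [lieDeriv_X, hZ]
  intro f hf
  obtain ⟨a, b, rfl⟩ := Ideal.mem_span_pair.1 hf
  have hI2 : ∀ f g h, h ∈ singIdeal k → lieDeriv Z f * lieDeriv Z g ∈ singIdeal k ^ 2 ∧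
      h * lieDeriv Z g ∈ singIdeal k ^ 2 := fun f g h hh => by
    rw [pow_two]
    exact ⟨Ideal.mul_mem_mul (lieDeriv_mem_singIdeal hZI f) (lieDeriv_mem_singIdeal hZI g),
      Ideal.mul_mem_mul hh (lieDeriv_mem_singIdeal hZI g)⟩
  have hPI := bifP_mem_singIdeal (k := k)
  have hyI := yv_mem_singIdeal (k := k)
  have e : lieDeriv Z (lieDeriv Z (a * bifP k + b * yv k)) -
      (bifP' k * M 0 0 + M 1 1) * lieDeriv Z (a * bifP k + b * yv k) +
      bifP' k * (M 0 0 * M 1 1 - M 0 1 * M 1 0) * (a * bifP k + b * yv k) =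
      2 * (lieDeriv Z a * lieDeriv Z (bifP k)) + 2 * (lieDeriv Z b * lieDeriv Z (yv k)) +
      bifP k * lieDeriv Z (lieDeriv Z a) + yv k * lieDeriv Z (lieDeriv Z b) +
      a * (bifP k * lieDeriv Z (bifP' k * M 0 0) + yv k * lieDeriv Z (bifP' k * M 0 1)) +
      b * (bifP k * lieDeriv Z (M 1 0) + yv k * lieDeriv Z (M 1 1)) -
      (bifP' k * M 0 0 + M 1 1) * (bifP k * lieDeriv Z a + yv k * lieDeriv Z b) := by
    have hPP : lieDeriv Z (lieDeriv Z (bifP k)) = bifP' k * M 0 0 * lieDeriv Z (bifP k) +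
        bifP' k * M 0 1 * lieDeriv Z (yv k) +
        (bifP k * lieDeriv Z (bifP' k * M 0 0) + yv k * lieDeriv Z (bifP' k * M 0 1)) := by
      rw [hP, mul_add, ← mul_assoc, ← mul_assoc, lieDeriv_add, lieDeriv_mul Z _ (bifP k),
        lieDeriv_mul Z _ (yv k), hP]
      ring
    have hyy : lieDeriv Z (lieDeriv Z (yv k)) = M 1 0 * lieDeriv Z (bifP k) +
        M 1 1 * lieDeriv Z (yv k) +
        (bifP k * lieDeriv Z (M 1 0) + yv k * lieDeriv Z (M 1 1)) := by
      rw [hy, lieDeriv_add, lieDeriv_mul Z _ (bifP k), lieDeriv_mul Z _ (yv k), hy]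
      ring
    simp only [lieDeriv_add, lieDeriv_mul Z a, lieDeriv_mul Z b, lieDeriv_mul Z (bifP k),
      lieDeriv_mul Z (yv k), hPP, hyy]
    rw [hP, hy]
    ring
  rw [e]
  refine sub_mem (add_mem (add_mem (add_mem (add_mem (add_mem (Ideal.mul_mem_left _ _ (hI2 a (bifP k) _ hPI).1)
    (Ideal.mul_mem_left _ _ (hI2 b (yv k) _ hPI).1)) (hI2 0 (lieDeriv Z a) _ hPI).2)
    (hI2 0 (lieDeriv Z b) _ hyI).2) (Ideal.mul_mem_left _ _ (add_mem (hI2 0 _ _ hPI).2 (hI2 0 _ _ hyI).2)))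
    (Ideal.mul_mem_left _ _ (add_mem (hI2 0 _ _ hPI).2 (hI2 0 _ _ hyI).2))) (Ideal.mul_mem_left _ _
      (add_mem (hI2 0 _ _ hPI).2 (hI2 0 _ _ hyI).2))

theorem mul_mem_of_unit {R : Ideal (Series k)} {a f : Series k} (ha : constantCoeff a ≠ 0)
    (h : a * f ∈ R) : f ∈ R := by
  have := Ideal.mul_mem_left R a⁻¹ h
  rwa [← mul_assoc, MvPowerSeries.inv_mul_cancel _ ha, one_mul] at this

/-- The eigenvector `f` with eigenvalue `b ≢ l₂` has eigenvalue `l₁`. -/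
theorem HasCharpoly.eigenvalue {Z : Family k} (hZ : ∀ i, Z i ∈ singIdeal k) {l₁ l₂ f b : Series k}
    (h : HasCharpoly Z (l₁ + l₂) (l₁ * l₂)) (hf : f ∈ singIdeal k) (hb : lieDeriv Z f = b * f)
    (hne : constantCoeff (b - l₂) ≠ 0) : (b - l₁) * f ∈ singIdeal k ^ 2 := by
  refine mul_mem_of_unit hne ?_
  -- `Z·(Z·f) = b² f + f (Z·b)` and the last term lies in the square of the ideal, which leaves `(b
  -- - l₂)(b - l₁) f` there.
  have h1 := h f hf
  have h2 : f * lieDeriv Z b ∈ singIdeal k ^ 2 := by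
    rw [pow_two]; exact Ideal.mul_mem_mul hf (lieDeriv_mem_singIdeal hZ b)
  have := sub_mem h1 h2
  rw [hb, lieDeriv_mul, hb] at this
  convert this using 1
  ring

/-- The quadratic equation `s = 1 + w s ^ 2`. -/
theorem exists_quadratic {w : Series k} (hw : IsConvergent w) (hw0 : constantCoeff w = 0)
    (hwr : res w = w) : ∃ s : Series k, IsConvergent s ∧ res s = s ∧ s = 1 + w * s ^ 2 := by
  obtain ⟨r, hr, h⟩ := exists_bd_le_of_zero (a := fun _ : Unit => w) (fun _ => hw0) (fun _ => hw)
    (ε := 1 / 8) (by norm_num)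
  have hv : ∀ _ : Fin k ⊕ Fin 2, 0 ≤ r := fun _ => hr.le
  obtain ⟨s, ⟨hs1, hs2⟩, hfix⟩ := exists_fixedPoint (ω := wt k)
    ({s : Series k | ∀ d ∈ {d : Fin k ⊕ Fin 2 →₀ ℕ | d (Sum.inr 1) ≠ 0}, coeff d s = 0} ∩
      {s | Bd (fun _ => r) s 2}) (fun s => 1 + w * s ^ 2)
    ⟨0, fun d _ => by simp, (Bd.zero _).mono (by norm_num)⟩
    (fun s hs => ⟨setZero_eq_self_iff.1 (by
      rw [map_add, map_one, map_mul, map_pow, hwr, setZero_eq_self_iff.2 hs.1]),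
      ((Bd.one hv).add hv ((h ()).mul hv (hs.2.pow hv 2))).mono (by norm_num)⟩)
    ((stable_coeff _).inter (stable_Bd _ _)) (fun s _ s' _ n hn => by
      have e : 1 + w * s ^ 2 - (1 + w * s' ^ 2) = w * ((s - s') * (s + s')) := by ring
      rw [e]
      exact mul_mem_fil_of_le ((mem_fil_one wt_ne_zero).2 hw0) (Ideal.mul_mem_right _ _ hn)
        (by omega))
  exact ⟨s, hs2.isConvergent fun _ => hr, setZero_eq_self_iff.2 hs1, hfix.symm⟩

end

end SaddleNode

/-! ### Formal reduction to the normal form with matching eigenvalues -/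

namespace SaddleNode

open Filter Topology MvPowerSeries

noncomputable section

variable {k : ℕ}

theorem constantCoeff_bifP' (hk : 0 < k) : constantCoeff (bifP' k) = 0 :=
  (mem_fil_one wt_ne_zero).1 (fil_anti (by omega) bifP'_mem_fil)

theorem singIdeal_le_fil_three (hk : 0 < k) : singIdeal k ≤ fil (wt k) 3 := by
  refine Ideal.span_le.2 ?_
  rintro f (rfl | rfl)
  · exact fil_anti (by omega) bifP_mem_fil
  · exact yv_mem_fil

/-- The polynomial `∑ r_i X^i`. -/
def polyC (r : Fin (k + 1) → ParamSeries k) : Polynomial (Series k) :=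
  ∑ i, Polynomial.C (liftParam k (r i)) * Polynomial.X ^ (i : ℕ)

theorem eval_polyC (r : Fin (k + 1) → ParamSeries k) (f : Series k) :
    (polyC r).eval f = ∑ i, liftParam k (r i) * f ^ (i : ℕ) := by
  simp [polyC, Polynomial.eval_finsetSum]

theorem eval_polyC_xv (r : Fin (k + 1) → ParamSeries k) : (polyC r).eval (xv k) = polyX r :=
  eval_polyC _ _

theorem res_eval_polyC (r : Fin (k + 1) → ParamSeries k) (f : Series k) :
    res ((polyC r).eval f) = (polyC r).eval (res f) := by
  simp only [eval_polyC, map_sum, map_mul, map_pow, res_liftParam]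

/-- The polynomial `1 + μ X^k`. -/
def onePlus (μ : ParamSeries k) : Polynomial (Series k) :=
  1 + Polynomial.C (liftParam k μ) * Polynomial.X ^ k

theorem eval_onePlus (μ : ParamSeries k) (f : Series k) :
    (onePlus μ).eval f = 1 + liftParam k μ * f ^ k := by
  simp [onePlus]

theorem res_eval_onePlus (μ : ParamSeries k) (f : Series k) :
    res ((onePlus μ).eval f) = (onePlus μ).eval (res f) := by
  simp only [eval_onePlus, map_add, map_one, map_mul, map_pow, res_liftParam]

theorem constantCoeff_onePlus (hk : 0 < k) (μ : ParamSeries k) {f : Series k}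
    (hf : constantCoeff f = 0) : constantCoeff (1 + liftParam k μ * f ^ k) = 1 := by
  rw [map_add, map_one, map_mul, map_pow, hf, zero_pow hk.ne', mul_zero, add_zero]

theorem normalForm_zero (I : FormalInvariant k) : normalForm I 0 = polyX I.u * bifP k := rfl

theorem normalForm_one (I : FormalInvariant k) :
    normalForm I 1 = polyX I.u * (yv k * (1 + liftParam k I.mu * xv k ^ k)) := rfl

theorem pull_normalForm_zero (Ψ : FormalChange k) (I : FormalInvariant k) :
    Ψ.pull (normalForm I 0) = (∑ i, liftParam k (subst Ψ.par (I.u i)) * Ψ.map 0 ^ (i : ℕ)) *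
      bifPoly (fun j => liftParam k (Ψ.par j)) (Ψ.map 0) := by
  rw [normalForm_zero, Ψ.pull_mul, pull_bifP, Ψ.pull_polyX]

theorem pull_normalForm_one (Ψ : FormalChange k) (I : FormalInvariant k) :
    Ψ.pull (normalForm I 1) = (∑ i, liftParam k (subst Ψ.par (I.u i)) * Ψ.map 0 ^ (i : ℕ)) *
      (Ψ.map 1 * (1 + liftParam k (subst Ψ.par I.mu) * Ψ.map 0 ^ k)) := by
  rw [normalForm_one, Ψ.pull_mul, Ψ.pull_polyX, Ψ.pull_mul, Ψ.pull_add, Ψ.pull_mul, Ψ.pull_pow,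
    Ψ.pull_one, Ψ.pull_inr, Ψ.pull_inr, Ψ.pull_liftParam]

theorem res_of_mul {f g : Series k} (hf : res f = f) (hf0 : f ≠ 0) (h : res (f * g) = f * g) :
    res g = g := by
  rw [map_mul, hf] at h
  exact mul_left_cancel₀ hf0 h

/-- The formal step: a family whose linear part on the conormal module of the singular points has
the same trace and determinant as that of the normal form is conjugate to it. -/
theorem exists_conjugates_normalForm (hk : 0 < k) {Z : Family k} {l : ℂ} (I : FormalInvariant k)
    (hZ : ∀ i, Z i ∈ singIdeal k) (h1 : Z 1 - l • yv k ∈ fil (wt k) 4) (hl : l ≠ 0)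
    (hc : HasCharpoly Z
      (polyX I.u * bifP' k + polyX I.u * (1 + liftParam k I.mu * xv k ^ k))
      ((polyX I.u * bifP' k) * (polyX I.u * (1 + liftParam k I.mu * xv k ^ k)))) :
    ∃ N : FormalChange k, N.FixesParam ∧ Conjugates N Z (normalForm I) := by
  obtain ⟨Ψ, F, A, hΨ, hF, hA, hAl, hΨ0, hΨ1, hconj⟩ :=
    exists_poincareDulac (singIdeal_le_fil_three hk (hZ 0)) h1 hl
  have hu0 : constantCoeff (polyX I.u) ≠ 0 := by rw [constantCoeff_polyX]; exact I.u_ne_zero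
  have hP'0 := constantCoeff_bifP' hk
  have hm0 : constantCoeff (1 + liftParam k I.mu * xv k ^ k) = 1 :=
    constantCoeff_onePlus hk _ (constantCoeff_X _)
  have hc0 : lieDeriv Z (Ψ.map 0) = Ψ.pull F := hconj 0
  have hc1 : lieDeriv Z (Ψ.map 1) = Ψ.pull A * Ψ.map 1 := by
    have : lieDeriv Z (Ψ.map 1) = Ψ.pull (A * yv k) := hconj 1
    rw [this, Ψ.pull_mul, Ψ.pull_inr]
  -- All derivatives along `Z` lie in `(P, y)`; on `y = 0` this says that the reduced field vanishes
  -- where `P` does.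
  obtain ⟨g, hg⟩ : bifP k ∣ F := by
    have := bifP_dvd_res (lieDeriv_mem_singIdeal hZ (Ψ.map 0))
    rwa [hc0, FormalChange.res_pull_of_res hΨ hΨ0 hF] at this
  have hgr : res g = g := res_of_mul res_bifP bifP_ne_zero (by rw [← hg, hF])
  -- `P ∘ Ψ` is an eigenvector whose eigenvalue `(P' g) ∘ Ψ` differs by a unit from `u (1 + μ x^k)`.
  -- So `P' g ≡ P' u` modulo `P`, and `P'` can be cancelled because `P` is prime and does not divide
  -- it.
  obtain ⟨g₁, hg₁⟩ : bifP k ∣ g - polyX I.u := by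
    have hres : res (Ψ.pull (bifP k)) = bifP k := FormalChange.res_pull_of_res hΨ hΨ0 res_bifP
    have hmem : Ψ.pull (bifP k) ∈ singIdeal k := mem_singIdeal_of_res (by rw [hres])
    have hb : lieDeriv Z (Ψ.pull (bifP k)) = Ψ.pull (bifP' k * g) * Ψ.pull (bifP k) := by
      rw [hconj.lieDeriv_pull, lieDeriv_of_res _ res_bifP, pderiv_bifP, ← Ψ.pull_mul]
      congr 1
      rw [show (![F, A * yv k] : Family k) 0 = F from rfl, hg]
      ring
    have h2 := sq_dvd_res (hc.eigenvalue hZ hmem hb (by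
      rw [map_sub, Ψ.constantCoeff_pull, map_mul, map_mul, hP'0, zero_mul, zero_sub, hm0, mul_one]
      exact neg_ne_zero.2 hu0))
    rw [map_mul, map_sub, hres, FormalChange.res_pull_of_res hΨ hΨ0 (by
      rw [map_mul, res_bifP', hgr]), map_mul, res_polyX, res_bifP', pow_two] at h2
    have h3 := (mul_dvd_mul_iff_right (bifP_ne_zero (k := k))).1 h2
    refine bifP_dvd_of_dvd_mul hk ?_
    convert h3 using 1
    ring
  -- The second component of `Ψ` is an eigenvector with eigenvalue `A ∘ Ψ`, a unit, hence not
  -- congruent at the origin to `u P'`.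
  obtain ⟨m, hm⟩ : bifP k ∣ A - polyX I.u * (1 + liftParam k I.mu * xv k ^ k) := by
    have hmem : Ψ.map 1 ∈ singIdeal k := by
      refine mul_mem_of_unit (a := Ψ.pull A) (by rw [Ψ.constantCoeff_pull, hAl]; exact hl) ?_
      rw [← hc1]
      exact lieDeriv_mem_singIdeal hZ _
    rw [add_comm, mul_comm (polyX I.u * bifP' k)] at hc
    have h2 := bifP_dvd_yc (hc.eigenvalue hZ hmem hc1 (by
      rw [map_sub, Ψ.constantCoeff_pull, map_mul, hP'0, mul_zero, sub_zero, hAl]; exact hl))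
    rw [yc_mul, hΨ1, mul_one, map_sub, FormalChange.res_pull_of_res hΨ hΨ0 hA] at h2
    have h3 := (dvd_add_left ((bifP_dvd_res hmem).mul_right _)).1 h2
    rwa [map_mul, res_polyX, map_add, map_one, map_mul, map_pow, res_liftParam, res_xv] at h3
  have hg0 : constantCoeff g ≠ 0 := by
    have : g = polyX I.u + bifP k * g₁ := by rw [← hg₁]; ring
    rw [this, map_add, map_mul, constantCoeff_bifP, zero_mul, add_zero]
    exact hu0
  -- `g ≡ u` modulo `P`, so `P g ∂/∂x` and `P u ∂/∂x` agree modulo `P²` and a map `x + P q`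
  -- conjugates them. The resonant coefficient is arbitrary and is set to `0`.
  obtain ⟨q, hq, -, hode⟩ := exists_conj_mod_sq (b := polyC I.u) (c := 1) (g := g) (g₁ := g₁)
    (res_eval_polyC _) (fun f => by simp) hgr (by rwa [eval_polyC_xv])
    (by rw [eval_polyC_xv, Polynomial.eval_one, ← hg₁]; ring) 0
  rw [Polynomial.eval_one, mul_one] at hode
  have hX3 : res (xv k + bifP k * q) = xv k + bifP k * q := by
    rw [map_add, map_mul, res_xv, res_bifP, hq]
  have hw := eval_add_eq_quot₁ (polyC I.u * onePlus I.mu) (xv k) (bifP k * q)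
  obtain ⟨w₁, hw₁⟩ : ∃ w₁, w₁ = q * quot₁ (polyC I.u * onePlus I.mu) (xv k) (bifP k * q) - m :=
    ⟨_, rfl⟩
  obtain ⟨X3, hX3e⟩ : ∃ X3, X3 = xv k + bifP k * q := ⟨_, rfl⟩
  rw [← hX3e] at hode hX3 hw
  have hPw : bifP k * w₁ = (polyC I.u * onePlus I.mu).eval X3 - A := by
    rw [hw, hw₁, Polynomial.eval_mul, eval_polyC_xv, eval_onePlus, mul_sub, ← hm]
    ring
  have hw₁r : res w₁ = w₁ := res_of_mul res_bifP bifP_ne_zero (by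
    rw [hPw, map_sub, Polynomial.eval_mul, map_mul, res_eval_polyC, res_eval_onePlus, hX3, hA])
  -- The factor `y ↦ y v` must correct the rate of `y` by `P w₁`. Along `P g ∂/∂x` the `P` cancels,
  -- leaving the regular equation `g v' = w₁ v`.
  obtain ⟨v, hv, hv0, hvd⟩ := exists_linear_ode (w := g⁻¹ * w₁) (by
    rw [map_mul, setZero_inv hg0, hgr, hw₁r])
  have hvd' : g * pderiv ℂ (Sum.inr 0) v = w₁ * v := by
    rw [hvd, ← mul_assoc, ← mul_assoc, MvPowerSeries.mul_inv_cancel _ hg0, one_mul]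
  have hPq : bifP k * q ∈ fil (wt k) 4 := Ideal.mul_mem_right _ _ (fil_anti (by omega) bifP_mem_fil)
  obtain ⟨Ψ₃, hp, hX, hY⟩ := exists_formalChange (k := k) (p := X) (f := X3) (g := yv k * v)
    (fun j => constantCoeff_X _) (by rw [jacobianAtZero_X]; simp) (by
      rw [hX3e, map_add, map_mul, constantCoeff_bifP, zero_mul, add_zero, constantCoeff_X])
    (by rw [map_mul, constantCoeff_X, zero_mul]) (by
      rw [hX3e, map_add, hPq _ (by rw [Finsupp.weight_single, wt_x]; norm_num), add_zero,
        coeff_single_eq, pderiv_X_self, map_one]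
      exact one_ne_zero)
    ((Ideal.mul_mem_right v _ yv_mem_fil : yv k * v ∈ fil (wt k) 3) _
      (by rw [Finsupp.weight_single, wt_x]; norm_num)) (by
      rw [coeff_single_eq, Derivation.leibniz, pderiv_X_self, map_add, smul_eq_mul, smul_eq_mul,
        map_mul, constantCoeff_X, zero_mul, zero_add, mul_one, hv0]
      exact one_ne_zero)
  have hfix : Ψ₃.FixesParam := fun j => by rw [hp]
  refine ⟨Ψ₃.comp Ψ, fun j => by rw [FormalChange.comp_par, hfix j, hΨ.subst], hconj.comp ?_⟩
  intro i
  fin_cases i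
  · change lieDeriv _ (Ψ₃.map 0) = Ψ₃.pull (normalForm I 0)
    rw [pull_normalForm_zero, hX, lieDeriv_of_res _ hX3, show (![F, A * yv k] : Family k) 0 = F
      from rfl, hg, hode, eval_polyC]
    simp_rw [hfix.subst, hfix.par_eq]
  · change lieDeriv _ (Ψ₃.map 1) = Ψ₃.pull (normalForm I 1)
    rw [pull_normalForm_one, hX, hY, lieDeriv_mul, lieDeriv_X, lieDeriv_of_res _ hv,
      show (![F, A * yv k] : Family k) 0 = F from rfl,
      show (![F, A * yv k] : Family k) 1 = A * yv k from rfl]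
    simp_rw [hfix.subst]
    rw [← eval_polyC, ← eval_onePlus]
    rw [Polynomial.eval_mul] at hPw
    have e : A = (polyC I.u).eval X3 * (onePlus I.mu).eval X3 - bifP k * w₁ := by rw [hPw]; ring
    rw [hg, e]
    linear_combination (bifP k * yv k) * hvd'

end

end SaddleNode

/-! ### Convergent invariants from the eigenvalues along the singular points, and existence -/

namespace SaddleNode

open Filter Topology MvPowerSeries

noncomputable section

variable {k : ℕ}

theorem sub_res_mem_singIdeal (f : Series k) : f - res f ∈ singIdeal k :=
  mem_singIdeal_of_res (by rw [map_sub, setZero_setZero, sub_self]; exact dvd_zero _)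

/-- One of the roots of `X ^ 2 - τ X + P' D` is divisible by `P'`. -/
theorem exists_eigenvalue (hk : 0 < k) {τ D : Series k} (hτ : IsConvergent τ) (hD : IsConvergent D)
    (hrτ : res τ = τ) (hrD : res D = D) (hτ0 : constantCoeff τ ≠ 0) (hD0 : constantCoeff D ≠ 0) :
    ∃ h : Series k, IsConvergent h ∧ res h = h ∧ constantCoeff h ≠ 0 ∧
      bifP' k * h * (τ - bifP' k * h) = bifP' k * D := by
  have hτi := hτ.inv hτ0
  have hri : res τ⁻¹ = τ⁻¹ := by rw [setZero_inv hτ0, hrτ]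
  have hti := MvPowerSeries.mul_inv_cancel _ hτ0
  -- The root is sought as `P' D s / τ`, close to determinant over trace; the characteristic
  -- equation becomes `s = 1 + (P' D / τ²) s²`.
  obtain ⟨s, hs, hrs, h⟩ := exists_quadratic (k := k) (w := bifP' k * D * τ⁻¹ ^ 2)
    ((isConvergent_bifP'.mul hD).mul (hτi.pow 2)) (by
      rw [map_mul, map_mul, constantCoeff_bifP' hk, zero_mul, zero_mul])
    (by rw [map_mul, map_mul, map_pow, res_bifP', hrD, hri])
  refine ⟨D * τ⁻¹ * s, (hD.mul hτi).mul hs, by rw [map_mul, map_mul, hrD, hri, hrs], ?_, ?_⟩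
  · have hs0 : constantCoeff s = 1 := by
      rw [h, map_add, map_mul, map_mul, map_mul, constantCoeff_bifP' hk, zero_mul, zero_mul,
        zero_mul, map_one, add_zero]
    rw [map_mul, map_mul, hs0, mul_one]
    refine mul_ne_zero hD0 fun h0 => ?_
    have := congrArg constantCoeff hti
    rw [map_mul, h0, mul_zero, map_one] at this
    exact zero_ne_one this
  · linear_combination (bifP' k * D * s) * hti + bifP' k * D * h

/-- All choices that must converge are made here. The eigenvalues on the conormal module are
analytic, and the normal form with invariant `(μ, u)` is made to have the same ones modulo `(P, y)`.
The formal reduction that follows fixes the parameter, so it does not spoil the convergence of `φ`.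
-/
theorem exists_adapted (hk : 0 < k) {Z : Family k} (hZ : IsGenericUnfolding Z) :
    ∃ (N : FormalChange k) (Z' : Family k) (I : FormalInvariant k) (l : ℂ),
      (∀ j, IsConvergent (N.par j)) ∧ Conjugates N Z Z' ∧ (∀ i, Z' i ∈ singIdeal k) ∧
      Z' 1 - l • yv k ∈ fil (wt k) 4 ∧ l ≠ 0 ∧
      HasCharpoly Z'
        (polyX I.u * bifP' k + polyX I.u * (1 + liftParam k I.mu * xv k ^ k))
        ((polyX I.u * bifP' k) * (polyX I.u * (1 + liftParam k I.mu * xv k ^ k))) := by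
  obtain ⟨Φ, Z', M, hΦ, hconj, hM, hZ', hdet, hM11⟩ := hZ.exists_matrix hk
  have hZI : ∀ i, Z' i ∈ singIdeal k := fun i => by
    rw [hZ']; exact Ideal.mem_span_pair.2 ⟨_, _, rfl⟩
  have hP'0 := constantCoeff_bifP' hk
  have hm : ∀ i j, IsConvergent (res (M i j)) := fun i j => (hM i j).setZero _
  have hmr : ∀ i j, res (res (M i j)) = res (M i j) := fun i j => setZero_setZero _ _
  obtain ⟨τ, hτ⟩ : ∃ τ, τ = res (M 1 1) + bifP' k * res (M 0 0) := ⟨_, rfl⟩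
  obtain ⟨D, hD⟩ : ∃ D, D = res (M 0 0) * res (M 1 1) - res (M 0 1) * res (M 1 0) := ⟨_, rfl⟩
  have hτc : IsConvergent τ := by
    rw [hτ]; exact (hm 1 1).add (isConvergent_bifP'.mul (hm 0 0))
  have hτr : res τ = τ := by rw [hτ, map_add, map_mul, hmr, hmr, res_bifP']
  have hτ0 : constantCoeff τ ≠ 0 := by
    rw [hτ, map_add, map_mul, hP'0, zero_mul, add_zero, constantCoeff_setZero]
    exact hM11
  obtain ⟨h, hhc, hhr, hh0, hh⟩ := exists_eigenvalue hk (τ := τ) (D := D) hτc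
    (by rw [hD]; exact ((hm 0 0).mul (hm 1 1)).sub ((hm 0 1).mul (hm 1 0))) hτr
    (by rw [hD, map_sub, map_mul, map_mul, hmr, hmr, hmr, hmr]) hτ0 (by
      rw [hD, ← map_mul, ← map_mul, ← map_sub, constantCoeff_setZero]; exact hdet)
  have hchar : HasCharpoly Z' τ (bifP' k * D) := by
    refine (hasCharpoly_of_matrix hZ').congr hZI ?_ ?_
    · rw [hτ]
      convert add_mem (Ideal.mul_mem_left _ (bifP' k) (sub_res_mem_singIdeal (M 0 0)))
        (sub_res_mem_singIdeal (M 1 1)) using 1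
      ring
    · rw [hD, ← map_mul, ← map_mul, ← map_sub, ← mul_sub]
      exact Ideal.mul_mem_left _ _ (sub_res_mem_singIdeal _)
  obtain ⟨l₂, hl₂⟩ : ∃ l₂, l₂ = τ - bifP' k * h := ⟨_, rfl⟩
  rw [← hl₂] at hh
  have hl₂c : IsConvergent l₂ := by rw [hl₂]; exact hτc.sub (isConvergent_bifP'.mul hhc)
  have hl₂r : res l₂ = l₂ := by rw [hl₂, map_sub, map_mul, hτr, res_bifP', hhr]
  have hl₂0 : constantCoeff l₂ ≠ 0 := by
    rwa [hl₂, map_sub, map_mul, hP'0, zero_mul, sub_zero]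
  have hl₂i := MvPowerSeries.mul_inv_cancel _ hl₂0
  have hl₂i0 : constantCoeff l₂⁻¹ ≠ 0 := fun h0 => by
    have := congrArg constantCoeff hl₂i
    rw [map_mul, h0, mul_zero, map_one] at this
    exact zero_ne_one this
  -- The ratio `P' h / l₂` of the eigenvalues is insensitive to multiplication of the field by a
  -- unit. Its normalisation gives `φ` and `μ`, leaving the common factor of the eigenvalues to `u`.
  obtain ⟨W, hW⟩ : ∃ W, W = h * l₂⁻¹ := ⟨_, rfl⟩
  obtain ⟨X, φ, μ, hXc, hφc, hμc, hXr, hX0, hX1, hφ0, hφd, hnorm⟩ := exists_normalisation_x hk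
    (W := W) (by rw [hW, map_mul, setZero_inv hl₂0, hl₂r, hhr]) (by
      rw [hW]; exact hhc.mul (hl₂c.inv hl₂0)) (by rw [hW, map_mul]; exact mul_ne_zero hh0 hl₂i0)
  obtain ⟨K, hKp, hK0, hK1⟩ := exists_formalChange (g := yv k) hφ0 hφd hX0 (constantCoeff_X _) hX1
    (yv_mem_fil _ (by rw [Finsupp.weight_single, wt_x]; norm_num)) (by
      rw [coeff_single_eq, pderiv_X_self, map_one]; exact one_ne_zero)
  have hKan : K.IsAnalytic := ⟨fun j => by rw [hKp]; exact hφc j, fun i => by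
    fin_cases i
    · exact hK0 ▸ hXc
    · exact hK1 ▸ isConvergent_X _⟩
  obtain ⟨Θ, hKΘ, hΘK, hpar, -, -, hΘan⟩ := K.exists_inv
  replace hΘan := hΘan hKan
  obtain ⟨Z₁, hconj₁, -⟩ := exists_conjugates K Z'
  -- the unit `u`
  obtain ⟨w, hw⟩ : ∃ w : Series k, w = 1 + liftParam k μ * X ^ k := ⟨_, rfl⟩
  have hw0 : constantCoeff w = 1 := by rw [hw]; exact constantCoeff_onePlus hk _ hX0
  have hwc : IsConvergent w := by
    rw [hw]; exact isConvergent_one.add (hμc.liftParam.mul (hXc.pow k))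
  have hwr : res w = w := by
    rw [hw, map_add, map_one, map_mul, map_pow, res_liftParam, hXr]
  have hw0' : constantCoeff w ≠ 0 := by rw [hw0]; exact one_ne_zero
  have hwi := MvPowerSeries.mul_inv_cancel _ hw0'
  have hwi0 : constantCoeff w⁻¹ = 1 := by
    have := congrArg constantCoeff hwi
    rwa [map_mul, hw0, one_mul, map_one] at this
  have hresΘ : ∀ f, res f = f → res (Θ.pull f) = Θ.pull f := by
    intro f hf
    have := K.res_pull (Θ.pull f) (by rw [hK0, hXr]) (by rw [hK1, res_yv])
    rw [hKΘ, hf] at this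
    exact (hΘK _).symm.trans (congrArg Θ.pull this.symm)
  -- Only the class of `u` modulo `P` enters the eigenvalues, so the remainder of degree at most `k`
  -- suffices; it is formed in the new coordinates, where `u` lives.
  obtain ⟨q, u, -, hu, hdiv⟩ := exists_division (f := Θ.pull (l₂ * w⁻¹))
    (hresΘ _ (by rw [map_mul, setZero_inv hw0', hl₂r, hwr]))
    (hΘan.pull (hl₂c.mul (hwc.inv hw0')))
  have hu0 : constantCoeff (u 0) ≠ 0 := by
    have := congrArg constantCoeff hdiv
    rw [Θ.constantCoeff_pull, map_mul, hwi0, mul_one, map_add, map_mul, constantCoeff_bifP, mul_zero,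
      zero_add, constantCoeff_polyX] at this
    rwa [← this]
  -- images of the equations
  obtain ⟨E₁, hE₁⟩ : ∃ E₁, E₁ = W * pderiv ℂ (Sum.inr 0) X * w := ⟨_, rfl⟩
  have hX' : constantCoeff (pderiv ℂ (Sum.inr 0) X) ≠ 0 := by rwa [← coeff_single_eq]
  have hKP : K.pull (bifP k) = bifP k * E₁ := by
    rw [pull_bifP, hK0, hKp, ← hnorm, hE₁, hw]; ring
  have hE₁0 : constantCoeff E₁ ≠ 0 := by
    rw [hE₁, hW, map_mul, map_mul, map_mul, hw0, mul_one]
    exact mul_ne_zero (mul_ne_zero hh0 hl₂i0) hX'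
  have hKPI : K.pull (bifP k) ∈ singIdeal k := by
    rw [hKP]; exact Ideal.mul_mem_right _ _ bifP_mem_singIdeal
  have hΘP : bifP k = Θ.pull (bifP k) * Θ.pull E₁ := by rw [← Θ.pull_mul, ← hKP, hΘK]
  have hΘE : constantCoeff (Θ.pull E₁) ≠ 0 := by rwa [Θ.constantCoeff_pull]
  have hΘPI : Θ.pull (bifP k) ∈ singIdeal k := by
    refine mul_mem_of_unit hΘE ?_
    rw [mul_comm, ← hΘP]
    exact bifP_mem_singIdeal
  have hΘy : Θ.map 1 = yv k := by
    have := hΘK (yv k)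
    rwa [K.pull_inr, hK1, Θ.pull_inr] at this
  have hΘyI : Θ.map 1 ∈ singIdeal k := by rw [hΘy]; exact yv_mem_singIdeal
  have hZ₁ : ∀ i, Z₁ i = Θ.pull (lieDeriv Z' (K.map i)) := fun i => by rw [hconj₁ i, hΘK]
  have hZ₁I : ∀ i, Z₁ i ∈ singIdeal k := fun i => by
    rw [hZ₁]; exact pull_mem_singIdeal hΘPI hΘyI (lieDeriv_mem_singIdeal hZI _)
  have hKu : K.pull (polyX u) - l₂ * w⁻¹ ∈ singIdeal k := by
    have : K.pull (polyX u) - l₂ * w⁻¹ = - (K.pull q * K.pull (bifP k)) := by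
      rw [← K.pull_mul, ← hKΘ (l₂ * w⁻¹), hdiv, K.pull_add]
      ring
    rw [this]
    exact neg_mem (Ideal.mul_mem_left _ _ hKPI)
  -- Differentiating `P_φ(X) = P W X' w` and dropping the multiples of `P` gives the claim
  -- multiplied by the unit `X'`.
  have hE : K.pull (bifP' k) - bifP' k * W * w ∈ singIdeal k := by
    refine mul_mem_of_unit hX' ?_
    have h1 := congrArg (pderiv ℂ (Sum.inr 0)) hnorm
    rw [← hw, derivation_bifPoly] at h1
    simp only [pderiv_liftParam, zero_mul, Finset.sum_const_zero, add_zero] at h1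
    have e : bifP k * W * pderiv ℂ (Sum.inr 0) X * w =
      bifP k * (W * pderiv ℂ (Sum.inr 0) X * w) := by ring
    rw [e, Derivation.leibniz, pderiv_bifP, smul_eq_mul, smul_eq_mul] at h1
    rw [K.pull_bifP', hK0, hKp]
    have e2 : pderiv ℂ (Sum.inr 0) X * (bifDer (fun j => liftParam k (φ j)) X - bifP' k * W * w) =
        bifP k * pderiv ℂ (Sum.inr 0) (W * pderiv ℂ (Sum.inr 0) X * w) := by
      linear_combination -h1
    rw [e2]
    exact Ideal.mul_mem_right _ _ bifP_mem_singIdeal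
  have hμ' : K.pull (1 + liftParam k (subst Θ.par μ) * xv k ^ k) = w := by
    rw [K.pull_add, K.pull_one, K.pull_mul, K.pull_pow, K.pull_inr, K.pull_liftParam, hpar, hK0, hw]
  have hl₁ : K.pull (polyX u * bifP' k) - bifP' k * h ∈ singIdeal k := by
    have e : K.pull (polyX u * bifP' k) - bifP' k * h =
        (K.pull (polyX u) - l₂ * w⁻¹) * K.pull (bifP' k) +
          l₂ * w⁻¹ * (K.pull (bifP' k) - bifP' k * W * w) := by
      rw [K.pull_mul, hW]
      linear_combination (bifP' k * h * w * w⁻¹) * hl₂i + bifP' k * h * hwi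
    rw [e]
    exact add_mem (Ideal.mul_mem_right _ _ hKu) (Ideal.mul_mem_left _ _ hE)
  have hl₂' : K.pull (polyX u * (1 + liftParam k (subst Θ.par μ) * xv k ^ k)) - l₂ ∈ singIdeal k := by
    have e : K.pull (polyX u * (1 + liftParam k (subst Θ.par μ) * xv k ^ k)) - l₂ =
        (K.pull (polyX u) - l₂ * w⁻¹) * w := by
      rw [K.pull_mul, hμ']
      linear_combination l₂ * hwi
    rw [e]
    exact Ideal.mul_mem_right _ _ hKu
  refine ⟨K.comp Φ, Z₁, ⟨subst Θ.par μ, u, hμc.subst Θ.par_zero hΘan.1, hu, hu0⟩,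
    constantCoeff (M 1 1), fun j => ?_, hconj.comp hconj₁, hZ₁I, ?_, hM11, ?_⟩
  · rw [FormalChange.comp_par]
    exact (hKan.1 j).subst Φ.par_zero hΦ.1
  · rw [hZ₁, hK1, lieDeriv_X, hZ', Θ.pull_add, Θ.pull_mul, Θ.pull_mul, Θ.pull_inr, hΘy]
    have e : Θ.pull (M 1 0) * Θ.pull (bifP k) + Θ.pull (M 1 1) * yv k -
        constantCoeff (M 1 1) • yv k = Θ.pull (M 1 0) * Θ.pull (bifP k) +
          (Θ.pull (M 1 1) - C (constantCoeff (M 1 1))) * yv k := by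
      rw [smul_eq_C_mul]; ring
    rw [e]
    refine add_mem (Ideal.mul_mem_left _ _ ?_) ?_
    · refine mul_mem_of_unit hΘE ?_
      rw [mul_comm, ← hΘP]
      exact fil_anti (by omega) bifP_mem_fil
    · refine mul_mem_fil_of_le (s := 1) ?_ yv_mem_fil (by omega)
      rw [mem_fil_one wt_ne_zero, map_sub, Θ.constantCoeff_pull, constantCoeff_C, sub_self]
  · refine HasCharpoly.of_pull hconj₁ hΘK hKPI (by rw [hK1]; exact yv_mem_singIdeal) hΘPI hΘyI ?_
    refine hchar.congr hZI ?_ ?_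
    · have := add_mem hl₁ hl₂'
      rw [K.pull_add, ← neg_mem_iff]
      convert this using 1
      rw [hl₂]
      ring
    · rw [K.pull_mul, ← neg_mem_iff]
      have := add_mem (Ideal.mul_mem_right (K.pull (polyX u *
        (1 + liftParam k (subst Θ.par μ) * xv k ^ k))) _ hl₁)
        (Ideal.mul_mem_left _ (bifP' k * h) hl₂')
      convert this using 1
      linear_combination hh

theorem existence (hk : 0 < k) {Z : Family k} (hZ : IsGenericUnfolding Z) :
    ∃ (I : FormalInvariant k) (N : FormalChange k), (∀ j, IsConvergent (N.par j)) ∧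
      Conjugates N Z (normalForm I) := by
  obtain ⟨N, Z', I, l, hN, hconj, hZ', h1, hl, hchar⟩ := exists_adapted hk hZ
  obtain ⟨N', hfix, hconj'⟩ := exists_conjugates_normalForm hk I hZ' h1 hl hchar
  exact ⟨I, N'.comp N, fun j => by
    rw [FormalChange.comp_par, hfix j, subst_X (hasSubst_of_zero N.par_zero)]; exact hN j,
    hconj.comp hconj'⟩

end

end SaddleNode

/-! ### Equivalences of normal forms along the invariant curve `y = 0` -/

namespace SaddleNode

open Filter Topology MvPowerSeries

noncomputable section

variable {k : ℕ}

theorem yv_ne_zero : yv k ≠ 0 := fun h => by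
  have := congrArg (pderiv ℂ (Sum.inr 1)) h
  rw [pderiv_X_self, map_zero] at this
  exact one_ne_zero this

theorem FormalChange.jacobian_ne_zero (Ψ : FormalChange k) :
    constantCoeff (pderiv ℂ (Sum.inr 0) (Ψ.map 0)) * constantCoeff (pderiv ℂ (Sum.inr 1) (Ψ.map 1)) -
      constantCoeff (pderiv ℂ (Sum.inr 1) (Ψ.map 0)) *
        constantCoeff (pderiv ℂ (Sum.inr 0) (Ψ.map 1)) ≠ 0 := by
  have h := Ψ.map_invertible
  have c : ∀ i j, jacobianAtZero (atParamZero Ψ.map) i j =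
      constantCoeff (pderiv ℂ (Sum.inr j) (Ψ.map i)) := fun i j => coeff_single_killCompl _ _
  rwa [Matrix.det_fin_two, c, c, c, c] at h

theorem res_bifPoly (φ : Fin k → ParamSeries k) (f : Series k) :
    res (bifPoly (fun j => liftParam k (φ j)) f) = bifPoly (fun j => liftParam k (φ j)) (res f) := by
  simp only [bifPoly, map_add, map_sum, map_mul, map_pow, res_liftParam]

/-- Among all monomials only `1` and `x` have weight less than `3`. -/
theorem mem_fil_three {f : Series k} (h0 : constantCoeff f = 0)
    (h1 : coeff (Finsupp.single (Sum.inr 0) 1) f = 0) : f ∈ fil (wt k) 3 := by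
  intro d hd
  have h : ∀ i, i ≠ Sum.inr 0 → d i = 0 := by
    intro i hi
    by_contra hne
    have h2 := Finsupp.le_weight_of_ne_zero' (wt k) hne
    have h3 : 3 ≤ wt k i := by
      rcases i with j | i
      · have := j.2
        simp only [wt, Sum.elim_inl]
        omega
      · fin_cases i
        · exact absurd rfl hi
        · exact le_rfl
    omega
  have hd' : d = Finsupp.single (Sum.inr 0) (d (Sum.inr 0)) := by
    ext i
    rcases eq_or_ne i (Sum.inr 0) with rfl | hi
    · simp
    · rw [h i hi, Finsupp.single_eq_of_ne hi]
  rw [hd', Finsupp.weight_single, wt_x, smul_eq_mul] at hd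
  have h2 : d (Sum.inr 0) = 0 ∨ d (Sum.inr 0) = 1 := by omega
  rcases h2 with h2 | h2
  · rw [hd', h2, Finsupp.single_zero]; exact h0
  · rw [hd', h2]; exact h1

theorem coeff_single_liftParam_mul {p : ParamSeries k} (hp : constantCoeff p = 0) (f : Series k)
    (n : ℕ) : coeff (Finsupp.single (Sum.inr 0) n) (liftParam k p * f) = 0 := by
  have h := congrArg (coeff 0) (xc_liftParam_mul n p f)
  rw [coeff_xc, Finsupp.embDomain_zero, zero_add] at h
  rw [h, coeff_zero_eq_constantCoeff_apply, map_mul, hp, zero_mul]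

theorem constantCoeff_inv_ne_zero {f : Series k} (hf : constantCoeff f ≠ 0) :
    constantCoeff f⁻¹ ≠ 0 := by
  rw [constantCoeff_inv]; exact inv_ne_zero hf

theorem bifP_mul_sub_mem_fil (R : Series k) :
    bifP k * R - constantCoeff R • xv k ^ (k + 1) ∈ fil (wt k) (2 * k + 3) := by
  have e : bifP k * R - constantCoeff R • xv k ^ (k + 1) =
      (bifP k - xv k ^ (k + 1)) * R + xv k ^ (k + 1) * (R - C (constantCoeff R)) := by
    rw [smul_eq_C_mul]; ring
  rw [e]
  exact add_mem (Ideal.mul_mem_right _ _ bifP_sub_xpow_mem_fil)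
    (mul_mem_fil_of_le (xpow_mem_fil _) (sub_C_mem_fil_one wt_ne_zero R) (by omega))

theorem pow_sub_pow_rotation {α : ℂ} (hα : α ^ k = 1) (j : Fin k) :
    α * (α ^ (k + 1 - (j : ℕ)))⁻¹ = α ^ (j : ℕ) := by
  have hα0 : α ≠ 0 := by
    rintro rfl
    rw [zero_pow (by have := j.2; omega)] at hα
    exact zero_ne_one hα
  rw [mul_inv_eq_iff_eq_mul₀ (pow_ne_zero _ hα0), ← pow_add,
    show (j : ℕ) + (k + 1 - j) = k + 1 by have := j.2; omega, pow_succ, hα, one_mul]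

/-- Uniqueness of the normalisation of `V ∂/∂x` to `P / (1 + μ x^k) ∂/∂x`. -/
theorem normalisation_x_unique (hk : 0 < k) {W g₁ X₀ : Series k} {φ : Fin k → ParamSeries k}
    {μ ν : ParamSeries k} (hWr : res W = W) (hX : res X₀ = X₀) (hX0 : constantCoeff X₀ = 0)
    (hX1 : coeff (Finsupp.single (Sum.inr 0) 1) X₀ ≠ 0) (hφ0 : ∀ j, constantCoeff (φ j) = 0)
    (hW : W * (1 + liftParam k μ * xv k ^ k) = 1 + bifP k * g₁)
    (h : bifP k * W * pderiv ℂ (Sum.inr 0) X₀ * (1 + liftParam k ν * X₀ ^ k) =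
      bifPoly (fun j => liftParam k (φ j)) X₀) :
    ∃ (α : ℂ) (q : Series k), α ^ k = 1 ∧ res q = q ∧ X₀ = α • (xv k + bifP k * q) ∧
      (∀ j, φ j = rotation k α j • X j) ∧ ν = μ := by
  obtain ⟨α, hα⟩ : ∃ α, α = coeff (Finsupp.single (Sum.inr 0) 1) X₀ := ⟨_, rfl⟩
  rw [← hα] at hX1
  have hX3 : X₀ - α • xv k ∈ fil (wt k) 3 := mem_fil_three
    (by rw [map_sub, constantCoeff_smul, constantCoeff_X, smul_zero, hX0, sub_zero])
    (by rw [map_sub, coeff_smul, coeff_single_eq _ (xv k), pderiv_X_self, map_one, mul_one, hα,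
      sub_self])
  have hWc : constantCoeff W = 1 := by
    have := congrArg constantCoeff hW
    rwa [map_mul, constantCoeff_onePlus hk _ (constantCoeff_X _), mul_one, map_add, map_one, map_mul,
      constantCoeff_bifP, zero_mul, add_zero] at this
  have hV := bifP_mul_sub_mem_fil (k := k)
  -- The coefficients of `x^(k+1)` at `ε = y = 0` are `α` on the left and `α^(k+1)` on the right.
  have hαk : α ^ k = 1 := by
    have hl : coeff (Finsupp.single (Sum.inr 0) (k + 1)) (bifP k * W * pderiv ℂ (Sum.inr 0) X₀ *
        (1 + liftParam k ν * X₀ ^ k)) = α := by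
      have h1 := hV (W * pderiv ℂ (Sum.inr 0) X₀ * (1 + liftParam k ν * X₀ ^ k))
        (Finsupp.single (Sum.inr 0) (k + 1)) (by
          rw [Finsupp.weight_single, wt_x, smul_eq_mul]; omega)
      have hR : constantCoeff (W * pderiv ℂ (Sum.inr 0) X₀ * (1 + liftParam k ν * X₀ ^ k)) = α := by
        rw [map_mul, map_mul, hWc, one_mul, constantCoeff_onePlus hk _ hX0, mul_one,
          ← coeff_single_eq, ← hα]
      rw [map_sub, coeff_smul, coeff_single_xpow, if_pos rfl, mul_one, hR, sub_eq_zero] at h1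
      rw [← h1]
      congr 1
      ring
    have hr : coeff (Finsupp.single (Sum.inr 0) (k + 1)) (bifPoly (fun j => liftParam k (φ j)) X₀) =
        α ^ (k + 1) := by
      rw [bifPoly, map_add, map_sum, Finset.sum_eq_zero fun j _ =>
        coeff_single_liftParam_mul (hφ0 j) _ _, add_zero]
      have hx : X₀ ∈ fil (wt k) 2 := by
        have := add_mem (fil_anti (show 2 ≤ 3 by omega) hX3) (smul_mem_fil α xv_mem_fil)
        rwa [sub_add_cancel] at this
      have h1 := pow_sub_pow_mem_fil hx (smul_mem_fil α xv_mem_fil) hX3 (k + 1)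
        (Finsupp.single (Sum.inr 0) (k + 1)) (by
          rw [Finsupp.weight_single, wt_x, smul_eq_mul]; omega)
      rw [map_sub, smul_pow, coeff_smul, coeff_single_xpow, if_pos rfl, mul_one, sub_eq_zero] at h1
      exact h1
    rw [h, hr, pow_succ] at hl
    exact mul_right_cancel₀ hX1 (hl.trans (one_mul α).symm)
  -- the normalised coordinate
  obtain ⟨ξ, hξ⟩ : ∃ ξ, ξ = α⁻¹ • X₀ - xv k := ⟨_, rfl⟩
  have hC : (C α : Series k) * C α⁻¹ = 1 := by
    rw [← map_mul, mul_inv_cancel₀ hX1, map_one]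
  have hCk : (C α : Series k) ^ k = 1 := by rw [← map_pow, hαk, map_one]
  have hXξ : X₀ = C α * (xv k + ξ) := by
    rw [hξ, add_sub_cancel, smul_eq_C_mul, ← mul_assoc, hC, one_mul]
  have hξ3 : ξ ∈ fil (wt k) 3 := by
    have := smul_mem_fil α⁻¹ hX3
    rwa [smul_sub, smul_smul, inv_mul_cancel₀ hX1, one_smul, ← hξ] at this
  have hξr : res ξ = ξ := by rw [hξ, map_sub, map_smul, hX, res_xv]
  -- `x + P q` also normalises `P W ∂/∂x`, with parameters `ε` and invariant `μ`, and is chosen with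
  -- the same resonant coefficient as `ξ`. `kostov_unique` then forces the two normalisations to be
  -- equal.
  obtain ⟨q, hq, hκ, hode⟩ := exists_conj_mod_sq (b := 1) (c := onePlus μ) (g := W) (g₁ := g₁)
    (fun f => by simp) (res_eval_onePlus μ) hWr (by simp)
    (by rw [eval_onePlus, Polynomial.eval_one, hW]) (xc (k + 1) ξ)
  have hVW : bifP k * W - xv k ^ (k + 1) ∈ fil (wt k) (2 * k + 3) := by
    have := hV W
    rwa [hWc, one_smul] at this
  have hdX : pderiv ℂ (Sum.inr 0) X₀ = C α * (1 + pderiv ℂ (Sum.inr 0) ξ) := by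
    rw [hXξ, ← smul_eq_C_mul, Derivation.map_smul, map_add, pderiv_X_self, smul_eq_C_mul]
  have hnorm : bifP k * W * (1 + pderiv ℂ (Sum.inr 0) ξ) *
      (1 + liftParam k ν * (xv k + ξ) ^ k) = bifPoly (fun j => liftParam k
        ((α ^ (k + 1 - (j : ℕ)))⁻¹ • φ j)) (xv k + ξ) := by
    have hCα : (C α : Series k) ≠ 0 := fun h0 => by
      rw [h0, zero_mul] at hC
      exact zero_ne_one hC
    refine mul_left_cancel₀ hCα ?_
    rw [hdX, hXξ, mul_pow, hCk, one_mul] at h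
    have e : C α * bifPoly (fun j => liftParam k ((α ^ (k + 1 - (j : ℕ)))⁻¹ • φ j)) (xv k + ξ) =
        bifPoly (fun j => liftParam k (φ j)) (C α * (xv k + ξ)) := by
      rw [bifPoly, bifPoly, mul_add, mul_pow, pow_succ (C α), hCk, one_mul, Finset.mul_sum]
      congr 1
      refine Finset.sum_congr rfl fun j _ => ?_
      rw [map_smul, mul_pow, ← map_pow, ← pow_sub_pow_rotation hαk j, smul_eq_C_mul, map_mul]
      ring
    rw [e, ← h]
    ring
  obtain ⟨h1, h2, h3⟩ := kostov_unique hk (V := bifP k * W) (ξ := ξ) (ξ' := bifP k * q)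
    (φ' := X) (μ' := μ) hVW hξ3
    (Ideal.mul_mem_right _ _ (fil_anti (by omega) bifP_mem_fil)) hξr
    (by rw [map_mul, res_bifP, hq]) (fun j => by rw [liftParam_X]; exact X_inl_mem_fil j) hκ.symm
    hnorm (by
      simp_rw [liftParam_X]
      rw [Polynomial.eval_one, one_mul, eval_onePlus, map_add, pderiv_X_self] at hode
      rw [← hode]
      ring)
  refine ⟨α, q, hαk, hq, by rw [hXξ, h1, smul_eq_C_mul], fun j => ?_, h3⟩
  have h4 := congrFun h2 j
  rw [← h4, rotation, smul_smul, mul_inv_cancel₀ (pow_ne_zero _ hX1), one_smul]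

/-- The structure of an orbital equivalence of normal forms along the invariant curve `y = 0`. -/
theorem orbital_structure (hk : 0 < k) {I I' : FormalInvariant k} {Ψ : FormalChange k} {U : Series k}
    (hU : constantCoeff U ≠ 0) (h : Conjugates Ψ (fun i => U * normalForm I i) (normalForm I')) :
    ∃ (α : ℂ) (q V : Series k), α ^ k = 1 ∧ (∀ j, Ψ.par j = rotation k α j • X j) ∧
      subst Ψ.par I'.mu = I.mu ∧ res q = q ∧ res (Ψ.map 0) = α • (xv k + bifP k * q) ∧
      Ψ.map 1 = yv k * V ∧ constantCoeff V ≠ 0 ∧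
      bifP k ∣ res U * polyX I.u * (1 + liftParam k I.mu * xv k ^ k) -
        (∑ i, liftParam k (subst Ψ.par (I'.u i)) * res (Ψ.map 0) ^ (i : ℕ)) *
          (1 + liftParam k I.mu * res (Ψ.map 0) ^ k) := by
  have h0 := h 0
  have h1 := h 1
  rw [lieDeriv_eq_two, pull_normalForm_zero, normalForm_zero, normalForm_one] at h0
  rw [lieDeriv_eq_two, pull_normalForm_one, normalForm_zero, normalForm_one] at h1
  obtain ⟨X₀, hX₀⟩ : ∃ X₀, X₀ = res (Ψ.map 0) := ⟨_, rfl⟩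
  obtain ⟨A, hA⟩ : ∃ A, A = res U * polyX I.u := ⟨_, rfl⟩
  obtain ⟨B', hB'⟩ : ∃ B' : Series k, B' = ∑ i, liftParam k (subst Ψ.par (I'.u i)) * Ψ.map 0 ^ (i : ℕ) :=
    ⟨_, rfl⟩
  obtain ⟨B, hB⟩ : ∃ B : Series k, B = ∑ i, liftParam k (subst Ψ.par (I'.u i)) * X₀ ^ (i : ℕ) :=
    ⟨_, rfl⟩
  obtain ⟨ν, hν⟩ : ∃ ν, ν = subst Ψ.par I'.mu := ⟨_, rfl⟩
  rw [← hB'] at h0 h1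
  rw [← hν] at h1
  have hBB : res B' = B := by
    rw [hB', hB, hX₀, map_sum]
    simp only [map_mul, map_pow, res_liftParam]
  have hB0 : constantCoeff B ≠ 0 := by
    rw [← hBB, constantCoeff_setZero, hB', ← Ψ.pull_polyX, Ψ.constantCoeff_pull,
      constantCoeff_polyX]
    exact I'.u_ne_zero
  have hA0 : constantCoeff A ≠ 0 := by
    rw [hA, map_mul, constantCoeff_setZero, constantCoeff_polyX]
    exact mul_ne_zero hU I.u_ne_zero
  have hX₀0 : constantCoeff X₀ = 0 := by rw [hX₀, constantCoeff_setZero, Ψ.map_zero]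
  have hX₀r : res X₀ = X₀ := by rw [hX₀]; exact setZero_setZero _ _
  obtain ⟨M, hM⟩ : ∃ M, M = 1 + liftParam k ν * X₀ ^ k := ⟨_, rfl⟩
  have hM0 : constantCoeff M = 1 := by rw [hM]; exact constantCoeff_onePlus hk _ hX₀0
  have hMr : res (1 + liftParam k ν * Ψ.map 0 ^ k) = M := by
    rw [hM, hX₀, map_add, map_one, map_mul, map_pow, res_liftParam]
  have hBM0 : constantCoeff (B * M) ≠ 0 := by rw [map_mul, hM0, mul_one]; exact hB0
  have e0 : A * bifP k * pderiv ℂ (Sum.inr 0) X₀ =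
      B * bifPoly (fun j => liftParam k (Ψ.par j)) X₀ := by
    have := congrArg (res (k := k)) h0
    rw [map_add, map_mul, map_mul, map_mul, map_mul, map_mul, map_mul, map_mul, map_mul, res_yv,
      zero_mul, mul_zero, mul_zero, zero_mul, add_zero, hBB, res_bifPoly, res_polyX, res_bifP,
      res_pderiv_x, ← hX₀] at this
    rw [hA, ← this]
    ring
  -- On `y = 0` the second component satisfies an equation `(unit) Y = (unit) P ∂Y/∂x`, whose
  -- right-hand side has higher weight. So the curve `y = 0` is preserved.
  have hY₀ : res (Ψ.map 1) = 0 := by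
    have := congrArg (res (k := k)) h1
    rw [map_add, map_mul, map_mul, map_mul, map_mul, map_mul, map_mul, map_mul, map_mul, map_mul,
      res_yv, zero_mul, mul_zero, mul_zero, zero_mul, add_zero, hBB, res_polyX, res_bifP,
      res_pderiv_x, hMr] at this
    refine eq_zero_of_mem_fil_succ (ω := wt k) fun s hs => mul_mem_of_unit hBM0 ?_
    have e : B * M * res (Ψ.map 1) =
        bifP k * pderiv ℂ (Sum.inr 0) (res (Ψ.map 1)) * (res U * polyX I.u) := by
      linear_combination -this
    rw [e]
    exact Ideal.mul_mem_right _ _ (mul_mem_fil_of_le bifP_mem_fil (pderiv_x_mem_fil hs) (by omega))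
  obtain ⟨V, hV⟩ : X (Sum.inr 1) ∣ Ψ.map 1 := setZero_eq_zero_iff.1 hY₀
  have hjac := Ψ.jacobian_ne_zero
  rw [hV, Derivation.leibniz, Derivation.leibniz, pderiv_X_self,
    pderiv_X_of_ne (show (Sum.inr 1 : Fin k ⊕ Fin 2) ≠ Sum.inr 0 by simp), map_add, map_add,
    smul_eq_mul, smul_eq_mul, smul_eq_mul, smul_eq_mul, map_mul, map_mul, map_mul, map_mul, map_zero,
    map_one, constantCoeff_X] at hjac
  simp only [zero_mul, mul_zero, zero_add, mul_one, add_zero, sub_zero] at hjac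
  have hV0 : constantCoeff V ≠ 0 := right_ne_zero_of_mul hjac
  have hX₀1 : coeff (Finsupp.single (Sum.inr 0) 1) X₀ ≠ 0 := by
    rw [coeff_single_eq, hX₀, ← res_pderiv_x, constantCoeff_setZero]
    exact left_ne_zero_of_mul hjac
  obtain ⟨m, hm⟩ : ∃ m, m = 1 + liftParam k I.mu * xv k ^ k := ⟨_, rfl⟩
  have hmr : res m = m := by
    rw [hm, map_add, map_one, map_mul, map_pow, res_liftParam, res_xv]
  obtain ⟨v, hv⟩ : ∃ v, v = res V := ⟨_, rfl⟩
  have hv0 : constantCoeff v ≠ 0 := by rwa [hv, constantCoeff_setZero]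
  -- The second equation of conjugacy, divided by `y` and then restricted to `y = 0`.
  have e1 : A * bifP k * pderiv ℂ (Sum.inr 0) v + A * m * v = B * v * M := by
    have h2 : U * (polyX I.u * bifP k) * pderiv ℂ (Sum.inr 0) V +
        U * (polyX I.u * m) * (V + yv k * pderiv ℂ (Sum.inr 1) V) =
        B' * (V * (1 + liftParam k ν * Ψ.map 0 ^ k)) := by
      refine mul_left_cancel₀ (yv_ne_zero (k := k)) ?_
      rw [hV, Derivation.leibniz, Derivation.leibniz, pderiv_X_self,
        pderiv_X_of_ne (show (Sum.inr 1 : Fin k ⊕ Fin 2) ≠ Sum.inr 0 by simp), smul_eq_mul,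
        smul_eq_mul, smul_eq_mul, smul_eq_mul] at h1
      rw [hm]
      linear_combination h1
    have := congrArg (res (k := k)) h2
    simp only [map_add, map_mul, res_yv, zero_mul, add_zero, hmr, res_polyX, res_bifP,
      res_pderiv_x, hBB, ← hv] at this
    rw [map_one, map_pow, res_liftParam, ← hX₀, ← hM] at this
    rw [hA]
    linear_combination this
  have hBMi := MvPowerSeries.mul_inv_cancel _ hBM0
  have hvi := MvPowerSeries.mul_inv_cancel _ hv0
  -- Division of `e0` by `B` and of `e1` by `B M v` shows that `W = A / (B M)` is normalised by `X₀`
  -- with invariant `ν`, while `W (1 + μ x^k) ≡ 1` modulo `P`.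
  obtain ⟨α, q, hα, hq, hXq, hφ, hμ⟩ := normalisation_x_unique hk (W := A * (B * M)⁻¹)
    (g₁ := -(A * (B * M)⁻¹ * v⁻¹ * pderiv ℂ (Sum.inr 0) v)) (X₀ := X₀) (φ := Ψ.par) (μ := I.mu)
    (ν := ν) (by
      have hAr : res A = A := by
        rw [hA, map_mul, res_polyX, setZero_setZero]
      have hBr : res B = B := by rw [← hBB]; exact setZero_setZero _ _
      have hMr' : res M = M := by rw [← hMr]; exact setZero_setZero _ _
      rw [map_mul, setZero_inv hBM0, map_mul, hAr, hBr, hMr'])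
    hX₀r hX₀0 hX₀1 Ψ.par_zero (by
      rw [← hm]
      linear_combination ((B * M)⁻¹ * v⁻¹) * e1 + hBMi + (B * M * (B * M)⁻¹ - A * m * (B * M)⁻¹) * hvi)
    (by
      rw [← hM]
      have e : bifP k * (A * (B * M)⁻¹) * pderiv ℂ (Sum.inr 0) X₀ * M =
        (A * bifP k * pderiv ℂ (Sum.inr 0) X₀) * ((B * M)⁻¹ * M) := by ring
      rw [e, e0]
      linear_combination (bifPoly (fun j => liftParam k (Ψ.par j)) X₀) * hBMi)
  refine ⟨α, q, V, hα, hφ, by rw [← hν, hμ], hq, by rw [← hX₀, hXq], hV, hV0, ?_⟩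
  rw [← hX₀, ← hB, ← hA, ← hm, ← hμ, ← hM]
  refine ⟨-(A * v⁻¹ * pderiv ℂ (Sum.inr 0) v), ?_⟩
  linear_combination v⁻¹ * e1 + (B * M - A * m) * hvi

end

end SaddleNode

namespace SaddleNode

open Filter Topology MvPowerSeries

noncomputable section

variable {k : ℕ}

/-! ### Conjugacies of normal forms -/

/-- On series divisible by `y` the leading operator `l y ∂/∂y` is injective on each weight, while
`H` and the rest of `Z` raise the weight. -/
theorem eq_zero_of_lieDeriv_eq {Z : Family k} {l : ℂ} (h0 : Z 0 ∈ fil (wt k) 3)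
    (h1 : Z 1 - l • yv k ∈ fil (wt k) 4) (hl : l ≠ 0) {ν H : Series k} (hν : res ν = 0)
    (hH : constantCoeff H = 0) (h : lieDeriv Z ν = H * ν) : ν = 0 := by
  refine eq_zero_of_mem_fil_succ (ω := wt k) fun s hs => ?_
  have h2 : l • (yv k * pderiv ℂ (Sum.inr 1) ν) ∈ fil (wt k) (s + 1) := by
    have e : l • (yv k * pderiv ℂ (Sum.inr 1) ν) = H * ν -
        lieDeriv ![Z 0, Z 1 - l • yv k] ν := by
      rw [← h, lieDeriv_eq_two, lieDeriv_eq_two]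
      simp only [Matrix.cons_val_zero, Matrix.cons_val_one, smul_eq_C_mul]
      ring
    rw [e]
    exact sub_mem (mul_mem_fil_of_le ((mem_fil_one wt_ne_zero).2 hH) hs (by omega))
      (lieDeriv_mem_fil (Z := ![Z 0, Z 1 - l • yv k]) h0 h1 hs)
  intro d hd
  rcases eq_or_ne (d (Sum.inr 1)) 0 with hd1 | hd1
  · have := congrArg (coeff d) hν
    rwa [coeff_setZero, if_pos hd1] at this
  · have := h2 d hd
    rw [coeff_smul, coeff_yv_mul_pderiv] at this
    exact (mul_eq_zero.1 ((mul_eq_zero.1 this).resolve_left hl)).resolve_left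
      (Nat.cast_ne_zero.2 hd1)

variable {I I' : FormalInvariant k}

theorem normalForm_zero_mem_fil : normalForm I 0 ∈ fil (wt k) (2 * k + 2) :=
  Ideal.mul_mem_left _ _ bifP_mem_fil

theorem normalForm_one_sub_mem_fil (hk : 0 < k) :
    normalForm I 1 - constantCoeff (I.u 0) • yv k ∈ fil (wt k) 4 := by
  have e : normalForm I 1 - constantCoeff (I.u 0) • yv k =
      (polyX I.u * (1 + liftParam k I.mu * xv k ^ k) - C (constantCoeff (I.u 0))) * yv k := by
    rw [normalForm_one, smul_eq_C_mul]; ring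
  rw [e]
  refine mul_mem_fil_of_le (s := 1) ?_ yv_mem_fil (by omega)
  rw [mem_fil_one wt_ne_zero, map_sub, map_mul, constantCoeff_onePlus hk _ (constantCoeff_X _),
    mul_one, constantCoeff_polyX, constantCoeff_C, sub_self]

theorem lieDeriv_normalForm_of_res {f : Series k} (hf : res f = f) :
    lieDeriv (normalForm I) f = polyX I.u * bifP k * pderiv ℂ (Sum.inr 0) f := by
  rw [lieDeriv_of_res _ hf, normalForm_zero]

theorem res_lieDeriv_normalForm (f : Series k) :
    res (lieDeriv (normalForm I) f) = lieDeriv (normalForm I) (res f) := by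
  rw [lieDeriv_normalForm_of_res (setZero_setZero _ _), lieDeriv_eq_two, map_add, map_mul, map_mul,
    normalForm_zero, normalForm_one, map_mul, map_mul, map_mul, res_yv, zero_mul, mul_zero,
    zero_mul, add_zero, res_polyX, res_bifP, res_pderiv_x]

theorem res_eval_bifPolynomial (f : Series k) :
    res ((bifPolynomial k).eval f) = (bifPolynomial k).eval (res f) := by
  rw [eval_bifPolynomial, eval_bifPolynomial]
  have := res_bifPoly (k := k) X f
  simp_rw [liftParam_X] at this
  exact this

theorem constantCoeff_bifPoly {f : Series k} (hf : constantCoeff f = 0) :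
    constantCoeff (bifPoly (fun j => X (Sum.inl j)) f) = 0 := by
  have h1 := map_bifPoly (constantCoeff (σ := Fin k ⊕ Fin 2) (R := ℂ)) (fun j => X (Sum.inl j)) f
  have h2 := map_bifPoly (constantCoeff (σ := Fin k ⊕ Fin 2) (R := ℂ)) (fun j => X (Sum.inl j)) (xv k)
  rw [hf] at h1
  rw [constantCoeff_X, ← h1] at h2
  exact h2.symm.trans constantCoeff_bifP

theorem constantCoeff_bifDer (hk : 0 < k) {f : Series k} (hf : constantCoeff f = 0) :
    constantCoeff (bifDer (fun j => X (Sum.inl j)) f) = 0 := by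
  have h1 := map_bifDer (constantCoeff (σ := Fin k ⊕ Fin 2) (R := ℂ)) (fun j => X (Sum.inl j)) f
  have h2 := map_bifDer (constantCoeff (σ := Fin k ⊕ Fin 2) (R := ℂ)) (fun j => X (Sum.inl j)) (xv k)
  rw [hf] at h1
  rw [constantCoeff_X, ← h1] at h2
  exact h2.symm.trans (constantCoeff_bifP' hk)

theorem constantCoeff_eval_polyC (r : Fin (k + 1) → ParamSeries k) {f : Series k}
    (hf : constantCoeff f = 0) : constantCoeff ((polyC r).eval f) = constantCoeff (r 0) := by
  rw [eval_polyC, map_sum, Finset.sum_eq_single 0]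
  · rw [Fin.val_zero, pow_zero, mul_one, constantCoeff_liftParam]
  · intro i _ hi
    rw [map_mul, map_pow, hf, zero_pow fun h0 => hi (Fin.ext h0), mul_zero]
  · simp

/-- `f` and its restriction to `y = 0` satisfy the same equation. Their difference is divisible by
`y` and, by Taylor expansion, satisfies a linear equation to which `eq_zero_of_lieDeriv_eq` applies.
-/
theorem res_eq_of_lieDeriv_eq (hk : 0 < k) {f : Series k} (hf0 : constantCoeff f = 0)
    (h : lieDeriv (normalForm I) f = (polyC I.u * bifPolynomial k).eval f) : res f = f := by
  have hr : lieDeriv (normalForm I) (res f) = (polyC I.u * bifPolynomial k).eval (res f) := by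
    rw [← res_lieDeriv_normalForm, h, Polynomial.eval_mul, map_mul, res_eval_polyC,
      res_eval_bifPolynomial, Polynomial.eval_mul]
  have hf0' : constantCoeff (res f) = 0 := by rwa [constantCoeff_setZero]
  obtain ⟨ν, hν⟩ : ∃ ν, ν = f - res f := ⟨_, rfl⟩
  have hq := eval_add_eq_quot₂ (polyC I.u * bifPolynomial k) (res f) ν
  obtain ⟨H, hH⟩ : ∃ H, H = (polyC I.u * bifPolynomial k).derivative.eval (res f) +
    ν * quot₂ (polyC I.u * bifPolynomial k) (res f) ν := ⟨_, rfl⟩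
  have := eq_zero_of_lieDeriv_eq (Z := normalForm I) (ν := ν) (H := H)
    (fil_anti (by omega) normalForm_zero_mem_fil)
    (normalForm_one_sub_mem_fil hk) I.u_ne_zero (by rw [hν, map_sub, setZero_setZero, sub_self])
    (by
      rw [hH, Polynomial.derivative_mul, Polynomial.eval_add, Polynomial.eval_mul,
        Polynomial.eval_mul, eval_derivative_bifPolynomial, eval_bifPolynomial, map_add, map_add,
        map_mul, map_mul, map_mul, constantCoeff_bifPoly hf0', constantCoeff_bifDer hk hf0', hν,
        map_sub, hf0, hf0', sub_zero, zero_mul, mul_zero, mul_zero, zero_add, zero_add])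
    (by
      have e : res f + ν = f := by rw [hν]; ring
      rw [e, ← h] at hq
      rw [hν, lieDeriv_sub, hr, ← hν, hq, hH]
      ring)
  rw [hν, sub_eq_zero] at this
  exact this.symm

theorem subst_rotation {p : Fin k → ParamSeries k} {α : ℂ} (hp : ∀ j, p j = rotation k α j • X j)
    (f : ParamSeries k) : subst p f = rescale (rotation k α) f := by
  rw [rescale_eq_subst]
  congr 1
  exact funext hp

theorem pull_normalForm_rotation {Ψ : FormalChange k} {α : ℂ} (hα : α ^ k = 1)
    (hp : ∀ j, Ψ.par j = rotation k α j • X j) (hI : I.IsRotation α I') {f : Series k}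
    (hf : Ψ.map 0 = α • f) :
    Ψ.pull (normalForm I' 0) = α • (polyC I.u * bifPolynomial k).eval f ∧
    Ψ.pull (normalForm I' 1) = (polyC I.u).eval f * (Ψ.map 1 * (onePlus I.mu).eval f) := by
  have hu : ∑ i, liftParam k (subst Ψ.par (I'.u i)) * Ψ.map 0 ^ (i : ℕ) = (polyC I.u).eval f := by
    rw [eval_polyC]
    refine Finset.sum_congr rfl fun i _ => ?_
    rw [subst_rotation hp, ← hI.2 i, hf, smul_pow, map_smul, mul_smul_comm, smul_mul_assoc]
  have hm : 1 + liftParam k (subst Ψ.par I'.mu) * Ψ.map 0 ^ k = (onePlus I.mu).eval f := by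
    rw [eval_onePlus, subst_rotation hp, hI.1, hf, smul_pow, hα, one_smul]
  have hP : bifPoly (fun j => liftParam k (Ψ.par j)) (Ψ.map 0) = α • (bifPolynomial k).eval f := by
    rw [eval_bifPolynomial, bifPoly, bifPoly, smul_add, hf, smul_pow, pow_succ α, hα, one_mul,
      Finset.smul_sum]
    congr 1
    refine Finset.sum_congr rfl fun j _ => ?_
    rw [hp, map_smul, liftParam_X, rotation, smul_pow, smul_mul_smul_comm, ← pow_add,
      show k + 1 - (j : ℕ) + j = k + 1 by have := j.2; omega, pow_succ, hα, one_mul]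
  rw [pull_normalForm_zero, pull_normalForm_one, hu, hm, hP, Polynomial.eval_mul, mul_smul_comm]
  exact ⟨rfl, rfl⟩

/-- With the time factor equal to `1`, `orbital_structure` gives a congruence modulo `P` between `u`
and the rotated `u'`, an equality because both have degree at most `k`. Independence of `y` follows
from `eq_zero_of_lieDeriv_eq`, and two differential equations in `x` remain. -/
theorem conj_structure (hk : 0 < k) {Ψ : FormalChange k}
    (h : Conjugates Ψ (normalForm I) (normalForm I')) :
    ∃ (α : ℂ) (q V : Series k), α ^ k = 1 ∧ (∀ j, Ψ.par j = rotation k α j • X j) ∧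
      I.IsRotation α I' ∧ res q = q ∧ Ψ.map 0 = α • (xv k + bifP k * q) ∧
      Ψ.map 1 = yv k * V ∧ res V = V ∧ constantCoeff V ≠ 0 ∧
      polyX I.u * bifP k * pderiv ℂ (Sum.inr 0) (xv k + bifP k * q) =
        (polyC I.u * bifPolynomial k).eval (xv k + bifP k * q) ∧
      polyX I.u * bifP k * pderiv ℂ (Sum.inr 0) V =
        ((polyC I.u * onePlus I.mu).eval (xv k + bifP k * q) -
          (polyC I.u * onePlus I.mu).eval (xv k)) * V := by
  obtain ⟨α, q, V, hα, hp, hμ, hq, hX, hY, hV, hdvd⟩ := orbital_structure hk (U := 1)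
    (by rw [map_one]; exact one_ne_zero) (Ψ := Ψ) (I := I) (I' := I') (by simpa only [one_mul] using h)
  have hα0 : α ≠ 0 := by
    rintro rfl
    rw [zero_pow hk.ne'] at hα
    exact zero_ne_one hα
  have hrot : I.IsRotation α I' := by
    refine ⟨by rw [← subst_rotation hp, hμ], fun i => ?_⟩
    have hm0 := constantCoeff_onePlus hk I.mu (constantCoeff_X (Sum.inr 0 : Fin k ⊕ Fin 2))
    obtain ⟨u', hu'⟩ : ∃ u' : Fin (k + 1) → ParamSeries k,
        u' = fun i : Fin (k + 1) => α ^ (i : ℕ) • rescale (rotation k α) (I'.u i) := ⟨_, rfl⟩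
    have h1 : ∑ i, liftParam k (subst Ψ.par (I'.u i)) * res (Ψ.map 0) ^ (i : ℕ) =
        (polyC u').eval (xv k + bifP k * q) := by
      rw [eval_polyC, hu', hX]
      refine Finset.sum_congr rfl fun i _ => ?_
      rw [subst_rotation hp, smul_pow, map_smul, mul_smul_comm, smul_mul_assoc]
    have h2 : 1 + liftParam k I.mu * res (Ψ.map 0) ^ k =
        (onePlus I.mu).eval (xv k + bifP k * q) := by
      rw [eval_onePlus, hX, smul_pow, hα, one_smul]
    rw [h1, h2, map_one, one_mul, ← Polynomial.eval_mul, eval_add_eq_quot₁, Polynomial.eval_mul,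
      eval_polyC_xv, eval_onePlus, ← sub_sub, mul_assoc (bifP k)] at hdvd
    have h3 := (dvd_sub_left (dvd_mul_right _ _)).1 hdvd
    rw [← sub_mul] at h3
    rcases bifP_dvd_mul hk h3 with h3 | ⟨g, h3⟩
    · have := congrFun (polyX_eq_of_dvd_sub h3) i
      rw [hu'] at this
      exact this.symm
    · have := congrArg constantCoeff h3
      rw [hm0, map_mul, constantCoeff_bifP, zero_mul] at this
      exact absurd this one_ne_zero
  obtain ⟨f, hf⟩ : ∃ f, f = α⁻¹ • Ψ.map 0 := ⟨_, rfl⟩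
  have hfX : Ψ.map 0 = α • f := by rw [hf, smul_smul, mul_inv_cancel₀ hα0, one_smul]
  have hf0 : constantCoeff f = 0 := by rw [hf, constantCoeff_smul, Ψ.map_zero, smul_zero]
  obtain ⟨h0, h1⟩ := pull_normalForm_rotation hα hp hrot hfX
  have hfd : lieDeriv (normalForm I) f = (polyC I.u * bifPolynomial k).eval f := by
    rw [hf, lieDeriv_smul, h 0, ← hf, h0, smul_smul, inv_mul_cancel₀ hα0, one_smul]
  have hfr := res_eq_of_lieDeriv_eq hk hf0 hfd
  have hfq : f = xv k + bifP k * q := by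
    rw [← hfr, hf, map_smul, hX, smul_smul, inv_mul_cancel₀ hα0, one_smul]
  have hVd : lieDeriv (normalForm I) V = ((polyC I.u * onePlus I.mu).eval f -
      (polyC I.u * onePlus I.mu).eval (xv k)) * V := by
    have := (h 1).trans h1
    rw [hY, lieDeriv_mul, lieDeriv_X, normalForm_one] at this
    refine mul_left_cancel₀ yv_ne_zero ?_
    rw [Polynomial.eval_mul, Polynomial.eval_mul, eval_polyC_xv, eval_onePlus _ (xv k)]
    linear_combination this
  have hVr : res V = V := by
    have := eq_zero_of_lieDeriv_eq (Z := normalForm I) (ν := V - res V)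
      (H := (polyC I.u * onePlus I.mu).eval f - (polyC I.u * onePlus I.mu).eval (xv k))
      (fil_anti (by omega) normalForm_zero_mem_fil)
      (normalForm_one_sub_mem_fil hk) I.u_ne_zero (by rw [map_sub, setZero_setZero, sub_self])
      (by
        rw [Polynomial.eval_mul, Polynomial.eval_mul, map_sub, map_mul, map_mul,
          constantCoeff_eval_polyC _ hf0, constantCoeff_eval_polyC _ (constantCoeff_X _),
          eval_onePlus, eval_onePlus, constantCoeff_onePlus hk _ hf0,
          constantCoeff_onePlus hk _ (constantCoeff_X _), sub_self])
      (by
        have hV' := congrArg (res (k := k)) hVd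
        rw [res_lieDeriv_normalForm, map_mul, map_sub, Polynomial.eval_mul, Polynomial.eval_mul,
          map_mul, map_mul, res_eval_polyC, res_eval_polyC, res_eval_onePlus, res_eval_onePlus,
          hfr, res_xv, ← Polynomial.eval_mul, ← Polynomial.eval_mul] at hV'
        rw [lieDeriv_sub, hV', hVd, mul_sub])
    exact (sub_eq_zero.1 this).symm
  refine ⟨α, q, V, hα, hp, hrot, hq, by rw [hfX, hfq], hY, hVr, hV, ?_, ?_⟩
  · rw [← hfq, ← hfd, lieDeriv_normalForm_of_res hfr]
  · rw [← hfq, ← hVd, lieDeriv_normalForm_of_res hVr]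

theorem conj_x_unique {q q' : Series k} (hq : res q = q) (hq' : res q' = q')
    (hκ : xc (k + 1) (bifP k * q) = xc (k + 1) (bifP k * q'))
    (h : polyX I.u * bifP k * pderiv ℂ (Sum.inr 0) (xv k + bifP k * q) =
      (polyC I.u * bifPolynomial k).eval (xv k + bifP k * q))
    (h' : polyX I.u * bifP k * pderiv ℂ (Sum.inr 0) (xv k + bifP k * q') =
      (polyC I.u * bifPolynomial k).eval (xv k + bifP k * q')) : q = q' := by
  rw [Polynomial.eval_mul, eval_bifPolynomial] at h h'
  refine conj_mod_sq_unique (b := polyC I.u) (c := 1) (g := polyX I.u) (g₁ := 0)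
    (by rw [eval_polyC_xv, constantCoeff_polyX]; exact I.u_ne_zero)
    (by rw [eval_polyC_xv, Polynomial.eval_one]; ring) hq hq' hκ ?_ ?_
  · rw [← h, Polynomial.eval_one]; ring
  · rw [← h', Polynomial.eval_one]; ring

/-- The quotient of two solutions has zero derivative in `x`, hence depends on `ε` only. -/
theorem linear_ode_unique {H V V' : Series k} (hV : res V = V) (hV' : res V' = V')
    (hV0 : constantCoeff V ≠ 0) (hV0' : constantCoeff V' ≠ 0)
    (h : polyX I.u * bifP k * pderiv ℂ (Sum.inr 0) V = H * V)
    (h' : polyX I.u * bifP k * pderiv ℂ (Sum.inr 0) V' = H * V') :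
    ∃ c : ParamSeries k, IsUnit c ∧ V' = liftParam k c * V := by
  have hi := MvPowerSeries.mul_inv_cancel _ hV0
  obtain ⟨r, hr⟩ : ∃ r, r = V' * V⁻¹ := ⟨_, rfl⟩
  have hrV : V' = r * V := by rw [hr]; linear_combination -V' * hi
  have hrr : res r = r := by rw [hr, map_mul, setZero_inv hV0, hV, hV']
  have hr' : pderiv ℂ (Sum.inr 0) r = 0 := by
    have hu : polyX I.u ≠ 0 := fun h0 => I.u_ne_zero (by
      rw [← constantCoeff_polyX, h0, map_zero])
    have hV1 : V ≠ 0 := fun h0 => hV0 (by rw [h0, map_zero])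
    refine mul_left_cancel₀ (mul_ne_zero (mul_ne_zero hu bifP_ne_zero) hV1) ?_
    rw [hrV, Derivation.leibniz, smul_eq_mul, smul_eq_mul] at h'
    linear_combination h' - r * h
  have hrc := eq_liftParam_of_pderiv_eq_zero hrr hr'
  refine ⟨xc 0 r, ?_, by rw [← hrc, hrV]⟩
  rw [isUnit_iff_constantCoeff, ← constantCoeff_liftParam, ← hrc, hr, map_mul]
  exact (mul_ne_zero hV0' (constantCoeff_inv_ne_zero hV0)).isUnit

end

end SaddleNode

namespace SaddleNode

open Filter Topology MvPowerSeries

noncomputable section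

variable {k : ℕ}

/-! ### Exponentials of operators that raise the filtration -/

section ExpTerm

variable {V V₁ V₂ : Type*} [AddCommGroup V] [Module ℂ V] [AddCommGroup V₁] [Module ℂ V₁]
  [AddCommGroup V₂] [Module ℂ V₂]

/-- The `n`-th term `T^n f / n!` of the exponential series. -/
def expTerm (T : V →ₗ[ℂ] V) (f : V) (n : ℕ) : V := (n.factorial : ℂ)⁻¹ • T^[n] f

theorem expTerm_zero (T : V →ₗ[ℂ] V) (f : V) : expTerm T f 0 = f := by simp [expTerm]

theorem expTerm_one (T : V →ₗ[ℂ] V) (f : V) : expTerm T f 1 = T f := by simp [expTerm]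

theorem expTerm_succ (T : V →ₗ[ℂ] V) (f : V) (n : ℕ) :
    ((n : ℂ) + 1) • expTerm T f (n + 1) = T (expTerm T f n) := by
  have hn : ((n : ℂ) + 1) ≠ 0 := by exact_mod_cast n.succ_ne_zero
  rw [expTerm, expTerm, map_smul, Function.iterate_succ_apply', smul_smul, Nat.factorial_succ]
  push_cast
  rw [mul_inv, mul_inv_cancel_left₀ hn]

theorem expTerm_add (T : V →ₗ[ℂ] V) (f g : V) (n : ℕ) :
    expTerm T (f + g) n = expTerm T f n + expTerm T g n := by
  simp only [expTerm, ← Module.End.coe_pow, map_add, smul_add]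

theorem map_expTerm {T : V →ₗ[ℂ] V} {T₁ : V₁ →ₗ[ℂ] V₁} {L : V →ₗ[ℂ] V₁}
    (h : ∀ f, L (T f) = T₁ (L f)) (f : V) (n : ℕ) : L (expTerm T f n) = expTerm T₁ (L f) n := by
  have : ∀ n, L (T^[n] f) = T₁^[n] (L f) := by
    intro n
    induction n with
    | zero => rfl
    | succ n ih => rw [Function.iterate_succ_apply', h, ih, Function.iterate_succ_apply']
  rw [expTerm, map_smul, this, expTerm]

/-- With the factorials included, the Leibniz rule becomes a convolution. Three different operators
are allowed so as to cover the product rule for `flowE` and the separation of a scalar operator from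
it. -/
theorem expTerm_leibniz {T : V →ₗ[ℂ] V} {T₁ : V₁ →ₗ[ℂ] V₁} {T₂ : V₂ →ₗ[ℂ] V₂}
    (B : V₁ →ₗ[ℂ] V₂ →ₗ[ℂ] V) (h : ∀ f g, T (B f g) = B (T₁ f) g + B f (T₂ g)) (f : V₁) (g : V₂)
    (n : ℕ) : expTerm T (B f g) n = ∑ p ∈ Finset.HasAntidiagonal.antidiagonal n,
      B (expTerm T₁ f p.1) (expTerm T₂ g p.2) := by
  induction n with
  | zero => simp [expTerm_zero]
  | succ n ih =>
    have hn : ((n : ℂ) + 1) ≠ 0 := by exact_mod_cast n.succ_ne_zero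
    refine smul_right_injective V hn ?_
    have h1 : ((n : ℂ) + 1) • ∑ p ∈ Finset.HasAntidiagonal.antidiagonal (n + 1),
        B (expTerm T₁ f p.1) (expTerm T₂ g p.2) =
        ∑ p ∈ Finset.HasAntidiagonal.antidiagonal (n + 1),
          (p.1 : ℂ) • B (expTerm T₁ f p.1) (expTerm T₂ g p.2) +
        ∑ p ∈ Finset.HasAntidiagonal.antidiagonal (n + 1),
          (p.2 : ℂ) • B (expTerm T₁ f p.1) (expTerm T₂ g p.2) := by
      rw [Finset.smul_sum, ← Finset.sum_add_distrib]
      refine Finset.sum_congr rfl fun p hp => ?_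
      rw [← add_smul, ← Nat.cast_add, Finset.HasAntidiagonal.mem_antidiagonal.1 hp, Nat.cast_add, Nat.cast_one]
    simp only
    rw [expTerm_succ, ih, h1, Finset.Nat.sum_antidiagonal_succ, Finset.Nat.sum_antidiagonal_succ',
      map_sum, ← sub_eq_zero]
    simp only [Nat.cast_zero, zero_smul, zero_add, h, Nat.cast_add, Nat.cast_one,
      Finset.sum_add_distrib, ← expTerm_succ, map_smul, LinearMap.smul_apply]
    exact sub_self _

end ExpTerm

/-- The operator raises the filtration. -/
def Raises (T : Series k →ₗ[ℂ] Series k) : Prop :=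
  ∀ s f, f ∈ fil (wt k) s → T f ∈ fil (wt k) (s + 1)

/-- The operator preserves the filtration. -/
def Preserves (L : Series k →ₗ[ℂ] Series k) : Prop :=
  ∀ s f, f ∈ fil (wt k) s → L f ∈ fil (wt k) s

/-- The exponential of an operator that raises the filtration. -/
def expOp (T : Series k →ₗ[ℂ] Series k) (f : Series k) : Series k :=
  fun d => ∑ n ∈ Finset.range (Finsupp.weight (wt k) d + 1), coeff d (expTerm T f n)

section ExpOp

variable {T T₁ T₂ L : Series k →ₗ[ℂ] Series k} (hT : Raises T)

include hT

theorem Raises.expTerm_mem {s : ℕ} {f : Series k} (hf : f ∈ fil (wt k) s) (n : ℕ) :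
    expTerm T f n ∈ fil (wt k) (s + n) := by
  refine smul_mem_fil _ ?_
  induction n with
  | zero => exact hf
  | succ n ih =>
    rw [Function.iterate_succ_apply']
    exact hT _ _ ih

theorem Raises.expOp_sub_mem {s : ℕ} {f : Series k} (hf : f ∈ fil (wt k) s) (N : ℕ) :
    expOp T f - ∑ n ∈ Finset.range N, expTerm T f n ∈ fil (wt k) (s + N) := by
  intro d hd
  have h1 : coeff d (expOp T f) = ∑ n ∈ Finset.range (Finsupp.weight (wt k) d + 1 + N),
      coeff d (expTerm T f n) := by
    refine Finset.sum_subset (Finset.range_mono (by omega)) fun n _ hn => ?_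
    rw [Finset.mem_range, not_lt] at hn
    exact hT.expTerm_mem hf n d (by omega)
  have h2 : coeff d (∑ n ∈ Finset.range N, expTerm T f n) =
      ∑ n ∈ Finset.range (Finsupp.weight (wt k) d + 1 + N), coeff d (expTerm T f n) := by
    rw [map_sum]
    refine Finset.sum_subset (Finset.range_mono (by omega)) fun n _ hn => ?_
    rw [Finset.mem_range, not_lt] at hn
    exact hT.expTerm_mem hf n d (by omega)
  rw [map_sub, h1, h2, sub_self]

theorem Raises.eq_expOp {f g : Series k}
    (h : ∀ N, g - ∑ n ∈ Finset.range N, expTerm T f n ∈ fil (wt k) N) : g = expOp T f := by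
  rw [← sub_eq_zero]
  refine eq_zero_of_mem_fil (ω := wt k) fun N => ?_
  have := sub_mem (h N) (fil_anti (show N ≤ 0 + N by omega)
    (hT.expOp_sub_mem (mem_fil_zero f) N))
  rwa [sub_sub_sub_cancel_right] at this

theorem Raises.expOp_sub_self_mem {s : ℕ} {f : Series k} (hf : f ∈ fil (wt k) s) :
    expOp T f - f ∈ fil (wt k) (s + 1) := by
  have := hT.expOp_sub_mem hf 1
  rwa [Finset.sum_range_one, expTerm_zero] at this

theorem Raises.expOp_add (f g : Series k) : expOp T (f + g) = expOp T f + expOp T g := by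
  refine (hT.eq_expOp fun N => ?_).symm
  simp_rw [expTerm_add, Finset.sum_add_distrib]
  rw [add_sub_add_comm]
  exact fil_anti (show N ≤ 0 + N by omega) (add_mem (hT.expOp_sub_mem (mem_fil_zero f) N)
    (hT.expOp_sub_mem (mem_fil_zero g) N))

theorem Raises.expOp_of_eq_zero {f : Series k} (hf : T f = 0) : expOp T f = f := by
  refine (hT.eq_expOp fun N => ?_).symm
  rcases N with _ | N
  · exact mem_fil_zero _
  · rw [Finset.sum_range_succ', expTerm_zero, Finset.sum_eq_zero, zero_add, sub_self]
    · exact zero_mem _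
    · intro n _
      rw [expTerm, Function.iterate_succ_apply, hf, ← Module.End.coe_pow, map_zero, smul_zero]

theorem Raises.map_expOp (hL : Preserves L) (h : ∀ f, L (T f) = T (L f)) (f : Series k) :
    L (expOp T f) = expOp T (L f) := by
  refine hT.eq_expOp fun N => ?_
  simp_rw [← map_expTerm h]
  rw [← map_sum, ← map_sub]
  exact hL _ _ (fil_anti (show N ≤ 0 + N by omega) (hT.expOp_sub_mem (mem_fil_zero f) N))

/-- The partial sum of the product is a triangular sum, and each discarded term has weight at least
`N`. For `T = T₁ = T₂` a derivation, this is multiplicativity of its exponential. -/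
theorem Raises.expOp_mul (hT₁ : Raises T₁) (hT₂ : Raises T₂)
    (h : ∀ f g, T (f * g) = T₁ f * g + f * T₂ g) (f g : Series k) :
    expOp T (f * g) = expOp T₁ f * expOp T₂ g := by
  refine (hT.eq_expOp fun N => ?_).symm
  have h1 : ∑ n ∈ Finset.range N, expTerm T (f * g) n = ∑ i ∈ Finset.range N,
      expTerm T₁ f i * ∑ j ∈ Finset.range (N - i), expTerm T₂ g j := by
    simp_rw [Finset.mul_sum]
    rw [← Finset.sum_range_diag_flip]
    refine Finset.sum_congr rfl fun n _ => ?_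
    rw [← Finset.Nat.sum_antidiagonal_eq_sum_range_succ
      (fun i j => expTerm T₁ f i * expTerm T₂ g j)]
    exact expTerm_leibniz (LinearMap.mul ℂ (Series k)) h f g n
  rw [h1]
  have e : expOp T₁ f * expOp T₂ g - ∑ i ∈ Finset.range N,
      expTerm T₁ f i * ∑ j ∈ Finset.range (N - i), expTerm T₂ g j =
      (expOp T₁ f - ∑ i ∈ Finset.range N, expTerm T₁ f i) * expOp T₂ g +
        ∑ i ∈ Finset.range N, expTerm T₁ f i *
          (expOp T₂ g - ∑ j ∈ Finset.range (N - i), expTerm T₂ g j) := by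
    simp_rw [mul_sub, Finset.sum_sub_distrib, ← Finset.sum_mul]
    ring
  rw [e]
  refine add_mem (Ideal.mul_mem_right _ _ (fil_anti (show N ≤ 0 + N by omega)
    (hT₁.expOp_sub_mem (mem_fil_zero f) N))) (Ideal.sum_mem _ fun i hi => ?_)
  exact mul_mem_fil_of_le (hT₁.expTerm_mem (mem_fil_zero f) i)
    (hT₂.expOp_sub_mem (mem_fil_zero g) (N - i)) (by have := Finset.mem_range.1 hi; omega)

theorem Raises.coeff_map_expTerm (hL : Preserves L) {f : Series k} {d : Fin k ⊕ Fin 2 →₀ ℕ} {n : ℕ}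
    (hn : n ∉ Finset.range (Finsupp.weight (wt k) d + 1)) : coeff d (L (expTerm T f n)) = 0 := by
  rw [Finset.mem_range, not_lt] at hn
  exact hL _ _ (hT.expTerm_mem (mem_fil_zero f) n) d (by omega)

theorem Raises.coeff_map_expOp (hL : Preserves L) (f : Series k) (d : Fin k ⊕ Fin 2 →₀ ℕ) :
    coeff d (L (expOp T f)) = ∑ n ∈ Finset.range (Finsupp.weight (wt k) d + 1),
      coeff d (L (expTerm T f n)) := by
  have := hL _ _ (hT.expOp_sub_mem (mem_fil_zero f) (Finsupp.weight (wt k) d + 1)) d (by omega)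
  rw [map_sub, map_sub, sub_eq_zero, map_sum, map_sum] at this
  exact this

theorem Raises.hasSum (hL : Preserves L) (f : Series k) (d : Fin k ⊕ Fin 2 →₀ ℕ) :
    HasSum (fun n => coeff d (L (expTerm T f n))) (coeff d (L (expOp T f))) := by
  rw [hT.coeff_map_expOp hL]
  exact hasSum_sum_of_ne_finset_zero fun n hn => hT.coeff_map_expTerm hL hn

theorem Raises.summable_norm (hL : Preserves L) (f : Series k) (d : Fin k ⊕ Fin 2 →₀ ℕ) :
    Summable fun n => ‖coeff d (L (expTerm T f n))‖ :=
  summable_of_ne_finset_zero (s := Finset.range (Finsupp.weight (wt k) d + 1)) fun n hn => by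
    rw [hT.coeff_map_expTerm hL hn, norm_zero]

end ExpOp

end

end SaddleNode

namespace SaddleNode

open Filter Topology MvPowerSeries

noncomputable section

variable {k : ℕ}

/-! ### The flow of the normal form -/

/-- The logarithmic derivative of `y` along the normal form. -/
def rateY (I : FormalInvariant k) : Series k := polyX I.u * (1 + liftParam k I.mu * xv k ^ k)

/-- The operator `t u P ∂/∂x`. -/
def flowT (I : FormalInvariant k) (t : ParamSeries k) : Series k →ₗ[ℂ] Series k :=
  LinearMap.mulLeft ℂ (liftParam k t * (polyX I.u * bifP k)) ∘ₗ
    ((pderiv ℂ (Sum.inr 0) : Derivation ℂ (Series k) (Series k)) : Series k →ₗ[ℂ] Series k)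

/-- The operator `t u P ∂/∂x + t u (1 + μ x^k) - t(0) u_0(0)`. -/
def flowE (I : FormalInvariant k) (t : ParamSeries k) : Series k →ₗ[ℂ] Series k :=
  LinearMap.mulLeft ℂ (liftParam k t * rateY I - C (constantCoeff t * constantCoeff (I.u 0))) +
    flowT I t

variable {I : FormalInvariant k} {t t' : ParamSeries k}

theorem flowT_apply (f : Series k) : flowT I t f =
    liftParam k t * (polyX I.u * bifP k) * pderiv ℂ (Sum.inr 0) f := rfl

theorem flowE_apply (f : Series k) : flowE I t f =
    (liftParam k t * rateY I - C (constantCoeff t * constantCoeff (I.u 0))) * f + flowT I t f := rfl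

theorem flowT_mul (f g : Series k) : flowT I t (f * g) = flowT I t f * g + f * flowT I t g := by
  simp only [flowT_apply, Derivation.leibniz, smul_eq_mul]
  ring

theorem flowE_mul (f g : Series k) : flowE I t (f * g) = flowE I t f * g + f * flowT I t g := by
  simp only [flowE_apply, flowT_mul]
  ring

theorem flowT_mem_fil {s : ℕ} {f : Series k} (hf : f ∈ fil (wt k) s) :
    flowT I t f ∈ fil (wt k) (s + 2 * k) :=
  mul_mem_fil_of_le (Ideal.mul_mem_left _ _ (Ideal.mul_mem_left _ _ bifP_mem_fil))
    (pderiv_x_mem_fil hf) (by omega)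

theorem constantCoeff_rateY (hk : 0 < k) :
    constantCoeff (rateY I) = constantCoeff (I.u 0) := by
  rw [rateY, map_mul, constantCoeff_onePlus hk _ (constantCoeff_X _), mul_one, constantCoeff_polyX]

theorem raises_flowT (hk : 0 < k) : Raises (flowT I t) := fun s _ hf =>
  fil_anti (show s + 1 ≤ s + 2 * k by omega) (flowT_mem_fil hf)

/-- The rate of `y` has the constant term `t(0) u₀(0)`, which does not raise the weight. It is
subtracted in `flowE` and restored in `flowV` as a factor `exp`. -/
theorem raises_flowE (hk : 0 < k) : Raises (flowE I t) := fun s f hf => by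
  rw [flowE_apply]
  refine add_mem (mul_mem_fil_of_le (s := 1) ?_ hf (by omega)) (raises_flowT hk _ _ hf)
  rw [mem_fil_one wt_ne_zero, map_sub, map_mul, constantCoeff_liftParam, constantCoeff_C,
    constantCoeff_rateY hk, sub_self]

/-- The first component of the flow. -/
def flowX (I : FormalInvariant k) (t : ParamSeries k) : Series k := expOp (flowT I t) (xv k)

/-- The second component of the flow, divided by `y`. -/
def flowV (I : FormalInvariant k) (t : ParamSeries k) : Series k :=
  Complex.exp (constantCoeff t * constantCoeff (I.u 0)) • expOp (flowE I t) 1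

theorem preserves_id : Preserves (LinearMap.id : Series k →ₗ[ℂ] Series k) := fun _ _ h => h

theorem preserves_mulLeft (g : Series k) : Preserves (LinearMap.mulLeft ℂ g) :=
  fun _ _ h => Ideal.mul_mem_left _ g h

theorem preserves_flowT : Preserves (flowT I t) := fun _ _ h =>
  fil_anti (by omega) (flowT_mem_fil h)

theorem preserves_res : Preserves (res (k := k)).toLinearMap := fun _ _ h => setZero_mem_fil h

theorem res_flowT (f : Series k) : res (flowT I t f) = flowT I t (res f) := by
  rw [flowT_apply, flowT_apply, map_mul, map_mul, map_mul, res_liftParam, res_polyX, res_bifP,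
    res_pderiv_x]

theorem res_rateY : res (rateY I) = rateY I := by
  rw [rateY, map_mul, res_polyX, map_add, map_one, map_mul, map_pow, res_liftParam, res_xv]

theorem res_flowE (f : Series k) : res (flowE I t f) = flowE I t (res f) := by
  rw [flowE_apply, flowE_apply, map_add, map_mul, map_sub, map_mul, res_flowT, res_rateY,
    res_liftParam, show res (C (constantCoeff t * constantCoeff (I.u 0)) : Series k) = _ from
      (res (k := k)).commutes _]
  rfl

theorem res_flowX (hk : 0 < k) : res (flowX I t) = flowX I t := by
  have := (raises_flowT (I := I) (t := t) hk).map_expOp preserves_res res_flowT (xv k)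
  rw [AlgHom.toLinearMap_apply, AlgHom.toLinearMap_apply, res_xv] at this
  exact this

/-! #### The exponential series of the normal form -/

theorem lieDeriv_iterate_x (n : ℕ) :
    (flowT I t)^[n] (xv k) = liftParam k t ^ n * (lieDeriv (normalForm I))^[n] (xv k) ∧
      res ((lieDeriv (normalForm I))^[n] (xv k)) = (lieDeriv (normalForm I))^[n] (xv k) := by
  induction n with
  | zero => exact ⟨by simp, res_xv⟩
  | succ n ih =>
    rw [Function.iterate_succ_apply', Function.iterate_succ_apply', res_lieDeriv_normalForm, ih.2,
      ih.1, lieDeriv_normalForm_of_res ih.2, flowT_apply]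
    refine ⟨?_, rfl⟩
    rw [← map_pow, Derivation.leibniz, pderiv_liftParam, smul_zero, add_zero, smul_eq_mul, map_pow]
    ring

theorem lieDeriv_yv_mul {f : Series k} (hf : res f = f) :
    lieDeriv (normalForm I) (yv k * f) = yv k * (rateY I * f + flowT I 1 f) := by
  rw [lieDeriv_mul, lieDeriv_X, normalForm_one, lieDeriv_normalForm_of_res hf, flowT_apply, map_one,
    rateY]
  ring

theorem lieDeriv_iterate_y (n : ℕ) :
    yv k * (flowE I t + (constantCoeff t * constantCoeff (I.u 0)) • (LinearMap.id : Series k →ₗ[ℂ] Series k))^[n] 1 =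
      liftParam k t ^ n * (lieDeriv (normalForm I))^[n] (yv k) ∧
    res ((flowE I t + (constantCoeff t * constantCoeff (I.u 0)) • (LinearMap.id : Series k →ₗ[ℂ] Series k))^[n] 1) =
      (flowE I t + (constantCoeff t * constantCoeff (I.u 0)) • (LinearMap.id : Series k →ₗ[ℂ] Series k))^[n] 1 := by
  induction n with
  | zero => exact ⟨by simp, map_one _⟩
  | succ n ih =>
    rw [Function.iterate_succ_apply', Function.iterate_succ_apply']
    obtain ⟨r, hr⟩ : ∃ r, r =
      (flowE I t + (constantCoeff t * constantCoeff (I.u 0)) • (LinearMap.id : Series k →ₗ[ℂ] Series k))^[n] 1 := ⟨_, rfl⟩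
    rw [← hr] at ih ⊢
    rw [LinearMap.add_apply, LinearMap.smul_apply, LinearMap.id_apply, map_add, res_flowE, map_smul,
      ih.2]
    refine ⟨?_, rfl⟩
    have h1 : liftParam k t * lieDeriv (normalForm I) (yv k * r) = liftParam k t ^ (n + 1) *
        lieDeriv (normalForm I) ((lieDeriv (normalForm I))^[n] (yv k)) := by
      rw [ih.1, ← map_pow, lieDeriv_liftParam_mul, map_pow, pow_succ]
      ring
    rw [← h1, lieDeriv_yv_mul ih.2, flowE_apply, flowT_apply, flowT_apply, smul_eq_C_mul, map_one]
    ring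

theorem hasSum_flowX (hk : 0 < k) (d : Fin k ⊕ Fin 2 →₀ ℕ) :
    HasSum (fun n : ℕ => coeff d ((n.factorial : ℂ)⁻¹ •
      (liftParam k t ^ n * (lieDeriv (normalForm I))^[n] (xv k)))) (coeff d (flowX I t)) := by
  simp_rw [← (lieDeriv_iterate_x _).1]
  exact (raises_flowT hk).hasSum preserves_id _ _

/-- The scalar part commutes with `flowE`, so the Lie series is a Cauchy product of the numerical
exponential series with a series that is finite in each coefficient. The first factor is why
convergence in `ℂ` is needed here. -/
theorem hasSum_flowY (hk : 0 < k) (d : Fin k ⊕ Fin 2 →₀ ℕ) :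
    HasSum (fun n : ℕ => coeff d ((n.factorial : ℂ)⁻¹ •
      (liftParam k t ^ n * (lieDeriv (normalForm I))^[n] (yv k)))) (coeff d (yv k * flowV I t)) := by
  simp_rw [← (lieDeriv_iterate_y _).1]
  obtain ⟨c, hc⟩ : ∃ c, c = constantCoeff t * constantCoeff (I.u 0) := ⟨_, rfl⟩
  have hE := raises_flowE (I := I) (t := t) hk
  have hL := preserves_mulLeft (yv k)
  have h1 : ∀ n, coeff d ((n.factorial : ℂ)⁻¹ • (yv k * (flowE I t + c • (LinearMap.id : Series k →ₗ[ℂ] Series k))^[n] 1)) =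
      ∑ p ∈ Finset.HasAntidiagonal.antidiagonal n, c ^ p.1 / p.1.factorial *
        coeff d (LinearMap.mulLeft ℂ (yv k) (expTerm (flowE I t) 1 p.2)) := by
    intro n
    have h2 := expTerm_leibniz (T := flowE I t + c • LinearMap.id) (T₁ := c • LinearMap.id)
      (T₂ := flowE I t) (LinearMap.lsmul ℂ (Series k)) (fun a f => by
        simp only [LinearMap.lsmul_apply, LinearMap.add_apply,
          LinearMap.smul_apply, LinearMap.id_apply, map_smul, smul_eq_mul, mul_smul]
        rw [smul_add, smul_comm a c, add_comm]) (1 : ℂ) 1 n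
    have h3 : ∀ i : ℕ, expTerm (c • LinearMap.id : ℂ →ₗ[ℂ] ℂ) 1 i = c ^ i / i.factorial := by
      intro i
      rw [expTerm, ← Module.End.coe_pow, show (c • LinearMap.id : ℂ →ₗ[ℂ] ℂ) =
        LinearMap.mulLeft ℂ c from rfl, LinearMap.pow_mulLeft, LinearMap.mulLeft_apply, smul_eq_mul]
      ring
    simp only [LinearMap.lsmul_apply, one_smul, h3] at h2
    rw [← mul_smul_comm, ← expTerm, h2, ← LinearMap.mulLeft_apply (R := ℂ), map_sum, map_sum]
    refine Finset.sum_congr rfl fun p _ => ?_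
    rw [map_smul, coeff_smul]
  have hs : Summable fun n : ℕ => ‖c ^ n / (n.factorial : ℂ)‖ := NormedSpace.norm_expSeries_div_summable c
  have hs' := hE.summable_norm hL 1 d
  have h4 := (summable_norm_sum_mul_antidiagonal_of_summable_norm hs hs').of_norm.hasSum
  rw [← tsum_mul_tsum_eq_tsum_sum_antidiagonal_of_summable_norm hs hs',
    (hE.hasSum hL 1 d).tsum_eq, (NormedSpace.expSeries_div_hasSum_exp c).tsum_eq] at h4
  rw [← hc]
  simp_rw [h1]
  have e : coeff d (yv k * flowV I t) = NormedSpace.exp c *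
      coeff d (LinearMap.mulLeft ℂ (yv k) (expOp (flowE I t) 1)) := by
    rw [flowV, ← hc, mul_smul_comm, coeff_smul, LinearMap.mulLeft_apply, Complex.exp_eq_exp_ℂ]
  rw [e]
  exact h4

theorem isTimeFlow_iff (hk : 0 < k) {Φ : Family k} : IsTimeFlow (normalForm I) t Φ ↔
    Φ 0 = flowX I t ∧ Φ 1 = yv k * flowV I t := by
  constructor
  · intro h
    constructor
    · ext d
      exact (h 0 d).unique (hasSum_flowX hk d)
    · ext d
      exact (h 1 d).unique (hasSum_flowY hk d)
  · rintro ⟨h0, h1⟩ i d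
    fin_cases i
    · change HasSum _ (coeff d (Φ 0))
      rw [h0]
      exact hasSum_flowX hk d
    · change HasSum _ (coeff d (Φ 1))
      rw [h1]
      exact hasSum_flowY hk d

/-! #### The flow is a conjugacy -/

/-- The ring homomorphism `exp (t u P ∂/∂x)`. -/
def flowHom (hk : 0 < k) (I : FormalInvariant k) (t : ParamSeries k) : Series k →+* Series k where
  toFun := expOp (flowT I t)
  map_one' := (raises_flowT hk).expOp_of_eq_zero (by
    rw [flowT_apply, Derivation.map_one_eq_zero, mul_zero])
  map_mul' := (raises_flowT hk).expOp_mul (raises_flowT hk) (raises_flowT hk) flowT_mul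
  map_zero' := (raises_flowT hk).expOp_of_eq_zero (map_zero _)
  map_add' := (raises_flowT hk).expOp_add

theorem flowHom_liftParam (hk : 0 < k) (p : ParamSeries k) :
    flowHom hk I t (liftParam k p) = liftParam k p :=
  (raises_flowT hk).expOp_of_eq_zero (by rw [flowT_apply, pderiv_liftParam, mul_zero])

theorem flowHom_xv (hk : 0 < k) : flowHom hk I t (xv k) = flowX I t := rfl

theorem flowHom_polyX (hk : 0 < k) (r : Fin (k + 1) → ParamSeries k) :
    flowHom hk I t (polyX r) = (polyC r).eval (flowX I t) := by
  rw [polyX, map_sum, eval_polyC]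
  simp only [map_mul, map_pow, flowHom_liftParam, flowHom_xv]

theorem flowHom_bifP (hk : 0 < k) :
    flowHom hk I t (bifP k) = (bifPolynomial k).eval (flowX I t) := by
  rw [bifP, map_bifPoly, eval_bifPolynomial]
  simp_rw [← liftParam_X, flowHom_liftParam, flowHom_xv]

theorem flowHom_rateY (hk : 0 < k) :
    flowHom hk I t (rateY I) = (polyC I.u * onePlus I.mu).eval (flowX I t) := by
  rw [rateY, map_mul, flowHom_polyX, map_add, map_one, map_mul, map_pow, flowHom_liftParam,
    flowHom_xv, Polynomial.eval_mul, eval_onePlus]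

theorem flowT_comm (f : Series k) : flowT I 1 (flowT I t f) = flowT I t (flowT I 1 f) := by
  simp only [flowT_apply, map_one, one_mul]
  rw [mul_assoc (liftParam k t), Derivation.leibniz, pderiv_liftParam, smul_zero, add_zero,
    smul_eq_mul]
  ring

/-- The exponential is a ring homomorphism fixing series in `ε` and commuting with the derivation `u
P ∂/∂x`. So the derivative of the flow is the exponential of `u P`, which is `u P` evaluated at the
flow. -/
theorem lieDeriv_flowX (hk : 0 < k) : lieDeriv (normalForm I) (flowX I t) =
    (polyC I.u * bifPolynomial k).eval (flowX I t) := by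
  rw [lieDeriv_normalForm_of_res (res_flowX hk)]
  have h := (raises_flowT (I := I) (t := t) hk).map_expOp (preserves_flowT (t := 1)) flowT_comm (xv k)
  rw [flowT_apply, flowT_apply, map_one, one_mul, pderiv_X_self, mul_one] at h
  refine h.trans ?_
  rw [Polynomial.eval_mul, ← flowHom_polyX hk, ← flowHom_bifP hk, ← map_mul]
  rfl

theorem res_expOp_flowE (hk : 0 < k) : res (expOp (flowE I t) 1) = expOp (flowE I t) 1 := by
  have := (raises_flowE (I := I) (t := t) hk).map_expOp preserves_res res_flowE 1
  rw [AlgHom.toLinearMap_apply, AlgHom.toLinearMap_apply, map_one] at this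
  exact this

theorem res_flowV (hk : 0 < k) : res (flowV I t) = flowV I t := by
  rw [flowV, map_smul, res_expOp_flowE hk]

theorem constantCoeff_flowV (hk : 0 < k) : constantCoeff (flowV I t) ≠ 0 := by
  have := (mem_fil_one wt_ne_zero).1 ((raises_flowE (I := I) (t := t) hk).expOp_sub_self_mem
    (s := 0) (mem_fil_zero 1))
  rw [map_sub, map_one, sub_eq_zero] at this
  rw [flowV, constantCoeff_smul, this, smul_eq_mul, mul_one]
  exact Complex.exp_ne_zero _

theorem lieDeriv_flowY (hk : 0 < k) : lieDeriv (normalForm I) (yv k * flowV I t) =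
    (polyC I.u * onePlus I.mu).eval (flowX I t) * (yv k * flowV I t) := by
  have hS : rateY I * expOp (flowE I t) 1 + flowT I 1 (expOp (flowE I t) 1) =
      (polyC I.u * onePlus I.mu).eval (flowX I t) * expOp (flowE I t) 1 := by
    -- The operator `f ↦ rateY f + u P ∂f/∂x`, by which the field acts on `y f`, commutes with
    -- `flowE` because `t` depends on `ε` only.
    have h := (raises_flowE (I := I) (t := t) hk).map_expOp
      (L := LinearMap.mulLeft ℂ (rateY I) + flowT I 1) (fun s f hf =>
        add_mem (preserves_mulLeft _ _ _ hf) (preserves_flowT _ _ hf)) (fun f => by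
        simp only [LinearMap.add_apply, LinearMap.mulLeft_apply, flowE_apply, map_add, flowT_comm,
          flowT_mul]
        have e : flowT I 1 (liftParam k t * rateY I - C (constantCoeff t * constantCoeff (I.u 0))) =
            flowT I t (rateY I) := by
          rw [map_sub, flowT_mul, flowT_apply (liftParam k t), pderiv_liftParam, flowT_apply,
            flowT_apply, flowT_apply, map_one, pderiv_C]
          ring
        rw [e]
        ring) 1
    rw [LinearMap.add_apply, LinearMap.add_apply, LinearMap.mulLeft_apply,
      LinearMap.mulLeft_apply, flowT_apply 1, Derivation.map_one_eq_zero, mul_zero, add_zero, mul_one,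
      ← one_mul (rateY I), (raises_flowE hk).expOp_mul (raises_flowE hk) (raises_flowT hk) flowE_mul,
      one_mul] at h
    rw [h, ← flowHom_rateY hk, mul_comm]
    rfl
  rw [lieDeriv_yv_mul (res_flowV hk), flowV, map_smul, mul_smul_comm, ← smul_add, hS]
  simp only [mul_smul_comm]
  ring_nf

theorem flowX_sub_mem (hk : 0 < k) : flowX I t - xv k ∈ fil (wt k) 3 :=
  (raises_flowT hk).expOp_sub_self_mem xv_mem_fil

end

end SaddleNode

namespace SaddleNode

open Filter Topology MvPowerSeries

noncomputable section

variable {k : ℕ} {I I' : FormalInvariant k} {t t' : ParamSeries k}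

/-! ### The time of the flow -/

theorem liftParam_mem_fil {s : ℕ} {p : ParamSeries k} :
    liftParam k p ∈ fil (wt k) s ↔ p ∈ fil (fun j => wt k (Sum.inl j)) s := by
  constructor
  · intro h e he
    rw [← coeff_liftParam]
    exact h _ (by rwa [weight_embDomain])
  · intro h d hd
    by_cases hd0 : ∀ i, d (Sum.inr i) = 0
    · obtain ⟨e, rfl⟩ := exists_embDomain_of_inr hd0
      rw [coeff_liftParam]
      exact h e (by rwa [weight_embDomain] at hd)
    · push Not at hd0
      obtain ⟨i, hi⟩ := hd0
      exact coeff_liftParam_eq_zero p hi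

theorem iterate_flowT_mem (n : ℕ) :
    (flowT I t)^[n] (xv k) ∈ fil (wt k) (2 + 2 * k * n) := by
  induction n with
  | zero => exact xv_mem_fil
  | succ n ih =>
    rw [Function.iterate_succ_apply']
    exact fil_anti (by rw [mul_add]; omega) (flowT_mem_fil ih)

/-- The first-order term of the exponential series gives `(t - t') u P`; from the second order on,
the terms already have weight at least `2 + 4k`. -/
theorem flowX_sub_flowX_mem (hk : 0 < k) {s : ℕ} (h : liftParam k t - liftParam k t' ∈ fil (wt k) s) :
    flowX I t - flowX I t' - (liftParam k t - liftParam k t') * (polyX I.u * bifP k) ∈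
      fil (wt k) (s + 2 * k + 3) := by
  obtain ⟨L, hL⟩ : ∃ L, L = lieDeriv (normalForm I) := ⟨_, rfl⟩
  have hterm : ∀ (t : ParamSeries k) n, expTerm (flowT I t) (xv k) n =
      (n.factorial : ℂ)⁻¹ • (liftParam k t ^ n * L^[n] (xv k)) := fun t n => by
    rw [expTerm, (lieDeriv_iterate_x n).1, hL]
  have hone : ∀ n, L^[n] (xv k) ∈ fil (wt k) (2 + 2 * k * n) := fun n => by
    have := iterate_flowT_mem (I := I) (t := 1) n
    rwa [(lieDeriv_iterate_x n).1, map_one, one_pow, one_mul, ← hL] at this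
  have hrest : ∀ n, expTerm (flowT I t) (xv k) (n + 2) - expTerm (flowT I t') (xv k) (n + 2) ∈
      fil (wt k) (s + 2 * k + 3) := fun n => by
    rw [hterm, hterm, ← smul_sub, ← sub_mul]
    refine smul_mem_fil _ (mul_mem_fil_of_le (Ideal.mem_of_dvd _ (sub_dvd_pow_sub_pow _ _ _) h)
      (hone (n + 2)) ?_)
    have : 2 * k * (n + 2) = 2 * k * n + 4 * k := by ring
    omega
  have hx := fil_anti (show s + 2 * k + 3 ≤ 2 + (s + 2 * k + 1 + 2) by omega)
    ((raises_flowT (I := I) (t := t) hk).expOp_sub_mem xv_mem_fil (s + 2 * k + 1 + 2))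
  have hx' := fil_anti (show s + 2 * k + 3 ≤ 2 + (s + 2 * k + 1 + 2) by omega)
    ((raises_flowT (I := I) (t := t') hk).expOp_sub_mem xv_mem_fil (s + 2 * k + 1 + 2))
  have hsum : ∑ n ∈ Finset.range (s + 2 * k + 1), (expTerm (flowT I t) (xv k) (n + 2) -
      expTerm (flowT I t') (xv k) (n + 2)) ∈ fil (wt k) (s + 2 * k + 3) :=
    Ideal.sum_mem _ fun n _ => hrest n
  rw [Finset.sum_range_succ', Finset.sum_range_succ', expTerm_zero, zero_add, expTerm_one,
    flowT_apply, pderiv_X_self, mul_one] at hx hx'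
  have := add_mem (sub_mem hx hx') hsum
  rw [Finset.sum_sub_distrib] at this
  convert this using 1
  rw [flowX, flowX]
  ring

/-- The coefficient of the time in the `x^{k+1}`-coefficient of the flow. -/
def timeCoeff (I : FormalInvariant k) : ParamSeries k := xc (k + 1) (polyX I.u * bifP k)

theorem constantCoeff_timeCoeff : constantCoeff (timeCoeff I) ≠ 0 := by
  have h := bifP_mul_sub_mem_fil (polyX I.u) (Finsupp.single (Sum.inr 0) (k + 1)) (by
    rw [Finsupp.weight_single, wt_x, smul_eq_mul]; omega)
  rw [map_sub, coeff_smul, coeff_single_xpow, if_pos rfl, mul_one, sub_eq_zero,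
    constantCoeff_polyX] at h
  rw [timeCoeff, ← coeff_zero_eq_constantCoeff_apply, coeff_xc, Finsupp.embDomain_zero, zero_add,
    mul_comm, h]
  exact I.u_ne_zero

theorem xc_flowX_sub_mem (hk : 0 < k) {s : ℕ} (h : t - t' ∈ fil (fun j => wt k (Sum.inl j)) s) :
    xc (k + 1) (flowX I t) - xc (k + 1) (flowX I t') - (t - t') * timeCoeff I ∈
      fil (fun j => wt k (Sum.inl j)) (s + 1) := by
  rw [← liftParam_mem_fil]
  have h1 := xc_mem_fil (n := k + 1) (flowX_sub_flowX_mem (I := I) hk (by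
    rw [← map_sub]; exact liftParam_mem_fil.2 h))
  rw [← map_sub (liftParam k), map_sub (xc (k + 1)), map_sub (xc (k + 1)), xc_liftParam_mul] at h1
  exact fil_anti (show s + 1 ≤ s + 2 * k + 3 - 2 * (k + 1) by omega) h1

theorem flowX_injective (hk : 0 < k) (h : flowX I t = flowX I t') : t = t' := by
  rw [← sub_eq_zero]
  refine eq_zero_of_mem_fil_succ (ω := fun j => wt k (Sum.inl j)) fun s hs => ?_
  have h1 := xc_flowX_sub_mem (I := I) hk hs
  rw [h, sub_self, zero_sub, neg_mem_iff] at h1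
  have h2 := Ideal.mul_mem_right (timeCoeff I)⁻¹ _ h1
  rwa [mul_assoc, MvPowerSeries.mul_inv_cancel _ constantCoeff_timeCoeff, mul_one] at h2

/-- The coefficient of `x^(k+1)` in the flow changes by a unit times the change of `t`, up to higher
weight. It can be inverted by Newton iteration with constant slope. -/
theorem exists_time (hk : 0 < k) (I : FormalInvariant k) (κ : ParamSeries k) :
    ∃ t, xc (k + 1) (flowX I t) = κ := by
  have hi := MvPowerSeries.mul_inv_cancel _ (constantCoeff_timeCoeff (I := I))
  obtain ⟨t, -, ht⟩ := exists_fixedPoint (ω := fun j => wt k (Sum.inl j)) Set.univ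
    (fun t => t + (timeCoeff I)⁻¹ * (κ - xc (k + 1) (flowX I t))) ⟨0, trivial⟩
    (fun _ _ => trivial) stable_univ (fun t _ t' _ s hs => by
      have h1 := Ideal.mul_mem_left _ (-(timeCoeff I)⁻¹) (xc_flowX_sub_mem (I := I) hk hs)
      convert h1 using 1
      linear_combination -(t - t') * hi)
  have h2 : (timeCoeff I)⁻¹ * (κ - xc (k + 1) (flowX I t)) = 0 := by
    simpa using ht
  refine ⟨t, ?_⟩
  have h3 : κ - xc (k + 1) (flowX I t) = 0 := by
    rw [← one_mul (κ - _), ← hi, mul_assoc, h2, mul_zero]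
  exact (sub_eq_zero.1 h3).symm

/-! ### Conjugacies as compositions of symmetries and flows -/

theorem coeff_flowX (hk : 0 < k) : coeff (Finsupp.single (Sum.inr 0) 1) (flowX I t) = 1 := by
  have h := flowX_sub_mem (I := I) (t := t) hk (Finsupp.single (Sum.inr 0) 1) (by
    rw [Finsupp.weight_single, wt_x]; norm_num)
  rwa [map_sub, coeff_single_eq _ (xv k), pderiv_X_self, map_one, sub_eq_zero] at h

theorem constantCoeff_flowX (hk : 0 < k) : constantCoeff (flowX I t) = 0 := by
  have h := (mem_fil_one wt_ne_zero).1 (fil_anti (show 1 ≤ 3 by omega)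
    (flowX_sub_mem (I := I) (t := t) hk))
  rwa [map_sub, constantCoeff_X, sub_zero] at h

theorem ne_zero_of_pow_eq_one {α : ℂ} (hk : 0 < k) (hα : α ^ k = 1) : α ≠ 0 := by
  rintro rfl
  rw [zero_pow hk.ne'] at hα
  exact zero_ne_one hα

/-- The change `(ε, x, y) ↦ (θ_α(ε), α x, c y) ∘ Φ^t`. -/
theorem exists_linearFlow (hk : 0 < k) {α : ℂ} (hα : α ^ k = 1) {c : ParamSeries k} (hc : IsUnit c)
    (t : ParamSeries k) (hI : I.IsRotation α I') :
    ∃ Ψ : FormalChange k, (∀ j, Ψ.par j = rotation k α j • X j) ∧ Ψ.map 0 = α • flowX I t ∧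
      Ψ.map 1 = liftParam k c * (yv k * flowV I t) ∧
      Conjugates Ψ (normalForm I) (normalForm I') := by
  classical
  have hα0 := ne_zero_of_pow_eq_one hk hα
  have hjac : jacobianAtZero (fun j : Fin k => rotation k α j • X j) =
      Matrix.diagonal (rotation k α) := by
    ext i j
    rw [jacobianAtZero, Matrix.of_apply, coeff_smul, coeff_X, Matrix.diagonal_apply]
    rcases eq_or_ne i j with rfl | h
    · simp
    · rw [if_neg h, if_neg, mul_zero]
      intro h0
      exact h ((Finsupp.single_left_inj one_ne_zero).1 h0).symm
  have hc0 : constantCoeff c ≠ 0 := (isUnit_iff_constantCoeff.1 hc).ne_zero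
  obtain ⟨Ψ, hp, h0, h1⟩ := exists_formalChange (k := k) (p := fun j => rotation k α j • X j)
    (f := α • flowX I t) (g := liftParam k c * (yv k * flowV I t))
    (fun j => by rw [constantCoeff_smul, constantCoeff_X, smul_zero])
    (by
      rw [hjac, Matrix.det_diagonal]
      exact Finset.prod_ne_zero_iff.2 fun j _ => pow_ne_zero _ hα0)
    (by rw [constantCoeff_smul, constantCoeff_flowX hk, smul_zero])
    (by rw [map_mul, map_mul, constantCoeff_X, zero_mul, mul_zero])
    (by rw [coeff_smul, coeff_flowX hk, mul_one]; exact hα0)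
    ((Ideal.mul_mem_left _ _ (Ideal.mul_mem_right _ _ yv_mem_fil) :
      liftParam k c * (yv k * flowV I t) ∈ fil (wt k) 3) _
        (by rw [Finsupp.weight_single, wt_x]; norm_num))
    (by
      rw [coeff_single_eq, Derivation.leibniz, Derivation.leibniz, pderiv_X_self,
        pderiv_liftParam, smul_zero, add_zero, pderiv_y_of_res (res_flowV hk), smul_zero, zero_add,
        smul_eq_mul, smul_eq_mul, mul_one, map_mul, constantCoeff_liftParam]
      exact mul_ne_zero hc0 (constantCoeff_flowV hk))
  obtain ⟨e0, e1⟩ := pull_normalForm_rotation hα (congrFun hp) hI h0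
  refine ⟨Ψ, congrFun hp, h0, h1, fun i => ?_⟩
  fin_cases i
  · change lieDeriv _ (Ψ.map 0) = Ψ.pull (normalForm I' 0)
    rw [e0, h0, lieDeriv_smul, lieDeriv_flowX hk]
  · change lieDeriv _ (Ψ.map 1) = Ψ.pull (normalForm I' 1)
    rw [e1, h1, lieDeriv_liftParam_mul, lieDeriv_flowY hk, Polynomial.eval_mul]
    ring

theorem isRotation_one : I.IsRotation 1 I := by
  have h : rotation k 1 = 1 := funext fun j => one_pow _
  constructor
  · rw [h, rescale_one]; rfl
  · intro i
    rw [h, rescale_one, one_pow, one_smul]; rfl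

/-- The time is chosen so that the flow has the same resonant coefficient as the conjugacy. Both
then solve the same regular equation for `q` with the same constant, and their second components
solve the same linear equation, so they differ by a factor in `ε`. -/
theorem Conjugates.eq_linearFlow (hk : 0 < k) {Ψ : FormalChange k}
    (h : Conjugates Ψ (normalForm I) (normalForm I')) :
    ∃ (α : ℂ) (c t : ParamSeries k), α ^ k = 1 ∧ IsUnit c ∧ I.IsRotation α I' ∧
      (∀ j, Ψ.par j = rotation k α j • X j) ∧ Ψ.map 0 = α • flowX I t ∧
      Ψ.map 1 = liftParam k c * (yv k * flowV I t) := by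
  obtain ⟨α, q, V, hα, hp, hI, hq, hX, hY, hVr, hV0, hode, hV⟩ := conj_structure hk h
  obtain ⟨t, ht⟩ := exists_time hk I (xc (k + 1) (xv k + bifP k * q))
  obtain ⟨Ψ', hp', hX', hY', h'⟩ := exists_linearFlow hk (one_pow k) isUnit_one t
    (isRotation_one (I := I))
  obtain ⟨α', q', V', -, -, -, hq', hX'', hY'', hVr', hV0', hode', hV'⟩ := conj_structure hk h'
  rw [one_smul] at hX'
  rw [map_one, one_mul] at hY'
  rw [hY'] at hY''
  rw [hX'] at hX''
  have hα' : α' = 1 := by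
    have h1 := coeff_flowX (I := I) (t := t) hk
    have h2 : bifP k * q' ∈ fil (wt k) 4 :=
      Ideal.mul_mem_right _ _ (fil_anti (by omega) bifP_mem_fil)
    rwa [hX'', coeff_smul, map_add, h2 _ (by rw [Finsupp.weight_single, wt_x]; norm_num), add_zero,
      coeff_single_eq, pderiv_X_self, map_one, mul_one] at h1
  rw [hα', one_smul] at hX''
  have hqq : q' = q := conj_x_unique hq' hq (by
    rw [hX'', map_add, map_add] at ht
    exact add_left_cancel ht) hode' hode
  rw [hqq] at hX'' hV'
  rw [← mul_left_cancel₀ yv_ne_zero hY''] at hVr' hV0' hV'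
  obtain ⟨c, hc, hcV⟩ := linear_ode_unique hVr' hVr hV0' hV0 hV' hV
  refine ⟨α, c, t, hα, hc, hI, hp, by rw [hX, hX''], by rw [hY, hcV]; ring⟩

theorem Conjugates.symm_of_inv {Ψ Θ : FormalChange k} {Z Z' : Family k} (h : Conjugates Ψ Z Z')
    (h₁ : ∀ f, Ψ.pull (Θ.pull f) = f) (h₂ : ∀ f, Θ.pull (Ψ.pull f) = f) : Conjugates Θ Z' Z := by
  intro i
  rw [← h₂ (lieDeriv Z' _), ← h.lieDeriv_pull, ← Θ.pull_inr, h₁, lieDeriv_X]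

theorem FormalChange.ext_of {Ψ Ψ' : FormalChange k} (hp : ∀ j, Ψ.par j = Ψ'.par j)
    (hm : ∀ i, Ψ.map i = Ψ'.map i) : Ψ = Ψ' := by
  cases Ψ
  cases Ψ'
  simp only [FormalChange.mk.injEq]
  exact ⟨funext hp, funext hm⟩

theorem subst_smul_X {p : Fin k → ParamSeries k} (hp : ∀ j, constantCoeff (p j) = 0) (a : ℂ)
    (j : Fin k) : subst p (a • X j : ParamSeries k) = a • p j := by
  rw [subst_smul (hasSubst_of_zero hp), subst_X (hasSubst_of_zero hp)]

/-- Uniqueness of the normalising changes. -/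
theorem uniqueness (hk : 0 < k) {Z : Family k} {N N' : FormalChange k}
    (h : Conjugates N Z (normalForm I)) :
    Conjugates N' Z (normalForm I') ↔ ∃! s : ℂ × ParamSeries k × ParamSeries k,
      s.1 ^ k = 1 ∧ IsUnit s.2.1 ∧ I.IsRotation s.1 I' ∧
        FormalChange.IsLinearFlowOf (normalForm I) s.1 s.2.1 s.2.2 N N' := by
  obtain ⟨Θ, h₁, h₂, h₃, -, -, -⟩ := N.exists_inv
  constructor
  · intro h'
    obtain ⟨α, c, t, hα, hc, hI, hp, hX, hY⟩ :=
      Conjugates.eq_linearFlow hk ((h.symm_of_inv h₁ h₂).comp h')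
    have hmap : ∀ i, N'.map i = N.pull ((N'.comp Θ).map i) := fun i => by
      rw [FormalChange.comp_map, h₁]
    refine ⟨(α, c, t), ⟨hα, hc, hI, fun j => ?_, ![flowX I t, yv k * flowV I t],
      (isTimeFlow_iff hk).2 ⟨rfl, rfl⟩, ?_, ?_⟩, ?_⟩
    · have := hp j
      rw [FormalChange.comp_par] at this
      rw [← h₃ (N'.par j), this, subst_smul_X N.par_zero]
    · rw [hmap, hX]; rfl
    · rw [hmap, hY]; rfl
    -- `N` is cancelled first. Then `α` is the coefficient of `x`, `t` follows from
    -- `flowX_injective`, and `c` is obtained by cancelling the second component of the flow.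
    · rintro ⟨α', c', t'⟩ ⟨-, -, -, -, Φ, hΦ, h0, h1⟩
      obtain ⟨hΦ0, hΦ1⟩ := (isTimeFlow_iff hk).1 hΦ
      simp only at h0 h1
      rw [hmap, hX, hΦ0] at h0
      rw [hmap, hY, hΦ1] at h1
      replace h0 := N.pull_bijective.1 h0
      replace h1 := N.pull_bijective.1 h1
      have e1 := congrArg (coeff (Finsupp.single (Sum.inr 0) 1)) h0
      rw [coeff_smul, coeff_smul, coeff_flowX hk, coeff_flowX hk, mul_one, mul_one] at e1
      rw [← e1] at h0
      have e2 := flowX_injective hk (smul_right_injective _ (ne_zero_of_pow_eq_one hk hα) h0)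
      rw [← e2] at h1
      have hne : yv k * flowV I t ≠ 0 := mul_ne_zero yv_ne_zero fun h0 =>
        constantCoeff_flowV (I := I) (t := t) hk (by rw [h0, map_zero])
      have e3 := liftParam_injective (mul_right_cancel₀ hne h1)
      rw [e1, e2, e3]
  · rintro ⟨⟨α, c, t⟩, ⟨hα, hc, hI, hp, Φ, hΦ, h0, h1⟩, -⟩
    obtain ⟨hΦ0, hΦ1⟩ := (isTimeFlow_iff hk).1 hΦ
    simp only at hα hc hI hp h0 h1
    rw [hΦ0] at h0
    rw [hΦ1] at h1
    obtain ⟨Ψ, hp', hX, hY, hΨ⟩ := exists_linearFlow hk hα hc t hI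
    have e : N' = Ψ.comp N := by
      refine FormalChange.ext_of (fun j => ?_) fun i => ?_
      · rw [FormalChange.comp_par, hp', hp, subst_smul_X N.par_zero]
      · rw [FormalChange.comp_map]
        fin_cases i
        · exact h0.trans (congrArg N.pull hX.symm)
        · exact h1.trans (congrArg N.pull hY.symm)
    rw [e]
    exact h.comp hΨ

/-! ### Equivalences of normal forms -/

theorem OrbitallyConjugates.rotation (hk : 0 < k) {Ψ : FormalChange k}
    (h : OrbitallyConjugates Ψ (normalForm I) (normalForm I')) :
    ∃ α : ℂ, α ^ k = 1 ∧ (∀ j, Ψ.par j = rotation k α j • X j) ∧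
      rescale (rotation k α) I'.mu = I.mu := by
  obtain ⟨U, hU, h⟩ := h
  obtain ⟨α, q, V, hα, hp, hμ, -⟩ := orbital_structure hk hU h
  exact ⟨α, hα, hp, by rw [← subst_rotation hp, hμ]⟩

theorem exists_id (k : ℕ) : ∃ Ψ : FormalChange k, Ψ.FixesParam ∧ (∀ i, Ψ.map i = X (Sum.inr i)) := by
  obtain ⟨Ψ, hp, h0, h1⟩ := exists_formalChange (k := k) (p := X) (f := xv k) (g := yv k)
    (fun j => constantCoeff_X _) (by rw [jacobianAtZero_X]; simp) (constantCoeff_X _)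
    (constantCoeff_X _) (by rw [coeff_single_eq, pderiv_X_self, map_one]; exact one_ne_zero)
    (yv_mem_fil _ (by rw [Finsupp.weight_single, wt_x]; norm_num))
    (by rw [coeff_single_eq, pderiv_X_self, map_one]; exact one_ne_zero)
  exact ⟨Ψ, fun j => by rw [hp], fun i => by fin_cases i <;> assumption⟩

theorem orbitally_conjugate_iff (hk : 0 < k) : (∃ Ψ : FormalChange k, Ψ.FixesParam ∧
    OrbitallyConjugates Ψ (normalForm I) (normalForm I')) ↔ I.mu = I'.mu := by
  constructor
  · rintro ⟨Ψ, hΨ, U, hU, h⟩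
    obtain ⟨α, q, V, hα, hp, hμ, -⟩ := orbital_structure hk hU h
    rw [← hμ, hΨ.subst]
  · intro h
    obtain ⟨Ψ, hΨ, hm⟩ := exists_id k
    have hu : constantCoeff (polyX I.u) ≠ 0 := by rw [constantCoeff_polyX]; exact I.u_ne_zero
    have hu' : constantCoeff (polyX I'.u) ≠ 0 := by rw [constantCoeff_polyX]; exact I'.u_ne_zero
    have hi := MvPowerSeries.mul_inv_cancel _ hu
    have hx := hm 0
    have hy := hm 1
    -- When `μ = μ'` the normal forms are proportional: the identity works with the time factor `u'
    -- / u`.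
    refine ⟨Ψ, hΨ, polyX I'.u * (polyX I.u)⁻¹, by
      rw [map_mul]; exact mul_ne_zero hu' (constantCoeff_inv_ne_zero hu), fun i => ?_⟩
    rw [hm, lieDeriv_X]
    fin_cases i
    · change polyX I'.u * (polyX I.u)⁻¹ * normalForm I 0 = Ψ.pull (normalForm I' 0)
      rw [pull_normalForm_zero, normalForm_zero, hx]
      simp_rw [hΨ.subst, hΨ.par_eq]
      rw [← polyX, ← bifP]
      linear_combination (polyX I'.u * bifP k) * hi
    · change polyX I'.u * (polyX I.u)⁻¹ * normalForm I 1 = Ψ.pull (normalForm I' 1)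
      rw [pull_normalForm_one, normalForm_one, hx, hy, ← h]
      simp_rw [hΨ.subst]
      rw [← polyX]
      linear_combination (polyX I'.u * (yv k * (1 + liftParam k I.mu * xv k ^ k))) * hi

/-- The multipliers of `ε_(k-1)` and `ε_(k-2)` are `α²` and `α³`; for `k = 1` there is only the
first, but then `α^k = 1` already says `α = 1`. -/
theorem eq_one_of_rotation (hk : 0 < k) {α : ℂ} (hα : α ^ k = 1) (h : ∀ j, rotation k α j = 1) :
    α = 1 := by
  have h2 := h ⟨k - 1, by omega⟩
  rw [rotation, show k + 1 - (k - 1) = 2 by omega] at h2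
  rcases Nat.lt_or_ge k 2 with hk2 | hk2
  · obtain rfl : k = 1 := by omega
    rwa [pow_one] at hα
  · have h3 := h ⟨k - 2, by omega⟩
    rw [rotation, show k + 1 - (k - 2) = 3 by omega, pow_succ, h2, one_mul] at h3
    exact h3

theorem conjugate_iff (hk : 0 < k) : (∃ Ψ : FormalChange k, Ψ.FixesParam ∧
    Conjugates Ψ (normalForm I) (normalForm I')) ↔ I = I' := by
  constructor
  · rintro ⟨Ψ, hΨ, h⟩
    obtain ⟨α, c, t, hα, -, hI, hp, -⟩ := h.eq_linearFlow hk
    have h1 : α = 1 := eq_one_of_rotation hk hα fun j => by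
      have := congrArg (coeff (Finsupp.single j 1)) (hp j)
      rw [hΨ j, coeff_smul, coeff_index_single_self_X, mul_one] at this
      exact this.symm
    have hrot : rotation k 1 = 1 := funext fun j => one_pow _
    obtain ⟨hμ, hu⟩ := hI
    rw [h1, hrot, rescale_one] at hμ
    simp_rw [h1, hrot, rescale_one, one_pow, one_smul] at hu
    exact FormalInvariant.ext hμ.symm (funext fun i => (hu i).symm)
  · rintro rfl
    obtain ⟨Ψ, hΨ, hm⟩ := exists_id k
    refine ⟨Ψ, hΨ, fun i => ?_⟩
    have ht : Ψ.total = X := by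
      funext i
      rcases i with j | i
      · rw [FormalChange.total_inl, hΨ.par_eq]
      · rw [FormalChange.total_inr, hm]
    rw [hm, lieDeriv_X, FormalChange.pull, ht]
    exact (congrFun subst_self _).symm

end

end SaddleNode

theorem mainTheorem1 (k : ℕ) (hk : 0 < k) :
    (∀ Z : SaddleNode.Family k, SaddleNode.IsGenericUnfolding Z →
      (∃ (I : SaddleNode.FormalInvariant k) (N : SaddleNode.FormalChange k),
        (∀ j, SaddleNode.IsConvergent (N.par j)) ∧
          SaddleNode.Conjugates N Z (SaddleNode.normalForm I)) ∧
      (∀ (I I' : SaddleNode.FormalInvariant k) (N N' : SaddleNode.FormalChange k),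
        SaddleNode.Conjugates N Z (SaddleNode.normalForm I) →
        (SaddleNode.Conjugates N' Z (SaddleNode.normalForm I') ↔
          ∃! s : ℂ × SaddleNode.ParamSeries k × SaddleNode.ParamSeries k,
            s.1 ^ k = 1 ∧ IsUnit s.2.1 ∧ I.IsRotation s.1 I' ∧
              SaddleNode.FormalChange.IsLinearFlowOf (SaddleNode.normalForm I)
                s.1 s.2.1 s.2.2 N N'))) ∧
    (∀ I I' : SaddleNode.FormalInvariant k,
      (∀ Ψ : SaddleNode.FormalChange k,
        SaddleNode.OrbitallyConjugates Ψ (SaddleNode.normalForm I) (SaddleNode.normalForm I') →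
        ∃ α : ℂ, α ^ k = 1 ∧
          (∀ j, Ψ.par j = SaddleNode.rotation k α j • MvPowerSeries.X j) ∧
          MvPowerSeries.rescale (SaddleNode.rotation k α) I'.mu = I.mu) ∧
      ((∃ Ψ : SaddleNode.FormalChange k, Ψ.FixesParam ∧
          SaddleNode.OrbitallyConjugates Ψ (SaddleNode.normalForm I) (SaddleNode.normalForm I')) ↔
        I.mu = I'.mu) ∧
      ((∃ Ψ : SaddleNode.FormalChange k, Ψ.FixesParam ∧
          SaddleNode.Conjugates Ψ (SaddleNode.normalForm I) (SaddleNode.normalForm I')) ↔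
        I = I')) := by
  refine ⟨fun Z hZ => ⟨SaddleNode.existence hk hZ, fun I I' N N' h => SaddleNode.uniqueness hk h⟩,
    fun I I' => ⟨fun Ψ h => h.rotation hk, SaddleNode.orbitally_conjugate_iff hk,
      SaddleNode.conjugate_iff hk⟩⟩
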